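/- **Notation.** Let $N\ge 0$ be an integer and $q,c_0,\dots,c_4\in\mathbb C$. Fix square roots $\sqrt q,\sqrt{c_0},\dots,\sqrt{c_4}$ with $$\sqrt q^{\,2N+3}\sqrt{c_0}\sqrt{c_1}\sqrt{c_2}\sqrt{c_3}\sqrt{c_4}=1 ,$$ so that $q^{2N+3}c_0c_1c_2c_3c_4=1$; every half-integer power below is formed multiplicatively from these square roots. Assume $q,c_0,\dots,c_4\neq0$; $q^k\ne1$ for $1\le k\le N$; none of $c_1c_2,\ c_2c_3,\ c_0c_3,\ c_0c_4,\ c_2c_4,\ qc_1c_2c_3,\ qc_0c_3c_4,\ qc_1c_2c_4$ lies in $\{q^{-2},\dots,q^{-2N}\}$; and $c_0,\dots,c_4\notin\{q^{-1},\dots,q^{-N}\}$. Put $(a;q)_k=\prod_{l=0}^{k-1}(1-aq^l)$, $\left[{N\atop n}\right]_q=\frac{(q;q)_N}{(q;q)_n(q;q)_{N-n}}$, $\lambda(x;c)=-(1-q^{-x})(1-cq^{x+1})$ and $\omega_n(c)=(-1)^nc^{n/2}q^{n(n+1)/2}$ for $n\in\mathbb Z$. For integers $0\le n\le M$ and $x\le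 M$ let $$\mathfrak p_n(x;c_1,c_2,c_3;M)=\Omega(n;c_1,c_2,c_3;M)\;{}_4\phi_3\!\left({q^{-n},\,c_2c_3q^{n+1},\,q^{-x},\,c_1c_2q^{x+1}\atop qc_2,\ c_1c_2c_3q^{M+2},\ q^{-M}};q,q\right),$$ $$\Omega(n;c_1,c_2,c_3;M)=\left[{M\atop n}\right]_q\frac{(1-c_2c_3q^{2n+1})(qc_2;q)_n(c_1c_2c_3q^{M+2};q)_n(qc_1;q)_{M-n}}{(qc_2)^{n-M/2}(c_2c_3q^{n+1};q)_{M+1}(qc_3;q)_n},$$ the series being summed over $0\le k\le n$, and let $\mathfrak p_n(x;\cdot\,;M)=0$ if $n<0$, $n>M$ or $x>M$. The Griffiths polynomials of $q$-Racah type are $$\mathcal G_{i,j}(x,y)=\sum_{a=0}^{\min(N-j,N-y)}\omega_a\!\Big(\frac{c_1c_2c_3}{c_4}\Big)\,\mathfrak p_i(a;c_1,c_2,c_3;N-j)\,\mathfrak p_j(y;c_3,c_0,c_4;N-a)\,\mathfrak p_a(x;c_4,c_2,c_1;N-y),$$ which vanish if $i<0$, $j<0$ or $i+j>N$. Define, with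 $\Phi^\varepsilon(n)=\Phi^\varepsilon(n;c_1,c_2,c_3;M)$ and $\Phi^\varepsilon_\pm(n)=\Phi^\varepsilon_\pm(n;c_1,c_2,c_3;M)$, $$\Phi^+(n)=\tfrac{-c_2q^{n-M}(1-q^n)(1-c_1q^{M-n+1})(1-c_2c_3q^{n+M+1})(1-c_3q^n)}{(1-c_2c_3q^{2n})(1-c_2c_3q^{2n+1})},\qquad \Phi^-(n)=\tfrac{(1-q^{n-M})(1-c_1c_2c_3q^{n+M+2})(1-c_2q^{n+1})(1-c_2c_3q^{n+1})}{(1-c_2c_3q^{2n+1})(1-c_2c_3q^{2n+2})},$$ $$\Phi_+^+(n)=-\sqrt{qc_2}\,c_2q^{2n-M-1}\tfrac{(1-q^n)(1-c_1q^{M-n+1})(1-c_1q^{M+2-n})(1-c_3q^n)}{(1-c_2c_3q^{2n})(1-c_2c_3q^{2n+1})},$$ $$\Phi_+^-(n)=-\tfrac{(1-c_1c_2c_3q^{n+M+2})(1-c_1c_2c_3q^{n+M+3})(1-c_2q^{n+1})(1-c_2c_3q^{n+1})}{c_3q^{M+1}\sqrt{qc_2}\,(1-c_2c_3q^{2n+1})(1-c_2c_3q^{2n+2})},$$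 $$\Phi_+^0(n)=-\Phi_+^+(n)-\Phi_+^-(n)-\tfrac{(1-c_1c_2q^{M+2})(1-c_1c_2c_3q^{M+2})}{c_3q^{M+1}\sqrt{qc_2}},$$ $$\Phi_-^+(n)=-\sqrt{qc_2}\,\tfrac{(1-q^n)(1-c_3q^n)(1-c_2c_3q^{n+M})(1-c_2c_3q^{n+M+1})}{q^M(1-c_2c_3q^{2n})(1-c_2c_3q^{2n+1})},$$ $$\Phi_-^-(n)=-c_3\sqrt{qc_2}\,q^M\tfrac{(1-q^{n-M})(1-q^{n-M+1})(1-c_2q^{n+1})(1-c_2c_3q^{n+1})}{(1-c_2c_3q^{2n+1})(1-c_2c_3q^{2n+2})},$$ $$\Phi_-^0(n)=-\Phi_-^+(n)-\Phi_-^-(n)-\sqrt{qc_2}\,(1-c_3q^M)(q^{-M}-1),$$ $$F^-_x(c,c')=cc'q^{x+1}\tfrac{(1-c'q^{x+1})(1-cc'q^{x+1})}{(1-cc'q^{2x+1})(1-cc'q^{2x+2})},\qquad F^+_x(c,c')=cc'^2q^{x+1}\tfrac{(1-cq^x)(1-q^x)}{(1-cc'q^{2x})(1-cc'q^{2x+1})}.$$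 The coefficients $A^{\varepsilon,\varepsilon'}_{i,j}=A^{\varepsilon,\varepsilon'}_{i,j}(c_1,c_2,c_3,c_4;N)$, $\varepsilon,\varepsilon'\in\{0,\pm1\}$, are $$A^{\varepsilon,\pm}_{i,j}=-c_3q^{N+1}F^{\pm}_j(c_4,c_0)\,\Phi^\varepsilon_\pm(i;c_1,c_2,c_3;N-j),$$ $$A^{\pm,0}_{i,j}=c_3q^{N+1}\big(F^+_j(c_4,c_0)+F^-_j(c_4,c_0)\big)\Phi^\pm(i;c_1,c_2,c_3;N-j),$$ $$A^{0,0}_{i,j}=-\frac{(1-c_3q^{N+1-j})\sqrt{qc_2}}{1-c_1c_2q^{N+2-j}}\sum_{\varepsilon}A^{\varepsilon,+}_{i,j}-\frac{1-c_1c_2q^{N+1-j}}{(1-c_3q^{N-j})\sqrt{qc_2}}\sum_\varepsilon A^{\varepsilon,-}_{i,j}-A^{+,0}_{i,j}-A^{-,0}_{i,j}.$$ $A(c_1,c_0,c_4,c_3;N)$ is obtained by the exchanges $c_2\leftrightarrow c_0$, $c_3\leftrightarrow c_4$ (and the same exchanges of the square roots). Where a denominator in these formulas vanishes under the assumptions above,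 then, for $\Omega$ and for every coefficient that is multiplied below by a $\mathcal G_{k,l}$ with $k,l\ge0$, $k+l\le N$, the singularity is removable on the parameter variety, and the regular value is meant. **Proposition.** For all nonnegative integers $i,j,x,y$ with $i+j\le N$ and $x+y\le N$, $$\lambda(y;c_3c_0)\,\mathcal G_{i,j}(x,y)=\sum_{\varepsilon,\varepsilon'\in\{0,\pm1\}}A^{\varepsilon,\varepsilon'}_{i+\varepsilon,j+\varepsilon'}(c_1,c_2,c_3,c_4;N)\,\mathcal G_{i+\varepsilon,j+\varepsilon'}(x,y),$$ $$\lambda(x;c_4c_2)\,\mathcal G_{i,j}(x,y)=\sum_{\varepsilon,\varepsilon'\in\{0,\pm1\}}\frac{\omega_\varepsilon(q^{2i}c_2c_3c_4/c_1)}{\omega_{\varepsilon'}(q^{2j}c_0c_3c_4/c_1)}\,A^{\varepsilon',\varepsilon}_{j+\varepsilon',i+\varepsilon}(c_1,c_0,c_4,c_3;N)\,\mathcal G_{i+\varepsilon,j+\varepsilon'}(x,y).$$ (Only those values of the coefficients matter for which $(i+\varepsilon,j+\varepsilon')$ satisfies $i+\varepsilon,\,j+\varepsilon'\ge0$ and $i+j+\varepsilon+\varepsilon'\le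 N$; the other terms are zero.) -/

import Mathlib

open Finset

namespace GriffithsQRacah

/-! Half-integer powers are expressed through fixed square roots: `s` is a square root of `q` and
`dₖ` is a square root of `cₖ`. So `q = s ^ 2`, `cₖ = dₖ ^ 2`, `√(q c₂) = s d₂`,
`(q c₂) ^ (n - N / 2) = (s d₂) ^ (2 n - N)`, `√(c₁ c₂ c₃ / c₄) = d₁ d₂ d₃ / d₄`, and so on.
Quotients `(1 - t q ^ m) / (1 - t q ^ n)` with `m = n`, which occur in the formulas at the border of
the index range, are cancelled, so that the apparent poles of the formulas are removed. -/

section Basic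

/-- The `q`-Pochhammer symbol `(a; q)_k`. -/
noncomputable def qPoch (q a : ℂ) (k : ℕ) : ℂ := ∏ l ∈ range k, (1 - a * q ^ l)

/-- The `q`-binomial coefficient, zero outside `0 ≤ n ≤ N`. -/
noncomputable def qBinom (q : ℂ) (N n : ℤ) : ℂ :=
  if 0 ≤ n ∧ n ≤ N then
    qPoch q q N.toNat / (qPoch q q n.toNat * qPoch q q (N - n).toNat)
  else 0

/-- The terminating basic hypergeometric series
`₄φ₃(q ^ (-n), a₂, a₃, a₄; b₁, b₂, b₃; q, z)`. -/
noncomputable def phi43 (q : ℂ) (n : ℕ) (a₂ a₃ a₄ b₁ b₂ b₃ z : ℂ) : ℂ :=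
  ∑ k ∈ range (n + 1),
    (qPoch q (q ^ (-(n : ℤ))) k * qPoch q a₂ k * qPoch q a₃ k * qPoch q a₄ k) /
      (qPoch q b₁ k * qPoch q b₂ k * qPoch q b₃ k) * (z ^ k / qPoch q q k)

/-- The quotient `(1 - t q ^ m) / (1 - t q ^ n)`, as a rational function of `t`:
it is `1` when `m = n`, also where the denominator vanishes. -/
noncomputable def quot (q t : ℂ) (m n : ℤ) : ℂ :=
  if m = n then 1 else (1 - t * q ^ m) / (1 - t * q ^ n)

theorem quot_eq {q t : ℂ} {m n : ℤ} (h : 1 - t * q ^ n ≠ 0) :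
    quot q t m n = (1 - t * q ^ m) / (1 - t * q ^ n) := by
  unfold quot
  split_ifs with hmn
  · subst hmn; rw [div_self h]
  · rfl

/-- The eigenvalue `λ(x; c)`. -/
noncomputable def lam (q c : ℂ) (x : ℤ) : ℂ := -(1 - q ^ (-x)) * (1 - c * q ^ (x + 1))

/-- `ω_n(c) = (-1) ^ n c ^ (n / 2) q ^ (n (n + 1) / 2)`, where `e` is the square root of `c`. -/
noncomputable def omegaFn (s e : ℂ) (n : ℤ) : ℂ :=
  (-1) ^ n * e ^ n * (s ^ 2) ^ (n * (n + 1) / 2)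

end Basic

section Racah

/-- The normalization `Ω(n; c₁, c₂, c₃; N)` (zero outside `0 ≤ n ≤ N`). The factor
`1 - c₂ c₃ q ^ (2 n + 1)` of the numerator is cancelled against the factor `l = n` of
`(c₂ c₃ q ^ (n + 1); q)_(N + 1)` in the denominator. -/
noncomputable def Omega (s d₁ d₂ d₃ : ℂ) (N n : ℤ) : ℂ :=
  let q := s ^ 2;
  let c₁ := d₁ ^ 2;
  let c₂ := d₂ ^ 2;
  let c₃ := d₃ ^ 2;
  qBinom q N n *
    (qPoch q (q * c₂) n.toNat * qPoch q (c₁ * c₂ * c₃ * q ^ (N + 2)) n.toNat *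
      qPoch q (q * c₁) (N - n).toNat) /
    ((s * d₂) ^ (2 * n - N) *
      (∏ l ∈ (range (N.toNat + 1)).erase n.toNat, (1 - c₂ * c₃ * q ^ (n + 1) * q ^ l)) *
      qPoch q (q * c₃) n.toNat)

/-- Away from the apparent poles `Omega` is given by the uncancelled formula. -/
theorem Omega_eq (s d₁ d₂ d₃ : ℂ) (N n : ℤ) (hs : s ≠ 0) (hn : 0 ≤ n) (hnN : n ≤ N)
    (h : 1 - d₂ ^ 2 * d₃ ^ 2 * (s ^ 2) ^ (2 * n + 1) ≠ 0) :
    Omega s d₁ d₂ d₃ N n =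
      qBinom (s ^ 2) N n *
        ((1 - d₂ ^ 2 * d₃ ^ 2 * (s ^ 2) ^ (2 * n + 1)) * qPoch (s ^ 2) (s ^ 2 * d₂ ^ 2) n.toNat *
          qPoch (s ^ 2) (d₁ ^ 2 * d₂ ^ 2 * d₃ ^ 2 * (s ^ 2) ^ (N + 2)) n.toNat *
          qPoch (s ^ 2) (s ^ 2 * d₁ ^ 2) (N - n).toNat) /
        ((s * d₂) ^ (2 * n - N) *
          qPoch (s ^ 2) (d₂ ^ 2 * d₃ ^ 2 * (s ^ 2) ^ (n + 1)) (N.toNat + 1) *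
          qPoch (s ^ 2) (s ^ 2 * d₃ ^ 2) n.toNat) := by
  have hmem : n.toNat ∈ range (N.toNat + 1) := by
    rw [Finset.mem_range]; omega
  have hp : (s ^ 2) ^ (2 * n + 1) = (s ^ 2) ^ (n + 1) * (s ^ 2) ^ n.toNat := by
    have h2 : (s ^ 2) ≠ 0 := pow_ne_zero 2 hs
    rw [← zpow_natCast (s ^ 2) n.toNat, Int.toNat_of_nonneg hn, ← zpow_add₀ h2]
    congr 1; ring
  have hP : qPoch (s ^ 2) (d₂ ^ 2 * d₃ ^ 2 * (s ^ 2) ^ (n + 1)) (N.toNat + 1) =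
      (1 - d₂ ^ 2 * d₃ ^ 2 * (s ^ 2) ^ (2 * n + 1)) *
        ∏ l ∈ (range (N.toNat + 1)).erase n.toNat,
          (1 - d₂ ^ 2 * d₃ ^ 2 * (s ^ 2) ^ (n + 1) * (s ^ 2) ^ l) := by
    unfold qPoch
    rw [← Finset.mul_prod_erase _ _ hmem, hp, mul_assoc (d₂ ^ 2 * d₃ ^ 2)]
  rw [hP]
  unfold Omega
  simp only
  generalize 1 - d₂ ^ 2 * d₃ ^ 2 * (s ^ 2) ^ (2 * n + 1) = u at h
  generalize ∏ l ∈ (range (N.toNat + 1)).erase n.toNat,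
          (1 - d₂ ^ 2 * d₃ ^ 2 * (s ^ 2) ^ (n + 1) * (s ^ 2) ^ l) = v
  rw [← mul_div_mul_left _ _ h]
  congr 1 <;> ring

/-- The `q`-Racah polynomial `p_n(x; c₁, c₂, c₃; N)`, zero for `n < 0`, `n > N` and `x > N`. -/
noncomputable def racah (s d₁ d₂ d₃ : ℂ) (N n x : ℤ) : ℂ :=
  let q := s ^ 2;
  let c₁ := d₁ ^ 2;
  let c₂ := d₂ ^ 2;
  let c₃ := d₃ ^ 2;
  if 0 ≤ n ∧ n ≤ N ∧ x ≤ N then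
    Omega s d₁ d₂ d₃ N n *
      phi43 q n.toNat (c₂ * c₃ * q ^ (n + 1)) (q ^ (-x)) (c₁ * c₂ * q ^ (x + 1))
        (q * c₂) (c₁ * c₂ * c₃ * q ^ (N + 2)) (q ^ (-N)) q
  else 0

/-- `Φ^+(n; c₁, c₂, c₃; N)`. -/
noncomputable def PhiPos (q c₁ c₂ c₃ : ℂ) (N n : ℤ) : ℂ :=
  -c₂ * q ^ (n - N) * ((1 - q ^ n) * (1 - c₁ * q ^ (N - n + 1)) * (1 - c₃ * q ^ n)) /
    (1 - c₂ * c₃ * q ^ (2 * n)) * quot q (c₂ * c₃) (n + N + 1) (2 * n + 1)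

/-- `Φ^-(n; c₁, c₂, c₃; N)`. -/
noncomputable def PhiNeg (q c₁ c₂ c₃ : ℂ) (N n : ℤ) : ℂ :=
  (1 - q ^ (n - N)) * (1 - c₁ * c₂ * c₃ * q ^ (n + N + 2)) * (1 - c₂ * q ^ (n + 1)) /
    (1 - c₂ * c₃ * q ^ (2 * n + 2)) * quot q (c₂ * c₃) (n + 1) (2 * n + 1)

/-- The coefficients `Φ^ε(n; c₁, c₂, c₃; N)` of the three-term recurrence relation. -/
noncomputable def Phi (q c₁ c₂ c₃ : ℂ) (N : ℤ) : SignType → ℤ → ℂ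
  | .pos, n => PhiPos q c₁ c₂ c₃ N n
  | .neg, n => PhiNeg q c₁ c₂ c₃ N n
  | .zero, n => -PhiPos q c₁ c₂ c₃ N n - PhiNeg q c₁ c₂ c₃ N n

/-- `Φ_+^+(n; c₁, c₂, c₃; N)`. -/
noncomputable def PhiUpPos (s d₁ d₂ d₃ : ℂ) (N n : ℤ) : ℂ :=
  let q := s ^ 2;
  let c₁ := d₁ ^ 2;
  let c₂ := d₂ ^ 2;
  let c₃ := d₃ ^ 2;
  -(s * d₂) * c₂ * q ^ (2 * n - N - 1) *
    ((1 - q ^ n) * (1 - c₁ * q ^ (N - n + 1)) * (1 - c₁ * q ^ (N + 2 - n)) * (1 - c₃ * q ^ n)) /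
    ((1 - c₂ * c₃ * q ^ (2 * n)) * (1 - c₂ * c₃ * q ^ (2 * n + 1)))

/-- `Φ_+^-(n; c₁, c₂, c₃; N)`. -/
noncomputable def PhiUpNeg (s d₁ d₂ d₃ : ℂ) (N n : ℤ) : ℂ :=
  let q := s ^ 2;
  let c₁ := d₁ ^ 2;
  let c₂ := d₂ ^ 2;
  let c₃ := d₃ ^ 2;
  -((1 - c₁ * c₂ * c₃ * q ^ (n + N + 2)) * (1 - c₁ * c₂ * c₃ * q ^ (n + N + 3)) *
      (1 - c₂ * q ^ (n + 1))) /
    (c₃ * q ^ (N + 1) * (s * d₂) * (1 - c₂ * c₃ * q ^ (2 * n + 2))) *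
    quot q (c₂ * c₃) (n + 1) (2 * n + 1)

/-- The coefficients `Φ_+^ε(n; c₁, c₂, c₃; N)` of the contiguity relation `N ↦ N + 1`. -/
noncomputable def PhiUp (s d₁ d₂ d₃ : ℂ) (N : ℤ) : SignType → ℤ → ℂ
  | .pos, n => PhiUpPos s d₁ d₂ d₃ N n
  | .neg, n => PhiUpNeg s d₁ d₂ d₃ N n
  | .zero, n =>
      -(PhiUpPos s d₁ d₂ d₃ N n + PhiUpNeg s d₁ d₂ d₃ N n) -
        (1 - d₁ ^ 2 * d₂ ^ 2 * (s ^ 2) ^ (N + 2)) *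
          (1 - d₁ ^ 2 * d₂ ^ 2 * d₃ ^ 2 * (s ^ 2) ^ (N + 2)) /
          (d₃ ^ 2 * (s ^ 2) ^ (N + 1) * (s * d₂))

/-- `Φ_-^+(n; c₁, c₂, c₃; N)`. -/
noncomputable def PhiDownPos (s d₂ d₃ : ℂ) (N n : ℤ) : ℂ :=
  let q := s ^ 2;
  let c₂ := d₂ ^ 2;
  let c₃ := d₃ ^ 2;
  -(s * d₂) * ((1 - q ^ n) * (1 - c₃ * q ^ n)) / q ^ N *
    quot q (c₂ * c₃) (n + N) (2 * n) * quot q (c₂ * c₃) (n + N + 1) (2 * n + 1)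

/-- `Φ_-^-(n; c₁, c₂, c₃; N)`. -/
noncomputable def PhiDownNeg (s d₂ d₃ : ℂ) (N n : ℤ) : ℂ :=
  let q := s ^ 2;
  let c₂ := d₂ ^ 2;
  let c₃ := d₃ ^ 2;
  -c₃ * (s * d₂) * q ^ N *
    ((1 - q ^ (n - N)) * (1 - q ^ (n - N + 1)) * (1 - c₂ * q ^ (n + 1))) /
    (1 - c₂ * c₃ * q ^ (2 * n + 2)) * quot q (c₂ * c₃) (n + 1) (2 * n + 1)

/-- The coefficients `Φ_-^ε(n; c₁, c₂, c₃; N)` of the contiguity relation `N ↦ N - 1`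
(they do not depend on `c₁`). -/
noncomputable def PhiDown (s d₂ d₃ : ℂ) (N : ℤ) : SignType → ℤ → ℂ
  | .pos, n => PhiDownPos s d₂ d₃ N n
  | .neg, n => PhiDownNeg s d₂ d₃ N n
  | .zero, n =>
      -(PhiDownPos s d₂ d₃ N n + PhiDownNeg s d₂ d₃ N n) -
        (s * d₂) * (1 - d₃ ^ 2 * (s ^ 2) ^ N) * ((s ^ 2) ^ (-N) - 1)

end Racah

section Bivariate

/-- The Griffiths polynomial `G_{i,j}(x, y; c₁, c₂, c₃, c₄; N)` of `q`-Racah type. The root `d₀` of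
the dependent parameter `c₀`, which is fixed by `q ^ (2 N + 3) c₀ c₁ c₂ c₃ c₄ = 1`, is passed
explicitly. By the conventions for `racah` it vanishes unless `0 ≤ i`, `0 ≤ j` and `i + j ≤ N`. -/
noncomputable def griffiths (s d₀ d₁ d₂ d₃ d₄ : ℂ) (N i j x y : ℤ) : ℂ :=
  ∑ a ∈ Icc 0 (min (N - j) (N - y)),
    omegaFn s (d₁ * d₂ * d₃ / d₄) a * racah s d₁ d₂ d₃ (N - j) i a *
      racah s d₃ d₀ d₄ (N - a) j y * racah s d₄ d₂ d₁ (N - y) a x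

/-- `F^-_x(c₁, c₂)`. -/
noncomputable def FNeg (q c₁ c₂ : ℂ) (x : ℤ) : ℂ :=
  c₁ * c₂ * q ^ (x + 1) * (1 - c₂ * q ^ (x + 1)) / (1 - c₁ * c₂ * q ^ (2 * x + 2)) *
    quot q (c₁ * c₂) (x + 1) (2 * x + 1)

/-- The quotient of `F^+_x(c₁, c₂)` without its denominator factor `1 - c₁ c₂ q ^ (2 x + 1)`. -/
noncomputable def FPosNum (q c₁ c₂ : ℂ) (x : ℤ) : ℂ :=
  c₁ * c₂ ^ 2 * q ^ (x + 1) * ((1 - c₁ * q ^ x) * (1 - q ^ x)) / (1 - c₁ * c₂ * q ^ (2 * x))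

/-- `F^+_x(c₁, c₂)`. -/
noncomputable def FPos (q c₁ c₂ : ℂ) (x : ℤ) : ℂ :=
  FPosNum q c₁ c₂ x / (1 - c₁ * c₂ * q ^ (2 * x + 1))

/-- The product `(1 - c₁ c₂ c₃ q ^ (N - j + 2)) F^+_j(c₄, c₀)`, as a function on the parameter
variety `q ^ (2 N + 3) c₀ c₁ c₂ c₃ c₄ = 1`. For `j = N` one has there
`(1 - c₁ c₂ c₃ q ^ 2) / (1 - c₄ c₀ q ^ (2 N + 1)) = - c₁ c₂ c₃ q ^ 2`. -/
noncomputable def FPosMul (q c₀ c₁ c₂ c₃ c₄ : ℂ) (N j : ℤ) : ℂ :=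
  if j = N then -(c₁ * c₂ * c₃ * q ^ 2) * FPosNum q c₄ c₀ j
  else (1 - c₁ * c₂ * c₃ * q ^ (N - j + 2)) * FPos q c₄ c₀ j

theorem FPosMul_eq {q c₀ c₁ c₂ c₃ c₄ : ℂ} {N j : ℤ} (hq : q ≠ 0)
    (hc : q ^ (2 * N + 3) * c₀ * c₁ * c₂ * c₃ * c₄ = 1)
    (h : 1 - c₄ * c₀ * q ^ (2 * N + 1) ≠ 0) :
    FPosMul q c₀ c₁ c₂ c₃ c₄ N j = (1 - c₁ * c₂ * c₃ * q ^ (N - j + 2)) * FPos q c₄ c₀ j := by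
  unfold FPosMul
  split_ifs with hj
  · subst hj
    have h3 : q ^ (2 * j + 3) = q ^ (2 * j + 1) * q ^ 2 := by
      rw [← zpow_natCast q 2, ← zpow_add₀ hq]; congr 1; push_cast; ring
    have h2 : q ^ (j - j + 2) = q ^ 2 := by
      rw [← zpow_natCast q 2]; congr 1; simp
    rw [h3] at hc
    rw [h2]
    unfold FPos
    generalize FPosNum q c₄ c₀ j = F
    generalize q ^ (2 * j + 1) = u at *
    rw [← mul_div_assoc, eq_div_iff h]
    linear_combination F * hc
  · rfl

/-- The product `F^+_j(c₄, c₀) Φ_+^ε(i; c₁, c₂, c₃; N - j)`. For `i = 0`, `j = N` every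
`Φ_+^ε(0; c₁, c₂, c₃; 0)` is divisible by `1 - c₁ c₂ c₃ q ^ 2`, and that factor is absorbed into
`FPosMul`. -/
noncomputable def FPosPhiUp (s d₀ d₁ d₂ d₃ d₄ : ℂ) (N : ℤ) (ε : SignType) (i j : ℤ) : ℂ :=
  let q := s ^ 2;
  let c₁ := d₁ ^ 2;
  let c₂ := d₂ ^ 2;
  let c₃ := d₃ ^ 2;
  if i = 0 ∧ j = N then
    FPosMul q (d₀ ^ 2) c₁ c₂ c₃ (d₄ ^ 2) N j *
      match ε with
      | .pos => 0
      | .neg =>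
          -((1 - c₁ * c₂ * c₃ * q ^ 3) * (1 - c₂ * q)) / (c₃ * q * (s * d₂) * (1 - c₂ * c₃ * q ^ 2))
      | .zero =>
          (1 - c₁ * c₂ * c₃ * q ^ 3) * (1 - c₂ * q) / (c₃ * q * (s * d₂) * (1 - c₂ * c₃ * q ^ 2)) -
            (1 - c₁ * c₂ * q ^ 2) / (c₃ * q * (s * d₂))
  else FPos q (d₄ ^ 2) (d₀ ^ 2) j * PhiUp s d₁ d₂ d₃ (N - j) ε i

theorem FPosPhiUp_eq {s d₀ d₁ d₂ d₃ d₄ : ℂ} {N : ℤ} (ε : SignType) (i j : ℤ) (hs : s ≠ 0)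
    (hc : (s ^ 2) ^ (2 * N + 3) * d₀ ^ 2 * d₁ ^ 2 * d₂ ^ 2 * d₃ ^ 2 * d₄ ^ 2 = 1)
    (h : 1 - d₄ ^ 2 * d₀ ^ 2 * (s ^ 2) ^ (2 * N + 1) ≠ 0) :
    FPosPhiUp s d₀ d₁ d₂ d₃ d₄ N ε i j =
      FPos (s ^ 2) (d₄ ^ 2) (d₀ ^ 2) j * PhiUp s d₁ d₂ d₃ (N - j) ε i := by
  have hq : s ^ 2 ≠ 0 := pow_ne_zero 2 hs
  unfold FPosPhiUp
  simp only
  split_ifs with hij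
  · obtain ⟨rfl, rfl⟩ := hij
    rw [FPosMul_eq hq hc h]
    have e2 : (s ^ 2) ^ (j - j + 2) = (s ^ 2) ^ 2 := by
      rw [← zpow_natCast (s ^ 2) 2]; congr 1; simp
    have e1 : (s ^ 2) ^ (j - j + 1) = s ^ 2 := by simp
    have e3 : (s ^ 2) ^ (0 + (j - j) + 3) = (s ^ 2) ^ 3 := by
      rw [← zpow_natCast (s ^ 2) 3]; congr 1; simp
    have e4 : (s ^ 2) ^ (0 + (j - j) + 2) = (s ^ 2) ^ 2 := by
      rw [← zpow_natCast (s ^ 2) 2]; congr 1; simp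
    have e5 : (s ^ 2) ^ ((0 : ℤ) + 1) = s ^ 2 := by simp
    have e6 : (s ^ 2) ^ (2 * (0 : ℤ) + 2) = (s ^ 2) ^ 2 := by
      rw [← zpow_natCast (s ^ 2) 2]; congr 1
    have e7 : quot (s ^ 2) (d₂ ^ 2 * d₃ ^ 2) (0 + 1) (2 * 0 + 1) = 1 := by simp [quot]
    have e8 : PhiUpPos s d₁ d₂ d₃ (j - j) 0 = 0 := by simp [PhiUpPos]
    have e9 : PhiUpNeg s d₁ d₂ d₃ (j - j) 0 =
        -((1 - d₁ ^ 2 * d₂ ^ 2 * d₃ ^ 2 * (s ^ 2) ^ 2) *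
          (1 - d₁ ^ 2 * d₂ ^ 2 * d₃ ^ 2 * (s ^ 2) ^ 3) * (1 - d₂ ^ 2 * s ^ 2)) /
        (d₃ ^ 2 * s ^ 2 * (s * d₂) * (1 - d₂ ^ 2 * d₃ ^ 2 * (s ^ 2) ^ 2)) := by
      simp only [PhiUpNeg, e1, e3, e4, e5, e6, e7, mul_one]
    cases ε
    · simp only [PhiUp, e8, e9, e2, e1]; ring
    · simp only [PhiUp, e9, e2]; ring
    · simp only [PhiUp, e8, mul_zero]
  · rfl

/-- The quantity `g_j`, which is the sum of the first two terms of `A^{0,0}_{i,j}`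
(see `coeffA_zero_zero`). -/
noncomputable def gCoeff (q c₀ c₁ c₂ c₃ c₄ : ℂ) (N j : ℤ) : ℂ :=
  -(1 - c₃ * q ^ (N + 1 - j)) * q ^ j * FPosMul q c₀ c₁ c₂ c₃ c₄ N j -
    c₃ * (1 - q ^ (N - j)) * (q ^ (j + 1) - c₁ * c₂ * q ^ (N + 2)) * FNeg q c₄ c₀ j

/-- The coefficients `A^{ε,ε'}_{i,j}(c₁, c₂, c₃, c₄; N)`. -/
noncomputable def coeffA (s d₀ d₁ d₂ d₃ d₄ : ℂ) (N : ℤ) (ε ε' : SignType) (i j : ℤ) : ℂ :=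
  let q := s ^ 2;
  let c₀ := d₀ ^ 2;
  let c₁ := d₁ ^ 2;
  let c₂ := d₂ ^ 2;
  let c₃ := d₃ ^ 2;
  let c₄ := d₄ ^ 2;
  match ε, ε' with
  | ε, .pos => -c₃ * q ^ (N + 1) * FPosPhiUp s d₀ d₁ d₂ d₃ d₄ N ε i j
  | ε, .neg => -c₃ * q ^ (N + 1) * (FNeg q c₄ c₀ j * PhiDown s d₂ d₃ (N - j) ε i)
  | .pos, .zero => c₃ * q ^ (N + 1) * (FPos q c₄ c₀ j + FNeg q c₄ c₀ j) *
      Phi q c₁ c₂ c₃ (N - j) .pos i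
  | .neg, .zero => c₃ * q ^ (N + 1) * (FPos q c₄ c₀ j + FNeg q c₄ c₀ j) *
      Phi q c₁ c₂ c₃ (N - j) .neg i
  | .zero, .zero => gCoeff q c₀ c₁ c₂ c₃ c₄ N j -
      (c₃ * q ^ (N + 1) * (FPos q c₄ c₀ j + FNeg q c₄ c₀ j) * Phi q c₁ c₂ c₃ (N - j) .pos i +
       c₃ * q ^ (N + 1) * (FPos q c₄ c₀ j + FNeg q c₄ c₀ j) * Phi q c₁ c₂ c₃ (N - j) .neg i)

/-- The defining relation of `A^{0,0}_{i,j}`, away from the zeros of the denominators. -/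
theorem coeffA_zero_zero {s d₀ d₁ d₂ d₃ d₄ : ℂ} {N : ℤ} (i j : ℤ) (hs : s ≠ 0) (hd₂ : d₂ ≠ 0)
    (hd₃ : d₃ ≠ 0)
    (hc : (s ^ 2) ^ (2 * N + 3) * d₀ ^ 2 * d₁ ^ 2 * d₂ ^ 2 * d₃ ^ 2 * d₄ ^ 2 = 1)
    (h : 1 - d₄ ^ 2 * d₀ ^ 2 * (s ^ 2) ^ (2 * N + 1) ≠ 0)
    (h₁ : 1 - d₁ ^ 2 * d₂ ^ 2 * (s ^ 2) ^ (N + 2 - j) ≠ 0)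
    (h₂ : 1 - d₃ ^ 2 * (s ^ 2) ^ (N - j) ≠ 0) :
    coeffA s d₀ d₁ d₂ d₃ d₄ N 0 0 i j =
      -((1 - d₃ ^ 2 * (s ^ 2) ^ (N + 1 - j)) * (s * d₂) /
          (1 - d₁ ^ 2 * d₂ ^ 2 * (s ^ 2) ^ (N + 2 - j))) *
        ∑ ε : SignType, coeffA s d₀ d₁ d₂ d₃ d₄ N ε 1 i j -
      (1 - d₁ ^ 2 * d₂ ^ 2 * (s ^ 2) ^ (N + 1 - j)) /
          ((1 - d₃ ^ 2 * (s ^ 2) ^ (N - j)) * (s * d₂)) *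
        ∑ ε : SignType, coeffA s d₀ d₁ d₂ d₃ d₄ N ε (-1) i j -
      (coeffA s d₀ d₁ d₂ d₃ d₄ N 1 0 i j + coeffA s d₀ d₁ d₂ d₃ d₄ N (-1) 0 i j) := by
  have hq : s ^ 2 ≠ 0 := pow_ne_zero 2 hs
  have hU : ∑ ε : SignType, coeffA s d₀ d₁ d₂ d₃ d₄ N ε 1 i j =
      -d₃ ^ 2 * (s ^ 2) ^ (N + 1) * (FPos (s ^ 2) (d₄ ^ 2) (d₀ ^ 2) j *
        (-((1 - d₁ ^ 2 * d₂ ^ 2 * (s ^ 2) ^ (N - j + 2)) *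
          (1 - d₁ ^ 2 * d₂ ^ 2 * d₃ ^ 2 * (s ^ 2) ^ (N - j + 2)) /
          (d₃ ^ 2 * (s ^ 2) ^ (N - j + 1) * (s * d₂))))) := by
    have : ∀ ε : SignType, coeffA s d₀ d₁ d₂ d₃ d₄ N ε 1 i j =
        -d₃ ^ 2 * (s ^ 2) ^ (N + 1) * FPosPhiUp s d₀ d₁ d₂ d₃ d₄ N ε i j := by
      intro ε; cases ε <;> rfl
    simp only [this, FPosPhiUp_eq _ i j hs hc h, ← Finset.mul_sum]
    congr 2
    rw [SignType.univ_eq]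
    simp [PhiUp]
    ring
  have hV : ∑ ε : SignType, coeffA s d₀ d₁ d₂ d₃ d₄ N ε (-1) i j =
      -d₃ ^ 2 * (s ^ 2) ^ (N + 1) * (FNeg (s ^ 2) (d₄ ^ 2) (d₀ ^ 2) j *
        (-(s * d₂ * (1 - d₃ ^ 2 * (s ^ 2) ^ (N - j)) * ((s ^ 2) ^ (-(N - j)) - 1)))) := by
    have : ∀ ε : SignType, coeffA s d₀ d₁ d₂ d₃ d₄ N ε (-1) i j =
        -d₃ ^ 2 * (s ^ 2) ^ (N + 1) *
          (FNeg (s ^ 2) (d₄ ^ 2) (d₀ ^ 2) j * PhiDown s d₂ d₃ (N - j) ε i) := by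
      intro ε; cases ε <;> rfl
    simp only [this, ← Finset.mul_sum]
    congr 2
    rw [SignType.univ_eq]
    simp [PhiDown]
    ring
  have h00 : coeffA s d₀ d₁ d₂ d₃ d₄ N 0 0 i j =
      gCoeff (s ^ 2) (d₀ ^ 2) (d₁ ^ 2) (d₂ ^ 2) (d₃ ^ 2) (d₄ ^ 2) N j -
      (coeffA s d₀ d₁ d₂ d₃ d₄ N 1 0 i j + coeffA s d₀ d₁ d₂ d₃ d₄ N (-1) 0 i j) := rfl
  rw [hU, hV, h00]
  congr 1
  unfold gCoeff
  rw [FPosMul_eq hq hc h]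
  generalize FPos (s ^ 2) (d₄ ^ 2) (d₀ ^ 2) j = F
  generalize FNeg (s ^ 2) (d₄ ^ 2) (d₀ ^ 2) j = G
  have hQ : (s ^ 2) ^ j ≠ 0 := zpow_ne_zero _ hq
  have hT : (s ^ 2) ^ (N - j) ≠ 0 := zpow_ne_zero _ hq
  have p1 : (s ^ 2) ^ (N + 1) = (s ^ 2) ^ j * (s ^ 2) ^ (N - j) * s ^ 2 := by
    rw [← zpow_add₀ hq, ← zpow_add_one₀ hq]; congr 1; ring
  have p2 : (s ^ 2) ^ (N - j + 1) = (s ^ 2) ^ (N - j) * s ^ 2 := by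
    rw [← zpow_add_one₀ hq]
  have p3 : (s ^ 2) ^ (N - j + 2) = (s ^ 2) ^ (N - j) * s ^ 2 * s ^ 2 := by
    rw [← zpow_add_one₀ hq, ← zpow_add_one₀ hq]; congr 1; ring
  have p4 : (s ^ 2) ^ (N + 2 - j) = (s ^ 2) ^ (N - j) * s ^ 2 * s ^ 2 := by
    rw [← p3]; congr 1; ring
  have p5 : (s ^ 2) ^ (N + 1 - j) = (s ^ 2) ^ (N - j) * s ^ 2 := by
    rw [← p2]; congr 1; ring
  have p6 : (s ^ 2) ^ (j + 1) = (s ^ 2) ^ j * s ^ 2 := zpow_add_one₀ hq _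
  have p7 : (s ^ 2) ^ (N + 2) = (s ^ 2) ^ j * (s ^ 2) ^ (N - j) * s ^ 2 * s ^ 2 := by
    rw [← p1, ← zpow_add_one₀ hq]; congr 1; ring
  rw [p4] at h₁
  rw [zpow_neg, p1, p2, p3, p4, p5, p6, p7]
  generalize (s ^ 2) ^ j = Q at *
  generalize (s ^ 2) ^ (N - j) = T at *
  generalize hu : 1 - d₁ ^ 2 * d₂ ^ 2 * (T * s ^ 2 * s ^ 2) = u at *
  generalize hv : 1 - d₃ ^ 2 * T = v at *
  field_simp

/-- The standing constraints on the parameters `q, c₀, c₁, c₂, c₃, c₄`. -/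
structure Admissible (N : ℕ) (q c₀ c₁ c₂ c₃ c₄ : ℂ) : Prop where
  q_ne_zero : q ≠ 0
  c_ne_zero : ∀ c ∈ ({c₀, c₁, c₂, c₃, c₄} : Set ℂ), c ≠ 0
  q_pow_ne_one : ∀ k : ℕ, 1 ≤ k → k ≤ N → q ^ k ≠ 1
  prod_ne : ∀ t ∈ ({c₁ * c₂, c₂ * c₃, c₀ * c₃, c₀ * c₄, c₂ * c₄,
      q * c₁ * c₂ * c₃, q * c₀ * c₃ * c₄, q * c₁ * c₂ * c₄} : Set ℂ),
    ∀ k : ℕ, 2 ≤ k → k ≤ 2 * N → t ≠ (q ^ k)⁻¹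
  c_ne : ∀ c ∈ ({c₀, c₁, c₂, c₃, c₄} : Set ℂ), ∀ k : ℕ, 1 ≤ k → k ≤ N → c ≠ (q ^ k)⁻¹

end Bivariate

end GriffithsQRacah

namespace GriffithsQRacah

/-! ### The series in a q-quadratic basis, and bidiagonal difference operators on it. -/

section Series

/-! The univariate polynomials satisfy three relations: the three-term recurrence with eigenvalue
λ(x), and two contiguity relations that change the level M by one, with eigenvalues `lamUp` and
`lamDown`. In the basis (y⁻¹;q)_k (c₂c₃qy;q)_k, y = q^n, each of the difference operators y ↦ qy, y
↦ y/q involved is bidiagonal. Transposing it onto the coefficients of the series (`sum_three_term`)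
leaves one scalar identity for each k. The weights Ω then carry these relations from the bare series
to the polynomials: they interchange the coefficients of the two contiguity relations and symmetrize
the three-term one (`Omega_mul_PhiUp`, `Omega_mul_PhiPos`). The series is symmetric under n ↔ x, c₁
↔ c₃, so the same relations hold in the variable x.

First recurrence. Multiplication by λ(y) acts on the middle factor p_j(y; c₃,c₀,c₄; N−a) of the sum
over a. Its recurrence coefficients depend on a through the level N−a. On the variety
q^(2N+3)c₀c₁c₂c₃c₄ = 1 they are, as functions of a, multiples of the eigenvalues `lamUp` and
`lamDown` of the first factor p_i(a; c₁,c₂,c₃; N−j), and, for the central coefficient, affine in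
λ(a). The relations of the first factor therefore absorb them, and the coefficients so produced are
the A's. This is `Phi_mul_racah`.

Second recurrence. Multiplication by λ(x) shifts the summation index a in the third factor. By
`Phi_mul_racah` for the permuted parameters, the resulting coefficient acts on the middle factor
through the coefficients A(c₃,c₀,c₄,c₁). What remains concerns the first factor alone: a weighted
sum over shifts of its variable has to become a sum over shifts of its degree with the coefficients
A(c₁,c₀,c₄,c₃) (`coeffA_intertwine`). Let X be multiplication by μ(b) = q^(−b) + c₁c₂q^(b+1), and
let T be one of the dual recurrence or contiguity operators in b. The sum is a multiple of XT − qTX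
plus a multiple of a relation already known: in b this q-commutator has the coefficients g_ε(b)(μ(b)
− qμ(b−ε)), where μ(b) − qμ(b∓1) is a monomial in q^b. On degrees, X is tridiagonal and T acts by a
scalar, so XT − qTX can be expanded there as well (`q_commutator`). The two expansions match term by
term.

All of this divides by factors that may vanish under the stated assumptions. It is carried out for
generic parameters and extended by continuity along a curve in the parameter variety through the
given point (`recurrence_relations`). The cancelled forms of Ω and of the coefficients are
continuous there. -/

theorem qPoch_succ (q a : ℂ) (k : ℕ) : qPoch q a (k + 1) = qPoch q a k * (1 - a * q ^ k) := by
  simp [qPoch, prod_range_succ]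

theorem qPoch_succ' (q a : ℂ) (k : ℕ) : qPoch q a (k + 1) = (1 - a) * qPoch q (a * q) k := by
  simp only [qPoch, prod_range_succ']
  rw [mul_comm]
  simp [pow_succ', mul_assoc]

@[simp] theorem qPoch_zero (q a : ℂ) : qPoch q a 0 = 1 := by simp [qPoch]

theorem qPoch_shift (q a : ℂ) (k : ℕ) :
    (1 - a) * qPoch q (a * q) k = qPoch q a k * (1 - a * q ^ k) := by
  rw [← qPoch_succ', qPoch_succ]

/-- The product `(y⁻¹; q)_k (t q y; q)_k`. -/
noncomputable def psi (q t y : ℂ) (k : ℕ) : ℂ := qPoch q y⁻¹ k * qPoch q (t * q * y) k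

@[simp] theorem psi_zero (q t y : ℂ) : psi q t y 0 = 1 := by simp [psi]

theorem psi_succ (q t y : ℂ) (k : ℕ) :
    psi q t y (k + 1) = (1 - q ^ k / y) * (1 - t * q * y * q ^ k) * psi q t y k := by
  simp only [psi, qPoch_succ]; ring

/-- Both sides contain the same Pochhammer products up to their end factors, so a shift of y changes
psi by a multiple of the previous basis element. The prefactor is kept on the left: dividing by it
would exclude the zeros of 1 − tqy. -/
theorem psi_shift_up {q t y : ℂ} (hq : q ≠ 0) (hy : y ≠ 0) (k : ℕ) :
    (1 - t * q * y) * (psi q t (q * y) (k + 1) - psi q t y (k + 1)) =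
      -(psi q t y k * ((1 - t * q * y * q ^ k) * (1 - q * q ^ k) *
        (1 - t * q ^ 2 * y ^ 2) / (q * y))) := by
  have h1 : psi q t (q * y) (k + 1) =
      (1 - (q * y)⁻¹) * qPoch q y⁻¹ k * (qPoch q (t * q * y * q) k * (1 - t * q * y * q * q ^ k)) := by
    rw [psi, qPoch_succ' q (q * y)⁻¹, qPoch_succ]
    rw [show (q * y)⁻¹ * q = y⁻¹ by field_simp, show t * q * (q * y) = t * q * y * q by ring]
  have h2 := qPoch_shift q (t * q * y) k
  rw [h1, psi_succ]
  unfold psi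
  calc _ = (1 - (q * y)⁻¹) * qPoch q y⁻¹ k * (((1 - t * q * y) * qPoch q (t * q * y * q) k) *
        (1 - t * q * y * q * q ^ k)) - (1 - t * q * y) * ((1 - q ^ k / y) * (1 - t * q * y * q ^ k) *
        (qPoch q y⁻¹ k * qPoch q (t * q * y) k)) := by ring
    _ = _ := by
      rw [h2]
      field_simp
      ring

/-- The prefactor 1 − y vanishes at n = 0, where y/q lies outside the index range; in this
multiplied form the identity holds there too. -/
theorem psi_shift_down {q t y : ℂ} (hq : q ≠ 0) (hy : y ≠ 0) (k : ℕ) :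
    (1 - y) * (psi q t (y / q) (k + 1) - psi q t y (k + 1)) =
      -(psi q t y k * ((1 - q ^ k / y) * (1 - q * q ^ k) * (1 - t * y ^ 2))) := by
  have h1 : psi q t (y / q) (k + 1) =
      qPoch q (y⁻¹ * q) k * (1 - y⁻¹ * q * q ^ k) * ((1 - t * y) * qPoch q (t * q * y) k) := by
    rw [psi, qPoch_succ, qPoch_succ' q (t * q * (y / q))]
    rw [show (y / q)⁻¹ = y⁻¹ * q by field_simp, show t * q * (y / q) = t * y by field_simp,
      show t * y * q = t * q * y by ring]
  have h2 := qPoch_shift q y⁻¹ k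
  rw [h1, psi_succ]
  unfold psi
  have h3 : (1 - y) * qPoch q (y⁻¹ * q) k = -y * (qPoch q y⁻¹ k * (1 - y⁻¹ * q ^ k)) := by
    rw [← h2]; field_simp; ring
  calc _ = ((1 - y) * qPoch q (y⁻¹ * q) k) * (1 - y⁻¹ * q * q ^ k) *
        ((1 - t * y) * qPoch q (t * q * y) k) - (1 - y) * ((1 - q ^ k / y) * (1 - t * q * y * q ^ k) *
        (qPoch q y⁻¹ k * qPoch q (t * q * y) k)) := by ring
    _ = _ := by
      rw [h3]
      field_simp
      ring

/-- The factor `(1 - y) (1 - b y) / ((1 - a b y ^ 2) (1 - a b q y ^ 2))`. -/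
noncomputable def wPos (q a b y : ℂ) : ℂ :=
  (1 - y) * (1 - b * y) / ((1 - a * b * y ^ 2) * (1 - a * b * q * y ^ 2))

/-- The factor `(1 - a q y) (1 - a b q y) / ((1 - a b q y ^ 2) (1 - a b q ^ 2 y ^ 2))`. -/
noncomputable def wNeg (q a b y : ℂ) : ℂ :=
  (1 - a * q * y) * (1 - a * b * q * y) / ((1 - a * b * q * y ^ 2) * (1 - a * b * q ^ 2 * y ^ 2))

/-- The factor 1 − abqy in the numerator of `wNeg` is what `psi_shift_up` requires, and 1 − abq²y²
cancels against its right-hand side. -/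
theorem wNeg_mul_psi {q a b y : ℂ} (hq : q ≠ 0) (hy : y ≠ 0)
    (h2 : 1 - a * b * q ^ 2 * y ^ 2 ≠ 0) (k : ℕ) :
    wNeg q a b y * (psi q (a * b) (q * y) (k + 1) - psi q (a * b) y (k + 1)) =
      -(psi q (a * b) y k * ((1 - a * q * y) * (1 - a * b * q * y * q ^ k) * (1 - q * q ^ k) /
        (q * y * (1 - a * b * q * y ^ 2)))) := by
  have h := psi_shift_up (t := a * b) hq hy k
  unfold wNeg
  calc _ = (1 - a * q * y) / ((1 - a * b * q * y ^ 2) * (1 - a * b * q ^ 2 * y ^ 2)) *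
      ((1 - a * b * q * y) * (psi q (a * b) (q * y) (k + 1) - psi q (a * b) y (k + 1))) := by ring
    _ = _ := by
      rw [h]
      generalize psi q (a * b) y k = P
      generalize hX : 1 - a * b * q ^ 2 * y ^ 2 = X at *
      rw [← sub_eq_zero]
      generalize (1 - a * b * q * y ^ 2) = T
      field_simp
      ring

theorem wPos_mul_psi {q a b y : ℂ} (hq : q ≠ 0) (hy : y ≠ 0)
    (h0 : 1 - a * b * y ^ 2 ≠ 0) (k : ℕ) :
    wPos q a b y * (psi q (a * b) (y / q) (k + 1) - psi q (a * b) y (k + 1)) =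
      -(psi q (a * b) y k * ((1 - b * y) * (1 - q ^ k / y) * (1 - q * q ^ k) /
        (1 - a * b * q * y ^ 2))) := by
  have h := psi_shift_down (t := a * b) hq hy k
  unfold wPos
  calc _ = (1 - b * y) / ((1 - a * b * y ^ 2) * (1 - a * b * q * y ^ 2)) *
      ((1 - y) * (psi q (a * b) (y / q) (k + 1) - psi q (a * b) y (k + 1))) := by ring
    _ = _ := by
      rw [h]
      generalize psi q (a * b) y k = P
      generalize hX : 1 - a * b * y ^ 2 = X at *
      generalize (1 - a * b * q * y ^ 2) = T
      field_simp

/-- The coefficient of `(y⁻¹; q)_k (c₂ c₃ q y; q)_k` in the `q`-Racah series. -/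
noncomputable def sig (q c₁ c₂ c₃ m z : ℂ) (k : ℕ) : ℂ :=
  psi q (c₁ * c₂) z k / (qPoch q (q * c₂) k * qPoch q (c₁ * c₂ * c₃ * q ^ 2 * m) k *
    qPoch q m⁻¹ k) * (q ^ k / qPoch q q k)

theorem psi_eq_zero {q : ℂ} (hq : q ≠ 0) (t : ℂ) {x k : ℕ} (h : x < k) : psi q t (q ^ x) k = 0 := by
  unfold psi qPoch
  rw [prod_eq_zero (mem_range.2 h), zero_mul]
  field_simp
  simp

theorem sig_eq_zero {q : ℂ} (hq : q ≠ 0) (c₁ c₂ c₃ m : ℂ) {x k : ℕ} (h : x < k) :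
    sig q c₁ c₂ c₃ m (q ^ x) k = 0 := by
  simp [sig, psi_eq_zero hq _ h]

/-- The truncated `q`-Racah series as a function of `y = q ^ n` and `z = q ^ x`. -/
noncomputable def wser (q c₁ c₂ c₃ m : ℂ) (K : ℕ) (y z : ℂ) : ℂ :=
  ∑ k ∈ range (K + 1), psi q (c₂ * c₃) y k * sig q c₁ c₂ c₃ m z k

/-- Summation by parts: the operator acts on the basis by the diagonal entries α and the subdiagonal
entries β, so on coefficients it acts by σ ↦ α_k σ_k + β_k σ_{k+1}. The condition σ_{K+1} = 0 makes
the truncated sum close. The k = 0 term is separate because the zeroth basis element is constant,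
whence α₀ = c. -/
theorem sum_three_term {q t y : ℂ} {B D c : ℂ} {K : ℕ} (σ α β τ : ℕ → ℂ)
    (hstep : ∀ k, B * (psi q t (q * y) (k + 1) - psi q t y (k + 1)) +
      D * (psi q t (y / q) (k + 1) - psi q t y (k + 1)) =
        (α (k + 1) - c) * psi q t y (k + 1) + β k * psi q t y k)
    (h0 : α 0 = c) (hσ : σ (K + 1) = 0)
    (hτ : ∀ k ≤ K, psi q t y k * (α k * σ k + β k * σ (k + 1)) = psi q t y k * τ k) :
    B * (∑ k ∈ range (K + 1), psi q t (q * y) k * σ k - ∑ k ∈ range (K + 1), psi q t y k * σ k) +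
      D * (∑ k ∈ range (K + 1), psi q t (y / q) k * σ k - ∑ k ∈ range (K + 1), psi q t y k * σ k) +
      c * ∑ k ∈ range (K + 1), psi q t y k * σ k = ∑ k ∈ range (K + 1), psi q t y k * τ k := by
  have h1 : ∑ k ∈ range (K + 1), psi q t y k * τ k =
      ∑ k ∈ range (K + 1), α k * psi q t y k * σ k +
        ∑ k ∈ range (K + 1), β k * psi q t y k * σ (k + 1) := by
    rw [← sum_add_distrib]
    refine sum_congr rfl fun k hk => ?_
    rw [← hτ k (by rw [mem_range] at hk; omega)]
    ring
  rw [h1, sum_range_succ (fun k => β k * psi q t y k * σ (k + 1)), hσ, mul_zero, add_zero,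
    sum_range_succ' (fun k => psi q t (q * y) k * σ k), sum_range_succ' (fun k => psi q t y k * σ k),
    sum_range_succ' (fun k => psi q t (y / q) k * σ k), sum_range_succ' (fun k => α k * psi q t y k * σ k)]
  simp only [psi_zero, h0]
  have : ∑ k ∈ range K, α (k + 1) * psi q t y (k + 1) * σ (k + 1) +
      ∑ k ∈ range K, β k * psi q t y k * σ (k + 1) =
      B * (∑ k ∈ range K, psi q t (q * y) (k + 1) * σ (k + 1) -
        ∑ k ∈ range K, psi q t y (k + 1) * σ (k + 1)) +
      D * (∑ k ∈ range K, psi q t (y / q) (k + 1) * σ (k + 1) -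
        ∑ k ∈ range K, psi q t y (k + 1) * σ (k + 1)) +
      c * ∑ k ∈ range K, psi q t y (k + 1) * σ (k + 1) := by
    rw [← sum_add_distrib, ← sum_sub_distrib, ← sum_sub_distrib, mul_sum, mul_sum, mul_sum,
      ← sum_add_distrib, ← sum_add_distrib]
    refine sum_congr rfl fun k _ => ?_
    linear_combination (-σ (k + 1)) * hstep k
  linear_combination -this

end Series

/-! ### The recurrence and the two contiguity relations for the bare series. -/

section Relations

/-- After both shifts every term is a multiple of one basis element. Cancelling it leaves the
rational identity `h`, with the denominator 1 − abqy² cleared. -/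
theorem wPos_wNeg_step {q a b y : ℂ} (hq : q ≠ 0) (hy : y ≠ 0)
    (h0 : 1 - a * b * y ^ 2 ≠ 0) (h2 : 1 - a * b * q ^ 2 * y ^ 2 ≠ 0) (B D E P : ℂ) (k : ℕ)
    (h : -(B * ((1 - a * q * y) * (1 - a * b * q * y * q ^ k) * (1 - q * q ^ k) / (q * y))) -
      D * ((1 - b * y) * (1 - q ^ k / y) * (1 - q * q ^ k)) = (1 - a * b * q * y ^ 2) *
        (E * ((1 - q ^ k / y) * (1 - a * b * q * y * q ^ k)) + P))
    (h1 : 1 - a * b * q * y ^ 2 ≠ 0) :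
    B * wNeg q a b y * (psi q (a * b) (q * y) (k + 1) - psi q (a * b) y (k + 1)) +
      D * wPos q a b y * (psi q (a * b) (y / q) (k + 1) - psi q (a * b) y (k + 1)) =
      E * psi q (a * b) y (k + 1) + P * psi q (a * b) y k := by
  rw [mul_assoc, mul_assoc, wNeg_mul_psi hq hy h2, wPos_mul_psi hq hy h0, psi_succ]
  generalize psi q (a * b) y k = S
  have h3 : -(B * ((1 - a * q * y) * (1 - a * b * q * y * q ^ k) * (1 - q * q ^ k) /
      (q * y * (1 - a * b * q * y ^ 2)))) -
      D * ((1 - b * y) * (1 - q ^ k / y) * (1 - q * q ^ k) / (1 - a * b * q * y ^ 2)) =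
      E * ((1 - q ^ k / y) * (1 - a * b * q * y * q ^ k)) + P := by
    rw [← mul_right_inj' h1, ← h, ← div_div]
    generalize (1 - a * q * y) * (1 - a * b * q * y * q ^ k) * (1 - q * q ^ k) / (q * y) = X
    generalize (1 - b * y) * (1 - q ^ k / y) * (1 - q * q ^ k) = Y
    field_simp
  linear_combination S * h3

/-- The coefficients form a q-hypergeometric sequence. At k = x both sides vanish, so the
denominators have to be nonzero only for k < x. -/
theorem sig_succ {q c₁ c₂ c₃ m : ℂ} (hq : q ≠ 0) {x k : ℕ} (hk : k ≤ x)
    (h : k < x → 1 - q * c₂ * q ^ k ≠ 0 ∧ 1 - c₁ * c₂ * c₃ * q ^ 2 * m * q ^ k ≠ 0 ∧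
      1 - m⁻¹ * q ^ k ≠ 0 ∧ 1 - q * q ^ k ≠ 0) :
    sig q c₁ c₂ c₃ m (q ^ x) (k + 1) * ((1 - q * c₂ * q ^ k) *
      (1 - c₁ * c₂ * c₃ * q ^ 2 * m * q ^ k) * (1 - m⁻¹ * q ^ k) * (1 - q * q ^ k)) =
    sig q c₁ c₂ c₃ m (q ^ x) k * (q * (1 - q ^ k / q ^ x) * (1 - c₁ * c₂ * q * q ^ x * q ^ k)) := by
  rcases hk.eq_or_lt with rfl | hlt
  · rw [sig_eq_zero hq _ _ _ _ (Nat.lt_succ_self k), div_self (pow_ne_zero _ hq)]; simp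
  · obtain ⟨h1, h2, h3, h4⟩ := h hlt
    unfold sig
    simp only [psi_succ, qPoch_succ, pow_succ' q k]
    generalize 1 - q * c₂ * q ^ k = A at *
    generalize 1 - c₁ * c₂ * c₃ * q ^ 2 * m * q ^ k = B at *
    generalize 1 - m⁻¹ * q ^ k = C at *
    generalize 1 - q * q ^ k = D at *
    generalize 1 - q ^ k / q ^ x = X
    generalize 1 - c₁ * c₂ * q * q ^ x * q ^ k = Y
    field_simp

/-- Only the two Pochhammer factors containing m change with the level, and each changes by a
telescoping quotient. -/
theorem sig_level {q c₁ c₂ c₃ m : ℂ} (hq : q ≠ 0) (z : ℂ) (k : ℕ)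
    (h1 : 1 - c₁ * c₂ * c₃ * q ^ 2 * m ≠ 0) (h2 : 1 - c₁ * c₂ * c₃ * q ^ 2 * m * q ^ k ≠ 0)
    (h3 : 1 - (q * m)⁻¹ ≠ 0) (h4 : 1 - (q * m)⁻¹ * q ^ k ≠ 0) :
    sig q c₁ c₂ c₃ (q * m) z k * ((1 - c₁ * c₂ * c₃ * q ^ 2 * m * q ^ k) * (1 - (q * m)⁻¹)) =
      sig q c₁ c₂ c₃ m z k * ((1 - c₁ * c₂ * c₃ * q ^ 2 * m) * (1 - (q * m)⁻¹ * q ^ k)) := by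
  have e1 := qPoch_shift q (c₁ * c₂ * c₃ * q ^ 2 * m) k
  have e2 := qPoch_shift q ((q * m)⁻¹) k
  rw [show (q * m)⁻¹ * q = m⁻¹ by field_simp] at e2
  unfold sig
  rw [show c₁ * c₂ * c₃ * q ^ 2 * (q * m) = c₁ * c₂ * c₃ * q ^ 2 * m * q by ring]
  have f1 : qPoch q (c₁ * c₂ * c₃ * q ^ 2 * m * q) k = qPoch q (c₁ * c₂ * c₃ * q ^ 2 * m) k *
      (1 - c₁ * c₂ * c₃ * q ^ 2 * m * q ^ k) / (1 - c₁ * c₂ * c₃ * q ^ 2 * m) := by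
    rw [eq_div_iff h1, ← e1]; ring
  have f2 : qPoch q m⁻¹ k = qPoch q (q * m)⁻¹ k * (1 - (q * m)⁻¹ * q ^ k) / (1 - (q * m)⁻¹) := by
    rw [eq_div_iff h3, ← e2]; ring
  rw [f1, f2]
  generalize qPoch q (c₁ * c₂ * c₃ * q ^ 2 * m) k = X
  generalize qPoch q (q * m)⁻¹ k = Y
  generalize 1 - c₁ * c₂ * c₃ * q ^ 2 * m * q ^ k = A at *
  generalize 1 - c₁ * c₂ * c₃ * q ^ 2 * m = A' at *
  generalize 1 - (q * m)⁻¹ * q ^ k = B at *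
  generalize 1 - (q * m)⁻¹ = B' at *
  generalize psi q (c₁ * c₂) z k = P
  generalize qPoch q (q * c₂) k = Q
  generalize q ^ k / qPoch q q k = R
  simp only [div_eq_mul_inv, mul_inv, inv_inv]
  have i1 := mul_inv_cancel₀ h1
  have i2 := mul_inv_cancel₀ h2
  have i3 := mul_inv_cancel₀ h3
  have i4 := mul_inv_cancel₀ h4
  calc _ = P * (Q⁻¹ * X⁻¹ * Y⁻¹) * R * (A * A⁻¹) * B' * A' := by ring
    _ = P * (Q⁻¹ * X⁻¹ * Y⁻¹) * R * (B * B⁻¹) * B' * A' := by rw [i2, i4]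
    _ = _ := by ring

/-- The diagonal entries are the eigenvalues λ(k) at the integers k, and β_k σ_{k+1} supplies λ(x) −
λ(k). -/
theorem wser_recurrence {q c₁ c₂ c₃ m y : ℂ} (hq : q ≠ 0) (hm : m ≠ 0) (hy : y ≠ 0) (x : ℕ)
    (h0 : 1 - c₂ * c₃ * y ^ 2 ≠ 0) (h1 : 1 - c₂ * c₃ * q * y ^ 2 ≠ 0)
    (h2 : 1 - c₂ * c₃ * q ^ 2 * y ^ 2 ≠ 0)
    (h : ∀ k < x, 1 - q * c₂ * q ^ k ≠ 0 ∧ 1 - c₁ * c₂ * c₃ * q ^ 2 * m * q ^ k ≠ 0 ∧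
      1 - m⁻¹ * q ^ k ≠ 0 ∧ 1 - q * q ^ k ≠ 0) :
    (1 - y / m) * (1 - c₁ * c₂ * c₃ * q ^ 2 * m * y) * wNeg q c₂ c₃ y *
        (wser q c₁ c₂ c₃ m x (q * y) (q ^ x) - wser q c₁ c₂ c₃ m x y (q ^ x)) +
      -c₂ * (y / m) * (1 - c₁ * q * m / y) * (1 - c₂ * c₃ * q * m * y) * wPos q c₂ c₃ y *
        (wser q c₁ c₂ c₃ m x (y / q) (q ^ x) - wser q c₁ c₂ c₃ m x y (q ^ x)) =
      -(1 - (q ^ x)⁻¹) * (1 - c₁ * c₂ * q * q ^ x) * wser q c₁ c₂ c₃ m x y (q ^ x) := by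
  have := sum_three_term (q := q) (t := c₂ * c₃) (y := y)
    (B := (1 - y / m) * (1 - c₁ * c₂ * c₃ * q ^ 2 * m * y) * wNeg q c₂ c₃ y)
    (D := -c₂ * (y / m) * (1 - c₁ * q * m / y) * (1 - c₂ * c₃ * q * m * y) * wPos q c₂ c₃ y)
    (c := 0) (K := x) (sig q c₁ c₂ c₃ m (q ^ x))
    (fun k => -(1 - (q ^ k)⁻¹) * (1 - c₁ * c₂ * q * q ^ k))
    (fun k => -((1 - q * c₂ * q ^ k) *
      (1 - c₁ * c₂ * c₃ * q ^ 2 * m * q ^ k) * (1 - m⁻¹ * q ^ k) * (1 - q * q ^ k)) / (q * q ^ k))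
    (fun k => -(1 - (q ^ x)⁻¹) * (1 - c₁ * c₂ * q * q ^ x) * sig q c₁ c₂ c₃ m (q ^ x) k)
    ?_ (by simp) (sig_eq_zero hq _ _ _ _ (Nat.lt_succ_self x)) ?_
  · simp only [zero_mul, add_zero] at this
    unfold wser
    rw [this, mul_sum]
    exact sum_congr rfl fun k _ => by ring
  · intro k
    refine wPos_wNeg_step hq hy h0 h2 _ _ _ _ k ?_ h1
    have hp : q ^ k ≠ 0 := pow_ne_zero _ hq
    rw [pow_succ' q k]
    generalize q ^ k = p at *
    field_simp
    ring
  · intro k hk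
    -- This turns β_k σ_{k+1} into (λ(x) − λ(k)) σ_k; adding α_k σ_k = λ(k) σ_k leaves λ(x) σ_k.
    have hs := sig_succ (c₁ := c₁) (c₂ := c₂) (c₃ := c₃) (m := m) hq hk (fun hlt => h k hlt)
    congr 1
    have hp : q ^ k ≠ 0 := pow_ne_zero _ hq
    have hz : q ^ x ≠ 0 := pow_ne_zero _ hq
    generalize q ^ k = p at *
    generalize q ^ x = z at *
    generalize sig q c₁ c₂ c₃ m z k = S at *
    generalize sig q c₁ c₂ c₃ m z (k + 1) = S' at *
    have : -((1 - q * c₂ * p) * (1 - c₁ * c₂ * c₃ * q ^ 2 * m * p) * (1 - m⁻¹ * p) *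
        (1 - q * p)) / (q * p) * S' = - (S * (q * (1 - p / z) * (1 - c₁ * c₂ * q * z * p))) /
          (q * p) := by rw [← hs]; ring
    rw [this]
    field_simp
    ring

/-- Here the transposed coefficients are not multiples of the old ones but of those at level qm: the
factor 1 − q^k/(qm) common to α_k and β_k is the level quotient of `sig_level`. -/
theorem wser_up {q c₁ c₂ c₃ m y : ℂ} (hq : q ≠ 0) (hm : m ≠ 0) (hy : y ≠ 0) (x : ℕ)
    (h0 : 1 - c₂ * c₃ * y ^ 2 ≠ 0) (h1 : 1 - c₂ * c₃ * q * y ^ 2 ≠ 0)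
    (h2 : 1 - c₂ * c₃ * q ^ 2 * y ^ 2 ≠ 0)
    (h : ∀ k < x, 1 - q * c₂ * q ^ k ≠ 0 ∧ 1 - m⁻¹ * q ^ k ≠ 0 ∧ 1 - q * q ^ k ≠ 0)
    (hb : ∀ k ≤ x, 1 - c₁ * c₂ * c₃ * q ^ 2 * m * q ^ k ≠ 0)
    (hm' : ∀ k ≤ x, 1 - (q * m)⁻¹ * q ^ k ≠ 0) :
    -c₃ * (q * m) * (1 - y / (q * m)) * (1 - y / m) * wNeg q c₂ c₃ y *
        (wser q c₁ c₂ c₃ m x (q * y) (q ^ x) - wser q c₁ c₂ c₃ m x y (q ^ x)) +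
      -(1 - c₂ * c₃ * q * m * y) * (1 - c₂ * c₃ * q ^ 2 * m * y) / (q * m) * wPos q c₂ c₃ y *
        (wser q c₁ c₂ c₃ m x (y / q) (q ^ x) - wser q c₁ c₂ c₃ m x y (q ^ x)) +
      -((1 - c₃ * (q * m)) * ((q * m)⁻¹ - 1)) * wser q c₁ c₂ c₃ m x y (q ^ x) =
      (1 - (q * m)⁻¹) / (1 - c₁ * c₂ * c₃ * q ^ 2 * m) *
        ((1 - c₃ * q * m / q ^ x) * (1 - c₁ * c₂ * c₃ * q ^ 2 * m * q ^ x)) *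
        wser q c₁ c₂ c₃ (q * m) x y (q ^ x) := by
  have hb0 : 1 - c₁ * c₂ * c₃ * q ^ 2 * m ≠ 0 := by simpa using hb 0 (Nat.zero_le _)
  have hm0 : 1 - (q * m)⁻¹ ≠ 0 := by simpa using hm' 0 (Nat.zero_le _)
  have := sum_three_term (q := q) (t := c₂ * c₃) (y := y)
    (B := -c₃ * (q * m) * (1 - y / (q * m)) * (1 - y / m) * wNeg q c₂ c₃ y)
    (D := -(1 - c₂ * c₃ * q * m * y) * (1 - c₂ * c₃ * q ^ 2 * m * y) / (q * m) * wPos q c₂ c₃ y)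
    (c := -((1 - c₃ * (q * m)) * ((q * m)⁻¹ - 1))) (K := x) (sig q c₁ c₂ c₃ m (q ^ x))
    (fun k => (1 - q ^ k / (q * m)) * (1 - c₃ * q * m / q ^ k))
    (fun k => c₃ * m / q ^ k * (1 - q ^ k / (q * m)) * ((1 - q * c₂ * q ^ k) *
       (1 - m⁻¹ * q ^ k) * (1 - q * q ^ k)))
    (fun k => (1 - (q * m)⁻¹) / (1 - c₁ * c₂ * c₃ * q ^ 2 * m) *
        ((1 - c₃ * q * m / q ^ x) * (1 - c₁ * c₂ * c₃ * q ^ 2 * m * q ^ x)) *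
        sig q c₁ c₂ c₃ (q * m) (q ^ x) k)
    ?_ (by simp; ring) (sig_eq_zero hq _ _ _ _ (Nat.lt_succ_self x)) ?_
  · unfold wser
    rw [this, mul_sum]
    exact sum_congr rfl fun k _ => by ring
  · intro k
    refine wPos_wNeg_step hq hy h0 h2 _ _ _ _ k ?_ h1
    have hp : q ^ k ≠ 0 := pow_ne_zero _ hq
    rw [pow_succ' q k]
    generalize q ^ k = p at *
    field_simp
    ring
  · intro k hk
    have hs := sig_succ (c₁ := c₁) (c₂ := c₂) (c₃ := c₃) (m := m) hq hk
      (fun hlt => ⟨(h k hlt).1, hb k hk, (h k hlt).2⟩)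
    have hbk := hb k hk
    have hl := sig_level (c₁ := c₁) (c₂ := c₂) (c₃ := c₃) (m := m) hq (q ^ x) k hb0 hbk hm0 (hm' k hk)
    congr 1
    have hp : q ^ k ≠ 0 := pow_ne_zero _ hq
    have hz : q ^ x ≠ 0 := pow_ne_zero _ hq
    generalize q ^ k = p at *
    generalize q ^ x = z at *
    generalize sig q c₁ c₂ c₃ m z k = S at *
    generalize sig q c₁ c₂ c₃ m z (k + 1) = S' at *
    generalize sig q c₁ c₂ c₃ (q * m) z k = S'' at *
    have e1 : c₃ * m / p * (1 - p / (q * m)) * ((1 - q * c₂ * p) *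
        (1 - m⁻¹ * p) * (1 - q * p)) * S' = c₃ * m / p * (1 - p / (q * m)) *
          (S * (q * (1 - p / z) * (1 - c₁ * c₂ * q * z * p))) /
            (1 - c₁ * c₂ * c₃ * q ^ 2 * m * p) := by
      rw [← hs, eq_div_iff hbk]; ring
    have e2 : (1 - (q * m)⁻¹) / (1 - c₁ * c₂ * c₃ * q ^ 2 * m) * S'' =
        S * (1 - p / (q * m)) / (1 - c₁ * c₂ * c₃ * q ^ 2 * m * p) := by
      rw [eq_div_iff hbk, div_mul_eq_mul_div, div_mul_eq_mul_div, div_eq_iff hb0]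
      linear_combination hl
    rw [e1, mul_right_comm ((1 - (q * m)⁻¹) / (1 - c₁ * c₂ * c₃ * q ^ 2 * m)), e2]
    rw [← mul_right_inj' hbk]
    generalize hB : 1 - c₁ * c₂ * c₃ * q ^ 2 * m * p = B at *
    field_simp
    rw [← hB]
    ring

/-- Companion of `wser_up`: the factor 1 − c₁c₂c₃q²mq^k common to α_k and β_k lowers the level. -/
theorem wser_down {q c₁ c₂ c₃ m y : ℂ} (hq : q ≠ 0) (hm : m ≠ 0) (hy : y ≠ 0) (hc₃ : c₃ ≠ 0)
    (x : ℕ) (h0 : 1 - c₂ * c₃ * y ^ 2 ≠ 0) (h1 : 1 - c₂ * c₃ * q * y ^ 2 ≠ 0)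
    (h2 : 1 - c₂ * c₃ * q ^ 2 * y ^ 2 ≠ 0)
    (h : ∀ k < x, 1 - q * c₂ * q ^ k ≠ 0 ∧ 1 - c₁ * c₂ * c₃ * q ^ 2 * (q * m) * q ^ k ≠ 0 ∧
      1 - (q * m)⁻¹ * q ^ k ≠ 0 ∧ 1 - q * q ^ k ≠ 0)
    (hb : ∀ k ≤ x, 1 - c₁ * c₂ * c₃ * q ^ 2 * m * q ^ k ≠ 0) (hm0 : 1 - (q * m)⁻¹ ≠ 0)
    (hm' : ∀ k ≤ x, 1 - (q * m)⁻¹ * q ^ k ≠ 0 ∨ psi q (c₂ * c₃) y k = 0) :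
    -((1 - c₁ * c₂ * c₃ * q ^ 2 * m * y) * (1 - c₁ * c₂ * c₃ * q ^ 3 * m * y)) / (c₃ * (q * m)) *
        wNeg q c₂ c₃ y *
        (wser q c₁ c₂ c₃ (q * m) x (q * y) (q ^ x) - wser q c₁ c₂ c₃ (q * m) x y (q ^ x)) +
      -c₂ ^ 2 * (y ^ 2 / m) * (1 - c₁ * q * m / y) * (1 - c₁ * q ^ 2 * m / y) * wPos q c₂ c₃ y *
        (wser q c₁ c₂ c₃ (q * m) x (y / q) (q ^ x) - wser q c₁ c₂ c₃ (q * m) x y (q ^ x)) +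
      -((1 - c₁ * c₂ * q ^ 2 * m) * (1 - c₁ * c₂ * c₃ * q ^ 2 * m) / (c₃ * (q * m))) *
        wser q c₁ c₂ c₃ (q * m) x y (q ^ x) =
      (1 - c₁ * c₂ * c₃ * q ^ 2 * m) / (1 - (q * m)⁻¹) *
        (-(((q ^ x)⁻¹ - (q * m)⁻¹) * (1 - c₁ * c₂ * q ^ 2 * m * q ^ x)) / (c₃ * (q * m))) *
        wser q c₁ c₂ c₃ m x y (q ^ x) := by
  have hb0 : 1 - c₁ * c₂ * c₃ * q ^ 2 * m ≠ 0 := by simpa using hb 0 (Nat.zero_le _)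
  have := sum_three_term (q := q) (t := c₂ * c₃) (y := y)
    (B := -((1 - c₁ * c₂ * c₃ * q ^ 2 * m * y) * (1 - c₁ * c₂ * c₃ * q ^ 3 * m * y)) / (c₃ * (q * m)) *
        wNeg q c₂ c₃ y)
    (D := -c₂ ^ 2 * (y ^ 2 / m) * (1 - c₁ * q * m / y) * (1 - c₁ * q ^ 2 * m / y) * wPos q c₂ c₃ y)
    (c := -((1 - c₁ * c₂ * q ^ 2 * m) * (1 - c₁ * c₂ * c₃ * q ^ 2 * m) / (c₃ * (q * m)))) (K := x)
    (sig q c₁ c₂ c₃ (q * m) (q ^ x))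
    (fun k => -((1 - c₁ * c₂ * c₃ * q ^ 2 * m * q ^ k) * (1 - c₁ * c₂ * q ^ 2 * m * q ^ k)) /
      (c₃ * (q * m) * q ^ k))
    (fun k => (1 - c₁ * c₂ * c₃ * q ^ 2 * m * q ^ k) * ((1 - q * c₂ * q ^ k) *
       (1 - c₁ * c₂ * c₃ * q ^ 2 * (q * m) * q ^ k) * (1 - q * q ^ k)) / (c₃ * (q * m) * q ^ k * q))
    (fun k => (1 - c₁ * c₂ * c₃ * q ^ 2 * m) / (1 - (q * m)⁻¹) *
        (-(((q ^ x)⁻¹ - (q * m)⁻¹) * (1 - c₁ * c₂ * q ^ 2 * m * q ^ x)) / (c₃ * (q * m))) *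
        sig q c₁ c₂ c₃ m (q ^ x) k)
    ?_ (by simp; ring) (sig_eq_zero hq _ _ _ _ (Nat.lt_succ_self x)) ?_
  · unfold wser
    rw [this, mul_sum]
    exact sum_congr rfl fun k _ => by ring
  · intro k
    refine wPos_wNeg_step hq hy h0 h2 _ _ _ _ k ?_ h1
    have hp : q ^ k ≠ 0 := pow_ne_zero _ hq
    rw [pow_succ' q k]
    generalize q ^ k = p at *
    field_simp
    ring
  · intro k hk
    -- Where the level factor may vanish, the basis element is zero and the k-th term contributes
    -- nothing to either side.
    rcases hm' k hk with hmk | hpsi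
    swap
    · simp [hpsi]
    have hs := sig_succ (c₁ := c₁) (c₂ := c₂) (c₃ := c₃) (m := q * m) hq hk (fun hlt => h k hlt)
    have hbk := hb k hk
    have hl := sig_level (c₁ := c₁) (c₂ := c₂) (c₃ := c₃) (m := m) hq (q ^ x) k hb0 hbk hm0 hmk
    congr 1
    have hp : q ^ k ≠ 0 := pow_ne_zero _ hq
    have hz : q ^ x ≠ 0 := pow_ne_zero _ hq
    generalize q ^ k = p at *
    generalize q ^ x = z at *
    generalize sig q c₁ c₂ c₃ (q * m) z k = S at *
    generalize sig q c₁ c₂ c₃ (q * m) z (k + 1) = S' at *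
    generalize sig q c₁ c₂ c₃ m z k = S'' at *
    have e1 : (1 - c₁ * c₂ * c₃ * q ^ 2 * m * p) * ((1 - q * c₂ * p) *
       (1 - c₁ * c₂ * c₃ * q ^ 2 * (q * m) * p) * (1 - q * p)) / (c₃ * (q * m) * p * q) * S' =
        (1 - c₁ * c₂ * c₃ * q ^ 2 * m * p) / (c₃ * (q * m) * p * q) *
          (S * (q * (1 - p / z) * (1 - c₁ * c₂ * q * z * p))) / (1 - (q * m)⁻¹ * p) := by
      rw [← hs, eq_div_iff hmk]; ring
    have e2 : (1 - c₁ * c₂ * c₃ * q ^ 2 * m) / (1 - (q * m)⁻¹) * S'' =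
        S * (1 - c₁ * c₂ * c₃ * q ^ 2 * m * p) / (1 - (q * m)⁻¹ * p) := by
      rw [eq_div_iff hmk, div_mul_eq_mul_div, div_mul_eq_mul_div, div_eq_iff hm0]
      linear_combination -hl
    rw [e1, mul_right_comm ((1 - c₁ * c₂ * c₃ * q ^ 2 * m) / (1 - (q * m)⁻¹)), e2]
    rw [← mul_right_inj' hmk]
    generalize hB : 1 - c₁ * c₂ * c₃ * q ^ 2 * m * p = B at *
    have hB' : 1 - (q * m)⁻¹ * p ≠ 0 := hmk
    generalize hD : 1 - (q * m)⁻¹ * p = D at *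
    field_simp
    have hD' : D = (q * m - p) / (q * m) := by rw [← hD]; field_simp
    rw [hD']
    field_simp
    ring

end Relations

/-! ### Integer arguments, duality, and the coefficients Φ in terms of `wPos` and `wNeg`. -/

section Integer

theorem zpow_two_mul_eq_sq (q : ℂ) (n : ℤ) : q ^ (2 * n) = (q ^ n) ^ 2 := by
  rw [mul_comm, zpow_mul]; norm_cast

theorem sum_signType (f : SignType → ℂ) : ∑ ε : SignType, f ε = f 1 + f 0 + f (-1) := by
  rw [SignType.univ_eq]
  simp
  ring

/-- The series part of the `q`-Racah polynomial. -/
noncomputable def racahSeries (q c₁ c₂ c₃ : ℂ) (M n x : ℤ) : ℂ :=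
  wser q c₁ c₂ c₃ (q ^ M) n.toNat (q ^ n) (q ^ x)

theorem racah_eq_Omega_mul {s d₁ d₂ d₃ : ℂ} (hs : s ≠ 0) {M n x : ℤ} (hn : 0 ≤ n) (hnM : n ≤ M)
    (hx : x ≤ M) : racah s d₁ d₂ d₃ M n x =
      Omega s d₁ d₂ d₃ M n * racahSeries (s ^ 2) (d₁ ^ 2) (d₂ ^ 2) (d₃ ^ 2) M n x := by
  have hq : s ^ 2 ≠ 0 := pow_ne_zero 2 hs
  have hc : 0 ≤ n ∧ n ≤ M ∧ x ≤ M := ⟨hn, hnM, hx⟩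
  simp only [racah, if_pos hc]
  congr 1
  unfold racahSeries wser phi43 sig psi
  refine sum_congr rfl fun k _ => ?_
  have e1 : (s ^ 2) ^ (-(n.toNat : ℤ)) = ((s ^ 2) ^ n)⁻¹ := by
    rw [Int.toNat_of_nonneg hn, zpow_neg]
  have e2 : d₂ ^ 2 * d₃ ^ 2 * (s ^ 2) ^ (n + 1) = d₂ ^ 2 * d₃ ^ 2 * s ^ 2 * (s ^ 2) ^ n := by
    rw [zpow_add_one₀ hq]; ring
  have e3 : d₁ ^ 2 * d₂ ^ 2 * (s ^ 2) ^ (x + 1) = d₁ ^ 2 * d₂ ^ 2 * s ^ 2 * (s ^ 2) ^ x := by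
    rw [zpow_add_one₀ hq]; ring
  have e4 : d₁ ^ 2 * d₂ ^ 2 * d₃ ^ 2 * (s ^ 2) ^ (M + 2) =
      d₁ ^ 2 * d₂ ^ 2 * d₃ ^ 2 * (s ^ 2) ^ 2 * (s ^ 2) ^ M := by
    rw [zpow_add₀ hq, zpow_ofNat]; ring
  rw [e1, e2, e3, e4, zpow_neg, zpow_neg]
  ring

/-- Basis elements vanish for k > n and coefficients for k > x. Truncating at x rather than n keeps
the range of summation fixed while n is shifted. -/
theorem wser_eq_of_le {q : ℂ} (hq : q ≠ 0) (c₁ c₂ c₃ m : ℂ) (n x : ℕ) :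
    wser q c₁ c₂ c₃ m n (q ^ n) (q ^ x) = wser q c₁ c₂ c₃ m x (q ^ n) (q ^ x) := by
  have key : ∀ K, n ≤ K ∨ x ≤ K →
      wser q c₁ c₂ c₃ m (n + x) (q ^ n) (q ^ x) = wser q c₁ c₂ c₃ m K (q ^ n) (q ^ x) ∨ n + x < K := by
    intro K hK
    by_cases h : n + x < K
    · exact Or.inr h
    left
    unfold wser
    symm
    apply sum_subset
    · intro k; simp only [mem_range]; omega
    · intro k _ hk
      rw [mem_range, not_lt] at hk
      rcases hK with hK | hK
      · rw [psi_eq_zero hq _ (by omega), zero_mul]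
      · rw [sig_eq_zero hq _ _ _ _ (by omega), mul_zero]
  rcases key n (Or.inl le_rfl) with h1 | h1
  · rcases key x (Or.inr le_rfl) with h2 | h2
    · rw [← h1, h2]
    · omega
  · omega

theorem racahSeries_eq_wser {q : ℂ} (hq : q ≠ 0) (c₁ c₂ c₃ : ℂ) (M : ℤ) {n : ℤ} (hn : 0 ≤ n)
    (x : ℕ) : racahSeries q c₁ c₂ c₃ M n x = wser q c₁ c₂ c₃ (q ^ M) x (q ^ n) (q ^ x) := by
  lift n to ℕ using hn
  unfold racahSeries
  simp only [Int.toNat_natCast, zpow_natCast]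
  exact wser_eq_of_le hq _ _ _ _ _ _

/-- Duality of the series: n and x enter through the same kind of product `psi`, with c₂c₃ and c₁c₂
interchanged. It supplies all relations in the variable x. -/
theorem racahSeries_symm {q : ℂ} (hq : q ≠ 0) (c₁ c₂ c₃ : ℂ) (M : ℤ) {n x : ℤ} (hn : 0 ≤ n)
    (hx : 0 ≤ x) : racahSeries q c₁ c₂ c₃ M n x = racahSeries q c₃ c₂ c₁ M x n := by
  lift x to ℕ using hx
  rw [racahSeries_eq_wser hq _ _ _ _ hn]
  unfold racahSeries wser sig
  simp only [Int.toNat_natCast, zpow_natCast]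
  refine sum_congr rfl fun k _ => ?_
  rw [mul_comm c₃ c₂, mul_comm c₂ c₁, show c₂ * c₃ * c₁ = c₁ * c₂ * c₃ by ring]
  ring

/-- No factor `1 - t q ^ k` with `0 ≤ k ≤ 2 K + 4` vanishes. -/
def Generic (q t : ℂ) (K : ℤ) : Prop := ∀ k : ℤ, 0 ≤ k → k ≤ 2 * K + 4 → 1 - t * q ^ k ≠ 0

/-- Genericity of the parameters of the `q`-Racah polynomials up to level `K`. -/
structure GenericRacah (q c₁ c₂ c₃ : ℂ) (K : ℤ) : Prop where
  q_ne : q ≠ 0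
  c₁_ne : c₁ ≠ 0
  c₂_ne : c₂ ≠ 0
  c₃_ne : c₃ ≠ 0
  q_pow : ∀ k : ℤ, 1 ≤ k → k ≤ K → 1 - q ^ k ≠ 0
  c₁_pow : ∀ k : ℤ, 1 ≤ k → k ≤ K → 1 - c₁ * q ^ k ≠ 0
  c₂_pow : ∀ k : ℤ, 1 ≤ k → k ≤ K → 1 - c₂ * q ^ k ≠ 0
  c₃_pow : ∀ k : ℤ, 1 ≤ k → k ≤ K → 1 - c₃ * q ^ k ≠ 0
  gen₁₂ : Generic q (c₁ * c₂) K
  gen₂₃ : Generic q (c₂ * c₃) K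
  gen₁₂₃ : Generic q (c₁ * c₂ * c₃) K

theorem GenericRacah.symm {q c₁ c₂ c₃ : ℂ} {K : ℤ} (h : GenericRacah q c₁ c₂ c₃ K) :
    GenericRacah q c₃ c₂ c₁ K where
  q_ne := h.q_ne
  c₁_ne := h.c₃_ne
  c₂_ne := h.c₂_ne
  c₃_ne := h.c₁_ne
  q_pow := h.q_pow
  c₁_pow := h.c₃_pow
  c₂_pow := h.c₂_pow
  c₃_pow := h.c₁_pow
  gen₁₂ := by rw [mul_comm]; exact h.gen₂₃
  gen₂₃ := by rw [mul_comm]; exact h.gen₁₂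
  gen₁₂₃ := by rw [show c₃ * c₂ * c₁ = c₁ * c₂ * c₃ by ring]; exact h.gen₁₂₃

theorem Generic.factors {q t : ℂ} {K : ℤ} (hq : q ≠ 0) (h : Generic q t K) {n : ℤ} (hn : 0 ≤ n)
    (hnK : n ≤ K + 1) : 1 - t * (q ^ n) ^ 2 ≠ 0 ∧ 1 - t * q * (q ^ n) ^ 2 ≠ 0 ∧
      1 - t * q ^ 2 * (q ^ n) ^ 2 ≠ 0 := by
  refine ⟨?_, ?_, ?_⟩
  · have := h (2 * n) (by omega) (by omega)
    rwa [zpow_two_mul_eq_sq] at this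
  · have := h (2 * n + 1) (by omega) (by omega)
    rw [zpow_add_one₀ hq, zpow_two_mul_eq_sq] at this
    intro h'; apply this; linear_combination h'
  · have := h (2 * n + 2) (by omega) (by omega)
    rw [zpow_add₀ hq, zpow_two_mul_eq_sq, zpow_ofNat] at this
    intro h'; apply this; linear_combination h'

/-- For generic parameters the cancelled quotient is an ordinary one. This and the next lemmas put
each coefficient in the form (elementary factors) × `wPos` or `wNeg`, in which later verifications
treat the weights as unknowns. -/
theorem PhiPos_eq {q c₁ c₂ c₃ : ℂ} (hq : q ≠ 0) (M n : ℤ)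
    (h1 : 1 - c₂ * c₃ * q * (q ^ n) ^ 2 ≠ 0) :
    PhiPos q c₁ c₂ c₃ M n = -c₂ * (q ^ n / q ^ M) * (1 - c₁ * q * q ^ M / q ^ n) *
      (1 - c₂ * c₃ * q * q ^ M * q ^ n) * wPos q c₂ c₃ (q ^ n) := by
  have h1' : 1 - c₂ * c₃ * q ^ (2 * n + 1) ≠ 0 := by
    rw [zpow_add_one₀ hq, zpow_two_mul_eq_sq]; intro h'; apply h1; linear_combination h'
  rw [PhiPos, quot_eq h1']
  simp only [zpow_add₀ hq, zpow_sub₀ hq, zpow_two_mul_eq_sq, zpow_one, wPos]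
  rw [show c₂ * c₃ * ((q ^ n) ^ 2 * q) = c₂ * c₃ * q * (q ^ n) ^ 2 by ring]
  generalize 1 - c₂ * c₃ * q * (q ^ n) ^ 2 = T
  generalize 1 - c₂ * c₃ * (q ^ n) ^ 2 = T₀
  generalize 1 - c₂ * c₃ * q ^ 2 * (q ^ n) ^ 2 = T₂
  generalize q ^ n = y
  generalize q ^ M = m
  ring

theorem PhiNeg_eq {q c₁ c₂ c₃ : ℂ} (hq : q ≠ 0) (M n : ℤ)
    (h1 : 1 - c₂ * c₃ * q * (q ^ n) ^ 2 ≠ 0) :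
    PhiNeg q c₁ c₂ c₃ M n = (1 - q ^ n / q ^ M) * (1 - c₁ * c₂ * c₃ * q ^ 2 * q ^ M * q ^ n) *
      wNeg q c₂ c₃ (q ^ n) := by
  have h1' : 1 - c₂ * c₃ * q ^ (2 * n + 1) ≠ 0 := by
    rw [zpow_add_one₀ hq, zpow_two_mul_eq_sq]; intro h'; apply h1; linear_combination h'
  rw [PhiNeg, quot_eq h1']
  simp only [zpow_add₀ hq, zpow_sub₀ hq, zpow_two_mul_eq_sq, zpow_ofNat, pow_one, wNeg]
  rw [show c₂ * c₃ * ((q ^ n) ^ 2 * q) = c₂ * c₃ * q * (q ^ n) ^ 2 by ring,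
    show c₂ * c₃ * ((q ^ n) ^ 2 * q ^ 2) = c₂ * c₃ * q ^ 2 * (q ^ n) ^ 2 by ring]
  generalize 1 - c₂ * c₃ * q * (q ^ n) ^ 2 = T
  generalize 1 - c₂ * c₃ * (q ^ n) ^ 2 = T₀
  generalize 1 - c₂ * c₃ * q ^ 2 * (q ^ n) ^ 2 = T₂
  generalize q ^ n = y
  generalize q ^ M = m
  ring

theorem PhiUpPos_eq {s d₁ d₂ d₃ q c₁ c₂ c₃ : ℂ} (hs : s ^ 2 = q) (h₁ : d₁ ^ 2 = c₁)
    (h₂ : d₂ ^ 2 = c₂) (h₃ : d₃ ^ 2 = c₃) (hq : q ≠ 0) (M n : ℤ) :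
    s * d₂ * PhiUpPos s d₁ d₂ d₃ M n = -c₂ ^ 2 * ((q ^ n) ^ 2 / q ^ M) *
      (1 - c₁ * q * q ^ M / q ^ n) * (1 - c₁ * q ^ 2 * q ^ M / q ^ n) * wPos q c₂ c₃ (q ^ n) := by
  simp only [PhiUpPos, hs, h₁, h₂, h₃]
  have hr : s * d₂ * (s * d₂) = q * c₂ := by rw [← hs, ← h₂]; ring
  simp only [zpow_add₀ hq, zpow_sub₀ hq, zpow_two_mul_eq_sq, zpow_ofNat, pow_one, wPos]
  rw [show c₂ * c₃ * ((q ^ n) ^ 2 * q) = c₂ * c₃ * q * (q ^ n) ^ 2 by ring]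
  calc _ = -(s * d₂ * (s * d₂)) * c₂ * ((q ^ n) ^ 2 / q ^ M / q) * (1 - c₁ * q * q ^ M / q ^ n) *
      (1 - c₁ * q ^ 2 * q ^ M / q ^ n) * ((1 - q ^ n) * (1 - c₃ * q ^ n) / ((1 - c₂ * c₃ * (q ^ n) ^ 2) *
        (1 - c₂ * c₃ * q * (q ^ n) ^ 2))) := by ring
    _ = _ := by rw [hr]; field_simp

theorem PhiUpNeg_eq {s d₁ d₂ d₃ q c₁ c₂ c₃ : ℂ} (hs : s ^ 2 = q) (h₁ : d₁ ^ 2 = c₁)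
    (h₂ : d₂ ^ 2 = c₂) (h₃ : d₃ ^ 2 = c₃) (hq : q ≠ 0) (hc₂ : c₂ ≠ 0) (M n : ℤ)
    (h1 : 1 - c₂ * c₃ * q * (q ^ n) ^ 2 ≠ 0) :
    s * d₂ * PhiUpNeg s d₁ d₂ d₃ M n = -((1 - c₁ * c₂ * c₃ * q ^ 2 * q ^ M * q ^ n) *
      (1 - c₁ * c₂ * c₃ * q ^ 3 * q ^ M * q ^ n)) / (c₃ * (q * q ^ M)) * wNeg q c₂ c₃ (q ^ n) := by
  have h1' : 1 - c₂ * c₃ * q ^ (2 * n + 1) ≠ 0 := by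
    rw [zpow_add_one₀ hq, zpow_two_mul_eq_sq]; intro h'; apply h1; linear_combination h'
  have hr : s * d₂ ≠ 0 := by
    intro h; apply hc₂; rw [← h₂]
    rcases mul_eq_zero.1 h with h | h
    · exact absurd (by rw [← hs, h]; simp) hq
    · rw [h]; simp
  simp only [PhiUpNeg, hs, h₁, h₂, h₃]
  rw [quot_eq h1']
  simp only [zpow_add₀ hq, zpow_two_mul_eq_sq, zpow_ofNat, pow_one, wNeg]
  rw [show c₂ * c₃ * ((q ^ n) ^ 2 * q) = c₂ * c₃ * q * (q ^ n) ^ 2 by ring,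
    show c₂ * c₃ * ((q ^ n) ^ 2 * q ^ 2) = c₂ * c₃ * q ^ 2 * (q ^ n) ^ 2 by ring]
  generalize s * d₂ = r at *
  have hrr : r * r⁻¹ = 1 := mul_inv_cancel₀ hr
  generalize 1 - c₂ * c₃ * q * (q ^ n) ^ 2 = T
  generalize 1 - c₂ * c₃ * q ^ 2 * (q ^ n) ^ 2 = T₂
  generalize q ^ n = y
  generalize q ^ M = m
  calc _ = (r * r⁻¹) * (-((1 - c₁ * c₂ * c₃ * q ^ 2 * m * y) *
      (1 - c₁ * c₂ * c₃ * q ^ 3 * m * y)) / (c₃ * (q * m)) *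
      ((1 - c₂ * q * y) * (1 - c₂ * c₃ * q * y) / (T * T₂))) := by ring
    _ = _ := by rw [hrr, one_mul]

theorem PhiDownPos_eq {s d₂ d₃ q c₂ c₃ : ℂ} (hs : s ^ 2 = q)
    (h₂ : d₂ ^ 2 = c₂) (h₃ : d₃ ^ 2 = c₃) (hq : q ≠ 0) (M n : ℤ)
    (h0 : 1 - c₂ * c₃ * (q ^ n) ^ 2 ≠ 0) (h1 : 1 - c₂ * c₃ * q * (q ^ n) ^ 2 ≠ 0) :
    PhiDownPos s d₂ d₃ M n = s * d₂ * (-(1 - c₂ * c₃ * q ^ M * q ^ n) *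
      (1 - c₂ * c₃ * q * q ^ M * q ^ n) / q ^ M * wPos q c₂ c₃ (q ^ n)) := by
  have h1' : 1 - c₂ * c₃ * q ^ (2 * n + 1) ≠ 0 := by
    rw [zpow_add_one₀ hq, zpow_two_mul_eq_sq]; intro h'; apply h1; linear_combination h'
  have h0' : 1 - c₂ * c₃ * q ^ (2 * n) ≠ 0 := by
    rw [zpow_two_mul_eq_sq]; exact h0
  simp only [PhiDownPos, hs, h₂, h₃]
  rw [quot_eq h0', quot_eq h1']
  simp only [zpow_add₀ hq, zpow_two_mul_eq_sq, zpow_ofNat, pow_one, wPos]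
  rw [show c₂ * c₃ * ((q ^ n) ^ 2 * q) = c₂ * c₃ * q * (q ^ n) ^ 2 by ring]
  generalize 1 - c₂ * c₃ * q * (q ^ n) ^ 2 = T
  generalize 1 - c₂ * c₃ * (q ^ n) ^ 2 = T₀
  generalize 1 - c₂ * c₃ * q ^ 2 * (q ^ n) ^ 2 = T₂
  generalize q ^ n = y
  generalize q ^ M = m
  ring

theorem PhiDownNeg_eq {s d₂ d₃ q c₂ c₃ : ℂ} (hs : s ^ 2 = q)
    (h₂ : d₂ ^ 2 = c₂) (h₃ : d₃ ^ 2 = c₃) (hq : q ≠ 0) (M n : ℤ)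
    (h1 : 1 - c₂ * c₃ * q * (q ^ n) ^ 2 ≠ 0) :
    PhiDownNeg s d₂ d₃ M n = s * d₂ * (-c₃ * q ^ M * (1 - q ^ n / q ^ M) *
      (1 - q * q ^ n / q ^ M) * wNeg q c₂ c₃ (q ^ n)) := by
  have h1' : 1 - c₂ * c₃ * q ^ (2 * n + 1) ≠ 0 := by
    rw [zpow_add_one₀ hq, zpow_two_mul_eq_sq]; intro h'; apply h1; linear_combination h'
  simp only [PhiDownNeg, hs, h₂, h₃]
  rw [quot_eq h1']
  simp only [zpow_add₀ hq, zpow_sub₀ hq, zpow_two_mul_eq_sq, zpow_ofNat, pow_one, wNeg]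
  rw [show c₂ * c₃ * ((q ^ n) ^ 2 * q) = c₂ * c₃ * q * (q ^ n) ^ 2 by ring,
    show c₂ * c₃ * ((q ^ n) ^ 2 * q ^ 2) = c₂ * c₃ * q ^ 2 * (q ^ n) ^ 2 by ring]
  generalize 1 - c₂ * c₃ * q * (q ^ n) ^ 2 = T
  generalize 1 - c₂ * c₃ * (q ^ n) ^ 2 = T₀
  generalize 1 - c₂ * c₃ * q ^ 2 * (q ^ n) ^ 2 = T₂
  generalize q ^ n = y
  generalize q ^ M = m
  ring

end Integer

/-! ### The three relations of the series with the named coefficients. -/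

section IntegerRelations

variable {s d₁ d₂ d₃ q c₁ c₂ c₃ : ℂ} {K M n x : ℤ}

theorem racahSeries_succ (hq : q ≠ 0) (hn : 0 ≤ n) (x : ℕ) :
    racahSeries q c₁ c₂ c₃ M (n + 1) x = wser q c₁ c₂ c₃ (q ^ M) x (q * q ^ n) (q ^ x) := by
  rw [racahSeries_eq_wser hq _ _ _ _ (by omega), zpow_add_one₀ hq, mul_comm]

/-- At n = 0 the series of index −1 is not the analytic continuation to y = q⁻¹, but its coefficient
vanishes. -/
theorem mul_racahSeries_pred (hq : q ≠ 0) (hn : 0 ≤ n) (x : ℕ) {C : ℂ} (hC : n = 0 → C = 0) :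
    C * racahSeries q c₁ c₂ c₃ M (n - 1) x =
      C * wser q c₁ c₂ c₃ (q ^ M) x (q ^ n / q) (q ^ x) := by
  rcases hn.eq_or_lt with h | h
  · rw [hC h.symm, zero_mul, zero_mul]
  · rw [racahSeries_eq_wser hq _ _ _ _ (by omega), zpow_sub_one₀ hq, div_eq_mul_inv]

theorem GenericRacah.level_ne (h : GenericRacah q c₁ c₂ c₃ K) {k : ℕ} (hk : (k : ℤ) < M)
    (hM : M ≤ K) : 1 - (q ^ M)⁻¹ * q ^ k ≠ 0 := by
  have := h.q_pow (M - k) (by omega) (by omega)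
  rw [zpow_sub₀ h.q_ne, zpow_natCast] at this
  have h1 : q ^ M ≠ 0 := zpow_ne_zero _ h.q_ne
  have h2 : q ^ k ≠ 0 := pow_ne_zero _ h.q_ne
  intro h'
  apply this
  field_simp at h' ⊢
  linear_combination -h'

theorem GenericRacah.q_nat (h : GenericRacah q c₁ c₂ c₃ K) {k : ℕ} (hk : (k : ℤ) < K) :
    1 - q * q ^ k ≠ 0 := by
  have := h.q_pow (k + 1) (by omega) (by omega)
  rwa [zpow_add_one₀ h.q_ne, zpow_natCast, mul_comm] at this

theorem GenericRacah.c₂_nat (h : GenericRacah q c₁ c₂ c₃ K) {k : ℕ} (hk : (k : ℤ) < K) :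
    1 - q * c₂ * q ^ k ≠ 0 := by
  have := h.c₂_pow (k + 1) (by omega) (by omega)
  rw [zpow_add_one₀ h.q_ne, zpow_natCast] at this
  intro h'; apply this; linear_combination h'

theorem GenericRacah.prod_nat (h : GenericRacah q c₁ c₂ c₃ K) {k : ℕ} (hM : 0 ≤ M)
    (hk : M + k ≤ 2 * K + 2) : 1 - c₁ * c₂ * c₃ * q ^ 2 * q ^ M * q ^ k ≠ 0 := by
  have := h.gen₁₂₃ (M + k + 2) (by omega) (by omega)
  rw [zpow_add₀ h.q_ne, zpow_add₀ h.q_ne, zpow_natCast, zpow_ofNat] at this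
  intro h'; apply this; linear_combination h'

/-- The signs of ε in Φ are opposite to those for the polynomials; the weights Ω reverse them in
`Omega_mul_Phi`. -/
theorem racahSeries_recurrence (h : GenericRacah q c₁ c₂ c₃ K) (hn : 0 ≤ n) (hnK : n ≤ K + 1)
    (hx : 0 ≤ x) (hxM : x ≤ M) (hM : M ≤ K) :
    lam q (c₁ * c₂) x * racahSeries q c₁ c₂ c₃ M n x =
      ∑ ε : SignType, Phi q c₁ c₂ c₃ M (-ε) n * racahSeries q c₁ c₂ c₃ M (n + ε) x := by
  lift x to ℕ using hx
  have hq := h.q_ne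
  obtain ⟨g0, g1, g2⟩ := h.gen₂₃.factors hq hn hnK
  have hpow : ∀ k < x, 1 - q * c₂ * q ^ k ≠ 0 ∧ 1 - c₁ * c₂ * c₃ * q ^ 2 * q ^ M * q ^ k ≠ 0 ∧
      1 - (q ^ M)⁻¹ * q ^ k ≠ 0 ∧ 1 - q * q ^ k ≠ 0 := fun k hk =>
    ⟨h.c₂_nat (by omega), h.prod_nat (by omega) (by omega), h.level_ne (by omega) hM,
      h.q_nat (by omega)⟩
  have key := wser_recurrence (c₁ := c₁) hq (zpow_ne_zero M hq) (zpow_ne_zero n hq) x g0 g1 g2 hpow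
  rw [← PhiPos_eq hq M n g1, ← PhiNeg_eq hq M n g1] at key
  rw [sum_signType]
  have e1 : ((1 : SignType) : ℤ) = 1 := rfl
  have e2 : ((0 : SignType) : ℤ) = 0 := rfl
  have e3 : ((-1 : SignType) : ℤ) = -1 := rfl
  have f1 : Phi q c₁ c₂ c₃ M (-1) n = PhiNeg q c₁ c₂ c₃ M n := rfl
  have f2 : Phi q c₁ c₂ c₃ M (-0) n = -PhiPos q c₁ c₂ c₃ M n - PhiNeg q c₁ c₂ c₃ M n := rfl
  have f3 : Phi q c₁ c₂ c₃ M (- -1) n = PhiPos q c₁ c₂ c₃ M n := rfl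
  have hl : lam q (c₁ * c₂) x = -(1 - (q ^ x)⁻¹) * (1 - c₁ * c₂ * q * q ^ x) := by
    rw [lam, zpow_add_one₀ hq, zpow_neg, zpow_natCast]; ring
  rw [e1, e2, e3, f1, f2, f3, racahSeries_succ hq hn, add_zero, ← sub_eq_add_neg,
    mul_racahSeries_pred hq hn, racahSeries_eq_wser hq _ _ _ _ hn, hl]
  · linear_combination -key
  · rintro rfl; simp [PhiPos]

/-- The eigenvalue in the contiguity relation `M ↦ M + 1`. -/
noncomputable def lamUp (q c₁ c₂ c₃ : ℂ) (M x : ℤ) : ℂ :=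
  -((1 - c₃ * q * q ^ M / q ^ x) * (1 - c₁ * c₂ * c₃ * q ^ 2 * q ^ M * q ^ x)) / (c₃ * (q * q ^ M))

/-- The eigenvalue in the contiguity relation `M + 1 ↦ M`. -/
noncomputable def lamDown (q c₁ c₂ : ℂ) (M x : ℤ) : ℂ :=
  ((q ^ x)⁻¹ - (q * q ^ M)⁻¹) * (1 - c₁ * c₂ * q ^ 2 * q ^ M * q ^ x)

/-- The constant relating the two contiguity relations; `r` is a square root of `q c₂`. -/
noncomputable def kap (r q c₁ c₂ c₃ : ℂ) (M : ℤ) : ℂ :=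
  (1 - c₁ * c₂ * c₃ * q ^ 2 * q ^ M) / (c₃ * r * (1 - q * q ^ M))

/-- The series rises one level with the coefficients Φ_−, whereas the polynomials do so with Φ_+.
The exchange, with the constant `kap`, is again due to Ω. -/
theorem racahSeries_up (hs : s ^ 2 = q) (h₂ : d₂ ^ 2 = c₂) (h₃ : d₃ ^ 2 = c₃)
    (h : GenericRacah q c₁ c₂ c₃ K) (hn : 0 ≤ n) (hnK : n ≤ K + 1)
    (hx : 0 ≤ x) (hxM : x ≤ M) (hM : M + 1 ≤ K) :
    lamUp q c₁ c₂ c₃ M x * racahSeries q c₁ c₂ c₃ (M + 1) n x = kap (s * d₂) q c₁ c₂ c₃ M *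
      ∑ ε : SignType, PhiDown s d₂ d₃ (M + 1) (-ε) n * racahSeries q c₁ c₂ c₃ M (n + ε) x := by
  lift x to ℕ using hx
  have hq := h.q_ne
  have hr : s * d₂ ≠ 0 := by
    refine mul_ne_zero ?_ ?_
    · rintro rfl; apply hq; rw [← hs]; simp
    · rintro rfl; apply h.c₂_ne; rw [← h₂]; simp
  obtain ⟨g0, g1, g2⟩ := h.gen₂₃.factors hq hn hnK
  have hm1 : q ^ (M + 1) = q * q ^ M := by rw [zpow_add_one₀ hq, mul_comm]
  have key := wser_up (c₁ := c₁) hq (zpow_ne_zero M hq) (zpow_ne_zero n hq) x g0 g1 g2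
    (fun k hk => ⟨h.c₂_nat (by omega), h.level_ne (by omega) (by omega), h.q_nat (by omega)⟩)
    (fun k hk => h.prod_nat (by omega) (by omega))
    (fun k hk => by rw [← hm1]; exact h.level_ne (by omega) hM)
  have hb0 : 1 - c₁ * c₂ * c₃ * q ^ 2 * q ^ M ≠ 0 := by
    simpa using h.prod_nat (k := 0) (M := M) (by omega) (by omega)
  have hq0 : 1 - q * q ^ M ≠ 0 := by rw [← hm1]; exact h.q_pow _ (by omega) hM
  have hP := PhiDownPos_eq hs h₂ h₃ hq (M + 1) n g0 g1
  have hN := PhiDownNeg_eq hs h₂ h₃ hq (M + 1) n g1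
  have hq1 : 1 - (q * q ^ M)⁻¹ ≠ 0 := by
    intro h'; apply hq0
    have : q * q ^ M ≠ 0 := mul_ne_zero hq (zpow_ne_zero _ hq)
    field_simp at h'; linear_combination -h'
  rw [hm1] at hP hN
  rw [sum_signType]
  have e1 : ((1 : SignType) : ℤ) = 1 := rfl
  have e2 : ((0 : SignType) : ℤ) = 0 := rfl
  have e3 : ((-1 : SignType) : ℤ) = -1 := rfl
  have f1 : PhiDown s d₂ d₃ (M + 1) (-1) n = PhiDownNeg s d₂ d₃ (M + 1) n := rfl
  have f2 : PhiDown s d₂ d₃ (M + 1) (-0) n =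
      -(PhiDownPos s d₂ d₃ (M + 1) n + PhiDownNeg s d₂ d₃ (M + 1) n) -
        (s * d₂) * (1 - d₃ ^ 2 * (s ^ 2) ^ (M + 1)) * ((s ^ 2) ^ (-(M + 1)) - 1) := rfl
  have f3 : PhiDown s d₂ d₃ (M + 1) (- -1) n = PhiDownPos s d₂ d₃ (M + 1) n := rfl
  rw [e1, e2, e3, f1, f2, f3, racahSeries_succ hq hn, add_zero, ← sub_eq_add_neg,
    mul_racahSeries_pred hq hn, racahSeries_eq_wser hq _ _ _ _ hn,
    racahSeries_eq_wser hq _ _ _ _ hn, hP, hN, hs, h₃, zpow_neg, hm1]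
  · rw [kap, lamUp, zpow_natCast]
    have hc3 := h.c₃_ne
    have hm := zpow_ne_zero M hq
    generalize wser q c₁ c₂ c₃ (q * q ^ M) x (q ^ n) (q ^ x) = V at *
    generalize wser q c₁ c₂ c₃ (q ^ M) x (q ^ n) (q ^ x) = V0 at *
    generalize wser q c₁ c₂ c₃ (q ^ M) x (q ^ n / q) (q ^ x) = V1 at *
    generalize wser q c₁ c₂ c₃ (q ^ M) x (q * q ^ n) (q ^ x) = V2 at *
    generalize wPos q c₂ c₃ (q ^ n) = P at *
    generalize wNeg q c₂ c₃ (q ^ n) = Q at *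
    -- The scalar in `wser_up` is the quotient of the eigenvalue by `kap` and √(qc₂).
    have e4 : (1 - (q * q ^ M)⁻¹) / (1 - c₁ * c₂ * c₃ * q ^ 2 * q ^ M) *
        ((1 - c₃ * q * q ^ M / q ^ x) * (1 - c₁ * c₂ * c₃ * q ^ 2 * q ^ M * q ^ x)) * V =
        (kap (s * d₂) q c₁ c₂ c₃ M)⁻¹ * (lamUp q c₁ c₂ c₃ M x * V) / (s * d₂) := by
      rw [kap, lamUp, zpow_natCast]
      generalize s * d₂ = r at *
      generalize hB : 1 - c₁ * c₂ * c₃ * q ^ 2 * q ^ M = B at *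
      generalize (1 - c₃ * q * q ^ M / q ^ x) * (1 - c₁ * c₂ * c₃ * q ^ 2 * q ^ M * q ^ x) = Y
      generalize q ^ M = m at *
      field_simp
      ring
    rw [e4, kap, lamUp, zpow_natCast] at key
    have hk : (1 - c₁ * c₂ * c₃ * q ^ 2 * q ^ M) / (c₃ * (s * d₂) * (1 - q * q ^ M)) ≠ 0 :=
      div_ne_zero hb0 (mul_ne_zero (mul_ne_zero hc3 hr) hq0)
    generalize (1 - c₁ * c₂ * c₃ * q ^ 2 * q ^ M) / (c₃ * (s * d₂) * (1 - q * q ^ M)) = k at *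
    generalize -((1 - c₃ * q * q ^ M / q ^ x) * (1 - c₁ * c₂ * c₃ * q ^ 2 * q ^ M * q ^ x)) /
      (c₃ * (q * q ^ M)) * V = Y at *
    rw [eq_div_iff hr, ← mul_right_inj' hk, mul_inv_cancel_left₀ hk] at key
    rw [← key]
    generalize s * d₂ = r
    generalize q ^ M = m at *
    generalize q ^ n = y
    field_simp
    ring
  · rintro rfl; simp [PhiDownPos]

theorem racahSeries_down (hs : s ^ 2 = q) (h₁ : d₁ ^ 2 = c₁) (h₂ : d₂ ^ 2 = c₂) (h₃ : d₃ ^ 2 = c₃)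
    (h : GenericRacah q c₁ c₂ c₃ K) (hn : 0 ≤ n) (hnK : n ≤ K + 1)
    (hx : 0 ≤ x) (hxM : x ≤ M + 1) (hnx : x ≤ M ∨ n ≤ M) (hM0 : 0 ≤ M) (hM : M + 1 ≤ K) :
    kap (s * d₂) q c₁ c₂ c₃ M * (lamDown q c₁ c₂ M x * racahSeries q c₁ c₂ c₃ M n x) =
      ∑ ε : SignType, PhiUp s d₁ d₂ d₃ M (-ε) n * racahSeries q c₁ c₂ c₃ (M + 1) (n + ε) x := by
  lift x to ℕ using hx
  have hq := h.q_ne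
  have hr : s * d₂ ≠ 0 := by
    refine mul_ne_zero ?_ ?_
    · rintro rfl; apply hq; rw [← hs]; simp
    · rintro rfl; apply h.c₂_ne; rw [← h₂]; simp
  obtain ⟨g0, g1, g2⟩ := h.gen₂₃.factors hq hn hnK
  have hm1 : q ^ (M + 1) = q * q ^ M := by rw [zpow_add_one₀ hq, mul_comm]
  have hq0 : 1 - q * q ^ M ≠ 0 := by rw [← hm1]; exact h.q_pow _ (by omega) hM
  have hq1 : 1 - (q * q ^ M)⁻¹ ≠ 0 := by
    intro h'; apply hq0
    have : q * q ^ M ≠ 0 := mul_ne_zero hq (zpow_ne_zero _ hq)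
    field_simp at h'; linear_combination -h'
  have hb0 : 1 - c₁ * c₂ * c₃ * q ^ 2 * q ^ M ≠ 0 := by
    simpa using h.prod_nat (k := 0) (M := M) (by omega) (by omega)
  have key := wser_down (c₁ := c₁) hq (zpow_ne_zero M hq) (zpow_ne_zero n hq) h.c₃_ne x g0 g1 g2
    (fun k hk => ⟨h.c₂_nat (by omega), by rw [← hm1]; exact h.prod_nat (by omega) (by omega),
      by rw [← hm1]; exact h.level_ne (by omega) (by omega), h.q_nat (by omega)⟩)
    (fun k hk => h.prod_nat (by omega) (by omega)) hq1
    -- The value k = M + 1 occurs only if x = M + 1. Then n ≤ M < k by `hnx`, so the basis element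
    -- is zero.
    (fun k hk => by
      by_cases hkM : (k : ℤ) < M + 1
      · left; rw [← hm1]; exact h.level_ne (by omega) hM
      · right
        have : n.toNat < k := by omega
        rw [← Int.toNat_of_nonneg hn, zpow_natCast]
        exact psi_eq_zero hq _ this)
  have hP := PhiUpPos_eq hs h₁ h₂ h₃ hq M n
  have hN := PhiUpNeg_eq hs h₁ h₂ h₃ hq h.c₂_ne M n g1
  rw [← hP, ← hN] at key
  rw [sum_signType]
  have e1 : ((1 : SignType) : ℤ) = 1 := rfl
  have e2 : ((0 : SignType) : ℤ) = 0 := rfl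
  have e3 : ((-1 : SignType) : ℤ) = -1 := rfl
  have f1 : PhiUp s d₁ d₂ d₃ M (-1) n = PhiUpNeg s d₁ d₂ d₃ M n := rfl
  have f2 : PhiUp s d₁ d₂ d₃ M (-0) n =
      -(PhiUpPos s d₁ d₂ d₃ M n + PhiUpNeg s d₁ d₂ d₃ M n) -
        (1 - d₁ ^ 2 * d₂ ^ 2 * (s ^ 2) ^ (M + 2)) *
          (1 - d₁ ^ 2 * d₂ ^ 2 * d₃ ^ 2 * (s ^ 2) ^ (M + 2)) /
          (d₃ ^ 2 * (s ^ 2) ^ (M + 1) * (s * d₂)) := rfl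
  have f3 : PhiUp s d₁ d₂ d₃ M (- -1) n = PhiUpPos s d₁ d₂ d₃ M n := rfl
  rw [e1, e2, e3, f1, f2, f3, racahSeries_succ hq hn, add_zero, ← sub_eq_add_neg,
    mul_racahSeries_pred hq hn, racahSeries_eq_wser hq _ _ _ _ hn,
    racahSeries_eq_wser hq _ _ _ _ hn, hs, h₁, h₂, h₃, hm1, zpow_add₀ hq, zpow_ofNat]
  · have hc3 := h.c₃_ne
    have hm := zpow_ne_zero M hq
    rw [kap, lamDown, zpow_natCast]
    generalize wser q c₁ c₂ c₃ (q * q ^ M) x (q ^ n) (q ^ x) = V at *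
    generalize wser q c₁ c₂ c₃ (q ^ M) x (q ^ n) (q ^ x) = V0 at *
    generalize wser q c₁ c₂ c₃ (q * q ^ M) x (q ^ n / q) (q ^ x) = V1 at *
    generalize wser q c₁ c₂ c₃ (q * q ^ M) x (q * q ^ n) (q ^ x) = V2 at *
    generalize PhiUpPos s d₁ d₂ d₃ M n = P at *
    generalize PhiUpNeg s d₁ d₂ d₃ M n = Q at *
    generalize s * d₂ = r at *
    rw [← mul_right_inj' hr]
    have e4 : r * ((1 - c₁ * c₂ * c₃ * q ^ 2 * q ^ M) / (c₃ * r * (1 - q * q ^ M)) *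
        (((q ^ x)⁻¹ - (q * q ^ M)⁻¹) * (1 - c₁ * c₂ * q ^ 2 * q ^ M * q ^ x) * V0)) =
        (1 - c₁ * c₂ * c₃ * q ^ 2 * q ^ M) / (1 - (q * q ^ M)⁻¹) *
        (-(((q ^ x)⁻¹ - (q * q ^ M)⁻¹) * (1 - c₁ * c₂ * q ^ 2 * q ^ M * q ^ x)) /
          (c₃ * (q * q ^ M))) * V0 := by
      generalize ((q ^ x)⁻¹ - (q * q ^ M)⁻¹) * (1 - c₁ * c₂ * q ^ 2 * q ^ M * q ^ x) = Y
      generalize 1 - c₁ * c₂ * c₃ * q ^ 2 * q ^ M = B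
      generalize q ^ M = m at *
      have hqm : q * m - 1 ≠ 0 := fun h' => hq0 (by linear_combination -h')
      have e5 : 1 - (q * m)⁻¹ = (q * m - 1) / (q * m) := by field_simp
      rw [e5]
      field_simp
      ring
    rw [e4, ← key]
    have e6 : (1 - c₁ * c₂ * (q ^ M * q ^ 2)) * (1 - c₁ * c₂ * c₃ * (q ^ M * q ^ 2)) /
        (c₃ * (q * q ^ M) * r) = (1 - c₁ * c₂ * q ^ 2 * q ^ M) *
        (1 - c₁ * c₂ * c₃ * q ^ 2 * q ^ M) / (c₃ * (q * q ^ M)) / r := by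
      rw [div_div]; ring
    rw [e6]
    generalize (1 - c₁ * c₂ * q ^ 2 * q ^ M) *
        (1 - c₁ * c₂ * c₃ * q ^ 2 * q ^ M) / (c₃ * (q * q ^ M)) = T
    field_simp
    ring
  · rintro rfl; simp [PhiUpPos]

end IntegerRelations

/-! ### Factorization of the central contiguity coefficients. -/

section Normalization

variable {s d₁ d₂ d₃ q c₁ c₂ c₃ : ℂ} {K M n x : ℤ}

/-- The combination `wPos + b q y ^ 2 wNeg - 1`. -/
noncomputable def wZero (q a b y : ℂ) : ℂ := wPos q a b y + b * q * y ^ 2 * wNeg q a b y - 1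

/-- Together with `wPos_mul` this gives linear relations for the two weights; they reduce the
identities for central coefficients to polynomial ones. -/
theorem wPos_wNeg_rel {q a b y : ℂ} (h0 : 1 - a * b * y ^ 2 ≠ 0) (h1 : 1 - a * b * q * y ^ 2 ≠ 0)
    (h2 : 1 - a * b * q ^ 2 * y ^ 2 ≠ 0) :
    q * a * (1 - a * b * y ^ 2) * wPos q a b y - (1 - a * b * q ^ 2 * y ^ 2) * wNeg q a b y =
      q * a - 1 := by
  have e1 : (1 - a * b * y ^ 2) * wPos q a b y =
      (1 - y) * (1 - b * y) / (1 - a * b * q * y ^ 2) := by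
    rw [wPos, mul_div_assoc', mul_div_mul_left _ _ h0]
  have e2 : (1 - a * b * q ^ 2 * y ^ 2) * wNeg q a b y =
      (1 - a * q * y) * (1 - a * b * q * y) / (1 - a * b * q * y ^ 2) := by
    rw [wNeg, mul_comm (1 - a * b * q * y ^ 2), mul_div_assoc', mul_div_mul_left _ _ h2]
  rw [mul_assoc (q * a), e1, e2, mul_div_assoc', ← sub_div, div_eq_iff h1]
  ring

theorem wPos_mul {q a b y : ℂ} (h0 : 1 - a * b * y ^ 2 ≠ 0) (h1 : 1 - a * b * q * y ^ 2 ≠ 0) :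
    (1 - a * b * y ^ 2) * (1 - a * b * q * y ^ 2) * wPos q a b y = (1 - y) * (1 - b * y) := by
  rw [wPos, mul_div_cancel₀ _ (mul_ne_zero h0 h1)]

theorem PhiDown_one_eq (hs : s ^ 2 = q) (h₂ : d₂ ^ 2 = c₂) (h₃ : d₃ ^ 2 = c₃)
    (h : GenericRacah q c₁ c₂ c₃ K) (hn : 0 ≤ n) (hnK : n ≤ K + 1) (M : ℤ) :
    PhiDown s d₂ d₃ M 1 n = s * d₂ * (-(1 - c₂ * c₃ * q ^ M * q ^ n) *
      (1 - c₂ * c₃ * q * q ^ M * q ^ n) / q ^ M * wPos q c₂ c₃ (q ^ n)) := by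
  obtain ⟨g0, g1, g2⟩ := h.gen₂₃.factors h.q_ne hn hnK
  exact PhiDownPos_eq hs h₂ h₃ h.q_ne M n g0 g1

theorem PhiDown_neg_one_eq (hs : s ^ 2 = q) (h₂ : d₂ ^ 2 = c₂) (h₃ : d₃ ^ 2 = c₃)
    (h : GenericRacah q c₁ c₂ c₃ K) (hn : 0 ≤ n) (hnK : n ≤ K + 1) (M : ℤ) :
    PhiDown s d₂ d₃ M (-1) n = s * d₂ * (-c₃ * q ^ M * (1 - q ^ n / q ^ M) *
      (1 - q * q ^ n / q ^ M) * wNeg q c₂ c₃ (q ^ n)) := by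
  obtain ⟨g0, g1, g2⟩ := h.gen₂₃.factors h.q_ne hn hnK
  exact PhiDownNeg_eq hs h₂ h₃ h.q_ne M n g1

/-- Although defined by a sum, the central coefficient is a product, with `wZero` playing the part
of `wPos` and `wNeg`. Only this form shows that it vanishes at n = M, and permits comparison with
its counterpart `PhiUp_zero_eq` through Ω. -/
theorem PhiDown_zero_eq (hs : s ^ 2 = q) (h₂ : d₂ ^ 2 = c₂) (h₃ : d₃ ^ 2 = c₃)
    (h : GenericRacah q c₁ c₂ c₃ K) (hn : 0 ≤ n) (hnK : n ≤ K + 1) (M : ℤ) :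
    PhiDown s d₂ d₃ M 0 n = s * d₂ * (wZero q c₂ c₃ (q ^ n) * (1 - q ^ M / q ^ n) *
      (1 - c₂ * c₃ * q * q ^ M * q ^ n) / q ^ M) := by
  obtain ⟨g0, g1, g2⟩ := h.gen₂₃.factors h.q_ne hn hnK
  have hq := h.q_ne
  have hc₂ := h.c₂_ne
  have hrel := wPos_wNeg_rel g0 g1 g2
  have hP := wPos_mul g0 g1
  have f : PhiDown s d₂ d₃ M 0 n = -(PhiDownPos s d₂ d₃ M n + PhiDownNeg s d₂ d₃ M n) -
        (s * d₂) * (1 - d₃ ^ 2 * (s ^ 2) ^ M) * ((s ^ 2) ^ (-M) - 1) := rfl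
  rw [f, PhiDownPos_eq hs h₂ h₃ hq M n g0 g1, PhiDownNeg_eq hs h₂ h₃ hq M n g1, hs, h₃, zpow_neg,
    wZero]
  have hm := zpow_ne_zero M hq
  have hy := zpow_ne_zero n hq
  generalize wPos q c₂ c₃ (q ^ n) = P at *
  generalize wNeg q c₂ c₃ (q ^ n) = Q at *
  generalize s * d₂ = r
  generalize q ^ M = m at *
  generalize q ^ n = y at *
  field_simp
  linear_combination (-(r * c₃ * y * m * (m - y))) * hrel + r * m * hP

theorem PhiUp_one_eq (hs : s ^ 2 = q) (h₁ : d₁ ^ 2 = c₁) (h₂ : d₂ ^ 2 = c₂) (h₃ : d₃ ^ 2 = c₃)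
    (hq : q ≠ 0) (M n : ℤ) :
    s * d₂ * PhiUp s d₁ d₂ d₃ M 1 n = -c₂ ^ 2 * ((q ^ n) ^ 2 / q ^ M) *
      (1 - c₁ * q * q ^ M / q ^ n) * (1 - c₁ * q ^ 2 * q ^ M / q ^ n) * wPos q c₂ c₃ (q ^ n) :=
  PhiUpPos_eq hs h₁ h₂ h₃ hq M n

theorem PhiUp_neg_one_eq (hs : s ^ 2 = q) (h₁ : d₁ ^ 2 = c₁) (h₂ : d₂ ^ 2 = c₂) (h₃ : d₃ ^ 2 = c₃)
    (h : GenericRacah q c₁ c₂ c₃ K) (hn : 0 ≤ n) (hnK : n ≤ K + 1) (M : ℤ) :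
    s * d₂ * PhiUp s d₁ d₂ d₃ M (-1) n = -((1 - c₁ * c₂ * c₃ * q ^ 2 * q ^ M * q ^ n) *
      (1 - c₁ * c₂ * c₃ * q ^ 3 * q ^ M * q ^ n)) / (c₃ * (q * q ^ M)) * wNeg q c₂ c₃ (q ^ n) := by
  obtain ⟨g0, g1, g2⟩ := h.gen₂₃.factors h.q_ne hn hnK
  exact PhiUpNeg_eq hs h₁ h₂ h₃ h.q_ne h.c₂_ne M n g1

theorem GenericRacah.root_ne (h : GenericRacah q c₁ c₂ c₃ K) (hs : s ^ 2 = q) (h₂ : d₂ ^ 2 = c₂) :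
    s * d₂ ≠ 0 := by
  refine mul_ne_zero ?_ ?_
  · rintro rfl; apply h.q_ne; rw [← hs]; simp
  · rintro rfl; apply h.c₂_ne; rw [← h₂]; simp

theorem PhiUp_zero_eq (hs : s ^ 2 = q) (h₁ : d₁ ^ 2 = c₁) (h₂ : d₂ ^ 2 = c₂) (h₃ : d₃ ^ 2 = c₃)
    (h : GenericRacah q c₁ c₂ c₃ K) (hn : 0 ≤ n) (hnK : n ≤ K + 1) (M : ℤ) :
    s * d₂ * PhiUp s d₁ d₂ d₃ M 0 n = c₂ / (c₃ * q ^ M) * wZero q c₂ c₃ (q ^ n) *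
      (1 - c₁ * q * q ^ M / q ^ n) * (1 - c₁ * c₂ * c₃ * q ^ 2 * q ^ M * q ^ n) := by
  obtain ⟨g0, g1, g2⟩ := h.gen₂₃.factors h.q_ne hn hnK
  have hq := h.q_ne
  have hc₂ := h.c₂_ne
  have hc₃ := h.c₃_ne
  have hrel := wPos_wNeg_rel g0 g1 g2
  have hP := wPos_mul g0 g1
  have f : PhiUp s d₁ d₂ d₃ M 0 n =
      -(PhiUpPos s d₁ d₂ d₃ M n + PhiUpNeg s d₁ d₂ d₃ M n) -
        (1 - d₁ ^ 2 * d₂ ^ 2 * (s ^ 2) ^ (M + 2)) *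
          (1 - d₁ ^ 2 * d₂ ^ 2 * d₃ ^ 2 * (s ^ 2) ^ (M + 2)) /
          (d₃ ^ 2 * (s ^ 2) ^ (M + 1) * (s * d₂)) := rfl
  have hr := h.root_ne hs h₂
  have e1 : s * d₂ * ((1 - c₁ * c₂ * q ^ (M + 2)) * (1 - c₁ * c₂ * c₃ * q ^ (M + 2)) /
      (c₃ * q ^ (M + 1) * (s * d₂))) = (1 - c₁ * c₂ * q ^ 2 * q ^ M) *
        (1 - c₁ * c₂ * c₃ * q ^ 2 * q ^ M) / (c₃ * (q * q ^ M)) := by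
    rw [zpow_add₀ hq, zpow_add_one₀ hq, zpow_ofNat]
    have hm := zpow_ne_zero M hq
    generalize s * d₂ = r at *
    generalize q ^ M = m at *
    field_simp
  rw [f, mul_sub, mul_neg, mul_add, PhiUpPos_eq hs h₁ h₂ h₃ hq, PhiUpNeg_eq hs h₁ h₂ h₃ hq hc₂ M n g1,
    hs, h₁, h₂, h₃, e1, wZero]
  have hm := zpow_ne_zero M hq
  have hy := zpow_ne_zero n hq
  generalize wPos q c₂ c₃ (q ^ n) = P at *
  generalize wNeg q c₂ c₃ (q ^ n) = Q at *
  generalize q ^ M = m at *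
  generalize q ^ n = y at *
  field_simp
  linear_combination (-(y * (1 - c₁ * c₂ * c₃ * q ^ 2 * m * y))) * hrel + c₁ * c₂ * q ^ 2 * m * hP

end Normalization

/-! ### Quotients of the weights Ω in the degree and in the level. -/

section OmegaRelations

variable {s d₁ d₂ d₃ q c₁ c₂ c₃ : ℂ} {K M n x : ℤ}

theorem qPoch_ne_zero {q a : ℂ} {k : ℕ} (h : ∀ l < k, 1 - a * q ^ l ≠ 0) : qPoch q a k ≠ 0 :=
  prod_ne_zero_iff.2 fun l hl => h l (mem_range.1 hl)

theorem GenericRacah.c₃_nat (h : GenericRacah q c₁ c₂ c₃ K) {k : ℕ} (hk : (k : ℤ) < K) :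
    1 - q * c₃ * q ^ k ≠ 0 := by
  have := h.c₃_pow (k + 1) (by omega) (by omega)
  rw [zpow_add_one₀ h.q_ne, zpow_natCast] at this
  intro h'; apply this; linear_combination h'

/-- The denominator of `Omega` at level `n + k`. -/
noncomputable def OmegaDen (q c₂ c₃ : ℂ) (n k : ℕ) : ℂ :=
  qPoch q q n * qPoch q q k * qPoch q (c₂ * c₃ * q ^ (n + 1)) (n + k + 1) * qPoch q (q * c₃) n

theorem OmegaDen_ne_zero (h : GenericRacah q c₁ c₂ c₃ K) {n k : ℕ} (hK : ((n + k : ℕ) : ℤ) ≤ K) :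
    OmegaDen q c₂ c₃ n k ≠ 0 := by
  push_cast at hK
  refine mul_ne_zero (mul_ne_zero (mul_ne_zero ?_ ?_) ?_) ?_
  · exact qPoch_ne_zero fun l hl => h.q_nat (by omega)
  · exact qPoch_ne_zero fun l hl => h.q_nat (by omega)
  · refine qPoch_ne_zero fun l hl => ?_
    have := h.gen₂₃ (n + 1 + l) (by omega) (by omega)
    rwa [show (n : ℤ) + 1 + l = ((n + 1 + l : ℕ) : ℤ) by push_cast; ring, zpow_natCast, pow_add,
      ← mul_assoc] at this
  · exact qPoch_ne_zero fun l hl => h.c₃_nat (by omega)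

/-- Writing the level as n + k makes all exponents natural numbers and splits the half-integer power
into r^k/r^n with r = √(qc₂). -/
theorem Omega_mul_OmegaDen (hs : s ^ 2 = q) (h₁ : d₁ ^ 2 = c₁) (h₂ : d₂ ^ 2 = c₂)
    (h₃ : d₃ ^ 2 = c₃) (h : GenericRacah q c₁ c₂ c₃ K) {n k : ℕ} (hK : ((n + k : ℕ) : ℤ) ≤ K) :
    Omega s d₁ d₂ d₃ (n + k : ℕ) n * (OmegaDen q c₂ c₃ n k * (s * d₂) ^ n) =
      qPoch q q (n + k) * ((1 - c₂ * c₃ * q ^ (2 * n + 1)) * qPoch q (q * c₂) n *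
        qPoch q (c₁ * c₂ * c₃ * q ^ (n + k + 2)) n * qPoch q (q * c₁) k) * (s * d₂) ^ k := by
  have hq := h.q_ne
  have hr := h.root_ne hs h₂
  have hs0 : s ≠ 0 := left_ne_zero_of_mul hr
  have hD := OmegaDen_ne_zero h hK
  have hT : 1 - d₂ ^ 2 * d₃ ^ 2 * (s ^ 2) ^ (2 * (n : ℤ) + 1) ≠ 0 := by
    rw [hs, h₂, h₃]; push_cast at hK; exact h.gen₂₃ _ (by omega) (by omega)
  have e1 : (s * d₂) ^ (2 * (n : ℤ) - ((n + k : ℕ) : ℤ)) = (s * d₂) ^ n / (s * d₂) ^ k := by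
    rw [← zpow_natCast, ← zpow_natCast, ← zpow_sub₀ hr]; congr 1; push_cast; ring
  have e2 : q ^ (2 * (n : ℤ) + 1) = q ^ (2 * n + 1) := by rw [← zpow_natCast]; push_cast; rfl
  have e3 : q ^ (((n + k : ℕ) : ℤ) + 2) = q ^ (n + k + 2) := by rw [← zpow_natCast]; push_cast; rfl
  have e4 : q ^ ((n : ℤ) + 1) = q ^ (n + 1) := by rw [← zpow_natCast]; push_cast; rfl
  have e5 : (((n + k : ℕ) : ℤ) - n).toNat = k := by omega
  rw [Omega_eq s d₁ d₂ d₃ _ _ hs0 (by omega) (by omega) hT, hs, h₁, h₂, h₃, qBinom,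
    if_pos ⟨by omega, by omega⟩, e1, e2, e3, e4, e5, Int.toNat_natCast, Int.toNat_natCast]
  have hrn := pow_ne_zero n hr
  have hrk := pow_ne_zero k hr
  unfold OmegaDen at *
  simp only [mul_ne_zero_iff] at hD
  obtain ⟨⟨⟨h1, h2⟩, h3⟩, h4⟩ := hD
  generalize (s * d₂) ^ n = rn at *
  generalize (s * d₂) ^ k = rk at *
  generalize qPoch q (c₂ * c₃ * q ^ (n + 1)) (n + k + 1) = X at *
  generalize qPoch q (q * c₃) n = Y at *
  field_simp

theorem Omega_succ_aux (hs : s ^ 2 = q) (h₁ : d₁ ^ 2 = c₁) (h₂ : d₂ ^ 2 = c₂)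
    (h₃ : d₃ ^ 2 = c₃) (h : GenericRacah q c₁ c₂ c₃ K) {n k : ℕ} (hK : ((n + k + 1 : ℕ) : ℤ) ≤ K) :
    Omega s d₁ d₂ d₃ (n + k + 1 : ℕ) (n + 1 : ℕ) * ((1 - q * q ^ n) *
        (1 - c₂ * c₃ * q ^ (2 * n + 1)) * (1 - q * c₁ * q ^ k) * (q * c₂) *
        (1 - c₂ * c₃ * q ^ (n + 1) * q ^ (n + k + 2)) * (1 - q * c₃ * q ^ n)) =
      Omega s d₁ d₂ d₃ (n + k + 1 : ℕ) n * ((1 - q * q ^ k) *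
        (1 - c₂ * c₃ * q ^ (2 * n + 3)) * (1 - q * c₂ * q ^ n) *
        (1 - c₁ * c₂ * c₃ * q ^ (n + k + 3) * q ^ n) * (1 - c₂ * c₃ * q ^ (n + 1))) := by
  have hr := h.root_ne hs h₂
  have hD1 := OmegaDen_ne_zero h (n := n + 1) (k := k) (by push_cast at *; omega)
  have hD2 := OmegaDen_ne_zero h (n := n) (k := k + 1) (by push_cast at *; omega)
  have H1 := Omega_mul_OmegaDen hs h₁ h₂ h₃ h (n := n + 1) (k := k) (by push_cast at *; omega)
  have H2 := Omega_mul_OmegaDen hs h₁ h₂ h₃ h (n := n) (k := k + 1) (by push_cast at *; omega)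
  rw [show n + 1 + k = n + k + 1 by ring] at H1
  rw [← add_assoc n k 1] at H2
  -- Raising n moves the base of the long Pochhammer symbol in the denominator while its length
  -- stays fixed, so only its first and last factors change.
  have hsh := qPoch_shift q (c₂ * c₃ * q ^ (n + 1)) (n + k + 2)
  have hDrel : OmegaDen q c₂ c₃ (n + 1) k * ((1 - q * q ^ k) * (1 - c₂ * c₃ * q ^ (n + 1))) =
      OmegaDen q c₂ c₃ n (k + 1) * ((1 - q * q ^ n) *
        (1 - c₂ * c₃ * q ^ (n + 1) * q ^ (n + k + 2)) * (1 - q * c₃ * q ^ n)) := by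
    unfold OmegaDen
    rw [qPoch_succ q q n, qPoch_succ q q k, qPoch_succ q (q * c₃) n, show n + 1 + k + 1 = n + k + 2 by ring,
      show n + (k + 1) + 1 = n + k + 2 by ring,
      show c₂ * c₃ * q ^ (n + 1 + 1) = c₂ * c₃ * q ^ (n + 1) * q by ring]
    linear_combination (qPoch q q n * (1 - q * q ^ n) * qPoch q q k * qPoch q (q * c₃) n *
      (1 - q * c₃ * q ^ n) * (1 - q * q ^ k)) * hsh
  have hrr : (s * d₂) * (s * d₂) = q * c₂ := by rw [← hs, ← h₂]; ring
  rw [qPoch_succ q (q * c₂), qPoch_succ q (c₁ * c₂ * c₃ * q ^ (n + k + 1 + 2))] at H1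
  rw [qPoch_succ q (q * c₁)] at H2
  have hne : OmegaDen q c₂ c₃ n (k + 1) * (s * d₂) ^ n ≠ 0 := mul_ne_zero hD2 (pow_ne_zero _ hr)
  rw [← mul_right_inj' hne]
  generalize Omega s d₁ d₂ d₃ (n + k + 1 : ℕ) (n + 1 : ℕ) = O1 at *
  generalize Omega s d₁ d₂ d₃ (n + k + 1 : ℕ) n = O2 at *
  generalize OmegaDen q c₂ c₃ n (k + 1) = D2 at *
  generalize OmegaDen q c₂ c₃ (n + 1) k = D1 at *
  rw [pow_succ (s * d₂)] at H1 H2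
  rw [show 2 * (n + 1) + 1 = 2 * n + 3 by ring, show n + k + 1 + 2 = n + k + 3 by ring] at H1
  rw [show n + k + 1 + 2 = n + k + 3 by ring] at H2
  generalize (s * d₂) = r at *
  generalize (1 - q * q ^ k) = A1 at *
  generalize (1 - q * q ^ n) = A2 at *
  generalize (1 - c₂ * c₃ * q ^ (n + 1) * q ^ (n + k + 2)) = A3 at *
  generalize 1 - c₂ * c₃ * q ^ (n + 1) = A4 at *
  generalize 1 - q * c₁ * q ^ k = A5 at *
  generalize 1 - c₂ * c₃ * q ^ (2 * n + 1) = A6 at *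
  generalize 1 - q * c₃ * q ^ n = A7 at *
  generalize 1 - c₂ * c₃ * q ^ (2 * n + 3) = A8 at *
  linear_combination (-(O1 * A6 * A5 * r ^ n * (q * c₂))) * hDrel +
    A6 * A5 * A1 * A4 * r * H1 - A1 * A8 * (1 - q * c₂ * q ^ n) *
        (1 - c₁ * c₂ * c₃ * q ^ (n + k + 3) * q ^ n) * A4 * H2 - O1 * A6 * A5 * r ^ n * D1 * A1 * A4 * hrr

theorem Omega_level_aux (hs : s ^ 2 = q) (h₁ : d₁ ^ 2 = c₁) (h₂ : d₂ ^ 2 = c₂)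
    (h₃ : d₃ ^ 2 = c₃) (h : GenericRacah q c₁ c₂ c₃ K) {n k : ℕ} (hK : ((n + k + 1 : ℕ) : ℤ) ≤ K) :
    Omega s d₁ d₂ d₃ (n + k : ℕ) n * ((1 - q * q ^ (n + k)) *
        (1 - c₁ * c₂ * c₃ * q ^ (n + k + 2) * q ^ n) * (1 - q * c₁ * q ^ k) * (s * d₂)) =
      Omega s d₁ d₂ d₃ (n + k + 1 : ℕ) n * ((1 - q * q ^ k) *
        (1 - c₂ * c₃ * q ^ (n + 1) * q ^ (n + k + 1)) * (1 - c₁ * c₂ * c₃ * q ^ (n + k + 2))) := by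
  have hr := h.root_ne hs h₂
  have hD1 := OmegaDen_ne_zero h (n := n) (k := k) (by push_cast at *; omega)
  have H1 := Omega_mul_OmegaDen hs h₁ h₂ h₃ h (n := n) (k := k) (by push_cast at *; omega)
  have H2 := Omega_mul_OmegaDen hs h₁ h₂ h₃ h (n := n) (k := k + 1) (by push_cast at *; omega)
  rw [← add_assoc n k 1] at H2
  have hsh := qPoch_shift q (c₁ * c₂ * c₃ * q ^ (n + k + 2)) n
  have hDrel : OmegaDen q c₂ c₃ n (k + 1) = OmegaDen q c₂ c₃ n k * ((1 - q * q ^ k) *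
        (1 - c₂ * c₃ * q ^ (n + 1) * q ^ (n + k + 1))) := by
    unfold OmegaDen
    rw [qPoch_succ q q k, ← add_assoc, qPoch_succ _ _ (n + k + 1)]
    ring
  rw [hDrel, qPoch_succ q (q * c₁), qPoch_succ q q, pow_succ (s * d₂),
    show c₁ * c₂ * c₃ * q ^ (n + k + 1 + 2) = c₁ * c₂ * c₃ * q ^ (n + k + 2) * q by ring] at H2
  have hne : OmegaDen q c₂ c₃ n k * (s * d₂) ^ n ≠ 0 := mul_ne_zero hD1 (pow_ne_zero _ hr)
  rw [← mul_right_inj' hne]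
  generalize Omega s d₁ d₂ d₃ (n + k : ℕ) n = O1 at *
  generalize Omega s d₁ d₂ d₃ (n + k + 1 : ℕ) n = O2 at *
  generalize OmegaDen q c₂ c₃ n k = D at *
  generalize (s * d₂) = r at *
  generalize (1 - q * q ^ k) = A1 at *
  generalize (1 - q * q ^ (n + k)) = A2 at *
  generalize 1 - c₂ * c₃ * q ^ (n + 1) * q ^ (n + k + 1) = A3 at *
  generalize 1 - c₁ * c₂ * c₃ * q ^ (n + k + 2) * q ^ n = A4 at *
  generalize 1 - c₁ * c₂ * c₃ * q ^ (n + k + 2) = A7 at *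
  generalize 1 - q * c₁ * q ^ k = A5 at *
  generalize 1 - c₂ * c₃ * q ^ (2 * n + 1) = A6 at *
  linear_combination A2 * A4 * A5 * r * H1 - A7 * H2 -
    qPoch q q (n + k) * A2 * A6 * qPoch q (q * c₂) n * qPoch q (q * c₁) k * A5 * r ^ k * r * hsh

/-- The weights `Omega` symmetrize the three-term recurrence relation. -/
theorem Omega_mul_PhiPos (hs : s ^ 2 = q) (h₁ : d₁ ^ 2 = c₁) (h₂ : d₂ ^ 2 = c₂)
    (h₃ : d₃ ^ 2 = c₃) (h : GenericRacah q c₁ c₂ c₃ K) (hn : 0 ≤ n) (hnM : n + 1 ≤ M)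
    (hM : M ≤ K) :
    Omega s d₁ d₂ d₃ M (n + 1) * PhiPos q c₁ c₂ c₃ M (n + 1) =
      Omega s d₁ d₂ d₃ M n * PhiNeg q c₁ c₂ c₃ M n := by
  have hq := h.q_ne
  obtain ⟨g0, g1, g2⟩ := h.gen₂₃.factors hq hn (by omega)
  obtain ⟨f0, f1, f2⟩ := h.gen₂₃.factors hq (n := n + 1) (by omega) (by omega)
  rw [PhiPos_eq hq M _ f1, PhiNeg_eq hq M n g1, wPos, wNeg]
  lift n to ℕ using hn
  obtain ⟨k, rfl⟩ : ∃ k : ℕ, M = (n + k + 1 : ℕ) := ⟨(M - n - 1).toNat, by omega⟩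
  have key := Omega_succ_aux hs h₁ h₂ h₃ h hM
  have e1 : q ^ ((n : ℤ) + 1) = q ^ n * q := by rw [zpow_add_one₀ hq, zpow_natCast]
  have e2 : q ^ (((n + k + 1 : ℕ) : ℤ)) = q ^ n * q ^ k * q := by rw [zpow_natCast]; ring
  have e3 : ((n : ℤ) + 1) = (n + 1 : ℕ) := by push_cast; rfl
  rw [e1] at f0 f1 f2 ⊢
  rw [e3, e2, zpow_natCast] at *
  rw [show q ^ (2 * n + 1) = q * (q ^ n) ^ 2 by ring, show q ^ (n + 1) = q * q ^ n by ring,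
    show q ^ (2 * n + 3) = q ^ 3 * (q ^ n) ^ 2 by ring,
    show q ^ (n + k + 2) = q ^ 2 * q ^ n * q ^ k by ring,
    show q ^ (n + k + 3) = q ^ 3 * q ^ n * q ^ k by ring] at key
  have hy := pow_ne_zero n hq
  have hk := pow_ne_zero k hq
  generalize Omega s d₁ d₂ d₃ (n + k + 1 : ℕ) (n + 1 : ℕ) = O1 at *
  generalize Omega s d₁ d₂ d₃ (n + k + 1 : ℕ) n = O2 at *
  generalize q ^ n = y at *
  generalize q ^ k = z at *
  rw [show c₂ * c₃ * (y * q) ^ 2 = c₂ * c₃ * q ^ 2 * y ^ 2 by ring]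
  rw [show c₂ * c₃ * (q * y ^ 2) = c₂ * c₃ * q * y ^ 2 by ring,
    show c₂ * c₃ * (q ^ 3 * y ^ 2) = c₂ * c₃ * q * (y * q) ^ 2 by ring] at key
  generalize 1 - c₂ * c₃ * q ^ 2 * y ^ 2 = G2 at *
  generalize 1 - c₂ * c₃ * q * y ^ 2 = G1 at *
  generalize 1 - c₂ * c₃ * q * (y * q) ^ 2 = F1 at *
  have hL : O1 * (-c₂ * (y * q / (y * z * q)) * (1 - c₁ * q * (y * z * q) / (y * q)) *
      (1 - c₂ * c₃ * q * (y * z * q) * (y * q)) * ((1 - y * q) * (1 - c₃ * (y * q)) / (G2 * F1))) =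
      -(O1 * ((1 - q * y) * (1 - q * c₁ * z) * (q * c₂) * (1 - c₂ * c₃ * (q * y) * (q ^ 2 * y * z)) *
        (1 - q * c₃ * y))) / (q * z * G2 * F1) := by
    rw [show y * q / (y * z * q) = z⁻¹ by field_simp, show c₁ * q * (y * z * q) / (y * q) =
      q * c₁ * z by field_simp]
    field_simp
  have hR : O2 * ((1 - y / (y * z * q)) * (1 - c₁ * c₂ * c₃ * q ^ 2 * (y * z * q) * y) *
      ((1 - c₂ * q * y) * (1 - c₂ * c₃ * q * y) / (G1 * G2))) =
      -(O2 * ((1 - q * z) * (1 - q * c₂ * y) * (1 - c₁ * c₂ * c₃ * (q ^ 3 * y * z) * y) *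
        (1 - c₂ * c₃ * (q * y)))) / (q * z * G2 * G1) := by
    rw [show y / (y * z * q) = (z * q)⁻¹ by field_simp]
    field_simp
    ring
  -- Both sides are now single fractions, differing only in the factor 1 − c₂c₃q^(2n+1) or 1 −
  -- c₂c₃q^(2n+3) of the denominator, so cross-multiplication gives `key`.
  rw [hL, hR, div_eq_div_iff (by positivity) (by positivity)]
  linear_combination (-(q * z * G2)) * key

/-- The level dependence of `Omega`. -/
theorem Omega_level (hs : s ^ 2 = q) (h₁ : d₁ ^ 2 = c₁) (h₂ : d₂ ^ 2 = c₂)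
    (h₃ : d₃ ^ 2 = c₃) (h : GenericRacah q c₁ c₂ c₃ K) (hn : 0 ≤ n) (hnM : n ≤ M)
    (hM : M + 1 ≤ K) :
    Omega s d₁ d₂ d₃ M n * ((1 - q * q ^ M) * (1 - c₁ * c₂ * c₃ * q ^ 2 * q ^ M * q ^ n) *
        (1 - c₁ * q * q ^ M / q ^ n) * (s * d₂)) =
      Omega s d₁ d₂ d₃ (M + 1) n * ((1 - q * q ^ M / q ^ n) *
        (1 - c₂ * c₃ * q ^ 2 * q ^ M * q ^ n) * (1 - c₁ * c₂ * c₃ * q ^ 2 * q ^ M)) := by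
  have hq := h.q_ne
  lift n to ℕ using hn
  obtain ⟨k, rfl⟩ : ∃ k : ℕ, M = (n + k : ℕ) := ⟨(M - n).toNat, by omega⟩
  have key := Omega_level_aux hs h₁ h₂ h₃ h (n := n) (k := k) (by push_cast at *; omega)
  rw [show (((n + k : ℕ) : ℤ) + 1) = (n + k + 1 : ℕ) by push_cast; rfl, zpow_natCast, zpow_natCast]
  rw [show c₁ * q * q ^ (n + k) / q ^ n = q * c₁ * q ^ k by field_simp; ring,
    show q * q ^ (n + k) / q ^ n = q * q ^ k by field_simp; ring]
  linear_combination key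

end OmegaRelations

/-! ### The weights Ω interchange the coefficients of the two contiguity relations. -/

section OmegaPhi

variable {s d₁ d₂ d₃ q c₁ c₂ c₃ : ℂ} {K M n x : ℤ}

/-- Two quotients combine: the degree quotient at fixed level, in the form of the symmetrized
recurrence, and the level quotient at fixed degree. The other neighbouring case takes the degree
step at level M + 1 instead. -/
theorem Omega_mul_PhiUp_one (hs : s ^ 2 = q) (h₁ : d₁ ^ 2 = c₁) (h₂ : d₂ ^ 2 = c₂)
    (h₃ : d₃ ^ 2 = c₃) (h : GenericRacah q c₁ c₂ c₃ K) (hn : 0 ≤ n) (hnM : n + 1 ≤ M)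
    (hM : M + 1 ≤ K) :
    Omega s d₁ d₂ d₃ M (n + 1) * PhiUp s d₁ d₂ d₃ M 1 (n + 1) =
      kap (s * d₂) q c₁ c₂ c₃ M * Omega s d₁ d₂ d₃ (M + 1) n * PhiDown s d₂ d₃ (M + 1) (-1) n := by
  have hq := h.q_ne
  have hr := h.root_ne hs h₂
  have hc₃ := h.c₃_ne
  obtain ⟨g0, g1, g2⟩ := h.gen₂₃.factors hq hn (by omega)
  obtain ⟨f0, f1, f2⟩ := h.gen₂₃.factors hq (n := n + 1) (by omega) (by omega)
  have key0 := Omega_mul_PhiPos hs h₁ h₂ h₃ h hn hnM (by omega)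
  have keyM := Omega_level hs h₁ h₂ h₃ h hn (by omega) hM
  rw [PhiPos_eq hq M _ f1, PhiNeg_eq hq M n g1] at key0
  have hm1 : q ^ (M + 1) = q * q ^ M := by rw [zpow_add_one₀ hq, mul_comm]
  have hn1 : q ^ (n + 1) = q * q ^ n := by rw [zpow_add_one₀ hq, mul_comm]
  have hqm : 1 - q * q ^ M ≠ 0 := by rw [← hm1]; exact h.q_pow _ (by omega) hM
  have hT : 1 - c₂ * c₃ * q ^ 2 * q ^ M * q ^ n ≠ 0 := by
    have := h.gen₂₃ (M + n + 2) (by omega) (by omega)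
    rw [zpow_add₀ hq, zpow_add₀ hq, zpow_ofNat] at this
    intro h'; apply this; linear_combination h'
  have hrr : (s * d₂) * (s * d₂) = q * c₂ := by rw [← hs, ← h₂]; ring
  rw [← mul_right_inj' hr, mul_left_comm, PhiUp_one_eq hs h₁ h₂ h₃ hq,
    PhiDown_neg_one_eq hs h₂ h₃ h hn (by omega), kap]
  rw [hn1] at key0 ⊢
  rw [hm1]
  have hy := zpow_ne_zero n hq
  have hm := zpow_ne_zero M hq
  generalize Omega s d₁ d₂ d₃ M (n + 1) = O1 at *
  generalize Omega s d₁ d₂ d₃ M n = O0 at *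
  generalize Omega s d₁ d₂ d₃ (M + 1) n = O at *
  generalize wPos q c₂ c₃ (q * q ^ n) = P at *
  generalize wNeg q c₂ c₃ (q ^ n) = Q at *
  generalize s * d₂ = r at *
  generalize q ^ n = y at *
  generalize q ^ M = m at *
  have hqm' : q * m - 1 ≠ 0 := fun h' => hqm (by linear_combination -h')
  generalize hqmv : 1 - q * m = v at *
  generalize hTv : 1 - c₂ * c₃ * q ^ 2 * m * y = T at *
  rw [show 1 - c₂ * c₃ * q * m * (q * y) = T by rw [← hTv]; ring] at key0
  field_simp at key0 keyM ⊢
  rw [← mul_right_inj' (mul_ne_zero hT hr)]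
  linear_combination c₂ * q * v * (y - q * m * c₁) * r * key0 + c₂ * q * (m - y) * Q * keyM -
    T * (m - y) * Q * O * (1 - c₂ * q ^ 2 * m * c₁ * c₃) * (y - q * m) * hrr

theorem Omega_mul_PhiUp_zero (hs : s ^ 2 = q) (h₁ : d₁ ^ 2 = c₁) (h₂ : d₂ ^ 2 = c₂)
    (h₃ : d₃ ^ 2 = c₃) (h : GenericRacah q c₁ c₂ c₃ K) (hn : 0 ≤ n) (hnM : n ≤ M)
    (hM : M + 1 ≤ K) :
    Omega s d₁ d₂ d₃ M n * PhiUp s d₁ d₂ d₃ M 0 n =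
      kap (s * d₂) q c₁ c₂ c₃ M * Omega s d₁ d₂ d₃ (M + 1) n * PhiDown s d₂ d₃ (M + 1) 0 n := by
  have hq := h.q_ne
  have hr := h.root_ne hs h₂
  have hc₃ := h.c₃_ne
  have keyM := Omega_level hs h₁ h₂ h₃ h hn hnM hM
  have hm1 : q ^ (M + 1) = q * q ^ M := by rw [zpow_add_one₀ hq, mul_comm]
  have hqm : 1 - q * q ^ M ≠ 0 := by rw [← hm1]; exact h.q_pow _ (by omega) hM
  have hrr : (s * d₂) * (s * d₂) = q * c₂ := by rw [← hs, ← h₂]; ring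
  rw [← mul_right_inj' hr, mul_left_comm, PhiUp_zero_eq hs h₁ h₂ h₃ h hn (by omega),
    PhiDown_zero_eq hs h₂ h₃ h hn (by omega), kap, hm1]
  have hy := zpow_ne_zero n hq
  have hm := zpow_ne_zero M hq
  generalize Omega s d₁ d₂ d₃ M n = O0 at *
  generalize Omega s d₁ d₂ d₃ (M + 1) n = O at *
  generalize wZero q c₂ c₃ (q ^ n) = Z at *
  generalize s * d₂ = r at *
  generalize q ^ n = y at *
  generalize q ^ M = m at *
  generalize hqmv : 1 - q * m = v at *
  field_simp at keyM ⊢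
  rw [← mul_right_inj' hr]
  linear_combination c₂ * q * Z * keyM - Z * (O * (y - q * m) * (1 - c₂ * c₃ * q ^ 2 * m * y) *
    (1 - c₁ * c₂ * c₃ * q ^ 2 * m)) * hrr

theorem Omega_mul_PhiUp_neg_one (hs : s ^ 2 = q) (h₁ : d₁ ^ 2 = c₁) (h₂ : d₂ ^ 2 = c₂)
    (h₃ : d₃ ^ 2 = c₃) (h : GenericRacah q c₁ c₂ c₃ K) (hn : 0 ≤ n) (hnM : n ≤ M)
    (hM : M + 1 ≤ K) :
    Omega s d₁ d₂ d₃ M n * PhiUp s d₁ d₂ d₃ M (-1) n =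
      kap (s * d₂) q c₁ c₂ c₃ M * Omega s d₁ d₂ d₃ (M + 1) (n + 1) *
        PhiDown s d₂ d₃ (M + 1) 1 (n + 1) := by
  have hq := h.q_ne
  have hr := h.root_ne hs h₂
  have hc₃ := h.c₃_ne
  obtain ⟨g0, g1, g2⟩ := h.gen₂₃.factors hq hn (by omega)
  obtain ⟨f0, f1, f2⟩ := h.gen₂₃.factors hq (n := n + 1) (by omega) (by omega)
  have key0 := Omega_mul_PhiPos hs h₁ h₂ h₃ h (M := M + 1) hn (by omega) hM
  have keyM := Omega_level hs h₁ h₂ h₃ h hn hnM hM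
  rw [PhiPos_eq hq _ _ f1, PhiNeg_eq hq _ n g1] at key0
  have hm1 : q ^ (M + 1) = q * q ^ M := by rw [zpow_add_one₀ hq, mul_comm]
  have hn1 : q ^ (n + 1) = q * q ^ n := by rw [zpow_add_one₀ hq, mul_comm]
  have hqm : 1 - q * q ^ M ≠ 0 := by rw [← hm1]; exact h.q_pow _ (by omega) hM
  have hT : 1 - c₁ * q * q ^ M / q ^ n ≠ 0 := by
    have := h.c₁_pow (M + 1 - n) (by omega) (by omega)
    rw [zpow_sub₀ hq, hm1] at this
    intro h'; apply this; linear_combination h'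
  have hrr : (s * d₂) * (s * d₂) = q * c₂ := by rw [← hs, ← h₂]; ring
  rw [← mul_right_inj' hr, mul_left_comm, PhiUp_neg_one_eq hs h₁ h₂ h₃ h hn (by omega),
    PhiDown_one_eq hs h₂ h₃ h (n := n + 1) (by omega) (by omega), kap]
  rw [hn1] at key0 ⊢
  rw [hm1] at key0 ⊢
  have hy := zpow_ne_zero n hq
  have hm := zpow_ne_zero M hq
  generalize Omega s d₁ d₂ d₃ (M + 1) (n + 1) = O1 at *
  generalize Omega s d₁ d₂ d₃ M n = O0 at *
  generalize Omega s d₁ d₂ d₃ (M + 1) n = O at *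
  generalize wPos q c₂ c₃ (q * q ^ n) = P at *
  generalize wNeg q c₂ c₃ (q ^ n) = Q at *
  generalize s * d₂ = r at *
  generalize q ^ n = y at *
  generalize q ^ M = m at *
  generalize hqmv : 1 - q * m = v at *
  rw [show c₁ * q * (q * m) / (q * y) = c₁ * q * m / y by field_simp] at key0
  generalize hTv : 1 - c₁ * q * m / y = T at *
  field_simp at key0 keyM ⊢
  rw [← mul_right_inj' (mul_ne_zero hr (mul_ne_zero hy hT))]
  linear_combination (-((1 - c₂ * q ^ 3 * y * m * c₃ * c₁) * Q)) * keyM -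
    (1 - c₂ * q ^ 2 * y * m * c₃) * (1 - c₂ * q ^ 2 * m * c₃ * c₁) * key0 +
    O1 * y * T * (1 - c₂ * q ^ 3 * y * m * c₃) * P * (1 - c₂ * q ^ 2 * y * m * c₃) *
      (1 - c₂ * q ^ 2 * m * c₃ * c₁) * hrr

/-- The weights `Omega` turn the two contiguity relations into each other. -/
theorem Omega_mul_PhiUp (hs : s ^ 2 = q) (h₁ : d₁ ^ 2 = c₁) (h₂ : d₂ ^ 2 = c₂)
    (h₃ : d₃ ^ 2 = c₃) (h : GenericRacah q c₁ c₂ c₃ K) (ε : SignType) (hn : 0 ≤ n)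
    (hε : 0 ≤ n + ε) (hεM : n + ε ≤ M) (hM : M + 1 ≤ K) :
    Omega s d₁ d₂ d₃ M (n + ε) * PhiUp s d₁ d₂ d₃ M ε (n + ε) =
      kap (s * d₂) q c₁ c₂ c₃ M * Omega s d₁ d₂ d₃ (M + 1) n * PhiDown s d₂ d₃ (M + 1) (-ε) n := by
  cases ε
  · simpa using Omega_mul_PhiUp_zero hs h₁ h₂ h₃ h hn (by simpa using hεM) hM
  · have e : (SignType.neg : ℤ) = -1 := rfl
    rw [e] at *
    have := Omega_mul_PhiUp_neg_one hs h₁ h₂ h₃ h (n := n + -1) hε hεM hM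
    rwa [show n + -1 + 1 = n by ring] at this
  · exact Omega_mul_PhiUp_one hs h₁ h₂ h₃ h hn hεM hM

end OmegaPhi

/-! ### The three relations of the normalized polynomials. -/

section RacahRelations

variable {s d₁ d₂ d₃ q c₁ c₂ c₃ : ℂ} {K M n x : ℤ}

theorem Omega_mul_Phi (hs : s ^ 2 = q) (h₁ : d₁ ^ 2 = c₁) (h₂ : d₂ ^ 2 = c₂)
    (h₃ : d₃ ^ 2 = c₃) (h : GenericRacah q c₁ c₂ c₃ K) (ε : SignType) (hn : 0 ≤ n)
    (hnM : n ≤ M) (hε : 0 ≤ n + ε) (hεM : n + ε ≤ M) (hM : M ≤ K) :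
    Omega s d₁ d₂ d₃ M (n + ε) * Phi q c₁ c₂ c₃ M ε (n + ε) =
      Omega s d₁ d₂ d₃ M n * Phi q c₁ c₂ c₃ M (-ε) n := by
  cases ε
  · simp
  · have e : (SignType.neg : ℤ) = -1 := rfl
    rw [e] at *
    have := Omega_mul_PhiPos hs h₁ h₂ h₃ h (n := n + -1) hε (by omega) hM
    rw [show n + -1 + 1 = n by ring] at this
    exact this.symm
  · exact Omega_mul_PhiPos hs h₁ h₂ h₃ h hn hεM hM

/-- The polynomials outside the degree range are zero by convention while the bare series are not;
the relations survive because the coefficients leading out of the range vanish. -/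
theorem Phi_eq_zero_of_edge (q c₁ c₂ c₃ : ℂ) (ε : SignType) (hn : 0 ≤ n) (hnM : n ≤ M)
    (hε : ¬(0 ≤ n + ε ∧ n + ε ≤ M)) : Phi q c₁ c₂ c₃ M (-ε) n = 0 := by
  cases ε
  · exact absurd ⟨by simpa using hn, by simpa using hnM⟩ hε
  · have e : (SignType.neg : ℤ) = -1 := rfl
    rw [e] at hε
    obtain rfl : n = 0 := by omega
    change PhiPos q c₁ c₂ c₃ M 0 = 0
    simp [PhiPos]
  · have e : (SignType.pos : ℤ) = 1 := rfl
    rw [e] at hε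
    obtain rfl : n = M := by omega
    change PhiNeg q c₁ c₂ c₃ n n = 0
    simp [PhiNeg]

/-- Descending from level M + 1 the range loses its top degree. Hence three coefficients must vanish
at the upper end: the central one at n = M + 1 and the raising ones at n = M and n = M + 1. -/
theorem PhiDown_eq_zero_of_edge (hs : s ^ 2 = q) (h₂ : d₂ ^ 2 = c₂) (h₃ : d₃ ^ 2 = c₃)
    (h : GenericRacah q c₁ c₂ c₃ K) (ε : SignType) (hn : 0 ≤ n) (hnM : n ≤ M + 1) (hM : M + 1 ≤ K)
    (hε : ¬(0 ≤ n + ε ∧ n + ε ≤ M)) : PhiDown s d₂ d₃ (M + 1) (-ε) n = 0 := by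
  have hq := h.q_ne
  have hy := zpow_ne_zero n hq
  cases ε
  · have e : ((SignType.zero : SignType) : ℤ) = 0 := rfl
    rw [e] at hε
    obtain rfl : n = M + 1 := by omega
    change PhiDown s d₂ d₃ (M + 1) 0 (M + 1) = 0
    rw [PhiDown_zero_eq hs h₂ h₃ h hn (by omega), div_self hy]
    simp
  · have e : (SignType.neg : ℤ) = -1 := rfl
    rw [e] at hε
    obtain rfl : n = 0 := by omega
    change PhiDownPos s d₂ d₃ (M + 1) 0 = 0
    simp [PhiDownPos]
  · have e : (SignType.pos : ℤ) = 1 := rfl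
    rw [e] at hε
    change PhiDownNeg s d₂ d₃ (M + 1) n = 0
    obtain rfl | rfl : n = M + 1 ∨ n = M := by omega
    · simp [PhiDownNeg]
    · simp [PhiDownNeg]

theorem PhiUp_eq_zero_of_edge (s d₁ d₂ d₃ : ℂ) (M : ℤ) (ε : SignType) (hn : 0 ≤ n)
    (hε : n + ε < 0) : PhiUp s d₁ d₂ d₃ M (-ε) n = 0 := by
  cases ε
  · simp at hε; omega
  · have e : (SignType.neg : ℤ) = -1 := rfl
    rw [e] at hε
    obtain rfl : n = 0 := by omega
    change PhiUpPos s d₁ d₂ d₃ M 0 = 0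
    simp [PhiUpPos]
  · have e : (SignType.pos : ℤ) = 1 := rfl
    rw [e] at hε; omega

theorem racah_eq_zero_of_not {s d₁ d₂ d₃ : ℂ} (h : ¬(0 ≤ n ∧ n ≤ M ∧ x ≤ M)) :
    racah s d₁ d₂ d₃ M n x = 0 := by
  simp only [racah, if_neg h]

theorem neg_one_le_signType (ε : SignType) : (-1 : ℤ) ≤ ε := by cases ε <;> decide

theorem signType_le_one (ε : SignType) : (ε : ℤ) ≤ 1 := by cases ε <;> decide

theorem racah_recurrence (hs : s ^ 2 = q) (h₁ : d₁ ^ 2 = c₁) (h₂ : d₂ ^ 2 = c₂)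
    (h₃ : d₃ ^ 2 = c₃) (h : GenericRacah q c₁ c₂ c₃ K) (hn : 0 ≤ n)
    (hnM : n ≤ M) (hx : 0 ≤ x) (hxM : x ≤ M) (hM : M ≤ K) :
    lam q (c₁ * c₂) x * racah s d₁ d₂ d₃ M n x =
      ∑ ε : SignType, Phi q c₁ c₂ c₃ M ε (n + ε) * racah s d₁ d₂ d₃ M (n + ε) x := by
  have hs0 : s ≠ 0 := left_ne_zero_of_mul (h.root_ne hs h₂)
  rw [racah_eq_Omega_mul hs0 hn hnM hxM, hs, h₁, h₂, h₃, mul_left_comm,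
    racahSeries_recurrence h hn (by omega) hx hxM hM, mul_sum]
  refine sum_congr rfl fun ε _ => ?_
  by_cases hε : 0 ≤ n + ε ∧ n + ε ≤ M
  · rw [racah_eq_Omega_mul hs0 hε.1 hε.2 hxM, hs, h₁, h₂, h₃, ← mul_assoc, ← mul_assoc,
      mul_comm _ (Omega _ _ _ _ _ (n + ε)), Omega_mul_Phi hs h₁ h₂ h₃ h ε hn hnM hε.1 hε.2 hM]
  · rw [Phi_eq_zero_of_edge q c₁ c₂ c₃ ε hn hnM hε, racah_eq_zero_of_not (by tauto)]
    simp

theorem racah_up (hs : s ^ 2 = q) (h₁ : d₁ ^ 2 = c₁) (h₂ : d₂ ^ 2 = c₂)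
    (h₃ : d₃ ^ 2 = c₃) (h : GenericRacah q c₁ c₂ c₃ K) (hn : 0 ≤ n)
    (hnM : n ≤ M + 1) (hx : 0 ≤ x) (hxM : x ≤ M) (hM : M + 1 ≤ K) :
    lamUp q c₁ c₂ c₃ M x * racah s d₁ d₂ d₃ (M + 1) n x =
      ∑ ε : SignType, PhiUp s d₁ d₂ d₃ M ε (n + ε) * racah s d₁ d₂ d₃ M (n + ε) x := by
  have hs0 : s ≠ 0 := left_ne_zero_of_mul (h.root_ne hs h₂)
  rw [racah_eq_Omega_mul hs0 hn hnM (by omega), hs, h₁, h₂, h₃, mul_left_comm,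
    racahSeries_up hs h₂ h₃ h hn (by omega) hx hxM hM, mul_sum, mul_sum]
  refine sum_congr rfl fun ε _ => ?_
  by_cases hε : 0 ≤ n + ε ∧ n + ε ≤ M
  · have := Omega_mul_PhiUp hs h₁ h₂ h₃ h ε hn hε.1 hε.2 hM
    rw [racah_eq_Omega_mul hs0 hε.1 hε.2 hxM, hs, h₁, h₂, h₃]
    linear_combination (-racahSeries q c₁ c₂ c₃ M (n + ε) x) * this
  · rw [PhiDown_eq_zero_of_edge hs h₂ h₃ h ε hn hnM hM hε, racah_eq_zero_of_not (by tauto)]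
    simp

theorem GenericRacah.kap_ne (h : GenericRacah q c₁ c₂ c₃ K) (hs : s ^ 2 = q) (h₂ : d₂ ^ 2 = c₂)
    (hM0 : 0 ≤ M) (hM : M + 1 ≤ K) : kap (s * d₂) q c₁ c₂ c₃ M ≠ 0 := by
  have h1 := h.prod_nat (k := 0) hM0 (by omega)
  rw [pow_zero, mul_one] at h1
  refine div_ne_zero h1 (mul_ne_zero (mul_ne_zero h.c₃_ne (h.root_ne hs h₂)) ?_)
  have := h.q_pow (M + 1) (by omega) hM
  rwa [zpow_add_one₀ h.q_ne, mul_comm] at this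

theorem lamDown_self (q c₁ c₂ : ℂ) (hq : q ≠ 0) : lamDown q c₁ c₂ M (M + 1) = 0 := by
  rw [lamDown, zpow_add_one₀ hq, mul_comm q, sub_self, zero_mul]

theorem racah_down (hs : s ^ 2 = q) (h₁ : d₁ ^ 2 = c₁) (h₂ : d₂ ^ 2 = c₂)
    (h₃ : d₃ ^ 2 = c₃) (h : GenericRacah q c₁ c₂ c₃ K) (hn : 0 ≤ n)
    (hnM : n ≤ M) (hx : 0 ≤ x) (hxM : x ≤ M + 1) (hM : M + 1 ≤ K) :
    lamDown q c₁ c₂ M x * racah s d₁ d₂ d₃ M n x =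
      ∑ ε : SignType, PhiDown s d₂ d₃ (M + 1) ε (n + ε) * racah s d₁ d₂ d₃ (M + 1) (n + ε) x := by
  have hs0 : s ≠ 0 := left_ne_zero_of_mul (h.root_ne hs h₂)
  have hk := h.kap_ne hs h₂ (M := M) (by omega) hM
  -- At x = M + 1 the polynomial of level M is cut to zero but its series is not; the eigenvalue
  -- vanishes there, so either may be used.
  have e1 : lamDown q c₁ c₂ M x * racah s d₁ d₂ d₃ M n x =
      lamDown q c₁ c₂ M x * (Omega s d₁ d₂ d₃ M n * racahSeries q c₁ c₂ c₃ M n x) := by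
    rcases hxM.lt_or_eq with hlt | rfl
    · rw [racah_eq_Omega_mul hs0 hn hnM (by omega), hs, h₁, h₂, h₃]
    · rw [lamDown_self _ _ _ h.q_ne, zero_mul, zero_mul]
  rw [e1, ← mul_right_inj' hk, mul_left_comm (lamDown _ _ _ _ _), mul_left_comm,
    racahSeries_down hs h₁ h₂ h₃ h hn (by omega) hx hxM (Or.inr hnM) (by omega) hM, mul_sum, mul_sum]
  refine sum_congr rfl fun ε _ => ?_
  have b1 := neg_one_le_signType ε
  have b2 := signType_le_one ε
  by_cases hε : 0 ≤ n + ε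
  · have h3 : ((-ε : SignType) : ℤ) = -ε := by cases ε <;> rfl
    -- The exchange relation is read from the neighbour n + ε with the step −ε, which leads back to
    -- n.
    have := Omega_mul_PhiUp hs h₁ h₂ h₃ h (n := n + ε) (-ε) hε (by rw [h3]; omega)
      (by rw [h3]; omega) hM
    rw [h3, show n + (ε : ℤ) + -ε = n by ring, neg_neg] at this
    rw [racah_eq_Omega_mul hs0 hε (by omega) hxM, hs, h₁, h₂, h₃]
    linear_combination racahSeries q c₁ c₂ c₃ (M + 1) (n + ε) x * this
  · rw [PhiUp_eq_zero_of_edge s d₁ d₂ d₃ M ε hn (by omega), racah_eq_zero_of_not (by tauto)]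
    simp

end RacahRelations

/-! ### Recurrence coefficients in one index as operators on the neighbouring factor. -/

section LemmaA

variable {s d₀ d₁ d₂ d₃ d₄ q c₀ c₁ c₂ c₃ c₄ : ℂ} {N i j a : ℤ}

theorem FPos_eq {q : ℂ} (hq : q ≠ 0) (c₄ c₀ : ℂ) (j : ℤ) :
    FPos q c₄ c₀ j = c₄ * c₀ ^ 2 * (q * q ^ j) * wPos q c₀ c₄ (q ^ j) := by
  rw [FPos, FPosNum, wPos, zpow_add_one₀ hq, zpow_add_one₀ hq, zpow_two_mul_eq_sq, div_div,
    mul_div_assoc']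
  congr 1 <;> ring

theorem FNeg_eq {q c₄ c₀ : ℂ} (hq : q ≠ 0) (h1 : 1 - c₀ * c₄ * q * (q ^ j) ^ 2 ≠ 0) :
    FNeg q c₄ c₀ j = c₄ * c₀ * (q * q ^ j) * wNeg q c₀ c₄ (q ^ j) := by
  have h1' : 1 - c₄ * c₀ * q ^ (2 * j + 1) ≠ 0 := by
    rw [zpow_add_one₀ hq, zpow_two_mul_eq_sq]; intro h'; apply h1; linear_combination h'
  rw [FNeg, quot_eq h1', wNeg, zpow_add_one₀ hq, zpow_add_one₀ hq, zpow_add₀ hq, zpow_two_mul_eq_sq,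
    zpow_ofNat, div_mul_div_comm, mul_div_assoc']
  congr 1 <;> ring

/-- The parameter constraint replaces c₁c₂c₃ by (q^(2N+3)c₀c₄)⁻¹. The two factors of Φ⁺ that contain
a then become those of the contiguity eigenvalue at level N − j. -/
theorem Phi_one_scalar (hcn : q ^ 3 * (q ^ N) ^ 2 * c₀ * c₁ * c₂ * c₃ * c₄ = 1)
    (h304 : GenericRacah q c₃ c₀ c₄ N) (hj : 0 ≤ j) (hjN : j ≤ N) (a : ℤ) :
    Phi q c₃ c₀ c₄ (N - a) 1 j =
      -c₃ * q ^ (N + 1) * FPos q c₄ c₀ j * lamUp q c₁ c₂ c₃ (N - j) a := by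
  have hq := h304.q_ne
  obtain ⟨g0, g1, g2⟩ := h304.gen₂₃.factors hq hj (by omega)
  have f : Phi q c₃ c₀ c₄ (N - a) 1 j = PhiPos q c₃ c₀ c₄ (N - a) j := rfl
  rw [f, PhiPos_eq hq _ _ g1, FPos_eq hq, lamUp, zpow_sub₀ hq, zpow_sub₀ hq, zpow_add_one₀ hq]
  have hc₃ := h304.c₁_ne
  have hc₀ := h304.c₂_ne
  have hc₄ := h304.c₃_ne
  have hn := zpow_ne_zero N hq
  have hA := zpow_ne_zero a hq
  have hJ := zpow_ne_zero j hq
  have hp : c₁ * c₂ * c₃ = (q ^ 3 * (q ^ N) ^ 2 * c₀ * c₄)⁻¹ := by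
    rw [← mul_eq_one_iff_eq_inv₀ (by positivity)]; linear_combination hcn
  rw [hp]
  generalize wPos q c₀ c₄ (q ^ j) = P
  generalize q ^ N = n at *
  generalize q ^ a = A at *
  generalize q ^ j = J at *
  field_simp
  ring

theorem Phi_neg_one_scalar (hcn : q ^ 3 * (q ^ N) ^ 2 * c₀ * c₁ * c₂ * c₃ * c₄ = 1)
    (h304 : GenericRacah q c₃ c₀ c₄ N) (hj : 0 ≤ j) (hjN : j ≤ N) (a : ℤ) :
    Phi q c₃ c₀ c₄ (N - a) (-1) j =
      -c₃ * q ^ (N + 1) * FNeg q c₄ c₀ j * lamDown q c₁ c₂ (N - j - 1) a := by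
  have hq := h304.q_ne
  obtain ⟨g0, g1, g2⟩ := h304.gen₂₃.factors hq hj (by omega)
  have f : Phi q c₃ c₀ c₄ (N - a) (-1) j = PhiNeg q c₃ c₀ c₄ (N - a) j := rfl
  rw [f, PhiNeg_eq hq _ _ g1, FNeg_eq hq g1, lamDown, zpow_sub_one₀ hq, zpow_sub₀ hq, zpow_sub₀ hq,
    zpow_add_one₀ hq]
  have hc₃ := h304.c₁_ne
  have hc₀ := h304.c₂_ne
  have hc₄ := h304.c₃_ne
  have hn := zpow_ne_zero N hq
  have hA := zpow_ne_zero a hq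
  have hJ := zpow_ne_zero j hq
  have hp : c₁ * c₂ = (q ^ 3 * (q ^ N) ^ 2 * c₀ * c₃ * c₄)⁻¹ := by
    rw [← mul_eq_one_iff_eq_inv₀ (by positivity)]; linear_combination hcn
  rw [hp]
  generalize wNeg q c₀ c₄ (q ^ j) = P
  generalize q ^ N = n at *
  generalize q ^ a = A at *
  generalize q ^ j = J at *
  field_simp
  ring

/-- Expanding their products shows that Φ⁺ and Φ⁻ are both affine in q^(−a) + c₁c₂q^(a+1), hence so
is −Φ⁺ − Φ⁻. The constant term is the quantity g_j entering A^{0,0}, independent of a. -/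
theorem Phi_zero_scalar (hcn : q ^ 3 * (q ^ N) ^ 2 * c₀ * c₁ * c₂ * c₃ * c₄ = 1)
    (h304 : GenericRacah q c₃ c₀ c₄ N) (hj : 0 ≤ j) (hjN : j ≤ N) (a : ℤ) :
    Phi q c₃ c₀ c₄ (N - a) 0 j = gCoeff q c₀ c₁ c₂ c₃ c₄ N j +
      c₃ * q ^ (N + 1) * (FPos q c₄ c₀ j + FNeg q c₄ c₀ j) * lam q (c₁ * c₂) a := by
  have hq := h304.q_ne
  obtain ⟨g0, g1, g2⟩ := h304.gen₂₃.factors hq hj (by omega)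
  have f : Phi q c₃ c₀ c₄ (N - a) 0 j =
      -PhiPos q c₃ c₀ c₄ (N - a) j - PhiNeg q c₃ c₀ c₄ (N - a) j := rfl
  have hc : q ^ (2 * N + 3) * c₀ * c₁ * c₂ * c₃ * c₄ = 1 := by
    rw [zpow_add₀ hq, zpow_two_mul_eq_sq, zpow_ofNat]; linear_combination hcn
  have h4 : 1 - c₄ * c₀ * q ^ (2 * N + 1) ≠ 0 := by
    rw [mul_comm c₄]; exact h304.gen₂₃ _ (by omega) (by omega)
  rw [f, PhiPos_eq hq _ _ g1, PhiNeg_eq hq _ _ g1, gCoeff, FPosMul_eq hq hc h4, FPos_eq hq,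
    FNeg_eq hq g1, lam, zpow_neg]
  simp only [zpow_sub₀ hq, zpow_add₀ hq, zpow_ofNat, pow_one]
  have hc₃ := h304.c₁_ne
  have hc₀ := h304.c₂_ne
  have hc₄ := h304.c₃_ne
  have hn := zpow_ne_zero N hq
  have hA := zpow_ne_zero a hq
  have hJ := zpow_ne_zero j hq
  have hp : c₁ * c₂ = (q ^ 3 * (q ^ N) ^ 2 * c₀ * c₃ * c₄)⁻¹ := by
    rw [← mul_eq_one_iff_eq_inv₀ (by positivity)]; linear_combination hcn
  rw [hp]
  generalize wNeg q c₀ c₄ (q ^ j) = Q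
  generalize wPos q c₀ c₄ (q ^ j) = P
  generalize q ^ N = n at *
  generalize q ^ a = A at *
  generalize q ^ j = J at *
  field_simp
  ring

theorem coeffA_eq_PhiUp (hs : s ^ 2 = q) (h₀ : d₀ ^ 2 = c₀) (h₁ : d₁ ^ 2 = c₁) (h₂ : d₂ ^ 2 = c₂)
    (h₃ : d₃ ^ 2 = c₃) (h₄ : d₄ ^ 2 = c₄)
    (hcn : q ^ 3 * (q ^ N) ^ 2 * c₀ * c₁ * c₂ * c₃ * c₄ = 1)
    (h304 : GenericRacah q c₃ c₀ c₄ N) (hN : 0 ≤ N) (ε : SignType) (i j : ℤ) :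
    coeffA s d₀ d₁ d₂ d₃ d₄ N ε 1 i j =
      -c₃ * q ^ (N + 1) * FPos q c₄ c₀ j * PhiUp s d₁ d₂ d₃ (N - j) ε i := by
  have hq := h304.q_ne
  have hs0 : s ≠ 0 := by rintro rfl; apply hq; rw [← hs]; simp
  have hc : q ^ (2 * N + 3) * c₀ * c₁ * c₂ * c₃ * c₄ = 1 := by
    rw [zpow_add₀ hq, zpow_two_mul_eq_sq, zpow_ofNat]; linear_combination hcn
  have h4 : 1 - c₄ * c₀ * q ^ (2 * N + 1) ≠ 0 := by
    rw [mul_comm c₄]; exact h304.gen₂₃ _ (by omega) (by omega)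
  have e : coeffA s d₀ d₁ d₂ d₃ d₄ N ε 1 i j =
      -d₃ ^ 2 * (s ^ 2) ^ (N + 1) * FPosPhiUp s d₀ d₁ d₂ d₃ d₄ N ε i j := by
    cases ε <;> rfl
  rw [e, FPosPhiUp_eq ε i j hs0 (by rw [hs, h₀, h₁, h₂, h₃, h₄]; exact hc)
    (by rw [hs, h₀, h₄]; exact h4), hs, h₀, h₃, h₄, mul_assoc (-c₃ * q ^ (N + 1))]

theorem coeffA_eq_PhiDown (hs : s ^ 2 = q) (h₀ : d₀ ^ 2 = c₀) (h₃ : d₃ ^ 2 = c₃) (h₄ : d₄ ^ 2 = c₄)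
    (N : ℤ) (ε : SignType) (i j : ℤ) :
    coeffA s d₀ d₁ d₂ d₃ d₄ N ε (-1) i j =
      -c₃ * q ^ (N + 1) * FNeg q c₄ c₀ j * PhiDown s d₂ d₃ (N - j) ε i := by
  have e : coeffA s d₀ d₁ d₂ d₃ d₄ N ε (-1) i j =
      -d₃ ^ 2 * (s ^ 2) ^ (N + 1) * (FNeg (s ^ 2) (d₄ ^ 2) (d₀ ^ 2) j *
        PhiDown s d₂ d₃ (N - j) ε i) := by
    cases ε <;> rfl
  rw [e, hs, h₀, h₃, h₄]; ring

theorem coeffA_eq_Phi (hs : s ^ 2 = q) (h₀ : d₀ ^ 2 = c₀) (h₁ : d₁ ^ 2 = c₁) (h₂ : d₂ ^ 2 = c₂)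
    (h₃ : d₃ ^ 2 = c₃) (h₄ : d₄ ^ 2 = c₄) (N : ℤ) (ε : SignType) (i j : ℤ) :
    coeffA s d₀ d₁ d₂ d₃ d₄ N ε 0 i j =
      (if ε = 0 then gCoeff q c₀ c₁ c₂ c₃ c₄ N j else 0) +
      c₃ * q ^ (N + 1) * (FPos q c₄ c₀ j + FNeg q c₄ c₀ j) * Phi q c₁ c₂ c₃ (N - j) ε i := by
  subst hs h₀ h₁ h₂ h₃ h₄
  cases ε
  · rw [if_pos (show SignType.zero = 0 from rfl)]
    change gCoeff (s ^ 2) (d₀ ^ 2) (d₁ ^ 2) (d₂ ^ 2) (d₃ ^ 2) (d₄ ^ 2) N j - _ = _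
    simp only [Phi]; ring
  · rw [if_neg (by decide), zero_add]; rfl
  · rw [if_neg (by decide), zero_add]; rfl

/-- The three-term recurrence coefficient in the variable `j`, as a function of `a`, acts on the
polynomial of level `N - j + ε'` as the coefficients `A` do. -/
theorem Phi_mul_racah (hs : s ^ 2 = q) (h₀ : d₀ ^ 2 = c₀) (h₁ : d₁ ^ 2 = c₁) (h₂ : d₂ ^ 2 = c₂)
    (h₃ : d₃ ^ 2 = c₃) (h₄ : d₄ ^ 2 = c₄)
    (hcn : q ^ 3 * (q ^ N) ^ 2 * c₀ * c₁ * c₂ * c₃ * c₄ = 1)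
    (h123 : GenericRacah q c₁ c₂ c₃ N) (h304 : GenericRacah q c₃ c₀ c₄ N) (ε' : SignType)
    (hj : 0 ≤ j) (ha : 0 ≤ a) (hja : j + a ≤ N) (hi : 0 ≤ i) (hij : i + j ≤ N + ε')
    (hjε : 0 ≤ j - ε') :
    Phi q c₃ c₀ c₄ (N - a) ε' j * racah s d₁ d₂ d₃ (N - j + ε') i a =
      ∑ ε : SignType, coeffA s d₀ d₁ d₂ d₃ d₄ N ε ε' (i + ε) j *
        racah s d₁ d₂ d₃ (N - j) (i + ε) a := by
  cases ε'
  · have e : ((SignType.zero : SignType) : ℤ) = 0 := rfl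
    rw [e] at hij hjε ⊢
    rw [add_zero] at hij ⊢
    have hR := racah_recurrence hs h₁ h₂ h₃ h123 hi (M := N - j) (by omega) ha (by omega) (by omega)
    change Phi q c₃ c₀ c₄ (N - a) 0 j * _ =
      ∑ ε : SignType, coeffA s d₀ d₁ d₂ d₃ d₄ N ε 0 (i + ε) j * _
    simp only [coeffA_eq_Phi hs h₀ h₁ h₂ h₃ h₄, add_mul _ _ (racah _ _ _ _ _ _ _), sum_add_distrib,
      mul_assoc (c₃ * q ^ (N + 1) * (FPos q c₄ c₀ j + FNeg q c₄ c₀ j)), ← mul_sum, ← hR, ite_mul,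
      zero_mul, sum_ite_eq', mem_univ, if_true]
    rw [Phi_zero_scalar hcn h304 hj (by omega)]
    have e0 : ((0 : SignType) : ℤ) = 0 := rfl
    rw [e0, add_zero]
    ring
  · have e : ((SignType.neg : SignType) : ℤ) = -1 := rfl
    rw [e] at hij hjε ⊢
    have hR := racah_down hs h₁ h₂ h₃ h123 hi (M := N - j - 1) (by omega) ha (by omega) (by omega)
    change Phi q c₃ c₀ c₄ (N - a) (-1) j * _ =
      ∑ ε : SignType, coeffA s d₀ d₁ d₂ d₃ d₄ N ε (-1) (i + ε) j * _
    rw [sub_add_cancel] at hR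
    simp only [coeffA_eq_PhiDown hs h₀ h₃ h₄, mul_assoc (-c₃ * q ^ (N + 1) * FNeg q c₄ c₀ j),
      ← mul_sum, ← hR]
    rw [Phi_neg_one_scalar hcn h304 hj (by omega), ← sub_eq_add_neg]
    ring
  · have e : ((SignType.pos : SignType) : ℤ) = 1 := rfl
    rw [e] at hij hjε ⊢
    have hR := racah_up hs h₁ h₂ h₃ h123 hi (M := N - j) (by omega) ha (by omega) (by omega)
    change Phi q c₃ c₀ c₄ (N - a) 1 j * _ =
      ∑ ε : SignType, coeffA s d₀ d₁ d₂ d₃ d₄ N ε 1 (i + ε) j * _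
    simp only [coeffA_eq_PhiUp hs h₀ h₁ h₂ h₃ h₄ hcn h304 (by omega : 0 ≤ N),
      mul_assoc (-c₃ * q ^ (N + 1) * FPos q c₄ c₀ j), ← mul_sum, ← hR]
    rw [Phi_one_scalar hcn h304 hj (by omega)]
    ring

end LemmaA

/-! ### The recurrence relation with eigenvalue λ(y). -/

section FirstRelation

variable {s d₀ d₁ d₂ d₃ d₄ q c₀ c₁ c₂ c₃ c₄ : ℂ} {N i j x y : ℤ}

/-- A range of summation independent of j lets sums for neighbouring j be compared term by term. -/
theorem griffiths_eq_sum (s d₀ d₁ d₂ d₃ d₄ : ℂ) (N i j x y : ℤ) :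
    griffiths s d₀ d₁ d₂ d₃ d₄ N i j x y = ∑ a ∈ Icc 0 N,
      omegaFn s (d₁ * d₂ * d₃ / d₄) a * racah s d₁ d₂ d₃ (N - j) i a *
        racah s d₃ d₀ d₄ (N - a) j y * racah s d₄ d₂ d₁ (N - y) a x := by
  by_cases hj : 0 ≤ j
  · refine sum_subset (fun a => ?_) fun a _ ha => ?_
    · simp only [mem_Icc]; omega
    · simp only [mem_Icc] at *
      by_cases h : a ≤ N - j
      · rw [racah_eq_zero_of_not (n := a) (by omega), mul_zero]
      · rw [racah_eq_zero_of_not (x := a) (by omega)]; simp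
  · have h0 : ∀ a, racah s d₃ d₀ d₄ (N - a) j y = 0 := fun a => racah_eq_zero_of_not (by omega)
    simp [griffiths, h0]

theorem first_relation (hs : s ^ 2 = q) (h₀ : d₀ ^ 2 = c₀) (h₁ : d₁ ^ 2 = c₁) (h₂ : d₂ ^ 2 = c₂)
    (h₃ : d₃ ^ 2 = c₃) (h₄ : d₄ ^ 2 = c₄)
    (hcn : q ^ 3 * (q ^ N) ^ 2 * c₀ * c₁ * c₂ * c₃ * c₄ = 1)
    (h123 : GenericRacah q c₁ c₂ c₃ N) (h304 : GenericRacah q c₃ c₀ c₄ N)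
    (hi : 0 ≤ i) (hj : 0 ≤ j) (hij : i + j ≤ N) (hy : 0 ≤ y) :
    lam q (c₃ * c₀) y * griffiths s d₀ d₁ d₂ d₃ d₄ N i j x y =
      ∑ ε : SignType, ∑ ε' : SignType,
        coeffA s d₀ d₁ d₂ d₃ d₄ N ε ε' (i + ε) (j + ε') *
          griffiths s d₀ d₁ d₂ d₃ d₄ N (i + ε) (j + ε') x y := by
  simp only [griffiths_eq_sum, mul_sum]
  simp only [sum_comm (t := Icc 0 N)]
  refine sum_congr rfl fun a ha => ?_
  rw [mem_Icc] at ha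
  -- Beyond N − y the third factor is zero; otherwise y ≤ N − a, as the recurrence of the middle
  -- factor requires.
  by_cases hay : a ≤ N - y
  swap
  · simp [racah_eq_zero_of_not (s := s) (d₁ := d₄) (d₂ := d₂) (d₃ := d₁) (M := N - y) (n := a)
      (x := x) (by omega)]
  have hR : racah s d₁ d₂ d₃ (N - j) i a * (lam q (c₃ * c₀) y * racah s d₃ d₀ d₄ (N - a) j y) =
      racah s d₁ d₂ d₃ (N - j) i a *
        ∑ ε' : SignType, Phi q c₃ c₀ c₄ (N - a) ε' (j + ε') * racah s d₃ d₀ d₄ (N - a) (j + ε') y := by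
    by_cases haj : a ≤ N - j
    · rw [racah_recurrence hs h₃ h₀ h₄ h304 hj (by omega) hy (by omega) (by omega)]
    · rw [racah_eq_zero_of_not (x := a) (by omega), zero_mul, zero_mul]
  have hA : ∀ ε' : SignType, Phi q c₃ c₀ c₄ (N - a) ε' (j + ε') * racah s d₁ d₂ d₃ (N - j) i a *
      racah s d₃ d₀ d₄ (N - a) (j + ε') y =
      (∑ ε : SignType, coeffA s d₀ d₁ d₂ d₃ d₄ N ε ε' (i + ε) (j + ε') *
        racah s d₁ d₂ d₃ (N - (j + ε')) (i + ε) a) * racah s d₃ d₀ d₄ (N - a) (j + ε') y := by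
    intro ε'
    by_cases hj' : 0 ≤ j + ε' ∧ j + ε' ≤ N - a
    · rw [← Phi_mul_racah hs h₀ h₁ h₂ h₃ h₄ hcn h123 h304 ε' hj'.1 ha.1 (by omega) hi (by omega)
        (by omega), show N - (j + ε') + ε' = N - j by ring]
    · rw [racah_eq_zero_of_not (n := j + ε') (by omega), mul_zero, mul_zero]
  calc _ = omegaFn s (d₁ * d₂ * d₃ / d₄) a * racah s d₄ d₂ d₁ (N - y) a x *
      (racah s d₁ d₂ d₃ (N - j) i a * (lam q (c₃ * c₀) y * racah s d₃ d₀ d₄ (N - a) j y)) := by ring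
    _ = ∑ ε' : SignType, omegaFn s (d₁ * d₂ * d₃ / d₄) a * racah s d₄ d₂ d₁ (N - y) a x *
      (Phi q c₃ c₀ c₄ (N - a) ε' (j + ε') * racah s d₁ d₂ d₃ (N - j) i a *
      racah s d₃ d₀ d₄ (N - a) (j + ε') y) := by
        rw [hR, mul_sum, mul_sum]
        exact sum_congr rfl fun _ _ => by ring
    _ = _ := by
        rw [sum_comm]
        refine sum_congr rfl fun ε' _ => ?_
        rw [hA, sum_mul, mul_sum]
        exact sum_congr rfl fun _ _ => by ring

end FirstRelation

/-! ### Recurrence and contiguity relations in the variable x. -/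

section DualRelations

variable {s d₁ d₂ d₃ q c₁ c₂ c₃ : ℂ} {K M n x : ℤ}

theorem sum_signType_neg (f : SignType → ℂ) : ∑ ε : SignType, f (-ε) = ∑ ε : SignType, f ε := by
  simp only [sum_signType, neg_neg, show (-0 : SignType) = 0 from rfl]
  ring

theorem coe_neg_signType (ε : SignType) : ((-ε : SignType) : ℤ) = -ε := by cases ε <;> rfl

theorem racah_eq_symm (hs : s ^ 2 = q) (h₁ : d₁ ^ 2 = c₁) (h₂ : d₂ ^ 2 = c₂) (h₃ : d₃ ^ 2 = c₃)
    (hs0 : s ≠ 0) (hn : 0 ≤ n) (hnM : n ≤ M) (hx : 0 ≤ x) (hxM : x ≤ M) :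
    racah s d₁ d₂ d₃ M n x = Omega s d₁ d₂ d₃ M n * racahSeries q c₃ c₂ c₁ M x n := by
  rw [racah_eq_Omega_mul hs0 hn hnM hxM, hs, h₁, h₂, h₃,
    racahSeries_symm (by rw [← hs]; exact pow_ne_zero 2 hs0) _ _ _ _ hn hx]

theorem racah_recurrence_dual (hs : s ^ 2 = q) (h₁ : d₁ ^ 2 = c₁) (h₂ : d₂ ^ 2 = c₂)
    (h₃ : d₃ ^ 2 = c₃) (h : GenericRacah q c₁ c₂ c₃ K) (hn : 0 ≤ n)
    (hnM : n ≤ M) (hx : 0 ≤ x) (hxM : x ≤ M) (hM : M ≤ K) :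
    ∑ ε : SignType, Phi q c₃ c₂ c₁ M ε x * racah s d₁ d₂ d₃ M n (x - ε) =
      lam q (c₃ * c₂) n * racah s d₁ d₂ d₃ M n x := by
  have hs0 : s ≠ 0 := left_ne_zero_of_mul (h.root_ne hs h₂)
  rw [racah_eq_symm hs h₁ h₂ h₃ hs0 hn hnM hx hxM, mul_left_comm,
    racahSeries_recurrence h.symm hx (by omega) hn hnM hM, mul_sum, ← sum_signType_neg]
  refine sum_congr rfl fun ε _ => ?_
  rw [coe_neg_signType, sub_neg_eq_add]
  by_cases hε : 0 ≤ x + ε ∧ x + ε ≤ M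
  · rw [racah_eq_symm hs h₁ h₂ h₃ hs0 hn hnM hε.1 hε.2]; ring
  · rw [Phi_eq_zero_of_edge q c₃ c₂ c₁ ε hx hxM hε]; ring

/-- Passing to the dual relation leaves Ω at two levels; their quotient converts one contiguity
eigenvalue of the dual series into the other. -/
theorem Omega_mul_kap (hs : s ^ 2 = q) (h₁ : d₁ ^ 2 = c₁) (h₂ : d₂ ^ 2 = c₂)
    (h₃ : d₃ ^ 2 = c₃) (h : GenericRacah q c₁ c₂ c₃ K) (hn : 0 ≤ n)
    (hnM : n ≤ M) (hM : M + 1 ≤ K) :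
    Omega s d₁ d₂ d₃ (M + 1) n * (kap (s * d₂) q c₃ c₂ c₁ M * lamDown q c₃ c₂ M n) =
      Omega s d₁ d₂ d₃ M n * lamUp q c₃ c₂ c₁ M n := by
  have key := Omega_level hs h₁ h₂ h₃ h hn hnM hM
  have hq := h.q_ne
  have hc₁ := h.c₁_ne
  have hr := h.root_ne hs h₂
  have hqm : 1 - q * q ^ M ≠ 0 := by
    have := h.q_pow (M + 1) (by omega) hM
    rwa [zpow_add_one₀ hq, mul_comm] at this
  have hy := zpow_ne_zero n hq
  have hm := zpow_ne_zero M hq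
  rw [kap, lamDown, lamUp]
  generalize Omega s d₁ d₂ d₃ (M + 1) n = O at *
  generalize Omega s d₁ d₂ d₃ M n = O0 at *
  generalize s * d₂ = r at *
  generalize q ^ n = y at *
  generalize q ^ M = m at *
  generalize hv : 1 - q * m = v at *
  field_simp at key ⊢
  linear_combination key

/-- Ω does not depend on x and does not rearrange the coefficients here, so a descending relation of
the dual series yields a relation from level M + 1 to level M. -/
theorem racah_up_dual (hs : s ^ 2 = q) (h₁ : d₁ ^ 2 = c₁) (h₂ : d₂ ^ 2 = c₂)
    (h₃ : d₃ ^ 2 = c₃) (h : GenericRacah q c₁ c₂ c₃ K) (hn : 0 ≤ n)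
    (hnM : n ≤ M + 1) (hx : 0 ≤ x) (hxM : x ≤ M) (hM : M + 1 ≤ K) :
    ∑ ε : SignType, PhiUp s d₃ d₂ d₁ M ε x * racah s d₁ d₂ d₃ (M + 1) n (x - ε) =
      lamUp q c₃ c₂ c₁ M n * racah s d₁ d₂ d₃ M n x := by
  have hs0 : s ≠ 0 := left_ne_zero_of_mul (h.root_ne hs h₂)
  have hD := racahSeries_down hs h₃ h₂ h₁ h.symm hx (by omega) hn hnM (Or.inr hxM) (by omega) hM
  trans Omega s d₁ d₂ d₃ (M + 1) n *
      (kap (s * d₂) q c₃ c₂ c₁ M * (lamDown q c₃ c₂ M n * racahSeries q c₃ c₂ c₁ M x n))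
  · rw [hD, mul_sum, ← sum_signType_neg]
    refine sum_congr rfl fun ε _ => ?_
    have b := signType_le_one ε
    rw [coe_neg_signType, sub_neg_eq_add]
    by_cases hε : 0 ≤ x + ε
    · rw [racah_eq_symm hs h₁ h₂ h₃ hs0 hn hnM hε (by omega)]; ring
    · rw [PhiUp_eq_zero_of_edge s d₃ d₂ d₁ M ε hx (by omega)]; ring
  · rcases hnM.lt_or_eq with hlt | rfl
    · rw [racah_eq_symm hs h₁ h₂ h₃ hs0 hn (by omega) hx hxM]
      linear_combination racahSeries q c₃ c₂ c₁ M x n *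
        Omega_mul_kap hs h₁ h₂ h₃ h hn (by omega) hM
    -- For n = M + 1 the right-hand polynomial is zero by convention, consistently with the zero of
    -- `lamDown`.
    · rw [lamDown_self _ _ _ h.q_ne, racah_eq_zero_of_not (by omega)]; ring

theorem racah_down_dual (hs : s ^ 2 = q) (h₁ : d₁ ^ 2 = c₁) (h₂ : d₂ ^ 2 = c₂)
    (h₃ : d₃ ^ 2 = c₃) (h : GenericRacah q c₁ c₂ c₃ K) (hn : 0 ≤ n)
    (hnM : n ≤ M) (hx : 0 ≤ x) (hxM : x ≤ M + 1) (hM : M + 1 ≤ K) :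
    ∑ ε : SignType, PhiDown s d₂ d₁ (M + 1) ε x * racah s d₁ d₂ d₃ M n (x - ε) =
      lamDown q c₃ c₂ M n * racah s d₁ d₂ d₃ (M + 1) n x := by
  have hs0 : s ≠ 0 := left_ne_zero_of_mul (h.root_ne hs h₂)
  have hk := h.symm.kap_ne hs h₂ (M := M) (by omega) hM
  have hU := racahSeries_up hs h₂ h₁ h.symm hx (by omega) hn hnM hM
  rw [← mul_right_inj' hk]
  trans Omega s d₁ d₂ d₃ M n * (lamUp q c₃ c₂ c₁ M n * racahSeries q c₃ c₂ c₁ (M + 1) x n)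
  · rw [hU, mul_left_comm (Omega _ _ _ _ _ _), ← sum_signType_neg]
    congr 1
    rw [mul_sum]
    refine sum_congr rfl fun ε _ => ?_
    rw [coe_neg_signType, sub_neg_eq_add]
    by_cases hε : 0 ≤ x + ε ∧ x + ε ≤ M
    · rw [racah_eq_symm hs h₁ h₂ h₃ hs0 hn hnM hε.1 hε.2]; ring
    · rw [PhiDown_eq_zero_of_edge hs h₂ h₁ h.symm ε hx hxM hM hε]; ring
  · rw [racah_eq_symm hs h₁ h₂ h₃ hs0 hn (by omega) hx hxM]
    linear_combination -racahSeries q c₃ c₂ c₁ (M + 1) x n *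
      Omega_mul_kap hs h₁ h₂ h₃ h hn hnM hM

end DualRelations

/-! ### Central coefficients in terms of μ(n), and the root relations. -/

section Symmetrization

variable {s d₀ d₁ d₂ d₃ d₄ q c₀ c₁ c₂ c₃ c₄ : ℂ} {K N M n x : ℤ}

/-- The eigenvalue `λ(n; t)` up to an additive constant: `q ^ (-n) + t q ^ (n + 1)`. -/
noncomputable def mu (q t : ℂ) (n : ℤ) : ℂ := (q ^ n)⁻¹ + t * q * q ^ n

theorem lam_eq_mu {q : ℂ} (hq : q ≠ 0) (t : ℂ) (n : ℤ) : lam q t n = mu q t n - 1 - t * q := by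
  have hy := zpow_ne_zero n hq
  rw [lam, mu, zpow_neg, zpow_add_one₀ hq]
  field_simp
  ring

theorem wPos_add_wNeg {q a b y : ℂ} (hy : y ≠ 0) (h0 : 1 - a * b * y ^ 2 ≠ 0)
    (h1 : 1 - a * b * q * y ^ 2 ≠ 0) (h2 : 1 - a * b * q ^ 2 * y ^ 2 ≠ 0) :
    b * (1 + q) * y * (a * wPos q a b y + wNeg q a b y) =
      1 + b + (y⁻¹ + a * b * q * y) * wZero q a b y := by
  have hrel := wPos_wNeg_rel h0 h1 h2
  have hP := wPos_mul h0 h1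
  rw [wZero]
  generalize wPos q a b y = P at *
  generalize wNeg q a b y = Q at *
  field_simp
  linear_combination (-(b * y ^ 2)) * hrel - hP

/-- In this form n enters only through μ(n) and `wZero`, and M only through q^(−M) + c₁c₂c₃q^(M+2).
Central coefficients of families with different parameters can then be compared. -/
theorem Phi_zero_eq (h : GenericRacah q c₁ c₂ c₃ K) (hq1 : 1 + q ≠ 0) (hn : 0 ≤ n)
    (hnK : n ≤ K + 1) (M : ℤ) :
    Phi q c₁ c₂ c₃ M 0 n = ((q ^ M)⁻¹ + c₁ * c₂ * c₃ * q ^ 2 * q ^ M) *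
      (1 + c₃ + mu q (c₂ * c₃) n * wZero q c₂ c₃ (q ^ n)) / (c₃ * (1 + q)) -
      1 - c₁ * c₂ * q - q * c₂ * (1 + c₁) * wZero q c₂ c₃ (q ^ n) := by
  have hq := h.q_ne
  obtain ⟨g0, g1, g2⟩ := h.gen₂₃.factors hq hn hnK
  have f : Phi q c₁ c₂ c₃ M 0 n = -PhiPos q c₁ c₂ c₃ M n - PhiNeg q c₁ c₂ c₃ M n := rfl
  have hc₃ := h.c₃_ne
  have hy := zpow_ne_zero n hq
  have hm := zpow_ne_zero M hq
  have hrel := wPos_wNeg_rel g0 g1 g2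
  rw [f, PhiPos_eq hq _ _ g1, PhiNeg_eq hq _ _ g1, mu, ← wPos_add_wNeg hy g0 g1 g2, wZero]
  generalize wPos q c₂ c₃ (q ^ n) = P at *
  generalize wNeg q c₂ c₃ (q ^ n) = Q at *
  generalize q ^ n = y at *
  generalize q ^ M = m at *
  field_simp
  linear_combination m * hrel

theorem FPos_add_FNeg (h : GenericRacah q c₄ c₂ c₁ K) (hn : 0 ≤ n) (hnK : n ≤ K + 1) :
    (1 + q) * (FPos q c₁ c₂ n + FNeg q c₁ c₂ n) =
      q * c₂ * (1 + c₁ + mu q (c₁ * c₂) n * wZero q c₂ c₁ (q ^ n)) := by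
  have hq := h.q_ne
  obtain ⟨g0, g1, g2⟩ := h.gen₂₃.factors hq hn hnK
  rw [FPos_eq hq, FNeg_eq hq g1, mu, mul_comm c₁ c₂, ← wPos_add_wNeg (zpow_ne_zero n hq) g0 g1 g2]
  ring

/-- The relations between the parameters and their square roots which are used throughout. -/
structure Roots (s d₀ d₁ d₂ d₃ d₄ q c₀ c₁ c₂ c₃ c₄ : ℂ) (N : ℤ) : Prop where
  hs : s ^ 2 = q
  h₀ : d₀ ^ 2 = c₀
  h₁ : d₁ ^ 2 = c₁
  h₂ : d₂ ^ 2 = c₂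
  h₃ : d₃ ^ 2 = c₃
  h₄ : d₄ ^ 2 = c₄
  prod : q * q ^ N * s * d₀ * d₁ * d₂ * d₃ * d₄ = 1

theorem Roots.prod_sq (h : Roots s d₀ d₁ d₂ d₃ d₄ q c₀ c₁ c₂ c₃ c₄ N) :
    q ^ 3 * (q ^ N) ^ 2 * c₀ * c₁ * c₂ * c₃ * c₄ = 1 := by
  have := h.prod
  calc _ = (q * q ^ N * s * d₀ * d₁ * d₂ * d₃ * d₄) ^ 2 := by
        rw [← h.h₀, ← h.h₁, ← h.h₂, ← h.h₃, ← h.h₄, mul_pow, mul_pow, mul_pow, mul_pow, mul_pow,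
          mul_pow, mul_pow, h.hs]; ring
    _ = 1 := by rw [this, one_pow]

end Symmetrization

/-! ### The coefficients A of the permuted families in explicit form. -/

section ExplicitCoefficients

variable {s d₀ d₁ d₂ d₃ d₄ q c₀ c₁ c₂ c₃ c₄ : ℂ} {K N b j : ℤ} {ε' : SignType}

theorem omegaFn_succ {s e : ℂ} (hs : s ≠ 0) (he : e ≠ 0) (n : ℤ) :
    omegaFn s e (n + 1) = -(e * (s ^ 2) ^ (n + 1)) * omegaFn s e n := by
  -- The increment (n + 1)·2 is even, so the integer division is additive here.
  have h1 : (n + 1) * (n + 1 + 1) / 2 = (n + 1) + n * (n + 1) / 2 := by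
    rw [show (n + 1) * (n + 1 + 1) = n * (n + 1) + (n + 1) * 2 by ring,
      Int.add_mul_ediv_right _ _ (by norm_num)]
    ring
  rw [omegaFn, omegaFn, h1, zpow_add₀ (pow_ne_zero 2 hs), zpow_add_one₀ he,
    zpow_add_one₀ (by norm_num : (-1 : ℂ) ≠ 0)]
  ring

theorem omegaFn_one (s e : ℂ) : omegaFn s e 1 = -(e * s ^ 2) := by simp [omegaFn]

theorem omegaFn_zero (s e : ℂ) : omegaFn s e 0 = 1 := by simp [omegaFn]

theorem omegaFn_neg_one (s e : ℂ) : omegaFn s e (-1) = -e⁻¹ := by simp [omegaFn]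

theorem Roots.ne (h : Roots s d₀ d₁ d₂ d₃ d₄ q c₀ c₁ c₂ c₃ c₄ N) :
    q ≠ 0 ∧ s ≠ 0 ∧ d₀ ≠ 0 ∧ d₁ ≠ 0 ∧ d₂ ≠ 0 ∧ d₃ ≠ 0 ∧ d₄ ≠ 0 := by
  have := h.prod
  have h1 : q * q ^ N * s * d₀ * d₁ * d₂ * d₃ * d₄ ≠ 0 := by rw [this]; exact one_ne_zero
  simp only [mul_ne_zero_iff] at h1
  tauto

/-- The exchange c₁ ↔ c₃ carries A(c₃,c₀,c₄,c₁), on the left of the intertwining identity, into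
A(c₁,c₀,c₄,c₃) on its right; formulas proved for one serve for the other. -/
theorem Roots.swap (h : Roots s d₀ d₁ d₂ d₃ d₄ q c₀ c₁ c₂ c₃ c₄ N) :
    Roots s d₀ d₃ d₂ d₁ d₄ q c₀ c₃ c₂ c₁ c₄ N :=
  ⟨h.hs, h.h₀, h.h₃, h.h₂, h.h₁, h.h₄, by rw [← h.prod]; ring⟩

/-- The coefficients `A` of the family `(c₂; c₃, c₀, c₄, c₁)`. -/
theorem coeffA_up_eq (H : Roots s d₀ d₁ d₂ d₃ d₄ q c₀ c₁ c₂ c₃ c₄ N)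
    (h421 : GenericRacah q c₄ c₂ c₁ N) (hN : 0 ≤ N) (ε' : SignType) (j b : ℤ) :
    coeffA s d₂ d₃ d₀ d₄ d₁ N ε' 1 j b = -c₄ * (q * q ^ N) *
      (c₁ * c₂ ^ 2 * (q * q ^ b) * wPos q c₂ c₁ (q ^ b)) * PhiUp s d₃ d₀ d₄ (N - b) ε' j := by
  rw [coeffA_eq_PhiUp H.hs H.h₂ H.h₃ H.h₀ H.h₄ H.h₁ (by rw [← H.prod_sq]; ring) h421 hN,
    FPos_eq H.ne.1, zpow_add_one₀ H.ne.1, mul_comm q (q ^ N)]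

theorem coeffA_down_eq (H : Roots s d₀ d₁ d₂ d₃ d₄ q c₀ c₁ c₂ c₃ c₄ N)
    (h421 : GenericRacah q c₄ c₂ c₁ K) (ε' : SignType) (j : ℤ) (hb : 0 ≤ b) (hbK : b ≤ K + 1) :
    coeffA s d₂ d₃ d₀ d₄ d₁ N ε' (-1) j b = -c₄ * (q * q ^ N) *
      (c₁ * c₂ * (q * q ^ b) * wNeg q c₂ c₁ (q ^ b)) * PhiDown s d₀ d₄ (N - b) ε' j := by
  obtain ⟨g0, g1, g2⟩ := h421.gen₂₃.factors H.ne.1 hb hbK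
  rw [coeffA_eq_PhiDown H.hs H.h₂ H.h₄ H.h₁, FNeg_eq H.ne.1 g1, zpow_add_one₀ H.ne.1,
    mul_comm q (q ^ N)]

theorem coeffA_mid_eq (H : Roots s d₀ d₁ d₂ d₃ d₄ q c₀ c₁ c₂ c₃ c₄ N)
    (h421 : GenericRacah q c₄ c₂ c₁ K) (hq1 : 1 + q ≠ 0) (hε' : ε' ≠ 0) (j : ℤ) (hb : 0 ≤ b)
    (hbK : b ≤ K + 1) :
    coeffA s d₂ d₃ d₀ d₄ d₁ N ε' 0 j b = c₄ * (q * q ^ N) *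
      (q * c₂ * (1 + c₁ + mu q (c₁ * c₂) b * wZero q c₂ c₁ (q ^ b)) / (1 + q)) *
        Phi q c₃ c₀ c₄ (N - b) ε' j := by
  rw [coeffA_eq_Phi H.hs H.h₂ H.h₃ H.h₀ H.h₄ H.h₁, if_neg hε', zero_add,
    ← FPos_add_FNeg h421 hb hbK, zpow_add_one₀ H.ne.1, mul_comm q (q ^ N),
    mul_div_cancel_left₀ _ hq1]

end ExplicitCoefficients

/-! ### The coefficient A^{0,0} as a q-commutator coefficient plus a constant. -/

section CentralCoefficient

variable {s d₀ d₁ d₂ d₃ d₄ q c₀ c₁ c₂ c₃ c₄ : ℂ} {K N b j : ℤ} {ε' : SignType}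

/-- With μ = y⁻¹ + abqy this determines `wZero` as a rational function of μ wherever μ² ≠ ab(1+q)².
It is used to eliminate μ²·`wZero`. -/
theorem wZero_rel {q a b y : ℂ} (hy : y ≠ 0) (h0 : 1 - a * b * y ^ 2 ≠ 0)
    (h1 : 1 - a * b * q * y ^ 2 ≠ 0) (h2 : 1 - a * b * q ^ 2 * y ^ 2 ≠ 0) :
    ((y⁻¹ + a * b * q * y) ^ 2 - a * b * (1 + q) ^ 2) * wZero q a b y +
      (1 + b) * (y⁻¹ + a * b * q * y) - b * (1 + q) * (1 + a) = 0 := by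
  rw [wZero, wPos, wNeg]
  generalize hT0 : 1 - a * b * y ^ 2 = T0 at *
  generalize hT1 : 1 - a * b * q * y ^ 2 = T1 at *
  generalize hT2 : 1 - a * b * q ^ 2 * y ^ 2 = T2 at *
  field_simp
  rw [← hT0, ← hT1, ← hT2]
  ring

/-- The constant term of the central coefficient. -/
noncomputable def delZero (q c₀ c₁ c₂ c₃ c₄ : ℂ) (N j : ℤ) : ℂ :=
  q / (1 + q) * ((1 + c₂) * (1 + c₄)) - 1 - q * c₂ * c₄ -
    wZero q c₀ c₄ (q ^ j) * (c₂ * (1 + c₁) * (1 + c₃)) / (q ^ N * (c₁ * c₂ * c₃) * (1 + q))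

theorem coeffA_zero_eq (H : Roots s d₀ d₁ d₂ d₃ d₄ q c₀ c₁ c₂ c₃ c₄ N)
    (h421 : GenericRacah q c₄ c₂ c₁ N) (h321 : GenericRacah q c₃ c₂ c₁ N)
    (h304 : GenericRacah q c₃ c₀ c₄ N) (hq1 : 1 + q ≠ 0)
    (hj : 0 ≤ j) (hjN : j ≤ N) (hb : 0 ≤ b) (hbN : b ≤ N) :
    coeffA s d₂ d₃ d₀ d₄ d₁ N 0 0 j b = wZero q c₀ c₄ (q ^ j) / (q * q ^ N * (c₁ * c₂ * c₃) * (1 + q)) *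
      (mu q (c₁ * c₂) b * (Phi q c₃ c₂ c₁ (N - j) 0 b + 1 + c₂ * c₃ * q)) +
        delZero q c₀ c₁ c₂ c₃ c₄ N j := by
  have hq := H.ne.1
  have hF := FPos_add_FNeg h421 hb (by omega : b ≤ N + 1)
  -- The argument a in `Phi_zero_scalar` is free. Taking it equal to j expresses g_b through a
  -- central coefficient at level N − j, the level in the claim.
  have hS := Phi_zero_scalar (c₀ := c₂) (c₁ := c₃) (c₂ := c₀) (c₃ := c₄) (c₄ := c₁) (N := N)
    (by rw [← H.prod_sq]; ring) h421 hb hbN j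
  rw [coeffA_eq_Phi H.hs H.h₂ H.h₃ H.h₀ H.h₄ H.h₁, if_pos rfl, ← sub_eq_of_eq_add hS, lam_eq_mu hq]
  have hF' : FPos q c₁ c₂ b + FNeg q c₁ c₂ b = q * c₂ * (1 + c₁ + mu q (c₁ * c₂) b *
    wZero q c₂ c₁ (q ^ b)) / (1 + q) := by rw [← hF, mul_div_cancel_left₀ _ hq1]
  rw [hF', Phi_zero_eq h421 hq1 hb (by omega), Phi_zero_eq h321 hq1 hb (by omega),
    Phi_zero_eq h304 hq1 hj (by omega), delZero]
  simp only [zpow_sub₀ hq, zpow_add_one₀ hq, mu]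
  obtain ⟨g0, g1, g2⟩ := h421.gen₂₃.factors hq hb (by omega)
  have hW := wZero_rel (zpow_ne_zero b hq) g0 g1 g2
  have hn := zpow_ne_zero N hq
  have hy := zpow_ne_zero b hq
  have hJ := zpow_ne_zero j hq
  have hc₀ := h304.c₂_ne
  have hc₁ := h421.c₃_ne
  have hc₂ := h421.c₂_ne
  have hc₃ := h304.c₁_ne
  have hc₄ := h421.c₁_ne
  have hp : c₀ = (q ^ 3 * (q ^ N) ^ 2 * c₁ * c₂ * c₃ * c₄)⁻¹ := by
    rw [← mul_eq_one_iff_eq_inv₀ (by positivity)]; linear_combination H.prod_sq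
  generalize wZero q c₀ c₄ (q ^ j) = Z at *
  generalize wZero q c₂ c₁ (q ^ b) = W at *
  clear hS hF hF' g0 g1 g2
  generalize q ^ N = n at *
  generalize q ^ b = y at *
  generalize q ^ j = J at *
  rw [hp]
  -- The two sides differ by a multiple of the relation for `wZero`: the left one contains
  -- μ²·`wZero`, from the product of F⁺ + F⁻ with λ.
  linear_combination (norm := skip) (q * (1 + c₄) / (c₁ * (1 + q) ^ 2)) * hW
  generalize hv : 1 + q = v at *
  field_simp
  ring

end CentralCoefficient

/-! ### q-commutators of multiplication by μ with the dual operators. -/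

section Commutators

variable {s d₁ d₂ d₃ q c₁ c₂ c₃ : ℂ} {K M i b : ℤ}

/-- Computes XT − qTX on U_i in two ways: X multiplies by μ in the variable and is tridiagonal in
the degree (ρ, ρ'), T shifts the variable by the coefficients g and sends U_k to ν_k V_k. The
hypothesis on TX carries the factor g_ε because the recurrence need not hold at a variable outside
the range, where g_ε vanishes. -/
theorem q_commutator (q μb ν0 V0 : ℂ) (μs g U0 VV ν ρ ρ' : SignType → ℂ)
    (UU : SignType → SignType → ℂ) (hT0 : ∑ ε : SignType, g ε * U0 ε = ν0 * V0)
    (hT : ∀ δ, ∑ ε : SignType, g ε * UU δ ε = ν δ * VV δ)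
    (hU : ∀ ε, g ε * (μs ε * U0 ε) = g ε * ∑ δ : SignType, ρ δ * UU δ ε)
    (hV : ν0 * (μb * V0) = ν0 * ∑ δ : SignType, ρ' δ * VV δ) :
    ∑ ε : SignType, g ε * (μb - q * μs ε) * U0 ε =
      ∑ δ : SignType, (ν0 * ρ' δ - q * (ρ δ * ν δ)) * VV δ := by
  calc _ = μb * ∑ ε : SignType, g ε * U0 ε - q * ∑ ε : SignType, g ε * (μs ε * U0 ε) := by
        rw [mul_sum, mul_sum, ← sum_sub_distrib]
        exact sum_congr rfl fun _ _ => by ring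
    _ = ν0 * (μb * V0) - q * ∑ δ : SignType, ρ δ * ∑ ε : SignType, g ε * UU δ ε := by
        rw [hT0]
        simp only [hU, mul_sum]
        rw [sum_comm]
        congr 1
        · ring
        · exact sum_congr rfl fun _ _ => sum_congr rfl fun _ _ => by ring
    _ = _ := by
        simp only [hT]
        rw [hV, mul_sum, mul_sum, ← sum_sub_distrib]
        exact sum_congr rfl fun _ _ => by ring

/-- The coefficients of the three-term recurrence relation for the eigenvalue `mu`. -/
noncomputable def PhiMu (q c₁ c₂ c₃ : ℂ) (M : ℤ) (ε : SignType) (n : ℤ) : ℂ :=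
  Phi q c₁ c₂ c₃ M ε n + if ε = 0 then 1 + c₁ * c₂ * q else 0

theorem mu_mul_racah (hs : s ^ 2 = q) (h₁ : d₁ ^ 2 = c₁) (h₂ : d₂ ^ 2 = c₂)
    (h₃ : d₃ ^ 2 = c₃) (h : GenericRacah q c₁ c₂ c₃ K) (hi : 0 ≤ i) (hiM : i ≤ M + 1) (hb : 0 ≤ b)
    (hM : M ≤ K) : mu q (c₁ * c₂) b * racah s d₁ d₂ d₃ M i b =
      ∑ ε : SignType, PhiMu q c₁ c₂ c₃ M ε (i + ε) * racah s d₁ d₂ d₃ M (i + ε) b := by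
  by_cases hbM : b ≤ M
  swap
  · have h0 : ∀ k, racah s d₁ d₂ d₃ M k b = 0 := fun k => racah_eq_zero_of_not (by omega)
    simp [h0]
  -- The degree M + 1 is needed when X acts after the level has dropped. The polynomial is zero, and
  -- so is the coefficient Φ⁻ at degree M.
  rcases hiM.eq_or_lt with rfl | hiM
  · have e1 : ((1 : SignType) : ℤ) = 1 := rfl
    have e2 : ((0 : SignType) : ℤ) = 0 := rfl
    have e3 : ((-1 : SignType) : ℤ) = -1 := rfl
    have f : PhiMu q c₁ c₂ c₃ M (-1) (M + 1 + -1) = PhiNeg q c₁ c₂ c₃ M (M + 1 + -1) + 0 := rfl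
    rw [sum_signType, e1, e2, e3, f, racah_eq_zero_of_not (n := M + 1 + 1) (by omega),
      racah_eq_zero_of_not (n := M + 1 + 0) (by omega), racah_eq_zero_of_not (n := M + 1) (by omega)]
    simp [PhiNeg]
  have hR := racah_recurrence hs h₁ h₂ h₃ h hi (by omega) hb hbM hM
  have e0 : ((0 : SignType) : ℤ) = 0 := rfl
  simp only [PhiMu, add_mul _ _ (racah _ _ _ _ _ _ _), sum_add_distrib, ← hR, ite_mul, zero_mul,
    sum_ite_eq', mem_univ, if_true]
  rw [e0, add_zero, lam_eq_mu h.q_ne]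
  ring

/-- The polynomials are not cut off at negative variables, so at b = 0 the shift to b − 1 is
harmless only because the coefficient g₁ is zero. -/
theorem mul_mu_mul_racah (hs : s ^ 2 = q) (h₁ : d₁ ^ 2 = c₁) (h₂ : d₂ ^ 2 = c₂)
    (h₃ : d₃ ^ 2 = c₃) (h : GenericRacah q c₁ c₂ c₃ K) (hi : 0 ≤ i) (hiM : i ≤ M + 1) (hb : 0 ≤ b)
    (hM : M ≤ K) (g : SignType → ℂ) (hg : b = 0 → g 1 = 0) (ε : SignType) :
    g ε * (mu q (c₁ * c₂) (b - ε) * racah s d₁ d₂ d₃ M i (b - ε)) =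
      g ε * ∑ δ : SignType, PhiMu q c₁ c₂ c₃ M δ (i + δ) * racah s d₁ d₂ d₃ M (i + δ) (b - ε) := by
  by_cases hε : 0 ≤ b - ε
  · rw [mu_mul_racah hs h₁ h₂ h₃ h hi hiM hε hM]
  · have : g ε = 0 := by
      cases ε
      · exact absurd (by simpa using hb) hε
      · have e : (SignType.neg : ℤ) = -1 := rfl
        rw [e] at hε; omega
      · have e : (SignType.pos : ℤ) = 1 := rfl
        rw [e] at hε
        exact hg (by omega)
    rw [this, zero_mul, zero_mul]

theorem racah_recurrence_mu_dual (hs : s ^ 2 = q) (h₁ : d₁ ^ 2 = c₁) (h₂ : d₂ ^ 2 = c₂)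
    (h₃ : d₃ ^ 2 = c₃) (h : GenericRacah q c₁ c₂ c₃ K) (hb : 0 ≤ b) (hbM : b ≤ M)
    (hM : M ≤ K) (i : ℤ) :
    ∑ ε : SignType, PhiMu q c₃ c₂ c₁ M ε b * racah s d₁ d₂ d₃ M i (b - ε) =
      mu q (c₂ * c₃) i * racah s d₁ d₂ d₃ M i b := by
  by_cases hi : 0 ≤ i ∧ i ≤ M
  · have hR := racah_recurrence_dual hs h₁ h₂ h₃ h hi.1 hi.2 hb hbM hM
    have e0 : ((0 : SignType) : ℤ) = 0 := rfl
    simp only [PhiMu, add_mul _ _ (racah _ _ _ _ _ _ _), sum_add_distrib, hR, ite_mul, zero_mul,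
      sum_ite_eq', mem_univ, if_true]
    rw [e0, sub_zero, lam_eq_mu h.q_ne, mul_comm c₃ c₂]
    ring
  · have h0 : ∀ x, racah s d₁ d₂ d₃ M i x = 0 := fun x => racah_eq_zero_of_not (by omega)
    simp [h0]

theorem PhiMu_one_zero (q c₁ c₂ c₃ : ℂ) (M : ℤ) : PhiMu q c₁ c₂ c₃ M 1 0 = 0 := by
  have h : PhiMu q c₁ c₂ c₃ M 1 0 = PhiPos q c₁ c₂ c₃ M 0 + 0 := rfl
  rw [h]; simp [PhiPos]

theorem commutator_mid (hs : s ^ 2 = q) (h₁ : d₁ ^ 2 = c₁) (h₂ : d₂ ^ 2 = c₂)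
    (h₃ : d₃ ^ 2 = c₃) (h : GenericRacah q c₁ c₂ c₃ K) (hi : 0 ≤ i) (hiM : i ≤ M) (hb : 0 ≤ b)
    (hbM : b ≤ M) (hM : M ≤ K) :
    ∑ ε : SignType, PhiMu q c₃ c₂ c₁ M ε b *
        (mu q (c₁ * c₂) b - q * mu q (c₁ * c₂) (b - ε)) * racah s d₁ d₂ d₃ M i (b - ε) =
      ∑ δ : SignType, (mu q (c₂ * c₃) i * PhiMu q c₁ c₂ c₃ M δ (i + δ) -
        q * (PhiMu q c₁ c₂ c₃ M δ (i + δ) * mu q (c₂ * c₃) (i + δ))) *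
          racah s d₁ d₂ d₃ M (i + δ) b := by
  refine q_commutator q _ _ (racah s d₁ d₂ d₃ M i b) (fun ε => mu q (c₁ * c₂) (b - ε)) _
    (fun ε => racah s d₁ d₂ d₃ M i (b - ε)) (fun δ => racah s d₁ d₂ d₃ M (i + δ) b)
    (fun δ => mu q (c₂ * c₃) (i + δ)) _ _ (fun δ ε => racah s d₁ d₂ d₃ M (i + δ) (b - ε))
    ?_ (fun δ => ?_) ?_ ?_
  · exact racah_recurrence_mu_dual hs h₁ h₂ h₃ h hb hbM hM i
  · exact racah_recurrence_mu_dual hs h₁ h₂ h₃ h hb hbM hM _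
  · exact mul_mu_mul_racah hs h₁ h₂ h₃ h hi (by omega) hb hM (fun ε => PhiMu q c₃ c₂ c₁ M ε b)
      (by rintro rfl; exact PhiMu_one_zero _ _ _ _ _)
  · rw [mu_mul_racah hs h₁ h₂ h₃ h hi (by omega) hb hM]

theorem racah_up_dual' (hs : s ^ 2 = q) (h₁ : d₁ ^ 2 = c₁) (h₂ : d₂ ^ 2 = c₂)
    (h₃ : d₃ ^ 2 = c₃) (h : GenericRacah q c₁ c₂ c₃ K) (hb : 0 ≤ b) (hbM : b ≤ M)
    (hM : M + 1 ≤ K) (i : ℤ) :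
    ∑ ε : SignType, PhiUp s d₃ d₂ d₁ M ε b * racah s d₁ d₂ d₃ (M + 1) i (b - ε) =
      lamUp q c₃ c₂ c₁ M i * racah s d₁ d₂ d₃ M i b := by
  by_cases hi : 0 ≤ i ∧ i ≤ M + 1
  · exact racah_up_dual hs h₁ h₂ h₃ h hi.1 hi.2 hb hbM hM
  · have h0 : ∀ x, racah s d₁ d₂ d₃ (M + 1) i x = 0 := fun x => racah_eq_zero_of_not (by omega)
    rw [racah_eq_zero_of_not (M := M) (by omega)]
    simp [h0]

/-- T maps level M + 1 to level M, so the tridiagonal action of X is taken at level M after T and at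
level M + 1 before it. -/
theorem commutator_up (hs : s ^ 2 = q) (h₁ : d₁ ^ 2 = c₁) (h₂ : d₂ ^ 2 = c₂)
    (h₃ : d₃ ^ 2 = c₃) (h : GenericRacah q c₁ c₂ c₃ K) (hi : 0 ≤ i) (hiM : i ≤ M + 1) (hb : 0 ≤ b)
    (hbM : b ≤ M) (hM : M + 1 ≤ K) :
    ∑ ε : SignType, PhiUp s d₃ d₂ d₁ M ε b *
        (mu q (c₁ * c₂) b - q * mu q (c₁ * c₂) (b - ε)) * racah s d₁ d₂ d₃ (M + 1) i (b - ε) =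
      ∑ δ : SignType, (lamUp q c₃ c₂ c₁ M i * PhiMu q c₁ c₂ c₃ M δ (i + δ) -
        q * (PhiMu q c₁ c₂ c₃ (M + 1) δ (i + δ) * lamUp q c₃ c₂ c₁ M (i + δ))) *
          racah s d₁ d₂ d₃ M (i + δ) b := by
  refine q_commutator q _ _ (racah s d₁ d₂ d₃ M i b) (fun ε => mu q (c₁ * c₂) (b - ε)) _
    (fun ε => racah s d₁ d₂ d₃ (M + 1) i (b - ε)) (fun δ => racah s d₁ d₂ d₃ M (i + δ) b)
    (fun δ => lamUp q c₃ c₂ c₁ M (i + δ)) _ _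
    (fun δ ε => racah s d₁ d₂ d₃ (M + 1) (i + δ) (b - ε)) ?_ (fun δ => ?_) ?_ ?_
  · exact racah_up_dual' hs h₁ h₂ h₃ h hb hbM hM i
  · exact racah_up_dual' hs h₁ h₂ h₃ h hb hbM hM _
  · refine mul_mu_mul_racah hs h₁ h₂ h₃ h hi (by omega) hb hM (fun ε => PhiUp s d₃ d₂ d₁ M ε b) ?_
    rintro rfl
    change PhiUpPos s d₃ d₂ d₁ M 0 = 0
    simp [PhiUpPos]
  · rw [mu_mul_racah hs h₁ h₂ h₃ h hi hiM hb (by omega)]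

theorem racah_down_dual' (hs : s ^ 2 = q) (h₁ : d₁ ^ 2 = c₁) (h₂ : d₂ ^ 2 = c₂)
    (h₃ : d₃ ^ 2 = c₃) (h : GenericRacah q c₁ c₂ c₃ K) (hb : 0 ≤ b) (hbM : b ≤ M + 1)
    (hM : M + 1 ≤ K) (i : ℤ) :
    ∑ ε : SignType, PhiDown s d₂ d₁ (M + 1) ε b * racah s d₁ d₂ d₃ M i (b - ε) =
      lamDown q c₃ c₂ M i * racah s d₁ d₂ d₃ (M + 1) i b := by
  by_cases hi : 0 ≤ i ∧ i ≤ M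
  · exact racah_down_dual hs h₁ h₂ h₃ h hi.1 hi.2 hb hbM hM
  · have h0 : ∀ x, racah s d₁ d₂ d₃ M i x = 0 := fun x => racah_eq_zero_of_not (by omega)
    -- At degree M + 1 the right-hand polynomial need not be zero, but its eigenvalue `lamDown` is.
    by_cases hi' : i = M + 1
    · subst hi'
      simp [h0, lamDown_self _ _ _ h.q_ne]
    · rw [racah_eq_zero_of_not (M := M + 1) (by omega)]
      simp [h0]

theorem commutator_down (hs : s ^ 2 = q) (h₁ : d₁ ^ 2 = c₁) (h₂ : d₂ ^ 2 = c₂)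
    (h₃ : d₃ ^ 2 = c₃) (h : GenericRacah q c₁ c₂ c₃ K) (hi : 0 ≤ i) (hiM : i ≤ M) (hb : 0 ≤ b)
    (hbM : b ≤ M + 1) (hM : M + 1 ≤ K) :
    ∑ ε : SignType, PhiDown s d₂ d₁ (M + 1) ε b *
        (mu q (c₁ * c₂) b - q * mu q (c₁ * c₂) (b - ε)) * racah s d₁ d₂ d₃ M i (b - ε) =
      ∑ δ : SignType, (lamDown q c₃ c₂ M i * PhiMu q c₁ c₂ c₃ (M + 1) δ (i + δ) -
        q * (PhiMu q c₁ c₂ c₃ M δ (i + δ) * lamDown q c₃ c₂ M (i + δ))) *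
          racah s d₁ d₂ d₃ (M + 1) (i + δ) b := by
  refine q_commutator q _ _ (racah s d₁ d₂ d₃ (M + 1) i b) (fun ε => mu q (c₁ * c₂) (b - ε)) _
    (fun ε => racah s d₁ d₂ d₃ M i (b - ε)) (fun δ => racah s d₁ d₂ d₃ (M + 1) (i + δ) b)
    (fun δ => lamDown q c₃ c₂ M (i + δ)) _ _
    (fun δ ε => racah s d₁ d₂ d₃ M (i + δ) (b - ε)) ?_ (fun δ => ?_) ?_ ?_
  · exact racah_down_dual' hs h₁ h₂ h₃ h hb hbM hM i
  · exact racah_down_dual' hs h₁ h₂ h₃ h hb hbM hM _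
  · refine mul_mu_mul_racah hs h₁ h₂ h₃ h hi (by omega) hb (by omega)
      (fun ε => PhiDown s d₂ d₁ (M + 1) ε b) ?_
    rintro rfl
    change PhiDownPos s d₂ d₁ (M + 1) 0 = 0
    simp [PhiDownPos]
  · rw [mu_mul_racah hs h₁ h₂ h₃ h hi (by omega) hb hM]

end Commutators

/-! ### Matching the shifts in the variable b: the rows ε' = 1. -/

section LeftCoefficients

variable {s d₀ d₁ d₂ d₃ d₄ q c₀ c₁ c₂ c₃ c₄ : ℂ} {K N b j : ℤ}

theorem Roots.e_mul (H : Roots s d₀ d₁ d₂ d₃ d₄ q c₀ c₁ c₂ c₃ c₄ N) :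
    d₁ * d₂ * d₃ / d₄ * (s * d₀) = (c₄ * (q * q ^ N))⁻¹ := by
  obtain ⟨hq, -, -, -, -, -, h4⟩ := H.ne
  have hn := zpow_ne_zero N hq
  rw [← H.h₄]
  have := H.prod
  field_simp
  linear_combination this

theorem Roots.c₀_eq (H : Roots s d₀ d₁ d₂ d₃ d₄ q c₀ c₁ c₂ c₃ c₄ N) :
    c₀ = (q ^ 3 * (q ^ N) ^ 2 * c₁ * c₂ * c₃ * c₄)⁻¹ := by
  apply eq_inv_of_mul_eq_one_left
  rw [← H.prod_sq]; ring

theorem Roots.c_ne (H : Roots s d₀ d₁ d₂ d₃ d₄ q c₀ c₁ c₂ c₃ c₄ N) :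
    c₀ ≠ 0 ∧ c₁ ≠ 0 ∧ c₂ ≠ 0 ∧ c₃ ≠ 0 ∧ c₄ ≠ 0 := by
  have := H.prod_sq
  have h1 : q ^ 3 * (q ^ N) ^ 2 * c₀ * c₁ * c₂ * c₃ * c₄ ≠ 0 := by rw [this]; exact one_ne_zero
  simp only [mul_ne_zero_iff] at h1
  tauto

/-- The genericity assumptions on the parameters of the bivariate polynomials. -/
structure GenericGriffiths (q c₀ c₁ c₂ c₃ c₄ : ℂ) (N : ℤ) : Prop where
  h123 : GenericRacah q c₁ c₂ c₃ N
  h304 : GenericRacah q c₃ c₀ c₄ N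
  h421 : GenericRacah q c₄ c₂ c₁ N
  h104 : GenericRacah q c₁ c₀ c₄ N
  h423 : GenericRacah q c₄ c₂ c₃ N
  q_sq : 1 - q ^ 2 ≠ 0

theorem Roots.sq₀ (H : Roots s d₀ d₁ d₂ d₃ d₄ q c₀ c₁ c₂ c₃ c₄ N) :
    (s * d₀) * (s * d₀) = q * c₀ := by rw [← H.hs, ← H.h₀]; ring

theorem Roots.sq₂ (H : Roots s d₀ d₁ d₂ d₃ d₄ q c₀ c₁ c₂ c₃ c₄ N) :
    (s * d₂) * (s * d₂) = q * c₂ := by rw [← H.hs, ← H.h₂]; ring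

/-- The relations and nonvanishing conditions used in the verification of the coefficient
identities. -/
theorem Roots.facts (H : Roots s d₀ d₁ d₂ d₃ d₄ q c₀ c₁ c₂ c₃ c₄ N) (b j : ℤ) :
    (c₀ ≠ 0 ∧ c₁ ≠ 0 ∧ c₂ ≠ 0 ∧ c₃ ≠ 0 ∧ c₄ ≠ 0) ∧ s * d₀ ≠ 0 ∧ s * d₂ ≠ 0 ∧
      (s * d₀) * (s * d₀) = q * c₀ ∧ (s * d₂) * (s * d₂) = q * c₂ ∧
      d₁ * d₂ * d₃ / d₄ * (s * d₀) = (c₄ * (q * q ^ N))⁻¹ ∧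
      c₀ = (q ^ 3 * (q ^ N) ^ 2 * c₁ * c₂ * c₃ * c₄)⁻¹ ∧ q ^ N ≠ 0 ∧ q ^ b ≠ 0 ∧ q ^ j ≠ 0 := by
  obtain ⟨hq, hs0, hd0, -, hd2, -⟩ := H.ne
  exact ⟨H.c_ne, mul_ne_zero hs0 hd0, mul_ne_zero hs0 hd2, H.sq₀, H.sq₂, H.e_mul, H.c₀_eq,
    zpow_ne_zero _ hq, zpow_ne_zero _ hq, zpow_ne_zero _ hq⟩

/-- The factor q in the q-commutator is chosen so that one of the two exponentials cancels and a
monomial remains. This monomial absorbs the quotient of neighbouring factors ω. -/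
theorem mu_sub_mu_pred (hq : q ≠ 0) (u : ℂ) (b : ℤ) :
    mu q u b - q * mu q u (b - 1) = (1 - q ^ 2) * (q ^ b)⁻¹ := by
  have := zpow_ne_zero b hq
  rw [mu, mu, zpow_sub_one₀ hq]
  field_simp
  ring

theorem mu_sub_mu_succ (hq : q ≠ 0) (u : ℂ) (b : ℤ) :
    mu q u b - q * mu q u (b + 1) = (1 - q ^ 2) * (u * q * q ^ b) := by
  have := zpow_ne_zero b hq
  rw [mu, mu, zpow_add_one₀ hq]
  field_simp
  ring

/-- The constant in front of the commutator for `ε' = 1`. -/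
noncomputable def CUp (r q c₀ c₁ c₄ : ℂ) (N j : ℤ) : ℂ :=
  c₁ * c₄ * (q * q ^ N) ^ 2 * r * (c₄ * c₀ ^ 2 * (q * q ^ j) * wPos q c₀ c₄ (q ^ j)) / (1 - q ^ 2)

/-- The constant in front of the contiguity relation for `ε' = 1`. -/
noncomputable def delUp (q c₀ c₁ c₂ c₃ c₄ : ℂ) (N j : ℤ) : ℂ :=
  -(c₃ * c₄ * (q * q ^ N) ^ 2 * (c₄ * c₀ ^ 2 * (q * q ^ j) * wPos q c₀ c₄ (q ^ j)) *
    (q * c₂ * (1 + c₁) / (1 + q)))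

/-- In the constant `CUp` everything independent of b is collected. The quotient of the ω's brings
in √(c₁c₂c₃/c₄)·√(qc₀) = (c₄q^(N+1))⁻¹, so no square root of c₀ survives. -/
theorem left_up_one (H : Roots s d₀ d₁ d₂ d₃ d₄ q c₀ c₁ c₂ c₃ c₄ N)
    (G : GenericGriffiths q c₀ c₁ c₂ c₃ c₄ N) (hN : 0 ≤ N) :
    omegaFn s (d₁ * d₂ * d₃ / d₄) (b - 1) * coeffA s d₂ d₃ d₀ d₄ d₁ N 1 1 j b =
      omegaFn s (d₁ * d₂ * d₃ / d₄) b * (CUp (s * d₂) q c₀ c₁ c₄ N j *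
        (PhiUp s d₃ d₂ d₁ (N - j) 1 b * (mu q (c₁ * c₂) b - q * mu q (c₁ * c₂) (b - 1)))) := by
  obtain ⟨hq, hs0, hd0, hd1, hd2, hd3, hd4⟩ := H.ne
  have hq2 := G.q_sq
  have hω := omegaFn_succ hs0 (e := d₁ * d₂ * d₃ / d₄) (by positivity) (b - 1)
  rw [sub_add_cancel, H.hs] at hω
  rw [hω, coeffA_up_eq H G.h421 hN, mu_sub_mu_pred hq, CUp, ← mul_right_inj' (mul_ne_zero hs0 hd0)]
  have U1 := PhiUp_one_eq H.hs H.h₃ H.h₀ H.h₄ hq (N - b) j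
  have U2 := PhiUp_one_eq H.hs H.h₃ H.h₂ H.h₁ hq (N - j) b
  obtain ⟨⟨hc₀, hc₁, hc₂, hc₃, hc₄⟩, hr0, hr, hs₀, hrr, he, hp, hn, hI, hJ⟩ := H.facts b j
  rw [zpow_sub₀ hq] at U1 U2
  generalize omegaFn s (d₁ * d₂ * d₃ / d₄) (b - 1) = w
  generalize PhiUp s d₃ d₀ d₄ (N - b) 1 j = u1 at *
  generalize PhiUp s d₃ d₂ d₁ (N - j) 1 b = u2 at *
  generalize d₁ * d₂ * d₃ / d₄ = e, s * d₀ = r0, s * d₂ = r at *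
  generalize wPos q c₀ c₄ (q ^ j) = A at *
  generalize wPos q c₂ c₁ (q ^ b) = P at *
  generalize q ^ N = n, q ^ b = y, q ^ j = J at *
  generalize hv : 1 - q ^ 2 = v at *
  calc _ = w * (-c₄ * (q * n) * (c₁ * c₂ ^ 2 * (q * y) * P)) * (r0 * u1) := by ring
    _ = -(e * r0) * y * w * (c₁ * c₄ * (q * n) ^ 2 * (c₄ * c₀ ^ 2 * (q * J) * A) / v * (v * y⁻¹)) *
        (r * u2) := by
      rw [U1, U2, he]
      field_simp
    _ = _ := by ring

theorem left_up_neg_one (H : Roots s d₀ d₁ d₂ d₃ d₄ q c₀ c₁ c₂ c₃ c₄ N)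
    (G : GenericGriffiths q c₀ c₁ c₂ c₃ c₄ N) (hj : 0 ≤ j) (hjN : j ≤ N)
    (hb : 0 ≤ b) (hbN : b ≤ N) :
    omegaFn s (d₁ * d₂ * d₃ / d₄) (b + 1) * coeffA s d₂ d₃ d₀ d₄ d₁ N 1 (-1) j b =
      omegaFn s (d₁ * d₂ * d₃ / d₄) b * (CUp (s * d₂) q c₀ c₁ c₄ N j *
        (PhiUp s d₃ d₂ d₁ (N - j) (-1) b *
          (mu q (c₁ * c₂) b - q * mu q (c₁ * c₂) (b + 1)))) := by
  obtain ⟨hq, hs0, hd0, hd1, hd2, hd3, hd4⟩ := H.ne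
  have hq2 := G.q_sq
  have hω := omegaFn_succ hs0 (e := d₁ * d₂ * d₃ / d₄) (by positivity) b
  rw [H.hs, zpow_add_one₀ hq] at hω
  rw [hω, coeffA_down_eq H G.h421 _ _ hb (by omega), mu_sub_mu_succ hq, CUp,
    PhiDown_one_eq H.hs H.h₀ H.h₄ G.h304 hj (by omega)]
  have U2 := PhiUp_neg_one_eq H.hs H.h₃ H.h₂ H.h₁ G.h123.symm hb (by omega) (N - j)
  obtain ⟨⟨hc₀, hc₁, hc₂, hc₃, hc₄⟩, hr0, hr, hs₀, hrr, he, hp, hn, hI, hJ⟩ := H.facts b j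
  rw [zpow_sub₀ hq] at U2 ⊢
  generalize omegaFn s (d₁ * d₂ * d₃ / d₄) b = w
  generalize PhiUp s d₃ d₂ d₁ (N - j) (-1) b = u2 at *
  generalize d₁ * d₂ * d₃ / d₄ = e, s * d₀ = r0, s * d₂ = r at *
  generalize wPos q c₀ c₄ (q ^ j) = A at *
  generalize wNeg q c₂ c₁ (q ^ b) = Q at *
  generalize q ^ N = n, q ^ b = y, q ^ j = J at *
  generalize hv : 1 - q ^ 2 = v at *
  calc _ = w * (-c₄ * (q * n) * (c₁ * c₂ * (q * y) * Q)) * (-(y * q) * (e * r0)) *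
        (-(1 - c₀ * c₄ * (n / y) * J) * (1 - c₀ * c₄ * q * (n / y) * J) / (n / y) * A) := by ring
    _ = w * (c₁ * c₄ * (q * n) ^ 2 * (c₄ * c₀ ^ 2 * (q * J) * A) / v * (v * (c₁ * c₂ * q * y))) *
        (r * u2) := by
      rw [U2, he, hp]
      field_simp
      ring
    _ = _ := by ring

/-- The unshifted coefficient is not purely a commutator coefficient: the part 1 + c₁ of
(1+q)(F⁺+F⁻)/(qc₂) leaves a multiple of the contiguity eigenvalue, which the known contiguity
relation handles. -/
theorem left_up_zero (H : Roots s d₀ d₁ d₂ d₃ d₄ q c₀ c₁ c₂ c₃ c₄ N)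
    (G : GenericGriffiths q c₀ c₁ c₂ c₃ c₄ N) (hj : 0 ≤ j) (hjN : j ≤ N)
    (hb : 0 ≤ b) (hbN : b ≤ N) :
    coeffA s d₂ d₃ d₀ d₄ d₁ N 1 0 j b = CUp (s * d₂) q c₀ c₁ c₄ N j *
        (PhiUp s d₃ d₂ d₁ (N - j) 0 b * (mu q (c₁ * c₂) b - q * mu q (c₁ * c₂) b)) +
      delUp q c₀ c₁ c₂ c₃ c₄ N j * lamUp q c₁ c₂ c₃ (N - j) b := by
  obtain ⟨hq, hs0, hd0, hd1, hd2, hd3, hd4⟩ := H.ne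
  have hq2 := G.q_sq
  obtain ⟨g0, g1, g2⟩ := G.h304.gen₂₃.factors hq hj (by omega)
  have hq1 : 1 + q ≠ 0 := fun h => hq2 (by linear_combination (1 - q) * h)
  have hq1' : 1 - q ≠ 0 := fun h => hq2 (by linear_combination (1 + q) * h)
  have f : Phi q c₃ c₀ c₄ (N - b) 1 j = PhiPos q c₃ c₀ c₄ (N - b) j := rfl
  rw [coeffA_mid_eq H G.h421 hq1 (by decide) _ hb (by omega), CUp, delUp, lamUp, f, PhiPos_eq hq _
    _ g1,
    show (1 - q ^ 2) = (1 - q) * (1 + q) by ring]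
  have U2 := PhiUp_zero_eq H.hs H.h₃ H.h₂ H.h₁ G.h123.symm hb (by omega) (N - j)
  obtain ⟨⟨hc₀, hc₁, hc₂, hc₃, hc₄⟩, hr0, hr, hs₀, hrr, he, hp, hn, hI, hJ⟩ := H.facts b j
  rw [zpow_sub₀ hq] at U2 ⊢
  rw [zpow_sub₀ hq]
  generalize PhiUp s d₃ d₂ d₁ (N - j) 0 b = u2 at *
  generalize s * d₂ = r at *
  generalize wPos q c₀ c₄ (q ^ j) = A at *
  generalize wZero q c₂ c₁ (q ^ b) = Q at *
  generalize mu q (c₁ * c₂) b = μ at *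
  generalize q ^ N = n, q ^ b = y, q ^ j = J at *
  generalize hv : 1 + q = v at *
  generalize hv' : 1 - q = v' at *
  calc _ = c₁ * c₄ * (q * n) ^ 2 * (c₄ * c₀ ^ 2 * (q * J) * A) / (v' * v) * (r * u2) * (v' * μ) +
      -(c₃ * c₄ * (q * n) ^ 2 * (c₄ * c₀ ^ 2 * (q * J) * A) * (q * c₂ * (1 + c₁) / v)) *
      (-((1 - c₃ * q * (n / J) / y) * (1 - c₁ * c₂ * c₃ * q ^ 2 * (n / J) * y)) /
        (c₃ * (q * (n / J)))) := by
        rw [U2, hp]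
        field_simp
        ring
    _ = _ := by
      rw [← hv']; ring

end LeftCoefficients

/-! ### Matching the shifts in the variable b: the rows ε' = 0 and ε' = −1. -/

section LeftCoefficientsRest

variable {s d₀ d₁ d₂ d₃ d₄ q c₀ c₁ c₂ c₃ c₄ : ℂ} {K N b j : ℤ}

/-- The constant in front of the commutator for `ε' = 0`. -/
noncomputable def CMid (q c₀ c₁ c₂ c₃ c₄ : ℂ) (N j : ℤ) : ℂ :=
  wZero q c₀ c₄ (q ^ j) / (q * q ^ N * (c₁ * c₂ * c₃) * (1 - q ^ 2))

/-- The constant in front of the commutator for `ε' = -1`. -/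
noncomputable def CDown (r q c₀ c₁ c₄ : ℂ) (j : ℤ) : ℂ :=
  c₄ * q ^ j * q * wNeg q c₀ c₄ (q ^ j) / (c₁ * r * (1 - q ^ 2))

/-- The constant in front of the contiguity relation for `ε' = -1`. -/
noncomputable def delDown (q c₀ c₁ c₂ c₃ c₄ : ℂ) (N j : ℤ) : ℂ :=
  -(c₃ * c₄ * (q * q ^ N) ^ 2 * (c₄ * c₀ * (q * q ^ j) * wNeg q c₀ c₄ (q ^ j)) *
    (q * c₂ * (1 + c₁) / (1 + q)))

theorem left_mid_one (H : Roots s d₀ d₁ d₂ d₃ d₄ q c₀ c₁ c₂ c₃ c₄ N)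
    (G : GenericGriffiths q c₀ c₁ c₂ c₃ c₄ N) (hj : 0 ≤ j) (hjN : j ≤ N)
    (hb : 0 ≤ b) (hbN : b ≤ N) :
    omegaFn s (d₁ * d₂ * d₃ / d₄) (b - 1) * coeffA s d₂ d₃ d₀ d₄ d₁ N 0 1 j b =
      omegaFn s (d₁ * d₂ * d₃ / d₄) b * (CMid q c₀ c₁ c₂ c₃ c₄ N j *
        (PhiMu q c₃ c₂ c₁ (N - j) 1 b *
          (mu q (c₁ * c₂) b - q * mu q (c₁ * c₂) (b - 1)))) := by
  obtain ⟨hq, hs0, hd0, hd1, hd2, hd3, hd4⟩ := H.ne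
  have hq2 := G.q_sq
  obtain ⟨g0, g1, g2⟩ := G.h123.symm.gen₂₃.factors hq hb (by omega)
  have f : PhiMu q c₃ c₂ c₁ (N - j) 1 b = PhiPos q c₃ c₂ c₁ (N - j) b + 0 := rfl
  have hω := omegaFn_succ hs0 (e := d₁ * d₂ * d₃ / d₄) (by positivity) (b - 1)
  rw [sub_add_cancel, H.hs] at hω
  rw [hω, coeffA_up_eq H G.h421 (by omega), mu_sub_mu_pred hq, CMid, f, PhiPos_eq hq _ _ g1,
    add_zero,
    ← mul_right_inj' (mul_ne_zero hs0 hd0)]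
  have U1 := PhiUp_zero_eq H.hs H.h₃ H.h₀ H.h₄ G.h304 hj (by omega) (N - b)
  obtain ⟨⟨hc₀, hc₁, hc₂, hc₃, hc₄⟩, hr0, hr, hs₀, hrr, he, hp, hn, hI, hJ⟩ := H.facts b j
  rw [zpow_sub₀ hq] at U1 ⊢
  generalize omegaFn s (d₁ * d₂ * d₃ / d₄) (b - 1) = w
  generalize PhiUp s d₃ d₀ d₄ (N - b) 0 j = u1 at *
  generalize d₁ * d₂ * d₃ / d₄ = e, s * d₀ = r0, s * d₂ = r at *
  generalize wPos q c₂ c₁ (q ^ b) = P at *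
  generalize wZero q c₀ c₄ (q ^ j) = Z at *
  generalize q ^ N = n, q ^ b = y, q ^ j = J at *
  generalize hv : 1 - q ^ 2 = v at *
  calc _ = w * (-c₄ * (q * n) * (c₁ * c₂ ^ 2 * (q * y) * P)) * (r0 * u1) := by ring
    _ = -(e * r0) * y * w * (Z / (q * n * (c₁ * c₂ * c₃) * v) * ((-c₂ * (y / (n / J)) *
        (1 - c₃ * q * (n / J) / y) * (1 - c₂ * c₁ * q * (n / J) * y) * P) * (v * y⁻¹))) := by
        rw [U1, he, hp]
        field_simp
        ring
    _ = _ := by ring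

theorem left_mid_neg_one (H : Roots s d₀ d₁ d₂ d₃ d₄ q c₀ c₁ c₂ c₃ c₄ N)
    (G : GenericGriffiths q c₀ c₁ c₂ c₃ c₄ N) (hj : 0 ≤ j) (hjN : j ≤ N)
    (hb : 0 ≤ b) (hbN : b ≤ N) :
    omegaFn s (d₁ * d₂ * d₃ / d₄) (b + 1) * coeffA s d₂ d₃ d₀ d₄ d₁ N 0 (-1) j b =
      omegaFn s (d₁ * d₂ * d₃ / d₄) b * (CMid q c₀ c₁ c₂ c₃ c₄ N j *
        (PhiMu q c₃ c₂ c₁ (N - j) (-1) b *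
          (mu q (c₁ * c₂) b - q * mu q (c₁ * c₂) (b + 1)))) := by
  obtain ⟨hq, hs0, hd0, hd1, hd2, hd3, hd4⟩ := H.ne
  have hq2 := G.q_sq
  obtain ⟨g0, g1, g2⟩ := G.h123.symm.gen₂₃.factors hq hb (by omega)
  have f : PhiMu q c₃ c₂ c₁ (N - j) (-1) b = PhiNeg q c₃ c₂ c₁ (N - j) b + 0 := rfl
  have hω := omegaFn_succ hs0 (e := d₁ * d₂ * d₃ / d₄) (by positivity) b
  rw [H.hs, zpow_add_one₀ hq] at hω
  rw [hω, coeffA_down_eq H G.h421 _ _ hb (by omega), mu_sub_mu_succ hq, CMid, f, PhiNeg_eq hq _ _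
    g1,
    add_zero, PhiDown_zero_eq H.hs H.h₀ H.h₄ G.h304 hj (by omega)]
  obtain ⟨⟨hc₀, hc₁, hc₂, hc₃, hc₄⟩, hr0, hr, hs₀, hrr, he, hp, hn, hI, hJ⟩ := H.facts b j
  rw [zpow_sub₀ hq, zpow_sub₀ hq]
  generalize omegaFn s (d₁ * d₂ * d₃ / d₄) b = w
  generalize d₁ * d₂ * d₃ / d₄ = e, s * d₀ = r0, s * d₂ = r at *
  generalize wNeg q c₂ c₁ (q ^ b) = P at *
  generalize wZero q c₀ c₄ (q ^ j) = Z at *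
  generalize q ^ N = n, q ^ b = y, q ^ j = J at *
  generalize hv : 1 - q ^ 2 = v at *
  calc _ = w * (-(y * q) * (e * r0)) * (-c₄ * (q * n) * (c₁ * c₂ * (q * y) * P)) *
        (Z * (1 - (n / y) / J) * (1 - c₀ * c₄ * q * (n / y) * J) / (n / y)) := by ring
    _ = _ := by
        rw [he, hp]
        field_simp
        ring

/-- For ε' = 0 the remainder beside the commutator is the constant `delZero`, independent of b, so
the identity operator takes the place of a contiguity relation. -/
theorem left_mid_zero (H : Roots s d₀ d₁ d₂ d₃ d₄ q c₀ c₁ c₂ c₃ c₄ N)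
    (G : GenericGriffiths q c₀ c₁ c₂ c₃ c₄ N) (hj : 0 ≤ j) (hjN : j ≤ N)
    (hb : 0 ≤ b) (hbN : b ≤ N) :
    coeffA s d₂ d₃ d₀ d₄ d₁ N 0 0 j b = CMid q c₀ c₁ c₂ c₃ c₄ N j *
        (PhiMu q c₃ c₂ c₁ (N - j) 0 b * (mu q (c₁ * c₂) b - q * mu q (c₁ * c₂) b)) +
      delZero q c₀ c₁ c₂ c₃ c₄ N j := by
  obtain ⟨hq, hs0, hd0, hd1, hd2, hd3, hd4⟩ := H.ne
  have hq2 := G.q_sq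
  have hq1 : 1 + q ≠ 0 := fun h => hq2 (by linear_combination (1 - q) * h)
  have hq1' : 1 - q ≠ 0 := fun h => hq2 (by linear_combination (1 + q) * h)
  have f : PhiMu q c₃ c₂ c₁ (N - j) 0 b = Phi q c₃ c₂ c₁ (N - j) 0 b + (1 + c₃ * c₂ * q) := rfl
  rw [coeffA_zero_eq H G.h421 G.h123.symm G.h304 hq1 hj hjN hb hbN, f, CMid,
    show (1 - q ^ 2) = (1 - q) * (1 + q) by ring]
  obtain ⟨⟨hc₀, hc₁, hc₂, hc₃, hc₄⟩, hr0, hr, hs₀, hrr, he, hp, hn, hI, hJ⟩ := H.facts b j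
  generalize mu q (c₁ * c₂) b = μ
  generalize Phi q c₃ c₂ c₁ (N - j) 0 b = F
  generalize wZero q c₀ c₄ (q ^ j) = Z
  generalize q ^ N = n at *
  generalize 1 + q = v at *
  congr 1
  rw [show μ - q * μ = (1 - q) * μ by ring]
  generalize 1 - q = v' at *
  field_simp
  ring

theorem left_down_one (H : Roots s d₀ d₁ d₂ d₃ d₄ q c₀ c₁ c₂ c₃ c₄ N)
    (G : GenericGriffiths q c₀ c₁ c₂ c₃ c₄ N) (hj : 0 ≤ j) (hjN : j ≤ N)
    (hb : 0 ≤ b) (hbN : b ≤ N) :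
    omegaFn s (d₁ * d₂ * d₃ / d₄) (b - 1) * coeffA s d₂ d₃ d₀ d₄ d₁ N (-1) 1 j b =
      omegaFn s (d₁ * d₂ * d₃ / d₄) b * (CDown (s * d₂) q c₀ c₁ c₄ j *
        (PhiDown s d₂ d₁ (N - j) 1 b *
          (mu q (c₁ * c₂) b - q * mu q (c₁ * c₂) (b - 1)))) := by
  obtain ⟨hq, hs0, hd0, hd1, hd2, hd3, hd4⟩ := H.ne
  have hq2 := G.q_sq
  have hω := omegaFn_succ hs0 (e := d₁ * d₂ * d₃ / d₄) (by positivity) (b - 1)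
  rw [sub_add_cancel, H.hs] at hω
  rw [hω, coeffA_up_eq H G.h421 (by omega), mu_sub_mu_pred hq, CDown,
    PhiDown_one_eq H.hs H.h₂ H.h₁ G.h123.symm hb (by omega), ← mul_right_inj' (mul_ne_zero hs0 hd0)]
  have U1 := PhiUp_neg_one_eq H.hs H.h₃ H.h₀ H.h₄ G.h304 hj (by omega) (N - b)
  obtain ⟨⟨hc₀, hc₁, hc₂, hc₃, hc₄⟩, hr0, hr, hs₀, hrr, he, hp, hn, hI, hJ⟩ := H.facts b j
  rw [zpow_sub₀ hq] at U1 ⊢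
  generalize omegaFn s (d₁ * d₂ * d₃ / d₄) (b - 1) = w
  generalize PhiUp s d₃ d₀ d₄ (N - b) (-1) j = u1 at *
  generalize d₁ * d₂ * d₃ / d₄ = e, s * d₀ = r0, s * d₂ = r at *
  generalize wPos q c₂ c₁ (q ^ b) = P at *
  generalize wNeg q c₀ c₄ (q ^ j) = Z at *
  generalize q ^ N = n, q ^ b = y, q ^ j = J at *
  generalize hv : 1 - q ^ 2 = v at *
  calc _ = w * (-c₄ * (q * n) * (c₁ * c₂ ^ 2 * (q * y) * P)) * (r0 * u1) := by ring
    _ = -(e * r0) * y * w * (c₄ * J * q * Z / (c₁ * r * v) * (r * (-(1 - c₂ * c₁ * (n / J) * y) *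
        (1 - c₂ * c₁ * q * (n / J) * y) / (n / J) * P) * (v * y⁻¹))) := by
        rw [U1, he, hp]
        field_simp
        ring
    _ = _ := by ring

theorem left_down_neg_one (H : Roots s d₀ d₁ d₂ d₃ d₄ q c₀ c₁ c₂ c₃ c₄ N)
    (G : GenericGriffiths q c₀ c₁ c₂ c₃ c₄ N) (hj : 0 ≤ j) (hjN : j ≤ N)
    (hb : 0 ≤ b) (hbN : b ≤ N) :
    omegaFn s (d₁ * d₂ * d₃ / d₄) (b + 1) * coeffA s d₂ d₃ d₀ d₄ d₁ N (-1) (-1) j b =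
      omegaFn s (d₁ * d₂ * d₃ / d₄) b * (CDown (s * d₂) q c₀ c₁ c₄ j *
        (PhiDown s d₂ d₁ (N - j) (-1) b *
          (mu q (c₁ * c₂) b - q * mu q (c₁ * c₂) (b + 1)))) := by
  obtain ⟨hq, hs0, hd0, hd1, hd2, hd3, hd4⟩ := H.ne
  have hq2 := G.q_sq
  have hω := omegaFn_succ hs0 (e := d₁ * d₂ * d₃ / d₄) (by positivity) b
  rw [H.hs, zpow_add_one₀ hq] at hω
  rw [hω, coeffA_down_eq H G.h421 _ _ hb (by omega), mu_sub_mu_succ hq, CDown,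
    PhiDown_neg_one_eq H.hs H.h₂ H.h₁ G.h123.symm hb (by omega),
    PhiDown_neg_one_eq H.hs H.h₀ H.h₄ G.h304 hj (by omega)]
  obtain ⟨⟨hc₀, hc₁, hc₂, hc₃, hc₄⟩, hr0, hr, hs₀, hrr, he, hp, hn, hI, hJ⟩ := H.facts b j
  rw [zpow_sub₀ hq, zpow_sub₀ hq]
  generalize omegaFn s (d₁ * d₂ * d₃ / d₄) b = w
  generalize d₁ * d₂ * d₃ / d₄ = e, s * d₀ = r0, s * d₂ = r at *
  generalize wNeg q c₂ c₁ (q ^ b) = P at *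
  generalize wNeg q c₀ c₄ (q ^ j) = Z at *
  generalize q ^ N = n, q ^ b = y, q ^ j = J at *
  generalize hv : 1 - q ^ 2 = v at *
  calc _ = w * (-(y * q) * (e * r0)) * (-c₄ * (q * n) * (c₁ * c₂ * (q * y) * P)) *
        (-c₄ * (n / y) * (1 - J / (n / y)) * (1 - q * J / (n / y)) * Z) := by ring
    _ = _ := by
        rw [he]
        field_simp

theorem left_down_zero (H : Roots s d₀ d₁ d₂ d₃ d₄ q c₀ c₁ c₂ c₃ c₄ N)
    (G : GenericGriffiths q c₀ c₁ c₂ c₃ c₄ N) (hj : 0 ≤ j) (hjN : j ≤ N)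
    (hb : 0 ≤ b) (hbN : b ≤ N) :
    coeffA s d₂ d₃ d₀ d₄ d₁ N (-1) 0 j b = CDown (s * d₂) q c₀ c₁ c₄ j *
        (PhiDown s d₂ d₁ (N - j) 0 b * (mu q (c₁ * c₂) b - q * mu q (c₁ * c₂) b)) +
      delDown q c₀ c₁ c₂ c₃ c₄ N j * lamDown q c₁ c₂ (N - j - 1) b := by
  obtain ⟨hq, hs0, hd0, hd1, hd2, hd3, hd4⟩ := H.ne
  have hq2 := G.q_sq
  obtain ⟨g0, g1, g2⟩ := G.h304.gen₂₃.factors hq hj (by omega)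
  have hq1 : 1 + q ≠ 0 := fun h => hq2 (by linear_combination (1 - q) * h)
  have hq1' : 1 - q ≠ 0 := fun h => hq2 (by linear_combination (1 + q) * h)
  have f : Phi q c₃ c₀ c₄ (N - b) (-1) j = PhiNeg q c₃ c₀ c₄ (N - b) j := rfl
  rw [coeffA_mid_eq H G.h421 hq1 (by decide) _ hb (by omega), CDown, delDown, lamDown, f,
    PhiNeg_eq hq _ _ g1, PhiDown_zero_eq H.hs H.h₂ H.h₁ G.h123.symm hb (by omega),
    show (1 - q ^ 2) = (1 - q) * (1 + q) by ring]
  obtain ⟨⟨hc₀, hc₁, hc₂, hc₃, hc₄⟩, hr0, hr, hs₀, hrr, he, hp, hn, hI, hJ⟩ := H.facts b j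
  rw [zpow_sub_one₀ hq, zpow_sub₀ hq, zpow_sub₀ hq]
  generalize mu q (c₁ * c₂) b = μ
  rw [show μ - q * μ = (1 - q) * μ by ring]
  generalize s * d₂ = r at *
  generalize wNeg q c₀ c₄ (q ^ j) = B at *
  generalize wZero q c₂ c₁ (q ^ b) = Q at *
  generalize q ^ N = n, q ^ b = y, q ^ j = J at *
  rw [hp]
  generalize hv : 1 + q = v at *
  generalize hv' : 1 - q = v' at *
  field_simp
  ring

end LeftCoefficientsRest

/-! ### Quotients of the factors ω, simplified by the product of the roots. -/

section RightRatios

variable {s d₀ d₁ d₂ d₃ d₄ q c₀ c₁ c₂ c₃ c₄ : ℂ} {K N i j : ℤ}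

theorem Roots.f₀_eq (H : Roots s d₀ d₁ d₂ d₃ d₄ q c₀ c₁ c₂ c₃ c₄ N) :
    d₀ * d₃ * d₄ / d₁ = (q * q ^ N * c₁ * (s * d₂))⁻¹ := by
  apply eq_inv_of_mul_eq_one_left
  obtain ⟨-, -, -, h1, -, -, -⟩ := H.ne
  rw [← H.h₁, div_mul_eq_mul_div, div_eq_one_iff_eq h1]
  linear_combination d₁ * H.prod

theorem Roots.f_eq (H : Roots s d₀ d₁ d₂ d₃ d₄ q c₀ c₁ c₂ c₃ c₄ N) :
    d₂ * d₃ * d₄ / d₁ = (q * q ^ N * c₁ * (s * d₀))⁻¹ := by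
  apply eq_inv_of_mul_eq_one_left
  obtain ⟨-, -, -, h1, -, -, -⟩ := H.ne
  rw [← H.h₁, div_mul_eq_mul_div, div_eq_one_iff_eq h1]
  linear_combination d₁ * H.prod

/-- The quotient of the factors `ω` in the second recurrence relation; the arguments are
`x = q ^ i` and `y = q ^ j`. -/
noncomputable def omegaRatio (s d₀ d₁ d₂ d₃ d₄ x y : ℂ) (δ ε' : SignType) : ℂ :=
  omegaFn s (x * (d₂ * d₃ * d₄ / d₁)) δ / omegaFn s (y * (d₀ * d₃ * d₄ / d₁)) ε'

/-- For δ = 1 a factor √(qc₀) is split off on the right, to meet Φ_+, whose product with this root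
is rational. For δ = −1 it stands on the left, to meet the factor √(qc₀) contained in Φ_−. -/
theorem ratio_one_one (H : Roots s d₀ d₁ d₂ d₃ d₄ q c₀ c₁ c₂ c₃ c₄ N) :
    omegaRatio s d₀ d₁ d₂ d₃ d₄ (q ^ i) (q ^ j / q) 1 1 = q ^ i * (s * d₂) / (q ^ j * c₀) * (s *
        d₀) := by
  obtain ⟨hq, hs0, hd0, hd1, hd2, hd3, hd4⟩ := H.ne
  obtain ⟨⟨hc₀, hc₁, hc₂, hc₃, hc₄⟩, hr0, hr, hs₀, hrr, he, hp, hn, hI, hJ⟩ := H.facts i j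
  have e1 : ((1 : SignType) : ℤ) = 1 := rfl
  simp only [omegaRatio, e1, omegaFn_one, H.f₀_eq, H.f_eq, H.hs]
  generalize s * d₀ = r0, s * d₂ = r, q ^ N = n, q ^ i = I, q ^ j = J at *
  field_simp
  linear_combination -hs₀

theorem ratio_zero_one (H : Roots s d₀ d₁ d₂ d₃ d₄ q c₀ c₁ c₂ c₃ c₄ N) :
    omegaRatio s d₀ d₁ d₂ d₃ d₄ (q ^ i) (q ^ j / q) 0 1 = -(q * q ^ N * c₁ * (s * d₂) / q ^ j) := by
  obtain ⟨hq, hs0, hd0, hd1, hd2, hd3, hd4⟩ := H.ne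
  obtain ⟨⟨hc₀, hc₁, hc₂, hc₃, hc₄⟩, hr0, hr, hs₀, hrr, he, hp, hn, hI, hJ⟩ := H.facts i j
  have e2 : ((0 : SignType) : ℤ) = 0 := rfl
  have e1 : ((1 : SignType) : ℤ) = 1 := rfl

  simp only [omegaRatio, e2, e1, omegaFn_zero, omegaFn_one, H.f₀_eq, H.hs]
  generalize s * d₀ = r0, s * d₂ = r, q ^ N = n, q ^ i = I, q ^ j = J at *
  field_simp

theorem ratio_neg_one_one (H : Roots s d₀ d₁ d₂ d₃ d₄ q c₀ c₁ c₂ c₃ c₄ N) :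
    omegaRatio s d₀ d₁ d₂ d₃ d₄ (q ^ i) (q ^ j / q) (-1) 1 * (s * d₀) = (q * q ^ N * c₁) ^ 2 * (q *
        c₀) * (s * d₂) / (q ^ i * q ^ j) := by
  obtain ⟨hq, hs0, hd0, hd1, hd2, hd3, hd4⟩ := H.ne
  obtain ⟨⟨hc₀, hc₁, hc₂, hc₃, hc₄⟩, hr0, hr, hs₀, hrr, he, hp, hn, hI, hJ⟩ := H.facts i j
  have e3 : ((-1 : SignType) : ℤ) = -1 := rfl
  have e1 : ((1 : SignType) : ℤ) = 1 := rfl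
  simp only [omegaRatio, e3, e1, omegaFn_neg_one, omegaFn_one, H.f₀_eq, H.f_eq, H.hs]
  generalize s * d₀ = r0, s * d₂ = r, q ^ N = n, q ^ i = I, q ^ j = J at *
  field_simp
  linear_combination hs₀

theorem ratio_one_zero (H : Roots s d₀ d₁ d₂ d₃ d₄ q c₀ c₁ c₂ c₃ c₄ N) :
    omegaRatio s d₀ d₁ d₂ d₃ d₄ (q ^ i) (q ^ j) 1 0 = -(q ^ i / (q ^ N * c₁ * (q * c₀))) * (s * d₀)
        := by
  obtain ⟨hq, hs0, hd0, hd1, hd2, hd3, hd4⟩ := H.ne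
  obtain ⟨⟨hc₀, hc₁, hc₂, hc₃, hc₄⟩, hr0, hr, hs₀, hrr, he, hp, hn, hI, hJ⟩ := H.facts i j
  have e1 : ((1 : SignType) : ℤ) = 1 := rfl
  have e2 : ((0 : SignType) : ℤ) = 0 := rfl
  simp only [omegaRatio, e1, e2, omegaFn_one, omegaFn_zero, H.f_eq, H.hs]
  generalize s * d₀ = r0, s * d₂ = r, q ^ N = n, q ^ i = I, q ^ j = J at *
  field_simp
  linear_combination hs₀

theorem ratio_neg_one_zero (H : Roots s d₀ d₁ d₂ d₃ d₄ q c₀ c₁ c₂ c₃ c₄ N) :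
    omegaRatio s d₀ d₁ d₂ d₃ d₄ (q ^ i) (q ^ j) (-1) 0 * (s * d₀) = -(q * q ^ N * c₁ * (q * c₀) / q
        ^ i) := by
  obtain ⟨hq, hs0, hd0, hd1, hd2, hd3, hd4⟩ := H.ne
  obtain ⟨⟨hc₀, hc₁, hc₂, hc₃, hc₄⟩, hr0, hr, hs₀, hrr, he, hp, hn, hI, hJ⟩ := H.facts i j
  have e3 : ((-1 : SignType) : ℤ) = -1 := rfl
  have e2 : ((0 : SignType) : ℤ) = 0 := rfl
  simp only [omegaRatio, e3, e2, omegaFn_neg_one, omegaFn_zero, H.f_eq]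
  generalize s * d₀ = r0, s * d₂ = r, q ^ N = n, q ^ i = I, q ^ j = J at *
  field_simp
  linear_combination -hs₀

theorem ratio_one_neg_one (H : Roots s d₀ d₁ d₂ d₃ d₄ q c₀ c₁ c₂ c₃ c₄ N) :
    omegaRatio s d₀ d₁ d₂ d₃ d₄ (q ^ i) (q ^ j * q) 1 (-1) = q ^ i * q ^ j / ((q ^ N) ^ 2 * c₁ ^ 2
        * (s * d₂) * (q * c₀)) * (s * d₀) := by
  obtain ⟨hq, hs0, hd0, hd1, hd2, hd3, hd4⟩ := H.ne
  obtain ⟨⟨hc₀, hc₁, hc₂, hc₃, hc₄⟩, hr0, hr, hs₀, hrr, he, hp, hn, hI, hJ⟩ := H.facts i j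
  have e1 : ((1 : SignType) : ℤ) = 1 := rfl
  have e3 : ((-1 : SignType) : ℤ) = -1 := rfl
  simp only [omegaRatio, e1, e3, omegaFn_one, omegaFn_neg_one, H.f₀_eq, H.f_eq, H.hs]
  generalize s * d₀ = r0, s * d₂ = r, q ^ N = n, q ^ i = I, q ^ j = J at *
  field_simp
  linear_combination -hs₀

theorem ratio_zero_neg_one (H : Roots s d₀ d₁ d₂ d₃ d₄ q c₀ c₁ c₂ c₃ c₄ N) :
    omegaRatio s d₀ d₁ d₂ d₃ d₄ (q ^ i) (q ^ j * q) 0 (-1) = -(q ^ j / (q ^ N * c₁ * (s * d₂))) :=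
        by
  obtain ⟨hq, hs0, hd0, hd1, hd2, hd3, hd4⟩ := H.ne
  obtain ⟨⟨hc₀, hc₁, hc₂, hc₃, hc₄⟩, hr0, hr, hs₀, hrr, he, hp, hn, hI, hJ⟩ := H.facts i j
  have e2 : ((0 : SignType) : ℤ) = 0 := rfl
  have e3 : ((-1 : SignType) : ℤ) = -1 := rfl

  simp only [omegaRatio, e2, e3, omegaFn_zero, omegaFn_neg_one, H.f₀_eq]
  generalize s * d₀ = r0, s * d₂ = r, q ^ N = n, q ^ i = I, q ^ j = J at *
  field_simp

theorem ratio_neg_one_neg_one (H : Roots s d₀ d₁ d₂ d₃ d₄ q c₀ c₁ c₂ c₃ c₄ N) :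
    omegaRatio s d₀ d₁ d₂ d₃ d₄ (q ^ i) (q ^ j * q) (-1) (-1) * (s * d₀) = q ^ j * q * (q * c₀) /
        (q ^ i * (s * d₂)) := by
  obtain ⟨hq, hs0, hd0, hd1, hd2, hd3, hd4⟩ := H.ne
  obtain ⟨⟨hc₀, hc₁, hc₂, hc₃, hc₄⟩, hr0, hr, hs₀, hrr, he, hp, hn, hI, hJ⟩ := H.facts i j
  have e3 : ((-1 : SignType) : ℤ) = -1 := rfl
  simp only [omegaRatio, e3, omegaFn_neg_one, H.f₀_eq, H.f_eq]
  generalize s * d₀ = r0, s * d₂ = r, q ^ N = n, q ^ i = I, q ^ j = J at *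
  field_simp
  linear_combination hs₀

end RightRatios

set_option linter.unusedSimpArgs false

/-! ### Matching the shifts in the degree i. -/

section RightCoefficients

variable {s d₀ d₁ d₂ d₃ d₄ q c₀ c₁ c₂ c₃ c₄ : ℂ} {N i j : ℤ}

/-- After the weights are named, the claim is a rational identity in q^i, q^j, q^N and the
parameters: both sides are multiples of the same product of a weight in j and a weight in i. The
companion cases have the same structure, with `wZero` in place of a weight for a zero shift. -/
theorem right_up_one (H : Roots s d₀ d₁ d₂ d₃ d₄ q c₀ c₁ c₂ c₃ c₄ N)
    (G : GenericGriffiths q c₀ c₁ c₂ c₃ c₄ N) (hj : 0 ≤ j) (hjN : j ≤ N)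
    (hk : 0 ≤ i + 1) (hkN : i + 1 ≤ N) :
    omegaRatio s d₀ d₁ d₂ d₃ d₄ (q ^ i) (q ^ j / q) 1 1 * coeffA s d₂ d₁ d₀ d₄ d₃ N 1 1 j (i + 1) =
      CUp (s * d₂) q c₀ c₁ c₄ N j * (lamUp q c₃ c₂ c₁ (N - j) i * PhiMu q c₁ c₂ c₃ (N - j) 1 (i +
          1) -
        q * (PhiMu q c₁ c₂ c₃ (N - j + 1) 1 (i + 1) * lamUp q c₃ c₂ c₁ (N - j) (i + 1))) +
      delUp q c₀ c₁ c₂ c₃ c₄ N j * PhiUp s d₁ d₂ d₃ (N - j) 1 (i + 1) := by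
  obtain ⟨hq, hs0, hd0, hd1, hd2, hd3, hd4⟩ := H.ne
  obtain ⟨⟨hc₀, hc₁, hc₂, hc₃, hc₄⟩, hr0, hr, hs₀, hrr, he, hp, hn, hI, hJ⟩ := H.facts i j
  have hq2 := G.q_sq
  have hq1 : 1 + q ≠ 0 := fun h => hq2 (by linear_combination (1 - q) * h)
  obtain ⟨g0, g1, g2⟩ := G.h423.gen₂₃.factors hq hk (by omega)
  have f : ∀ M, PhiMu q c₁ c₂ c₃ M 1 (i + 1) = PhiPos q c₁ c₂ c₃ M (i + 1) + 0 := fun _ => rfl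
  have U0 := PhiUp_one_eq H.hs H.h₁ H.h₀ H.h₄ hq (N - (i + 1)) j
  have U2 := PhiUp_one_eq H.hs H.h₁ H.h₂ H.h₃ hq (N - j) (i + 1)
  rw [ratio_one_one H, coeffA_up_eq H.swap G.h423 (by omega), f, f, PhiPos_eq hq _ _ g1, PhiPos_eq
    hq _ _ g1, CUp, delUp, lamUp, lamUp]
  generalize wPos q c₀ c₄ (q ^ j) = Z at *
  generalize wPos q c₂ c₃ (q ^ (i + 1)) = P at *
  generalize PhiUp s d₁ d₀ d₄ (N - (i + 1)) 1 j = u0 at *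
  generalize PhiUp s d₁ d₂ d₃ (N - j) 1 (i + 1) = u2 at *
  simp only [zpow_add_one₀ hq, zpow_sub_one₀ hq, zpow_sub₀ hq] at U0 U2 ⊢
  clear g0 g1 g2
  generalize s * d₀ = r0, s * d₂ = r, q ^ N = n, q ^ i = I, q ^ j = J at *
  -- Only √(qc₂)·Φ_+ has a known rational form, so a factor r²/(qc₂) = 1 is inserted.
  have hu2 : u2 = r * (r * u2) / (q * c₂) := by rw [← mul_assoc, hrr]; field_simp
  rw [U2] at hu2
  rw [hu2]
  rw [show ∀ A B : ℂ, A * r0 * (B * u0) = A * B * (r0 * u0) from fun _ _ => by ring, U0, hp]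
  simp only [show (1 - q ^ 2) = (1 - q) * (1 + q) by ring] at hq2 ⊢
  have hq1' := left_ne_zero_of_mul hq2
  generalize hv' : 1 + q = v' at *
  generalize hv : 1 - q = v at *
  field_simp
  rw [← hv, ← hv']
  ring

theorem right_up_zero (H : Roots s d₀ d₁ d₂ d₃ d₄ q c₀ c₁ c₂ c₃ c₄ N)
    (G : GenericGriffiths q c₀ c₁ c₂ c₃ c₄ N) (hj : 0 ≤ j) (hjN : j ≤ N)
    (hk : 0 ≤ i) (hkN : i ≤ N) :
    omegaRatio s d₀ d₁ d₂ d₃ d₄ (q ^ i) (q ^ j / q) 0 1 * coeffA s d₂ d₁ d₀ d₄ d₃ N 1 0 j i =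
      CUp (s * d₂) q c₀ c₁ c₄ N j * (lamUp q c₃ c₂ c₁ (N - j) i * PhiMu q c₁ c₂ c₃ (N - j) 0 i -
        q * (PhiMu q c₁ c₂ c₃ (N - j + 1) 0 i * lamUp q c₃ c₂ c₁ (N - j) i)) +
      delUp q c₀ c₁ c₂ c₃ c₄ N j * PhiUp s d₁ d₂ d₃ (N - j) 0 i := by
  obtain ⟨hq, hs0, hd0, hd1, hd2, hd3, hd4⟩ := H.ne
  obtain ⟨⟨hc₀, hc₁, hc₂, hc₃, hc₄⟩, hr0, hr, hs₀, hrr, he, hp, hn, hI, hJ⟩ := H.facts i j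
  have hq2 := G.q_sq
  have hq1 : 1 + q ≠ 0 := fun h => hq2 (by linear_combination (1 - q) * h)
  obtain ⟨g0, g1, g2⟩ := G.h423.gen₂₃.factors hq hk (by omega)
  obtain ⟨b0, b1, b2⟩ := G.h104.gen₂₃.factors hq hj (by omega)
  have f : ∀ M, PhiMu q c₁ c₂ c₃ M 0 i = Phi q c₁ c₂ c₃ M 0 i + (1 + c₁ * c₂ * q) := fun _ => rfl
  have f' : Phi q c₁ c₀ c₄ (N - i) 1 j = PhiPos q c₁ c₀ c₄ (N - i) j := rfl
  have U2 := PhiUp_zero_eq H.hs H.h₁ H.h₂ H.h₃ G.h123 hk (by omega) (N - j)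
  rw [ratio_zero_one H, coeffA_mid_eq H.swap G.h423 hq1 (by decide) _ hk (by omega), f', PhiPos_eq
    hq _ _ b1, f, f, Phi_zero_eq G.h123 hq1 hk (by omega), Phi_zero_eq G.h123 hq1 hk (by omega),
      CUp, delUp, lamUp]
  simp only [mul_comm c₃ c₂, mu] at *
  generalize wPos q c₀ c₄ (q ^ j) = Z at *
  generalize wZero q c₂ c₃ (q ^ i) = P at *
  generalize PhiUp s d₁ d₂ d₃ (N - j) 0 i = u2 at *
  simp only [zpow_add_one₀ hq, zpow_sub_one₀ hq, zpow_sub₀ hq] at U2 ⊢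
  clear g0 g1 g2 b0 b1 b2
  generalize s * d₀ = r0, s * d₂ = r, q ^ N = n, q ^ i = I, q ^ j = J at *
  have hu2 : u2 = r * (r * u2) / (q * c₂) := by rw [← mul_assoc, hrr]; field_simp
  rw [U2] at hu2
  rw [hu2]
  rw [hp]
  field_simp
  ring

theorem right_up_neg_one (H : Roots s d₀ d₁ d₂ d₃ d₄ q c₀ c₁ c₂ c₃ c₄ N)
    (G : GenericGriffiths q c₀ c₁ c₂ c₃ c₄ N) (hj : 0 ≤ j) (hjN : j ≤ N)
    (hk : 0 ≤ i - 1) (hkN : i - 1 ≤ N) :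
    omegaRatio s d₀ d₁ d₂ d₃ d₄ (q ^ i) (q ^ j / q) (-1) 1 * coeffA s d₂ d₁ d₀ d₄ d₃ N 1 (-1) j (i
        - 1) =
      CUp (s * d₂) q c₀ c₁ c₄ N j * (lamUp q c₃ c₂ c₁ (N - j) i * PhiMu q c₁ c₂ c₃ (N - j) (-1) (i
          - 1) -
        q * (PhiMu q c₁ c₂ c₃ (N - j + 1) (-1) (i - 1) * lamUp q c₃ c₂ c₁ (N - j) (i - 1))) +
      delUp q c₀ c₁ c₂ c₃ c₄ N j * PhiUp s d₁ d₂ d₃ (N - j) (-1) (i - 1) := by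
  obtain ⟨hq, hs0, hd0, hd1, hd2, hd3, hd4⟩ := H.ne
  obtain ⟨⟨hc₀, hc₁, hc₂, hc₃, hc₄⟩, hr0, hr, hs₀, hrr, he, hp, hn, hI, hJ⟩ := H.facts i j
  have hq2 := G.q_sq
  have hq1 : 1 + q ≠ 0 := fun h => hq2 (by linear_combination (1 - q) * h)
  obtain ⟨g0, g1, g2⟩ := G.h423.gen₂₃.factors hq hk (by omega)
  have f : ∀ M, PhiMu q c₁ c₂ c₃ M (-1) (i - 1) = PhiNeg q c₁ c₂ c₃ M (i - 1) + 0 := fun _ => rfl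
  have R0 := ratio_neg_one_one (i := i) (j := j) H
  have U2 := PhiUp_neg_one_eq H.hs H.h₁ H.h₂ H.h₃ G.h123 hk (by omega) (N - j)
  rw [coeffA_down_eq H.swap G.h423 _ _ hk (by omega), PhiDown_one_eq H.hs H.h₀ H.h₄ G.h104 hj (by
    omega), f, f, PhiNeg_eq hq _ _ g1, PhiNeg_eq hq _ _ g1, CUp, delUp, lamUp, lamUp]
  generalize wPos q c₀ c₄ (q ^ j) = Z at *
  generalize wNeg q c₂ c₃ (q ^ (i - 1)) = P at *
  generalize omegaRatio s d₀ d₁ d₂ d₃ d₄ (q ^ i) (q ^ j / q) (-1) 1 = ρ at *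
  generalize PhiUp s d₁ d₂ d₃ (N - j) (-1) (i - 1) = u2 at *
  simp only [zpow_add_one₀ hq, zpow_sub_one₀ hq, zpow_sub₀ hq] at U2 ⊢
  clear g0 g1 g2
  generalize s * d₀ = r0, s * d₂ = r, q ^ N = n, q ^ i = I, q ^ j = J at *
  have hu2 : u2 = r * (r * u2) / (q * c₂) := by rw [← mul_assoc, hrr]; field_simp
  rw [U2] at hu2
  rw [hu2]
  rw [show ∀ A B : ℂ, ρ * (A * (r0 * B)) = ρ * r0 * (A * B) from fun _ _ => by ring, R0, hp]
  simp only [show (1 - q ^ 2) = (1 - q) * (1 + q) by ring] at hq2 ⊢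
  have hq1' := left_ne_zero_of_mul hq2
  generalize hv' : 1 + q = v' at *
  generalize hv : 1 - q = v at *
  field_simp
  rw [← hv, ← hv']
  ring

theorem right_mid_one (H : Roots s d₀ d₁ d₂ d₃ d₄ q c₀ c₁ c₂ c₃ c₄ N)
    (G : GenericGriffiths q c₀ c₁ c₂ c₃ c₄ N) (hj : 0 ≤ j) (hjN : j ≤ N)
    (hk : 0 ≤ i + 1) (hkN : i + 1 ≤ N) :
    omegaRatio s d₀ d₁ d₂ d₃ d₄ (q ^ i) (q ^ j) 1 0 * coeffA s d₂ d₁ d₀ d₄ d₃ N 0 1 j (i + 1) =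
      CMid q c₀ c₁ c₂ c₃ c₄ N j * (mu q (c₂ * c₃) i * PhiMu q c₁ c₂ c₃ (N - j) 1 (i + 1) -
        q * (PhiMu q c₁ c₂ c₃ (N - j) 1 (i + 1) * mu q (c₂ * c₃) (i + 1))) := by
  obtain ⟨hq, hs0, hd0, hd1, hd2, hd3, hd4⟩ := H.ne
  obtain ⟨⟨hc₀, hc₁, hc₂, hc₃, hc₄⟩, hr0, hr, hs₀, hrr, he, hp, hn, hI, hJ⟩ := H.facts i j
  have hq2 := G.q_sq
  have hq1 : 1 + q ≠ 0 := fun h => hq2 (by linear_combination (1 - q) * h)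
  obtain ⟨g0, g1, g2⟩ := G.h423.gen₂₃.factors hq hk (by omega)
  have f : ∀ M, PhiMu q c₁ c₂ c₃ M 1 (i + 1) = PhiPos q c₁ c₂ c₃ M (i + 1) + 0 := fun _ => rfl
  have U0 := PhiUp_zero_eq H.hs H.h₁ H.h₀ H.h₄ G.h104 hj (by omega) (N - (i + 1))
  rw [ratio_one_zero H, coeffA_up_eq H.swap G.h423 (by omega), f, PhiPos_eq hq _ _ g1, CMid, mu, mu]
  generalize wZero q c₀ c₄ (q ^ j) = Z at *
  generalize wPos q c₂ c₃ (q ^ (i + 1)) = P at *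
  generalize PhiUp s d₁ d₀ d₄ (N - (i + 1)) 0 j = u0 at *
  simp only [zpow_add_one₀ hq, zpow_sub_one₀ hq, zpow_sub₀ hq] at U0 ⊢
  clear g0 g1 g2
  generalize s * d₀ = r0, s * d₂ = r, q ^ N = n, q ^ i = I, q ^ j = J at *
  rw [show ∀ A B : ℂ, A * r0 * (B * u0) = A * B * (r0 * u0) from fun _ _ => by ring, U0, hp]
  simp only [show (1 - q ^ 2) = (1 - q) * (1 + q) by ring] at hq2 ⊢
  have hq1' := left_ne_zero_of_mul hq2
  generalize hv' : 1 + q = v' at *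
  generalize hv : 1 - q = v at *
  field_simp
  rw [← hv, ← hv']
  ring

theorem right_mid_zero (H : Roots s d₀ d₁ d₂ d₃ d₄ q c₀ c₁ c₂ c₃ c₄ N)
    (G : GenericGriffiths q c₀ c₁ c₂ c₃ c₄ N) (hj : 0 ≤ j) (hjN : j ≤ N)
    (hk : 0 ≤ i) (hkN : i ≤ N) :
    omegaRatio s d₀ d₁ d₂ d₃ d₄ (q ^ i) (q ^ j) 0 0 * coeffA s d₂ d₁ d₀ d₄ d₃ N 0 0 j i =
      CMid q c₀ c₁ c₂ c₃ c₄ N j * (mu q (c₂ * c₃) i * PhiMu q c₁ c₂ c₃ (N - j) 0 i -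
        q * (PhiMu q c₁ c₂ c₃ (N - j) 0 i * mu q (c₂ * c₃) i)) +
      delZero q c₀ c₁ c₂ c₃ c₄ N j := by
  obtain ⟨hq, hs0, hd0, hd1, hd2, hd3, hd4⟩ := H.ne
  obtain ⟨⟨hc₀, hc₁, hc₂, hc₃, hc₄⟩, hr0, hr, hs₀, hrr, he, hp, hn, hI, hJ⟩ := H.facts i j
  have hq2 := G.q_sq
  have hq1 : 1 + q ≠ 0 := fun h => hq2 (by linear_combination (1 - q) * h)
  have f : PhiMu q c₁ c₂ c₃ (N - j) 0 i = Phi q c₁ c₂ c₃ (N - j) 0 i + (1 + c₁ * c₂ * q) := rfl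
  have h1 : omegaRatio s d₀ d₁ d₂ d₃ d₄ (q ^ i) (q ^ j) 0 0 = 1 := by
    have e2 : ((0 : SignType) : ℤ) = 0 := rfl
    simp [omegaRatio, e2, omegaFn_zero]
  rw [h1, one_mul, coeffA_zero_eq H.swap G.h423 G.h123 G.h104 hq1 hj hjN hk hkN, CMid, f, delZero,
    delZero,
    mul_comm c₃ c₂, show (1 - q ^ 2) = (1 - q) * (1 + q) by ring]
  have hq1' : 1 - q ≠ 0 := fun h => hq2 (by linear_combination (1 + q) * h)
  generalize mu q (c₂ * c₃) i = μ
  generalize Phi q c₁ c₂ c₃ (N - j) 0 i = F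
  generalize wZero q c₀ c₄ (q ^ j) = Z
  generalize q ^ N = n at *
  generalize 1 + q = v at *
  rw [show ∀ X : ℂ, μ * X - q * (X * μ) = (1 - q) * (μ * X) by intro X; ring]
  generalize 1 - q = v' at *
  field_simp
  ring

theorem right_mid_neg_one (H : Roots s d₀ d₁ d₂ d₃ d₄ q c₀ c₁ c₂ c₃ c₄ N)
    (G : GenericGriffiths q c₀ c₁ c₂ c₃ c₄ N) (hj : 0 ≤ j) (hjN : j ≤ N)
    (hk : 0 ≤ i - 1) (hkN : i - 1 ≤ N) :
    omegaRatio s d₀ d₁ d₂ d₃ d₄ (q ^ i) (q ^ j) (-1) 0 * coeffA s d₂ d₁ d₀ d₄ d₃ N 0 (-1) j (i - 1)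
        =
      CMid q c₀ c₁ c₂ c₃ c₄ N j * (mu q (c₂ * c₃) i * PhiMu q c₁ c₂ c₃ (N - j) (-1) (i - 1) -
        q * (PhiMu q c₁ c₂ c₃ (N - j) (-1) (i - 1) * mu q (c₂ * c₃) (i - 1))) := by
  obtain ⟨hq, hs0, hd0, hd1, hd2, hd3, hd4⟩ := H.ne
  obtain ⟨⟨hc₀, hc₁, hc₂, hc₃, hc₄⟩, hr0, hr, hs₀, hrr, he, hp, hn, hI, hJ⟩ := H.facts i j
  have hq2 := G.q_sq
  have hq1 : 1 + q ≠ 0 := fun h => hq2 (by linear_combination (1 - q) * h)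
  obtain ⟨g0, g1, g2⟩ := G.h423.gen₂₃.factors hq hk (by omega)
  have f : ∀ M, PhiMu q c₁ c₂ c₃ M (-1) (i - 1) = PhiNeg q c₁ c₂ c₃ M (i - 1) + 0 := fun _ => rfl
  have R0 := ratio_neg_one_zero (i := i) (j := j) H
  rw [coeffA_down_eq H.swap G.h423 _ _ hk (by omega), PhiDown_zero_eq H.hs H.h₀ H.h₄ G.h104 hj (by
    omega), f, PhiNeg_eq hq _ _ g1, CMid, mu, mu]
  generalize wZero q c₀ c₄ (q ^ j) = Z at *
  generalize wNeg q c₂ c₃ (q ^ (i - 1)) = P at *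
  generalize omegaRatio s d₀ d₁ d₂ d₃ d₄ (q ^ i) (q ^ j) (-1) 0 = ρ at *
  simp only [zpow_add_one₀ hq, zpow_sub_one₀ hq, zpow_sub₀ hq] at ⊢
  clear g0 g1 g2
  generalize s * d₀ = r0, s * d₂ = r, q ^ N = n, q ^ i = I, q ^ j = J at *
  rw [show ∀ A B : ℂ, ρ * (A * (r0 * B)) = ρ * r0 * (A * B) from fun _ _ => by ring, R0, hp]
  simp only [show (1 - q ^ 2) = (1 - q) * (1 + q) by ring] at hq2 ⊢
  have hq1' := left_ne_zero_of_mul hq2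
  generalize hv' : 1 + q = v' at *
  generalize hv : 1 - q = v at *
  field_simp
  rw [← hv, ← hv']
  ring

theorem right_down_one (H : Roots s d₀ d₁ d₂ d₃ d₄ q c₀ c₁ c₂ c₃ c₄ N)
    (G : GenericGriffiths q c₀ c₁ c₂ c₃ c₄ N) (hj : 0 ≤ j) (hjN : j ≤ N)
    (hk : 0 ≤ i + 1) (hkN : i + 1 ≤ N) :
    omegaRatio s d₀ d₁ d₂ d₃ d₄ (q ^ i) (q ^ j * q) 1 (-1) * coeffA s d₂ d₁ d₀ d₄ d₃ N (-1) 1 j (i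
        + 1) =
      CDown (s * d₂) q c₀ c₁ c₄ j * (lamDown q c₃ c₂ (N - j - 1) i * PhiMu q c₁ c₂ c₃ (N - j) 1 (i
          + 1) -
        q * (PhiMu q c₁ c₂ c₃ (N - j - 1) 1 (i + 1) * lamDown q c₃ c₂ (N - j - 1) (i + 1))) +
      delDown q c₀ c₁ c₂ c₃ c₄ N j * PhiDown s d₂ d₃ (N - j) 1 (i + 1) := by
  obtain ⟨hq, hs0, hd0, hd1, hd2, hd3, hd4⟩ := H.ne
  obtain ⟨⟨hc₀, hc₁, hc₂, hc₃, hc₄⟩, hr0, hr, hs₀, hrr, he, hp, hn, hI, hJ⟩ := H.facts i j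
  have hq2 := G.q_sq
  have hq1 : 1 + q ≠ 0 := fun h => hq2 (by linear_combination (1 - q) * h)
  obtain ⟨g0, g1, g2⟩ := G.h423.gen₂₃.factors hq hk (by omega)
  have f : ∀ M, PhiMu q c₁ c₂ c₃ M 1 (i + 1) = PhiPos q c₁ c₂ c₃ M (i + 1) + 0 := fun _ => rfl
  have U0 := PhiUp_neg_one_eq H.hs H.h₁ H.h₀ H.h₄ G.h104 hj (by omega) (N - (i + 1))
  rw [ratio_one_neg_one H, coeffA_up_eq H.swap G.h423 (by omega), f, f, PhiPos_eq hq _ _ g1,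
    PhiPos_eq hq _ _ g1, CDown, delDown, lamDown, lamDown, PhiDown_one_eq H.hs H.h₂ H.h₃ G.h123 hk
      (by omega)]
  generalize wNeg q c₀ c₄ (q ^ j) = Z at *
  generalize wPos q c₂ c₃ (q ^ (i + 1)) = P at *
  generalize PhiUp s d₁ d₀ d₄ (N - (i + 1)) (-1) j = u0 at *
  simp only [zpow_add_one₀ hq, zpow_sub_one₀ hq, zpow_sub₀ hq] at U0 ⊢
  clear g0 g1 g2
  generalize s * d₀ = r0, s * d₂ = r, q ^ N = n, q ^ i = I, q ^ j = J at *
  rw [show ∀ A B : ℂ, A * r0 * (B * u0) = A * B * (r0 * u0) from fun _ _ => by ring, U0, hp]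
  obtain rfl : c₂ = r * r / q := by rw [hrr]; field_simp
  simp only [show (1 - q ^ 2) = (1 - q) * (1 + q) by ring] at hq2 ⊢
  have hq1' := left_ne_zero_of_mul hq2
  generalize hv' : 1 + q = v' at *
  generalize hv : 1 - q = v at *
  field_simp
  rw [← hv, ← hv']
  ring

theorem right_down_zero (H : Roots s d₀ d₁ d₂ d₃ d₄ q c₀ c₁ c₂ c₃ c₄ N)
    (G : GenericGriffiths q c₀ c₁ c₂ c₃ c₄ N) (hj : 0 ≤ j) (hjN : j ≤ N)
    (hk : 0 ≤ i) (hkN : i ≤ N) :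
    omegaRatio s d₀ d₁ d₂ d₃ d₄ (q ^ i) (q ^ j * q) 0 (-1) * coeffA s d₂ d₁ d₀ d₄ d₃ N (-1) 0 j i =
      CDown (s * d₂) q c₀ c₁ c₄ j * (lamDown q c₃ c₂ (N - j - 1) i * PhiMu q c₁ c₂ c₃ (N - j) 0 i -
        q * (PhiMu q c₁ c₂ c₃ (N - j - 1) 0 i * lamDown q c₃ c₂ (N - j - 1) i)) +
      delDown q c₀ c₁ c₂ c₃ c₄ N j * PhiDown s d₂ d₃ (N - j) 0 i := by
  obtain ⟨hq, hs0, hd0, hd1, hd2, hd3, hd4⟩ := H.ne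
  obtain ⟨⟨hc₀, hc₁, hc₂, hc₃, hc₄⟩, hr0, hr, hs₀, hrr, he, hp, hn, hI, hJ⟩ := H.facts i j
  have hq2 := G.q_sq
  have hq1 : 1 + q ≠ 0 := fun h => hq2 (by linear_combination (1 - q) * h)
  obtain ⟨g0, g1, g2⟩ := G.h423.gen₂₃.factors hq hk (by omega)
  obtain ⟨b0, b1, b2⟩ := G.h104.gen₂₃.factors hq hj (by omega)
  have f : ∀ M, PhiMu q c₁ c₂ c₃ M 0 i = Phi q c₁ c₂ c₃ M 0 i + (1 + c₁ * c₂ * q) := fun _ => rfl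
  have f' : Phi q c₁ c₀ c₄ (N - i) (-1) j = PhiNeg q c₁ c₀ c₄ (N - i) j := rfl
  rw [ratio_zero_neg_one H, coeffA_mid_eq H.swap G.h423 hq1 (by decide) _ hk (by omega), f',
    PhiNeg_eq hq _ _ b1, f, f, Phi_zero_eq G.h123 hq1 hk (by omega), Phi_zero_eq G.h123 hq1 hk (by
      omega), CDown, delDown, lamDown, PhiDown_zero_eq H.hs H.h₂ H.h₃ G.h123 hk (by omega)]
  simp only [mul_comm c₃ c₂, mu] at *
  generalize wNeg q c₀ c₄ (q ^ j) = Z at *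
  generalize wZero q c₂ c₃ (q ^ i) = P at *
  simp only [zpow_add_one₀ hq, zpow_sub_one₀ hq, zpow_sub₀ hq] at ⊢
  clear g0 g1 g2 b0 b1 b2
  generalize s * d₀ = r0, s * d₂ = r, q ^ N = n, q ^ i = I, q ^ j = J at *
  rw [hp]
  obtain rfl : c₂ = r * r / q := by rw [hrr]; field_simp
  field_simp
  ring

theorem right_down_neg_one (H : Roots s d₀ d₁ d₂ d₃ d₄ q c₀ c₁ c₂ c₃ c₄ N)
    (G : GenericGriffiths q c₀ c₁ c₂ c₃ c₄ N) (hj : 0 ≤ j) (hjN : j ≤ N)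
    (hk : 0 ≤ i - 1) (hkN : i - 1 ≤ N) :
    omegaRatio s d₀ d₁ d₂ d₃ d₄ (q ^ i) (q ^ j * q) (-1) (-1) * coeffA s d₂ d₁ d₀ d₄ d₃ N (-1) (-1)
        j (i - 1) =
      CDown (s * d₂) q c₀ c₁ c₄ j * (lamDown q c₃ c₂ (N - j - 1) i * PhiMu q c₁ c₂ c₃ (N - j) (-1)
          (i - 1) -
        q * (PhiMu q c₁ c₂ c₃ (N - j - 1) (-1) (i - 1) * lamDown q c₃ c₂ (N - j - 1) (i - 1))) +
      delDown q c₀ c₁ c₂ c₃ c₄ N j * PhiDown s d₂ d₃ (N - j) (-1) (i - 1) := by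
  obtain ⟨hq, hs0, hd0, hd1, hd2, hd3, hd4⟩ := H.ne
  obtain ⟨⟨hc₀, hc₁, hc₂, hc₃, hc₄⟩, hr0, hr, hs₀, hrr, he, hp, hn, hI, hJ⟩ := H.facts i j
  have hq2 := G.q_sq
  have hq1 : 1 + q ≠ 0 := fun h => hq2 (by linear_combination (1 - q) * h)
  obtain ⟨g0, g1, g2⟩ := G.h423.gen₂₃.factors hq hk (by omega)
  have f : ∀ M, PhiMu q c₁ c₂ c₃ M (-1) (i - 1) = PhiNeg q c₁ c₂ c₃ M (i - 1) + 0 := fun _ => rfl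
  have R0 := ratio_neg_one_neg_one (i := i) (j := j) H
  rw [coeffA_down_eq H.swap G.h423 _ _ hk (by omega), PhiDown_neg_one_eq H.hs H.h₀ H.h₄ G.h104 hj
    (by omega), f, f, PhiNeg_eq hq _ _ g1, PhiNeg_eq hq _ _ g1, CDown, delDown, lamDown, lamDown,
      PhiDown_neg_one_eq H.hs H.h₂ H.h₃ G.h123 hk (by omega)]
  generalize wNeg q c₀ c₄ (q ^ j) = Z at *
  generalize wNeg q c₂ c₃ (q ^ (i - 1)) = P at *
  generalize omegaRatio s d₀ d₁ d₂ d₃ d₄ (q ^ i) (q ^ j * q) (-1) (-1) = ρ at *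
  simp only [zpow_add_one₀ hq, zpow_sub_one₀ hq, zpow_sub₀ hq] at ⊢
  clear g0 g1 g2
  generalize s * d₀ = r0, s * d₂ = r, q ^ N = n, q ^ i = I, q ^ j = J at *
  rw [show ∀ A B : ℂ, ρ * (A * (r0 * B)) = ρ * r0 * (A * B) from fun _ _ => by ring, R0, hp]
  obtain rfl : c₂ = r * r / q := by rw [hrr]; field_simp
  simp only [show (1 - q ^ 2) = (1 - q) * (1 + q) by ring] at hq2 ⊢
  have hq1' := left_ne_zero_of_mul hq2
  generalize hv' : 1 + q = v' at *
  generalize hv : 1 - q = v at *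
  field_simp
  rw [← hv, ← hv']
  ring

end RightCoefficients

/-! ### The intertwining relation for each shift of j. -/

section SignTypeSplit

variable {s d₀ d₁ d₂ d₃ d₄ q c₀ c₁ c₂ c₃ c₄ : ℂ} {N i j b : ℤ}

/-- A linear relation between the values of two families of functions, obtained from a commutator
relation and a contiguity relation by comparing coefficients. -/
theorem sum_eq_of_commutator {w C D : ℂ} {L g m U R p u V : SignType → ℂ} {l X : ℂ}
    (hL1 : L 1 = w * (C * (g 1 * m 1))) (hL0 : L 0 = w * (C * (g 0 * m 0) + D * l))
    (hL2 : L (-1) = w * (C * (g (-1) * m (-1))))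
    (hU0 : U 0 = X) (hcomm : ∑ ε, g ε * m ε * U ε = ∑ δ, p δ * V δ)
    (hX : l * X = ∑ δ, u δ * V δ) (hR : ∀ δ, R δ * V δ = (C * p δ + D * u δ) * V δ) :
    ∑ ε, L ε * U ε = w * ∑ δ, R δ * V δ := by
  have h1 : ∑ δ, R δ * V δ = C * ∑ δ, p δ * V δ + D * ∑ δ, u δ * V δ := by
    rw [mul_sum, mul_sum, ← sum_add_distrib]
    exact sum_congr rfl fun δ _ => by rw [hR]; ring
  rw [h1, ← hcomm, ← hX, sum_signType, sum_signType, hL1, hL0, hL2, hU0]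
  ring

/-- The q-commutator of the dual contiguity operator with weight `CUp`, plus the contiguity relation
itself with weight `delUp`. The other two shifts use the recurrence with the identity, and the
descending contiguity relation. -/
theorem coeffA_intertwine_up (H : Roots s d₀ d₁ d₂ d₃ d₄ q c₀ c₁ c₂ c₃ c₄ N)
    (G : GenericGriffiths q c₀ c₁ c₂ c₃ c₄ N) (hj : 1 ≤ j) (hjN : j ≤ N) (hi : 0 ≤ i)
    (hiN : i ≤ N - j + 1) (hb : 0 ≤ b) (hbN : b ≤ N - j) :
    ∑ ε : SignType, omegaFn s (d₁ * d₂ * d₃ / d₄) (b - ε) * coeffA s d₂ d₃ d₀ d₄ d₁ N 1 ε j b *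
        racah s d₁ d₂ d₃ (N - j + 1) i (b - ε) =
      omegaFn s (d₁ * d₂ * d₃ / d₄) b * ∑ δ : SignType,
        omegaRatio s d₀ d₁ d₂ d₃ d₄ (q ^ i) (q ^ j / q) δ 1 *
          coeffA s d₂ d₁ d₀ d₄ d₃ N 1 δ j (i + δ) * racah s d₁ d₂ d₃ (N - j) (i + δ) b := by
  have e1 : ((1 : SignType) : ℤ) = 1 := rfl
  have e2 : ((0 : SignType) : ℤ) = 0 := rfl
  have e3 : ((-1 : SignType) : ℤ) = -1 := rfl
  have hC := commutator_up H.hs H.h₁ H.h₂ H.h₃ G.h123 hi hiN hb hbN (by omega)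

  refine sum_eq_of_commutator (w := omegaFn s (d₁ * d₂ * d₃ / d₄) b) (C := CUp (s * d₂) q c₀ c₁ c₄ N j)
    (D := delUp q c₀ c₁ c₂ c₃ c₄ N j) (l := lamUp q c₁ c₂ c₃ (N - j) b)
    (g := fun ε => PhiUp s d₃ d₂ d₁ (N - j) ε b) (m := fun ε => mu q (c₁ * c₂) b - q * mu q (c₁ * c₂) (b - ε))
    (u := fun δ => PhiUp s d₁ d₂ d₃ (N - j) δ (i + δ))
    ?_ ?_ ?_ rfl hC ?_ fun δ => ?_
  · simp only [e1]
    exact left_up_one H G (by omega)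
  · simp only [e2, sub_zero]
    rw [left_up_zero H G (by omega) hjN hb (by omega)]
  · simp only [e3, sub_neg_eq_add]
    exact left_up_neg_one H G (by omega) hjN hb (by omega)
  · rw [e2, sub_zero]
    exact racah_up H.hs H.h₁ H.h₂ H.h₃ G.h123 hi hiN hb hbN (by omega)
  -- Coefficients have to agree only where the polynomial of degree i + δ is not zero by convention.
  · by_cases hk : 0 ≤ i + δ ∧ i + δ ≤ N - j
    swap
    · rw [racah_eq_zero_of_not (n := i + δ) (by omega), mul_zero, mul_zero]
    congr 1
    rcases (by decide : ∀ δ : SignType, δ = -1 ∨ δ = 0 ∨ δ = 1) δ with rfl | rfl | rfl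
    · exact right_up_neg_one H G (by omega) hjN hk.1 (by rw [e3] at hk; omega)
    · rw [e2, add_zero] at hk ⊢
      exact right_up_zero H G (by omega) hjN hk.1 (by omega)
    · exact right_up_one H G (by omega) hjN hk.1 (by rw [e1] at hk; omega)

theorem coeffA_intertwine_mid (H : Roots s d₀ d₁ d₂ d₃ d₄ q c₀ c₁ c₂ c₃ c₄ N)
    (G : GenericGriffiths q c₀ c₁ c₂ c₃ c₄ N) (hj : 0 ≤ j) (hjN : j ≤ N) (hi : 0 ≤ i)
    (hiN : i ≤ N - j) (hb : 0 ≤ b) (hbN : b ≤ N - j) :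
    ∑ ε : SignType, omegaFn s (d₁ * d₂ * d₃ / d₄) (b - ε) * coeffA s d₂ d₃ d₀ d₄ d₁ N 0 ε j b *
        racah s d₁ d₂ d₃ (N - j) i (b - ε) =
      omegaFn s (d₁ * d₂ * d₃ / d₄) b * ∑ δ : SignType,
        omegaRatio s d₀ d₁ d₂ d₃ d₄ (q ^ i) (q ^ j) δ 0 *
          coeffA s d₂ d₁ d₀ d₄ d₃ N 0 δ j (i + δ) * racah s d₁ d₂ d₃ (N - j) (i + δ) b := by
  have e1 : ((1 : SignType) : ℤ) = 1 := rfl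
  have e2 : ((0 : SignType) : ℤ) = 0 := rfl
  have e3 : ((-1 : SignType) : ℤ) = -1 := rfl
  have hC := commutator_mid H.hs H.h₁ H.h₂ H.h₃ G.h123 hi hiN hb hbN (by omega)

  refine sum_eq_of_commutator (w := omegaFn s (d₁ * d₂ * d₃ / d₄) b) (C := CMid q c₀ c₁ c₂ c₃ c₄ N j)
    (D := delZero q c₀ c₁ c₂ c₃ c₄ N j) (l := 1)
    (g := fun ε => PhiMu q c₃ c₂ c₁ (N - j) ε b) (m := fun ε => mu q (c₁ * c₂) b - q * mu q (c₁ * c₂) (b - ε))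
    (u := fun δ => if δ = 0 then 1 else 0)
    ?_ ?_ ?_ rfl hC ?_ fun δ => ?_
  · simp only [e1]
    exact left_mid_one H G (by omega) hjN hb (by omega)
  · simp only [e2, sub_zero]
    rw [left_mid_zero H G (by omega) hjN hb (by omega), mul_one]
  · simp only [e3, sub_neg_eq_add]
    exact left_mid_neg_one H G (by omega) hjN hb (by omega)
  · simp only [ite_mul, one_mul, zero_mul, sum_ite_eq', mem_univ, if_true, e2, sub_zero, add_zero]
  · by_cases hk : 0 ≤ i + δ ∧ i + δ ≤ N - j
    swap
    · rw [racah_eq_zero_of_not (n := i + δ) (by omega), mul_zero, mul_zero]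
    congr 1
    rcases (by decide : ∀ δ : SignType, δ = -1 ∨ δ = 0 ∨ δ = 1) δ with rfl | rfl | rfl
    · rw [if_neg (by decide), mul_zero, add_zero]
      exact right_mid_neg_one H G (by omega) hjN hk.1 (by rw [e3] at hk; omega)
    · rw [if_pos rfl, mul_one]
      rw [e2, add_zero] at hk ⊢
      exact right_mid_zero H G (by omega) hjN hk.1 (by omega)
    · rw [if_neg (by decide), mul_zero, add_zero]
      exact right_mid_one H G (by omega) hjN hk.1 (by rw [e1] at hk; omega)

theorem coeffA_intertwine_down (H : Roots s d₀ d₁ d₂ d₃ d₄ q c₀ c₁ c₂ c₃ c₄ N)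
    (G : GenericGriffiths q c₀ c₁ c₂ c₃ c₄ N) (hj : 0 ≤ j) (hjN : j ≤ N) (hi : 0 ≤ i)
    (hiN : i ≤ N - j - 1) (hb : 0 ≤ b) (hbN : b ≤ N - j) :
    ∑ ε : SignType, omegaFn s (d₁ * d₂ * d₃ / d₄) (b - ε) * coeffA s d₂ d₃ d₀ d₄ d₁ N (-1) ε j b *
        racah s d₁ d₂ d₃ (N - j - 1) i (b - ε) =
      omegaFn s (d₁ * d₂ * d₃ / d₄) b * ∑ δ : SignType,
        omegaRatio s d₀ d₁ d₂ d₃ d₄ (q ^ i) (q ^ j * q) δ (-1) *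
          coeffA s d₂ d₁ d₀ d₄ d₃ N (-1) δ j (i + δ) * racah s d₁ d₂ d₃ (N - j) (i + δ) b := by
  have e1 : ((1 : SignType) : ℤ) = 1 := rfl
  have e2 : ((0 : SignType) : ℤ) = 0 := rfl
  have e3 : ((-1 : SignType) : ℤ) = -1 := rfl
  have hC := commutator_down H.hs H.h₁ H.h₂ H.h₃ G.h123 (M := N - j - 1) hi hiN hb (by omega) (by omega)
  rw [sub_add_cancel] at hC
  refine sum_eq_of_commutator (w := omegaFn s (d₁ * d₂ * d₃ / d₄) b) (C := CDown (s * d₂) q c₀ c₁ c₄ j)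
    (D := delDown q c₀ c₁ c₂ c₃ c₄ N j) (l := lamDown q c₁ c₂ (N - j - 1) b)
    (g := fun ε => PhiDown s d₂ d₁ (N - j) ε b) (m := fun ε => mu q (c₁ * c₂) b - q * mu q (c₁ * c₂) (b - ε))
    (u := fun δ => PhiDown s d₂ d₃ (N - j) δ (i + δ))
    ?_ ?_ ?_ rfl hC ?_ fun δ => ?_
  · simp only [e1]
    exact left_down_one H G (by omega) hjN hb (by omega)
  · simp only [e2, sub_zero]
    rw [left_down_zero H G (by omega) hjN hb (by omega)]
  · simp only [e3, sub_neg_eq_add]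
    exact left_down_neg_one H G (by omega) hjN hb (by omega)
  · have := racah_down H.hs H.h₁ H.h₂ H.h₃ G.h123 (M := N - j - 1) hi hiN hb (by omega) (by omega)
    rw [e2, sub_zero]
    rwa [sub_add_cancel] at this
  · by_cases hk : 0 ≤ i + δ ∧ i + δ ≤ N - j
    swap
    · rw [racah_eq_zero_of_not (n := i + δ) (by omega), mul_zero, mul_zero]
    congr 1
    rcases (by decide : ∀ δ : SignType, δ = -1 ∨ δ = 0 ∨ δ = 1) δ with rfl | rfl | rfl
    · exact right_down_neg_one H G (by omega) hjN hk.1 (by rw [e3] at hk; omega)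
    · rw [e2, add_zero] at hk ⊢
      exact right_down_zero H G (by omega) hjN hk.1 (by omega)
    · exact right_down_one H G (by omega) hjN hk.1 (by rw [e1] at hk; omega)

end SignTypeSplit

/-! ### The recurrence relation with eigenvalue λ(x). -/

section SecondRelation

variable {s d₀ d₁ d₂ d₃ d₄ q c₀ c₁ c₂ c₃ c₄ : ℂ} {N i j x y b : ℤ}

theorem coeffA_intertwine (H : Roots s d₀ d₁ d₂ d₃ d₄ q c₀ c₁ c₂ c₃ c₄ N)
    (G : GenericGriffiths q c₀ c₁ c₂ c₃ c₄ N) (ε' : SignType) (hj : 0 ≤ j) (hj' : 0 ≤ j + ε')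
    (hi : 0 ≤ i) (hij : i + j ≤ N) (hb : 0 ≤ b) (hbN : b + (j + ε') ≤ N) :
    ∑ ε : SignType, omegaFn s (d₁ * d₂ * d₃ / d₄) (b - ε) *
        coeffA s d₂ d₃ d₀ d₄ d₁ N ε' ε (j + ε') b * racah s d₁ d₂ d₃ (N - j) i (b - ε) =
      omegaFn s (d₁ * d₂ * d₃ / d₄) b * ∑ δ : SignType,
        omegaRatio s d₀ d₁ d₂ d₃ d₄ (q ^ i) (q ^ j) δ ε' *
          coeffA s d₂ d₁ d₀ d₄ d₃ N ε' δ (j + ε') (i + δ) *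
            racah s d₁ d₂ d₃ (N - (j + ε')) (i + δ) b := by
  have hq := G.h123.q_ne
  rcases (by decide : ∀ δ : SignType, δ = -1 ∨ δ = 0 ∨ δ = 1) ε' with rfl | rfl | rfl
  · have e : ((-1 : SignType) : ℤ) = -1 := rfl
    rw [e] at hj' hbN ⊢
    have := coeffA_intertwine_down H G (j := j + -1) hj' (by omega) hi (by omega) hb (by omega)
    rwa [← zpow_add_one₀ hq, neg_add_cancel_right, show N - (j + -1) - 1 = N - j by ring] at this
  · have e : ((0 : SignType) : ℤ) = 0 := rfl
    simp only [e, add_zero] at hj' hbN ⊢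
    exact coeffA_intertwine_mid H G hj (by omega) hi (by omega) hb (by omega)
  · have e : ((1 : SignType) : ℤ) = 1 := rfl
    rw [e] at hj' hbN ⊢
    have := coeffA_intertwine_up H G (j := j + 1) (by omega) (by omega) hi (by omega) hb (by omega)
    rwa [show q ^ (j + 1) / q = q ^ j by rw [zpow_add_one₀ hq, mul_div_cancel_right₀ _ hq],
      show N - (j + 1) + 1 = N - j by ring] at this

theorem griffiths_eq_sum_Icc (hy : 0 ≤ y) (s d₀ d₁ d₂ d₃ d₄ : ℂ) (N i j x : ℤ) :
    griffiths s d₀ d₁ d₂ d₃ d₄ N i j x y = ∑ a ∈ Icc 0 (N - y),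
      omegaFn s (d₁ * d₂ * d₃ / d₄) a * racah s d₁ d₂ d₃ (N - j) i a *
        racah s d₃ d₀ d₄ (N - a) j y * racah s d₄ d₂ d₁ (N - y) a x := by
  rw [griffiths_eq_sum]
  refine (sum_subset (fun a => ?_) fun a _ ha => ?_).symm
  · simp only [mem_Icc]; omega
  · simp only [mem_Icc] at *
    rw [racah_eq_zero_of_not (M := N - y) (by omega), mul_zero]

/-- Shifting the index displaces the interval; `h` discards the terms that have entered outside it
and `h'` the boundary terms that are no longer reached. -/
theorem sum_Icc_add (F : ℤ → ℂ) (M k : ℤ) (h : ∀ b, ¬(0 ≤ b ∧ b ≤ M) → F b = 0)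
    (h' : ∀ b, 0 ≤ b → b ≤ M → ¬(0 ≤ b - k ∧ b - k ≤ M) → F b = 0) :
    ∑ a ∈ Icc 0 M, F (a + k) = ∑ b ∈ Icc 0 M, F b := by
  have e : ∑ a ∈ Icc 0 M, F (a + k) = ∑ b ∈ (Icc 0 M).map (addRightEmbedding k), F b := by
    rw [sum_map]; rfl
  rw [e]
  refine sum_congr_of_eq_on_inter (fun b _ hb => h b (by simpa using hb)) (fun b hb hb' => ?_)
    fun _ _ _ => rfl
  rw [mem_Icc] at hb
  refine h' b hb.1 hb.2 fun hk => hb' ?_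
  rw [mem_map]
  exact ⟨b - k, mem_Icc.2 hk, by simp⟩

theorem Phi_boundary (q c₁ c₂ c₃ : ℂ) (M : ℤ) (ε : SignType) (hb : 0 ≤ b) (hbM : b ≤ M)
    (h : ¬(0 ≤ b - ε ∧ b - ε ≤ M)) : Phi q c₁ c₂ c₃ M ε b = 0 := by
  rcases (by decide : ∀ δ : SignType, δ = -1 ∨ δ = 0 ∨ δ = 1) ε with rfl | rfl | rfl
  · have e : ((-1 : SignType) : ℤ) = -1 := rfl
    rw [e] at h
    obtain rfl : b = M := by omega
    change PhiNeg q c₁ c₂ c₃ b b = 0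
    simp [PhiNeg]
  · have e : ((0 : SignType) : ℤ) = 0 := rfl
    rw [e] at h
    omega
  · have e : ((1 : SignType) : ℤ) = 1 := rfl
    rw [e] at h
    obtain rfl : b = 0 := by omega
    change PhiPos q c₁ c₂ c₃ M 0 = 0
    simp [PhiPos]

/-- `Phi_mul_racah` with (c₀,c₁,c₂,c₃,c₄) replaced by (c₂,c₃,c₀,c₄,c₁), j by b and a by y. The first
factor is carried along since it removes the values b − ε > N − j. -/
theorem Phi_mul_racah_mul (H : Roots s d₀ d₁ d₂ d₃ d₄ q c₀ c₁ c₂ c₃ c₄ N)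
    (G : GenericGriffiths q c₀ c₁ c₂ c₃ c₄ N) (ε : SignType) (hj : 0 ≤ j) (hi : 0 ≤ i)
    (hij : i + j ≤ N) (hy : 0 ≤ y) (hb : 0 ≤ b) (hbN : b + y ≤ N) :
    racah s d₁ d₂ d₃ (N - j) i (b - ε) *
        (Phi q c₄ c₂ c₁ (N - y) ε b * racah s d₃ d₀ d₄ (N - (b - ε)) j y) =
      racah s d₁ d₂ d₃ (N - j) i (b - ε) *
        ∑ ε' : SignType, coeffA s d₂ d₃ d₀ d₄ d₁ N ε' ε (j + ε') b *
          racah s d₃ d₀ d₄ (N - b) (j + ε') y := by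
  by_cases hN : b - ε ≤ N - j
  swap
  · rw [racah_eq_zero_of_not (x := b - ε) (by omega), zero_mul, zero_mul]
  by_cases hε : 0 ≤ b - ε
  · rw [show N - (b - ε) = N - b + ε by ring, Phi_mul_racah H.hs H.h₂ H.h₃ H.h₀ H.h₄ H.h₁
      (by rw [← H.prod_sq]; ring) G.h304 G.h421 ε hb hy hbN hj (by omega) hε]
  · have h1 := signType_le_one ε
    obtain rfl : b = 0 := by omega
    obtain rfl : ε = 1 := by
      rcases (by decide : ∀ δ : SignType, δ = -1 ∨ δ = 0 ∨ δ = 1) ε with rfl | rfl | rfl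
      · exact absurd (by decide) hε
      · exact absurd (by decide) hε
      · rfl
    -- The only remaining edge is b = 0, ε = 1, where the shifted variable is −1: both sides vanish,
    -- the right one through the factor 1 − q^b of F⁺_b.
    have hc : ∀ ε', coeffA s d₂ d₃ d₀ d₄ d₁ N ε' 1 (j + (ε' : SignType)) 0 = 0 := fun ε' => by
      rw [coeffA_up_eq H G.h421 (by omega)]; simp [wPos]
    rw [Phi_boundary _ _ _ _ _ _ hb (by omega) (by omega)]
    simp [hc]

theorem second_relation (H : Roots s d₀ d₁ d₂ d₃ d₄ q c₀ c₁ c₂ c₃ c₄ N)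
    (G : GenericGriffiths q c₀ c₁ c₂ c₃ c₄ N) (hi : 0 ≤ i) (hj : 0 ≤ j) (hij : i + j ≤ N)
    (hx : 0 ≤ x) (hy : 0 ≤ y) (hxy : x + y ≤ N) :
    lam q (c₄ * c₂) x * griffiths s d₀ d₁ d₂ d₃ d₄ N i j x y =
      ∑ δ : SignType, ∑ ε' : SignType,
        omegaRatio s d₀ d₁ d₂ d₃ d₄ (q ^ i) (q ^ j) δ ε' *
          coeffA s d₂ d₁ d₀ d₄ d₃ N ε' δ (j + ε') (i + δ) *
            griffiths s d₀ d₁ d₂ d₃ d₄ N (i + δ) (j + ε') x y := by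
  simp only [griffiths_eq_sum_Icc hy]
  set w := omegaFn s (d₁ * d₂ * d₃ / d₄) with hw
  set F : SignType → ℤ → ℂ := fun ε b => w (b - ε) * racah s d₁ d₂ d₃ (N - j) i (b - ε) *
    racah s d₃ d₀ d₄ (N - (b - ε)) j y *
      (Phi q c₄ c₂ c₁ (N - y) ε b * racah s d₄ d₂ d₁ (N - y) b x) with hF
  -- The recurrence of the third factor raises or lowers a; resumming over b = a + ε leaves the
  -- third factor unshifted and moves the shift to the other two.
  have hshift : lam q (c₄ * c₂) x * ∑ a ∈ Icc 0 (N - y),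
      w a * racah s d₁ d₂ d₃ (N - j) i a * racah s d₃ d₀ d₄ (N - a) j y *
        racah s d₄ d₂ d₁ (N - y) a x = ∑ b ∈ Icc 0 (N - y), ∑ ε, F ε b := by
    calc _ = ∑ ε : SignType, ∑ a ∈ Icc 0 (N - y), F ε (a + ε) := by
          rw [sum_comm, mul_sum]
          refine sum_congr rfl fun a ha => ?_
          rw [mem_Icc] at ha
          rw [mul_left_comm, racah_recurrence H.hs H.h₄ H.h₂ H.h₁ G.h421 ha.1 ha.2 hx (by omega)
            (by omega), mul_sum]
          refine sum_congr rfl fun ε _ => ?_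
          simp only [hF, add_sub_cancel_right]
      _ = _ := by
          rw [sum_comm (s := Icc 0 (N - y))]
          refine sum_congr rfl fun ε _ => sum_Icc_add _ _ _ (fun b hb => ?_) fun b hb hb' h => ?_
          · simp only [hF]
            rw [racah_eq_zero_of_not (M := N - y) (by omega), mul_zero, mul_zero]
          · simp only [hF]
            rw [Phi_boundary _ _ _ _ _ _ hb hb' h, zero_mul, mul_zero]
  rw [hshift]
  simp only [mul_sum]
  simp only [sum_comm (t := Icc 0 (N - y))]
  refine sum_congr rfl fun b hb => ?_
  rw [mem_Icc] at hb
  -- The middle factor is kept as a multiplier so that the intertwining relation is needed only for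
  -- j + ε' in the range 0, …, N − b.
  have hD : ∀ ε' : SignType, racah s d₃ d₀ d₄ (N - b) (j + ε') y * (∑ ε : SignType,
      w (b - ε) * coeffA s d₂ d₃ d₀ d₄ d₁ N ε' ε (j + ε') b * racah s d₁ d₂ d₃ (N - j) i (b - ε)) =
      racah s d₃ d₀ d₄ (N - b) (j + ε') y * (w b * ∑ δ : SignType,
        omegaRatio s d₀ d₁ d₂ d₃ d₄ (q ^ i) (q ^ j) δ ε' *
          coeffA s d₂ d₁ d₀ d₄ d₃ N ε' δ (j + ε') (i + δ) *
            racah s d₁ d₂ d₃ (N - (j + ε')) (i + δ) b) := fun ε' => by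
    by_cases hj' : 0 ≤ j + ε' ∧ j + ε' ≤ N - b
    · rw [coeffA_intertwine H G ε' hj hj'.1 hi hij hb.1 (by omega)]
    · rw [racah_eq_zero_of_not (n := j + ε') (by omega), zero_mul, zero_mul]
  calc ∑ ε : SignType, F ε b = racah s d₄ d₂ d₁ (N - y) b x * ∑ ε : SignType, w (b - ε) *
        (racah s d₁ d₂ d₃ (N - j) i (b - ε) *
          (Phi q c₄ c₂ c₁ (N - y) ε b * racah s d₃ d₀ d₄ (N - (b - ε)) j y)) := by
        rw [mul_sum]
        exact sum_congr rfl fun _ _ => by simp only [hF]; ring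
    _ = racah s d₄ d₂ d₁ (N - y) b x * ∑ ε' : SignType, racah s d₃ d₀ d₄ (N - b) (j + ε') y *
        (∑ ε : SignType, w (b - ε) * coeffA s d₂ d₃ d₀ d₄ d₁ N ε' ε (j + ε') b *
          racah s d₁ d₂ d₃ (N - j) i (b - ε)) := by
        congr 1
        simp only [Phi_mul_racah_mul H G _ hj hi hij hy hb.1 (by omega : b + y ≤ N), mul_sum]
        rw [sum_comm]
        exact sum_congr rfl fun _ _ => sum_congr rfl fun _ _ => by ring
    _ = _ := by
        simp only [hD, mul_sum]
        rw [sum_comm]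
        exact sum_congr rfl fun _ _ => sum_congr rfl fun _ _ => by ring

end SecondRelation

/-! ### Continuity of the coefficients under the actual assumptions. -/

section Continuity

variable {X : Type*} [TopologicalSpace X] {p : X} {q t a c₀ c₁ c₂ c₃ c₄ s d₀ d₁ d₂ d₃ d₄ : X → ℂ}
  {K M N n : ℤ}

/-- The absence of poles in the factors `1 - t q ^ k`, `2 ≤ k ≤ 2 K`. -/
def Regular (q t : ℂ) (K : ℤ) : Prop := ∀ k : ℤ, 2 ≤ k → k ≤ 2 * K → 1 - t * q ^ k ≠ 0

theorem continuousAt_qPoch (hq : ContinuousAt q p) (ha : ContinuousAt a p) (k : ℕ) :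
    ContinuousAt (fun x => qPoch (q x) (a x) k) p := by
  unfold qPoch
  fun_prop

theorem continuousAt_quot (hq : ContinuousAt q p) (hq0 : q p ≠ 0) (ht : ContinuousAt t p) {m n : ℤ}
    (h : m ≠ n → 1 - t p * q p ^ n ≠ 0) : ContinuousAt (fun x => quot (q x) (t x) m n) p := by
  unfold quot
  split_ifs with hmn
  · exact continuousAt_const
  · have := h hmn
    fun_prop (disch := first | assumption | exact Or.inl hq0)

/-- The exponents 2n and 2n + 1 could leave the range 2, …, 2K only at the ends. At n = 0 the
coefficient is identically zero, and at n = M the quotient with denominator exponent 2n + 1 is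
identically 1. -/
theorem continuousAt_PhiPos (hq : ContinuousAt q p) (hq0 : q p ≠ 0) (h₁ : ContinuousAt c₁ p)
    (h₂ : ContinuousAt c₂ p) (h₃ : ContinuousAt c₃ p) (h : Regular (q p) (c₂ p * c₃ p) K)
    (hn : 0 ≤ n) (hnM : n ≤ M) (hM : M ≤ K) :
    ContinuousAt (fun x => PhiPos (q x) (c₁ x) (c₂ x) (c₃ x) M n) p := by
  unfold PhiPos
  rcases hn.eq_or_lt with rfl | hn
  · simp [continuousAt_const]
  · have e1 := h (2 * n) (by omega) (by omega)
    refine .mul (by fun_prop (disch := first | assumption | exact Or.inl hq0))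
      (continuousAt_quot hq hq0 (by fun_prop) fun hne => h _ (by omega) (by omega))

theorem continuousAt_PhiNeg (hq : ContinuousAt q p) (hq0 : q p ≠ 0) (h₁ : ContinuousAt c₁ p)
    (h₂ : ContinuousAt c₂ p) (h₃ : ContinuousAt c₃ p) (h : Regular (q p) (c₂ p * c₃ p) K)
    (hn : 0 ≤ n) (hnM : n ≤ M) (hM : M ≤ K) :
    ContinuousAt (fun x => PhiNeg (q x) (c₁ x) (c₂ x) (c₃ x) M n) p := by
  unfold PhiNeg
  rcases hnM.eq_or_lt with rfl | hnM
  · simp [continuousAt_const]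
  · have e1 := h (2 * n + 2) (by omega) (by omega)
    refine .mul (by fun_prop (disch := first | assumption | exact Or.inl hq0))
      (continuousAt_quot hq hq0 (by fun_prop) fun hne => h _ (by omega) (by omega))

theorem continuousAt_Phi (hq : ContinuousAt q p) (hq0 : q p ≠ 0) (h₁ : ContinuousAt c₁ p)
    (h₂ : ContinuousAt c₂ p) (h₃ : ContinuousAt c₃ p) (h : Regular (q p) (c₂ p * c₃ p) K)
    (hn : 0 ≤ n) (hnM : n ≤ M) (hM : M ≤ K) (ε : SignType) :
    ContinuousAt (fun x => Phi (q x) (c₁ x) (c₂ x) (c₃ x) M ε n) p := by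
  have h1 := continuousAt_PhiPos hq hq0 h₁ h₂ h₃ h hn hnM hM
  have h2 := continuousAt_PhiNeg hq hq0 h₁ h₂ h₃ h hn hnM hM
  cases ε
  · exact h1.neg.sub h2
  · exact h2
  · exact h1

theorem continuousAt_PhiUp (hs : ContinuousAt s p) (hs0 : s p ≠ 0) (h₁ : ContinuousAt d₁ p)
    (h₂ : ContinuousAt d₂ p) (h₃ : ContinuousAt d₃ p) (h₂0 : d₂ p ≠ 0) (h₃0 : d₃ p ≠ 0)
    (h : Regular (s p ^ 2) (d₂ p ^ 2 * d₃ p ^ 2) K)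
    (hn : 0 ≤ n) (hnM : n ≤ M) (hM : M + 1 ≤ K) (ε : SignType) :
    ContinuousAt (fun x => PhiUp (s x) (d₁ x) (d₂ x) (d₃ x) M ε n) p := by
  have hq0 : s p ^ 2 ≠ 0 := pow_ne_zero 2 hs0
  have hd0 : d₃ p ^ 2 * (s p ^ 2) ^ (M + 1) * (s p * d₂ p) ≠ 0 := by positivity
  have h1 : ContinuousAt (fun x => PhiUpPos (s x) (d₁ x) (d₂ x) (d₃ x) M n) p := by
    unfold PhiUpPos
    rcases hn.eq_or_lt with rfl | hn
    · simp [continuousAt_const]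
    · have e1 := mul_ne_zero (h (2 * n) (by omega) (by omega)) (h (2 * n + 1) (by omega) (by omega))
      fun_prop (disch := first | assumption | exact Or.inl hq0)
  have h2 : ContinuousAt (fun x => PhiUpNeg (s x) (d₁ x) (d₂ x) (d₃ x) M n) p := by
    unfold PhiUpNeg
    have e1 := mul_ne_zero hd0 (h (2 * n + 2) (by omega) (by omega))
    exact .mul (by fun_prop (disch := first | assumption | exact Or.inl hq0))
      (continuousAt_quot (hs.pow 2) hq0 (by fun_prop) fun hne => h _ (by omega) (by omega))
  cases ε
  · exact (h1.add h2).neg.sub (by fun_prop (disch := first | assumption | exact Or.inl hq0))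
  · exact h2
  · exact h1

theorem continuousAt_PhiDown (hs : ContinuousAt s p) (hs0 : s p ≠ 0)
    (h₂ : ContinuousAt d₂ p) (h₃ : ContinuousAt d₃ p)
    (h : Regular (s p ^ 2) (d₂ p ^ 2 * d₃ p ^ 2) K)
    (hn : 0 ≤ n) (hnM : n ≤ M) (hM : M ≤ K) (ε : SignType) :
    ContinuousAt (fun x => PhiDown (s x) (d₂ x) (d₃ x) M ε n) p := by
  have hq0 : s p ^ 2 ≠ 0 := pow_ne_zero 2 hs0
  have hq1 : (s p ^ 2) ^ M ≠ 0 := zpow_ne_zero _ hq0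
  have h1 : ContinuousAt (fun x => PhiDownPos (s x) (d₂ x) (d₃ x) M n) p := by
    unfold PhiDownPos
    rcases hn.eq_or_lt with rfl | hn
    · simp [continuousAt_const]
    · exact .mul (.mul (by fun_prop (disch := first | assumption | exact Or.inl hq0))
        (continuousAt_quot (hs.pow 2) hq0 (by fun_prop) fun hne => h _ (by omega) (by omega)))
        (continuousAt_quot (hs.pow 2) hq0 (by fun_prop) fun hne => h _ (by omega) (by omega))
  have h2 : ContinuousAt (fun x => PhiDownNeg (s x) (d₂ x) (d₃ x) M n) p := by
    unfold PhiDownNeg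
    rcases hnM.eq_or_lt with rfl | hnM
    · simp [continuousAt_const]
    · have e1 := h (2 * n + 2) (by omega) (by omega)
      exact .mul (by fun_prop (disch := first | assumption | exact Or.inl hq0))
        (continuousAt_quot (hs.pow 2) hq0 (by fun_prop) fun hne => h _ (by omega) (by omega))
  cases ε
  · exact (h1.add h2).neg.sub (by fun_prop (disch := first | assumption | exact Or.inl hq0))
  · exact h2
  · exact h1

theorem continuousAt_FNeg (hq : ContinuousAt q p) (hq0 : q p ≠ 0) (h₁ : ContinuousAt c₁ p)
    (h₂ : ContinuousAt c₂ p) (h : Regular (q p) (c₁ p * c₂ p) K) (hn : 0 ≤ n) (hnK : n + 1 ≤ K) :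
    ContinuousAt (fun x => FNeg (q x) (c₁ x) (c₂ x) n) p := by
  unfold FNeg
  have e1 := h (2 * n + 2) (by omega) (by omega)
  exact .mul (by fun_prop (disch := first | assumption | exact Or.inl hq0))
    (continuousAt_quot hq hq0 (by fun_prop) fun hne => h _ (by omega) (by omega))

theorem FPosNum_zero (q c₁ c₂ : ℂ) : FPosNum q c₁ c₂ 0 = 0 := by simp [FPosNum]

theorem FPos_zero (q c₁ c₂ : ℂ) : FPos q c₁ c₂ 0 = 0 := by simp [FPos, FPosNum_zero]

theorem continuousAt_FPosNum (hq : ContinuousAt q p) (hq0 : q p ≠ 0) (h₁ : ContinuousAt c₁ p)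
    (h₂ : ContinuousAt c₂ p) (h : Regular (q p) (c₁ p * c₂ p) K) (hn : 0 ≤ n) (hnK : n ≤ K) :
    ContinuousAt (fun x => FPosNum (q x) (c₁ x) (c₂ x) n) p := by
  rcases hn.eq_or_lt with rfl | hn
  · simp [FPosNum_zero, continuousAt_const]
  · unfold FPosNum
    have e1 := h (2 * n) (by omega) (by omega)
    fun_prop (disch := first | assumption | exact Or.inl hq0)

theorem continuousAt_FPos (hq : ContinuousAt q p) (hq0 : q p ≠ 0) (h₁ : ContinuousAt c₁ p)
    (h₂ : ContinuousAt c₂ p) (h : Regular (q p) (c₁ p * c₂ p) K) (hn : 0 ≤ n) (hnK : n + 1 ≤ K) :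
    ContinuousAt (fun x => FPos (q x) (c₁ x) (c₂ x) n) p := by
  rcases hn.eq_or_lt with rfl | hn
  · simp [FPos_zero, continuousAt_const]
  · unfold FPos
    have e1 := h (2 * n + 1) (by omega) (by omega)
    have e2 := continuousAt_FPosNum hq hq0 h₁ h₂ h hn.le (by omega)
    fun_prop (disch := first | assumption | exact Or.inl hq0)

theorem continuousAt_FPosMul (hq : ContinuousAt q p) (hq0 : q p ≠ 0) (h₀ : ContinuousAt c₀ p)
    (h₁ : ContinuousAt c₁ p) (h₂ : ContinuousAt c₂ p) (h₃ : ContinuousAt c₃ p)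
    (h₄ : ContinuousAt c₄ p) (h : Regular (q p) (c₄ p * c₀ p) N) {j : ℤ} (hj : 0 ≤ j) (hjN : j ≤ N) :
    ContinuousAt (fun x => FPosMul (q x) (c₀ x) (c₁ x) (c₂ x) (c₃ x) (c₄ x) N j) p := by
  unfold FPosMul
  split_ifs with e
  · have e2 := continuousAt_FPosNum hq hq0 h₄ h₀ h hj hjN
    fun_prop (disch := first | assumption | exact Or.inl hq0)
  · have e2 := continuousAt_FPos hq hq0 h₄ h₀ h hj (by omega)
    fun_prop (disch := first | assumption | exact Or.inl hq0)

theorem continuousAt_FPosPhiUp (hs : ContinuousAt s p) (hs0 : s p ≠ 0) (h₀ : ContinuousAt d₀ p)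
    (h₁ : ContinuousAt d₁ p) (h₂ : ContinuousAt d₂ p) (h₃ : ContinuousAt d₃ p)
    (h₄ : ContinuousAt d₄ p) (h₂0 : d₂ p ≠ 0) (h₃0 : d₃ p ≠ 0)
    (h : Regular (s p ^ 2) (d₂ p ^ 2 * d₃ p ^ 2) N)
    (h' : Regular (s p ^ 2) (d₄ p ^ 2 * d₀ p ^ 2) N) {i j : ℤ} (hi : 0 ≤ i) (hj : 0 ≤ j)
    (hij : i + j ≤ N) (ε : SignType) :
    ContinuousAt (fun x => FPosPhiUp (s x) (d₀ x) (d₁ x) (d₂ x) (d₃ x) (d₄ x) N ε i j) p := by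
  have hq0 : s p ^ 2 ≠ 0 := pow_ne_zero 2 hs0
  -- For j = 0 the factor F⁺ is identically zero. This is the case where Φ_+ has level N, to which
  -- its continuity lemma does not apply.
  rcases hj.eq_or_lt with rfl | hj1
  · have : ∀ x, FPosPhiUp (s x) (d₀ x) (d₁ x) (d₂ x) (d₃ x) (d₄ x) N ε i 0 = 0 := fun x => by
      simp [FPosPhiUp, FPosMul, FPos_zero, FPosNum_zero]
    simp [this, continuousAt_const]
  have e1 := continuousAt_FPosMul (hs.pow 2) hq0 (h₀.pow 2) (h₁.pow 2) (h₂.pow 2) (h₃.pow 2)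
    (h₄.pow 2) h' hj (by omega)
  unfold FPosPhiUp
  simp only
  split_ifs with e
  · have e2 : d₃ p ^ 2 * s p ^ 2 * (s p * d₂ p) ≠ 0 := by positivity
    have e3 := mul_ne_zero e2 (h 2 (by omega) (by omega))
    rw [zpow_ofNat] at e3
    refine e1.mul ?_
    cases ε
    · simp only
      fun_prop (disch := first | assumption | exact Or.inl hq0)
    · simp only
      fun_prop (disch := first | assumption | exact Or.inl hq0)
    · exact continuousAt_const
  · rcases (show j ≤ N by omega).eq_or_lt with rfl | hjN
    · omega
    · exact (continuousAt_FPos (hs.pow 2) hq0 (h₄.pow 2) (h₀.pow 2) h' hj (by omega)).mul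
        (continuousAt_PhiUp hs hs0 h₁ h₂ h₃ h₂0 h₃0 h hi (by omega) (by omega) ε)

theorem continuousAt_gCoeff (hq : ContinuousAt q p) (hq0 : q p ≠ 0) (h₀ : ContinuousAt c₀ p)
    (h₁ : ContinuousAt c₁ p) (h₂ : ContinuousAt c₂ p) (h₃ : ContinuousAt c₃ p)
    (h₄ : ContinuousAt c₄ p) (h : Regular (q p) (c₄ p * c₀ p) N) {j : ℤ} (hj : 0 ≤ j) (hjN : j ≤ N) :
    ContinuousAt (fun x => gCoeff (q x) (c₀ x) (c₁ x) (c₂ x) (c₃ x) (c₄ x) N j) p := by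
  have e1 := continuousAt_FPosMul hq hq0 h₀ h₁ h₂ h₃ h₄ h hj hjN
  unfold gCoeff
  refine .sub (by fun_prop (disch := first | assumption | exact Or.inl hq0)) ?_
  -- At j = N the pole of F⁻ is accompanied by the factor 1 − q^(N−j), identically zero.
  rcases hjN.eq_or_lt with rfl | hjN
  · simp [continuousAt_const]
  · have e2 := continuousAt_FNeg hq hq0 h₄ h₀ h hj (by omega)
    fun_prop (disch := first | assumption | exact Or.inl hq0)

theorem Phi_level_zero (q c₁ c₂ c₃ : ℂ) (ε : SignType) : Phi q c₁ c₂ c₃ 0 ε 0 = 0 := by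
  cases ε <;> simp [Phi, PhiPos, PhiNeg]

theorem PhiDown_level_zero (s d₂ d₃ : ℂ) (ε : SignType) : PhiDown s d₂ d₃ 0 ε 0 = 0 := by
  cases ε <;> simp [PhiDown, PhiDownPos, PhiDownNeg]

/-- For j = N one has i = 0, where F^± may have poles; there Φ and Φ_− at level 0 vanish
identically, and the product with Φ_+ is regularized in `FPosPhiUp`. -/
theorem continuousAt_coeffA (hs : ContinuousAt s p) (hs0 : s p ≠ 0) (h₀ : ContinuousAt d₀ p)
    (h₁ : ContinuousAt d₁ p) (h₂ : ContinuousAt d₂ p) (h₃ : ContinuousAt d₃ p)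
    (h₄ : ContinuousAt d₄ p) (h₂0 : d₂ p ≠ 0) (h₃0 : d₃ p ≠ 0)
    (h : Regular (s p ^ 2) (d₂ p ^ 2 * d₃ p ^ 2) N)
    (h' : Regular (s p ^ 2) (d₄ p ^ 2 * d₀ p ^ 2) N) {i j : ℤ} (hi : 0 ≤ i) (hj : 0 ≤ j)
    (hij : i + j ≤ N) (ε ε' : SignType) :
    ContinuousAt (fun x => coeffA (s x) (d₀ x) (d₁ x) (d₂ x) (d₃ x) (d₄ x) N ε ε' i j) p := by
  have hq0 : s p ^ 2 ≠ 0 := pow_ne_zero 2 hs0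
  have hw : ContinuousAt (fun x => d₃ x ^ 2 * (s x ^ 2) ^ (N + 1)) p := by
    fun_prop (disch := first | assumption | exact Or.inl hq0)
  have hmid : ∀ ε : SignType, ContinuousAt (fun x => d₃ x ^ 2 * (s x ^ 2) ^ (N + 1) *
      (FPos (s x ^ 2) (d₄ x ^ 2) (d₀ x ^ 2) j + FNeg (s x ^ 2) (d₄ x ^ 2) (d₀ x ^ 2) j) *
      Phi (s x ^ 2) (d₁ x ^ 2) (d₂ x ^ 2) (d₃ x ^ 2) (N - j) ε i) p := fun ε => by
    rcases (show j ≤ N by omega).eq_or_lt with rfl | hjN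
    · obtain rfl : i = 0 := by omega
      simp [Phi_level_zero, continuousAt_const]
    · exact (hw.mul ((continuousAt_FPos (hs.pow 2) hq0 (h₄.pow 2) (h₀.pow 2) h' hj (by omega)).add
        (continuousAt_FNeg (hs.pow 2) hq0 (h₄.pow 2) (h₀.pow 2) h' hj (by omega)))).mul
        (continuousAt_Phi (hs.pow 2) hq0 (h₁.pow 2) (h₂.pow 2) (h₃.pow 2) h hi (by omega)
          (by omega) ε)
  cases ε'
  · cases ε
    · exact (continuousAt_gCoeff (hs.pow 2) hq0 (h₀.pow 2) (h₁.pow 2) (h₂.pow 2) (h₃.pow 2)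
        (h₄.pow 2) h' hj (by omega)).sub ((hmid .pos).add (hmid .neg))
    · exact hmid .neg
    · exact hmid .pos
  · have f : ∀ x, coeffA (s x) (d₀ x) (d₁ x) (d₂ x) (d₃ x) (d₄ x) N ε .neg i j =
        -d₃ x ^ 2 * (s x ^ 2) ^ (N + 1) * (FNeg (s x ^ 2) (d₄ x ^ 2) (d₀ x ^ 2) j *
          PhiDown (s x) (d₂ x) (d₃ x) (N - j) ε i) := fun x => by cases ε <;> rfl
    simp only [f]
    rcases (show j ≤ N by omega).eq_or_lt with rfl | hjN
    · obtain rfl : i = 0 := by omega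
      simp [PhiDown_level_zero, continuousAt_const]
    · have e1 := continuousAt_FNeg (hs.pow 2) hq0 (h₄.pow 2) (h₀.pow 2) h' hj (by omega)
      have e2 := continuousAt_PhiDown hs hs0 h₂ h₃ h hi (by omega) (by omega : N - j ≤ N) ε
      simp only [neg_mul]
      exact (hw.mul (e1.mul e2)).neg
  · have f : ∀ x, coeffA (s x) (d₀ x) (d₁ x) (d₂ x) (d₃ x) (d₄ x) N ε .pos i j =
        -(d₃ x ^ 2 * (s x ^ 2) ^ (N + 1) * FPosPhiUp (s x) (d₀ x) (d₁ x) (d₂ x) (d₃ x) (d₄ x) N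
          ε i j) := fun x => by cases ε <;> simp [coeffA]
    simp only [f]
    exact (hw.mul (continuousAt_FPosPhiUp hs hs0 h₀ h₁ h₂ h₃ h₄ h₂0 h₃0 h h' hi hj hij ε)).neg

end Continuity

/-! ### Continuity of the univariate and bivariate polynomials. -/

section RacahContinuity

variable {X : Type*} [TopologicalSpace X] {p : X} {s e d₀ d₁ d₂ d₃ d₄ : X → ℂ} {K M N n : ℤ}

/-- The absence of poles in the `q`-Racah polynomials up to level `K`. -/
structure RegularRacah (q c₁ c₂ c₃ : ℂ) (K : ℤ) : Prop where
  q_ne : q ≠ 0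
  c₂_ne : c₂ ≠ 0
  q_pow : ∀ k : ℤ, 1 ≤ k → k ≤ K → 1 - q ^ k ≠ 0
  c₂_pow : ∀ k : ℤ, 1 ≤ k → k ≤ K → 1 - c₂ * q ^ k ≠ 0
  c₃_pow : ∀ k : ℤ, 1 ≤ k → k ≤ K → 1 - c₃ * q ^ k ≠ 0
  reg₂₃ : Regular q (c₂ * c₃) K
  reg₁₂₃ : ∀ k : ℤ, 3 ≤ k → k ≤ 2 * K + 1 → 1 - c₁ * c₂ * c₃ * q ^ k ≠ 0

theorem qPoch_mul_ne_zero {q c : ℂ} (h : ∀ k : ℤ, 1 ≤ k → k ≤ K → 1 - c * q ^ k ≠ 0) {k : ℕ}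
    (hk : (k : ℤ) ≤ K) : qPoch q (q * c) k ≠ 0 := by
  refine qPoch_ne_zero fun l hl => ?_
  have := h (l + 1 : ℕ) (by omega) (by omega)
  rwa [zpow_natCast, pow_succ', ← mul_assoc, mul_comm c] at this

theorem qPoch_self_ne_zero {q : ℂ} (h : ∀ k : ℤ, 1 ≤ k → k ≤ K → 1 - q ^ k ≠ 0) {k : ℕ}
    (hk : (k : ℤ) ≤ K) : qPoch q q k ≠ 0 := by
  have := qPoch_mul_ne_zero (c := 1) (by simpa using h) hk
  rwa [mul_one] at this

theorem continuousAt_qBinom {q : X → ℂ} (hq : ContinuousAt q p)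
    (h : ∀ k : ℤ, 1 ≤ k → k ≤ K → 1 - q p ^ k ≠ 0) (hM : M ≤ K) (n : ℤ) :
    ContinuousAt (fun x => qBinom (q x) M n) p := by
  unfold qBinom
  split_ifs with hn
  · have e := mul_ne_zero (qPoch_self_ne_zero h (k := n.toNat) (by omega))
      (qPoch_self_ne_zero h (k := (M - n).toNat) (by omega))
    have c := fun k => continuousAt_qPoch hq hq k
    exact (c _).div ((c _).mul (c _)) e
  · exact continuousAt_const

theorem continuousAt_Omega (hs : ContinuousAt s p) (h₁ : ContinuousAt d₁ p)
    (h₂ : ContinuousAt d₂ p) (h₃ : ContinuousAt d₃ p)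
    (h : RegularRacah (s p ^ 2) (d₁ p ^ 2) (d₂ p ^ 2) (d₃ p ^ 2) K)
    (hn : 0 ≤ n) (hnM : n ≤ M) (hM : M ≤ K) :
    ContinuousAt (fun x => Omega (s x) (d₁ x) (d₂ x) (d₃ x) M n) p := by
  have hq := h.q_ne
  have hr : s p * d₂ p ≠ 0 := mul_ne_zero (ne_zero_pow two_ne_zero hq)
    (ne_zero_pow two_ne_zero h.c₂_ne)
  have hr' := zpow_ne_zero (2 * n - M) hr
  -- With l = n removed, the exponents n + 1 + l run within 2, …, 2M, exactly the range that is
  -- assumed regular.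
  have hP : ∏ l ∈ (range (M.toNat + 1)).erase n.toNat,
      (1 - d₂ p ^ 2 * d₃ p ^ 2 * (s p ^ 2) ^ (n + 1) * (s p ^ 2) ^ l) ≠ 0 := by
    refine prod_ne_zero_iff.2 fun l hl => ?_
    rw [mem_erase, mem_range] at hl
    have := h.reg₂₃ (n + 1 + l) (by omega) (by omega)
    rwa [zpow_add₀ hq, zpow_natCast, ← mul_assoc] at this
  have hQ := qPoch_mul_ne_zero h.c₃_pow (k := n.toNat) (by omega)
  have c1 := continuousAt_qBinom (hs.pow 2) h.q_pow hM n
  have c2 := continuousAt_qPoch (hs.pow 2) ((hs.pow 2).mul (h₂.pow 2)) n.toNat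
  have c3 := continuousAt_qPoch (hs.pow 2) (a := fun x => d₁ x ^ 2 * d₂ x ^ 2 * d₃ x ^ 2 *
    (s x ^ 2) ^ (M + 2)) (by fun_prop (disch := exact Or.inl hq)) n.toNat
  have c4 := continuousAt_qPoch (hs.pow 2) ((hs.pow 2).mul (h₁.pow 2)) (M - n).toNat
  have c5 := continuousAt_qPoch (hs.pow 2) ((hs.pow 2).mul (h₃.pow 2)) n.toNat
  unfold Omega
  refine (c1.mul ((c2.mul c3).mul c4)).div (.mul (.mul ?_ ?_) c5) ?_
  · fun_prop (disch := exact Or.inl hr)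
  · fun_prop (disch := exact Or.inl hq)
  · exact mul_ne_zero (mul_ne_zero hr' hP) hQ

theorem continuousAt_racah (hs : ContinuousAt s p) (h₁ : ContinuousAt d₁ p)
    (h₂ : ContinuousAt d₂ p) (h₃ : ContinuousAt d₃ p)
    (h : RegularRacah (s p ^ 2) (d₁ p ^ 2) (d₂ p ^ 2) (d₃ p ^ 2) K) (hM : M ≤ K) (n y : ℤ) :
    ContinuousAt (fun x => racah (s x) (d₁ x) (d₂ x) (d₃ x) M n y) p := by
  have hq := h.q_ne
  unfold racah
  simp only
  split_ifs with hn
  swap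
  · exact continuousAt_const
  refine (continuousAt_Omega hs h₁ h₂ h₃ h hn.1 hn.2.1 hM).mul ?_
  unfold phi43
  refine tendsto_finsetSum _ fun k hk => ?_
  rw [mem_range] at hk
  have z : ∀ m : ℤ, ContinuousAt (fun x => (s x ^ 2) ^ m) p := fun m => by
    fun_prop (disch := exact Or.inl hq)
  have c1 := continuousAt_qPoch (hs.pow 2) (z (-(n.toNat : ℤ))) k
  have c2 := continuousAt_qPoch (hs.pow 2) (((h₂.pow 2).mul (h₃.pow 2)).mul (z (n + 1))) k
  have c3 := continuousAt_qPoch (hs.pow 2) (z (-y)) k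
  have c4 := continuousAt_qPoch (hs.pow 2) (((h₁.pow 2).mul (h₂.pow 2)).mul (z (y + 1))) k
  have c5 := continuousAt_qPoch (hs.pow 2) ((hs.pow 2).mul (h₂.pow 2)) k
  have c6 := continuousAt_qPoch (hs.pow 2)
    ((((h₁.pow 2).mul (h₂.pow 2)).mul (h₃.pow 2)).mul (z (M + 2))) k
  have c7 := continuousAt_qPoch (hs.pow 2) (z (-M)) k
  have c8 := continuousAt_qPoch (hs.pow 2) (hs.pow 2) k
  have n5 := qPoch_mul_ne_zero h.c₂_pow (k := k) (by omega)
  have n6 : qPoch (s p ^ 2) (d₁ p ^ 2 * d₂ p ^ 2 * d₃ p ^ 2 * (s p ^ 2) ^ (M + 2)) k ≠ 0 := by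
    refine qPoch_ne_zero fun l hl => ?_
    have := h.reg₁₂₃ (M + 2 + l) (by omega) (by omega)
    rwa [zpow_add₀ hq, zpow_natCast, ← mul_assoc] at this
  have n7 : qPoch (s p ^ 2) ((s p ^ 2) ^ (-M)) k ≠ 0 := by
    refine qPoch_ne_zero fun l hl => ?_
    have := h.q_pow (M - l) (by omega) (by omega)
    rw [← zpow_natCast (s p ^ 2) l, ← zpow_add₀ hq]
    intro h0
    apply this
    have h1 : (s p ^ 2) ^ (-M + (l : ℤ)) = 1 := (sub_eq_zero.1 h0).symm
    rw [show M - (l : ℤ) = -(-M + l) by ring, zpow_neg, h1, inv_one, sub_self]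
  have n8 := qPoch_self_ne_zero h.q_pow (k := k) (by omega)
  exact ((((c1.mul c2).mul c3).mul c4).div ((c5.mul c6).mul c7)
    (mul_ne_zero (mul_ne_zero n5 n6) n7)).mul (((hs.pow 2).pow k).div c8 n8)

theorem continuousAt_omegaFn (hs : ContinuousAt s p) (he : ContinuousAt e p) (hs0 : s p ≠ 0)
    (he0 : e p ≠ 0) (n : ℤ) : ContinuousAt (fun x => omegaFn (s x) (e x) n) p := by
  have := pow_ne_zero 2 hs0
  unfold omegaFn
  fun_prop (disch := first | exact Or.inl he0 | exact Or.inl this)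

theorem omegaFn_ne_zero {s e : ℂ} (hs : s ≠ 0) (he : e ≠ 0) (n : ℤ) : omegaFn s e n ≠ 0 :=
  mul_ne_zero (mul_ne_zero (zpow_ne_zero _ (by norm_num)) (zpow_ne_zero _ he))
    (zpow_ne_zero _ (pow_ne_zero 2 hs))

theorem griffiths_eq_zero {s d₀ d₁ d₂ d₃ d₄ : ℂ} {i j : ℤ} (h : ¬(0 ≤ i ∧ 0 ≤ j ∧ i + j ≤ N))
    (x y : ℤ) : griffiths s d₀ d₁ d₂ d₃ d₄ N i j x y = 0 := by
  refine sum_eq_zero fun a _ => ?_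
  by_cases hj : 0 ≤ j
  · rw [racah_eq_zero_of_not (n := i) (by omega)]
    simp
  · rw [racah_eq_zero_of_not (n := j) (by omega)]
    simp

theorem continuousAt_griffiths (hs : ContinuousAt s p) (h₀ : ContinuousAt d₀ p)
    (h₁ : ContinuousAt d₁ p) (h₂ : ContinuousAt d₂ p) (h₃ : ContinuousAt d₃ p)
    (h₄ : ContinuousAt d₄ p) (h₁0 : d₁ p ≠ 0) (h₃0 : d₃ p ≠ 0) (h₄0 : d₄ p ≠ 0)
    (h123 : RegularRacah (s p ^ 2) (d₁ p ^ 2) (d₂ p ^ 2) (d₃ p ^ 2) N)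
    (h304 : RegularRacah (s p ^ 2) (d₃ p ^ 2) (d₀ p ^ 2) (d₄ p ^ 2) N)
    (h421 : RegularRacah (s p ^ 2) (d₄ p ^ 2) (d₂ p ^ 2) (d₁ p ^ 2) N) {j y : ℤ} (i x : ℤ)
    (hj : 0 ≤ j) (hy : 0 ≤ y) :
    ContinuousAt (fun z => griffiths (s z) (d₀ z) (d₁ z) (d₂ z) (d₃ z) (d₄ z) N i j x y) p := by
  have hs0 : s p ≠ 0 := ne_zero_pow two_ne_zero h123.q_ne
  have h₂0 : d₂ p ≠ 0 := ne_zero_pow two_ne_zero h123.c₂_ne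
  unfold griffiths
  refine tendsto_finsetSum _ fun a ha => ?_
  rw [mem_Icc] at ha
  exact (((continuousAt_omegaFn hs (((h₁.mul h₂).mul h₃).div h₄ h₄0) hs0
    (div_ne_zero (mul_ne_zero (mul_ne_zero h₁0 h₂0) h₃0) h₄0) a).mul
    (continuousAt_racah hs h₁ h₂ h₃ h123 (by omega) i a)).mul
    (continuousAt_racah hs h₃ h₀ h₄ h304 (by omega) j y)).mul
    (continuousAt_racah hs h₄ h₂ h₁ h421 (by omega) a x)

/-- Where the polynomial vanishes by convention the product is constant zero, so nothing is asked of
the coefficient there. -/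
theorem continuousAt_mul_griffiths (hs : ContinuousAt s p) (h₀ : ContinuousAt d₀ p)
    (h₁ : ContinuousAt d₁ p) (h₂ : ContinuousAt d₂ p) (h₃ : ContinuousAt d₃ p)
    (h₄ : ContinuousAt d₄ p) (h₁0 : d₁ p ≠ 0) (h₃0 : d₃ p ≠ 0) (h₄0 : d₄ p ≠ 0)
    (h123 : RegularRacah (s p ^ 2) (d₁ p ^ 2) (d₂ p ^ 2) (d₃ p ^ 2) N)
    (h304 : RegularRacah (s p ^ 2) (d₃ p ^ 2) (d₀ p ^ 2) (d₄ p ^ 2) N)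
    (h421 : RegularRacah (s p ^ 2) (d₄ p ^ 2) (d₂ p ^ 2) (d₁ p ^ 2) N) {i j y : ℤ} (x : ℤ)
    (hy : 0 ≤ y) {f : X → ℂ} (hf : 0 ≤ i → 0 ≤ j → i + j ≤ N → ContinuousAt f p) :
    ContinuousAt (fun z => f z *
      griffiths (s z) (d₀ z) (d₁ z) (d₂ z) (d₃ z) (d₄ z) N i j x y) p := by
  by_cases h : 0 ≤ i ∧ 0 ≤ j ∧ i + j ≤ N
  · exact (hf h.1 h.2.1 h.2.2).mul
      (continuousAt_griffiths hs h₀ h₁ h₂ h₃ h₄ h₁0 h₃0 h₄0 h123 h304 h421 i x h.2.1 hy)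
  · simp [griffiths_eq_zero h, continuousAt_const]

end RacahContinuity

/-! ### Genericity on a punctured neighbourhood along a curve. -/

section Deformation

open Filter Topology

variable {s d₀ d₁ d₂ d₃ d₄ q t c c₀ c₁ c₂ c₃ c₄ : ℂ} {K m m₁ m₂ m₃ : ℤ}

theorem eventually_forall_Icc {X : Type*} {l : Filter X} {P : ℤ → X → Prop} {a b : ℤ}
    (h : ∀ k, a ≤ k → k ≤ b → ∀ᶠ x in l, P k x) : ∀ᶠ x in l, ∀ k, a ≤ k → k ≤ b → P k x := by
  have := (eventually_all_finset (Icc a b)).2 fun k hk => h k (mem_Icc.1 hk).1 (mem_Icc.1 hk).2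
  exact this.mono fun x hx k h1 h2 => hx k (mem_Icc.2 ⟨h1, h2⟩)

/-- Along the curve a factor becomes 1 − tq^k z^(m+2k), whose derivative at z = 1 is nonzero as long
as m + 2k ≠ 0. So even if it vanishes at z = 1 it does not nearby. -/
theorem eventually_generic (hq : q ≠ 0) (ht : t ≠ 0)
    (h : ∀ k : ℤ, 0 ≤ k → k ≤ 2 * K + 4 → m + 2 * k ≠ 0) :
    ∀ᶠ z in 𝓝[≠] (1 : ℂ), Generic (q * z ^ 2) (t * z ^ m) K := by
  refine eventually_forall_Icc fun k h1 h2 => ?_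
  have hd := (hasDerivAt_zpow (m + 2 * k) (1 : ℂ) (Or.inl one_ne_zero)).const_mul (t * q ^ k)
  have hne := hd.eventually_ne (c := 1) (by
    rw [one_zpow, mul_one]
    exact mul_ne_zero (mul_ne_zero ht (zpow_ne_zero _ hq)) (Int.cast_ne_zero.2 (h k h1 h2)))
  filter_upwards [hne, (continuousAt_id (x := (1 : ℂ))).eventually_ne one_ne_zero
    |>.filter_mono nhdsWithin_le_nhds] with z hz hz0 h0
  simp only [id] at hz0
  apply hz
  rw [zpow_add₀ hz0, zpow_mul, zpow_ofNat]
  rw [mul_zpow] at h0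
  linear_combination -h0

theorem eventually_one_sub_mul_zpow_ne (hq : q ≠ 0)
    (h : ∀ k : ℤ, 1 ≤ k → k ≤ K → 1 - c * q ^ k ≠ 0) (m : ℤ) :
    ∀ᶠ z in 𝓝[≠] (1 : ℂ), ∀ k : ℤ, 1 ≤ k → k ≤ K → 1 - c * z ^ m * (q * z ^ 2) ^ k ≠ 0 := by
  refine eventually_forall_Icc fun k h1 h2 => Eventually.filter_mono nhdsWithin_le_nhds ?_
  refine ContinuousAt.eventually_ne ?_ (by simpa using h k h1 h2)
  have : q * (1 : ℂ) ^ 2 ≠ 0 := by simpa using hq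
  fun_prop (disch := first | exact Or.inl this | exact Or.inl one_ne_zero)

theorem eventually_genericRacah (hq : q ≠ 0) (h₁ : c₁ ≠ 0) (h₂ : c₂ ≠ 0) (h₃ : c₃ ≠ 0)
    (hqp : ∀ k : ℤ, 1 ≤ k → k ≤ K → 1 - q ^ k ≠ 0)
    (h₁p : ∀ k : ℤ, 1 ≤ k → k ≤ K → 1 - c₁ * q ^ k ≠ 0)
    (h₂p : ∀ k : ℤ, 1 ≤ k → k ≤ K → 1 - c₂ * q ^ k ≠ 0)
    (h₃p : ∀ k : ℤ, 1 ≤ k → k ≤ K → 1 - c₃ * q ^ k ≠ 0)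
    (h12 : ∀ k : ℤ, 0 ≤ k → k ≤ 2 * K + 4 → m₁ + m₂ + 2 * k ≠ 0)
    (h23 : ∀ k : ℤ, 0 ≤ k → k ≤ 2 * K + 4 → m₂ + m₃ + 2 * k ≠ 0)
    (h123 : ∀ k : ℤ, 0 ≤ k → k ≤ 2 * K + 4 → m₁ + m₂ + m₃ + 2 * k ≠ 0) :
    ∀ᶠ z in 𝓝[≠] (1 : ℂ),
      GenericRacah (q * z ^ 2) (c₁ * z ^ m₁) (c₂ * z ^ m₂) (c₃ * z ^ m₃) K := by
  filter_upwards [eventually_generic (m := m₁ + m₂) hq (mul_ne_zero h₁ h₂) h12,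
    eventually_generic (m := m₂ + m₃) hq (mul_ne_zero h₂ h₃) h23,
    eventually_generic (m := m₁ + m₂ + m₃) hq (mul_ne_zero (mul_ne_zero h₁ h₂) h₃) h123,
    eventually_one_sub_mul_zpow_ne (c := 1) hq (by simpa using hqp) 0,
    eventually_one_sub_mul_zpow_ne hq h₁p m₁, eventually_one_sub_mul_zpow_ne hq h₂p m₂,
    eventually_one_sub_mul_zpow_ne hq h₃p m₃, (continuousAt_id (x := (1 : ℂ))).eventually_ne
      one_ne_zero |>.filter_mono nhdsWithin_le_nhds] with z e12 e23 e123 eq e1 e2 e3 hz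
  simp only [id] at hz
  have hzz := fun m : ℤ => zpow_ne_zero m hz
  refine ⟨by positivity, mul_ne_zero h₁ (hzz _), mul_ne_zero h₂ (hzz _), mul_ne_zero h₃ (hzz _),
    by simpa using eq, e1, e2, e3, ?_, ?_, ?_⟩
  · rwa [mul_mul_mul_comm, ← zpow_add₀ hz]
  · rwa [mul_mul_mul_comm, ← zpow_add₀ hz]
  · rwa [mul_mul_mul_comm c₁, ← zpow_add₀ hz, mul_mul_mul_comm, ← zpow_add₀ hz]

theorem eq_of_eventually_eq_punctured {f g : ℂ → ℂ} {p : ℂ} (hf : ContinuousAt f p)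
    (hg : ContinuousAt g p) (h : ∀ᶠ z in 𝓝[≠] p, f z = g z) : f p = g p :=
  tendsto_nhds_unique_of_eventuallyEq (hf.tendsto.mono_left nhdsWithin_le_nhds)
    (hg.tendsto.mono_left nhdsWithin_le_nhds) h

end Deformation

/-! ### From the stated assumptions to regularity. -/

section Admissible

variable {q t c₀ c₁ c₂ c₃ c₄ : ℂ} {N : ℕ}

theorem one_sub_mul_zpow_ne_zero {a b : ℕ}
    (h : ∀ k : ℕ, a ≤ k → k ≤ b → t ≠ (q ^ k)⁻¹) :
    ∀ k : ℤ, a ≤ k → k ≤ b → 1 - t * q ^ k ≠ 0 := by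
  intro k h1 h2 h0
  lift k to ℕ using by omega
  refine h k (by omega) (by omega) (eq_inv_of_mul_eq_one_left ?_)
  rw [zpow_natCast] at h0
  exact (sub_eq_zero.1 h0).symm

theorem Admissible.c_pow (h : Admissible N q c₀ c₁ c₂ c₃ c₄) :
    ∀ c ∈ ({c₀, c₁, c₂, c₃, c₄} : Set ℂ), ∀ k : ℤ, 1 ≤ k → k ≤ N → 1 - c * q ^ k ≠ 0 :=
  fun c hc => by simpa using one_sub_mul_zpow_ne_zero (h.c_ne c hc)

theorem Admissible.q_pow (h : Admissible N q c₀ c₁ c₂ c₃ c₄) :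
    ∀ k : ℤ, 1 ≤ k → k ≤ N → 1 - q ^ k ≠ 0 := by
  intro k h1 h2 h0
  lift k to ℕ using by omega
  rw [zpow_natCast] at h0
  exact h.q_pow_ne_one k (by omega) (by omega) (sub_eq_zero.1 h0).symm

theorem Admissible.regular (h : Admissible N q c₀ c₁ c₂ c₃ c₄) (t : ℂ)
    (ht : t ∈ ({c₁ * c₂, c₂ * c₃, c₀ * c₃, c₀ * c₄, c₂ * c₄,
      q * c₁ * c₂ * c₃, q * c₀ * c₃ * c₄, q * c₁ * c₂ * c₄} : Set ℂ)) : Regular q t N := by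
  have := one_sub_mul_zpow_ne_zero (h.prod_ne t ht)
  exact fun k h1 h2 => this k (by exact_mod_cast h1) (by push_cast; exact h2)

/-- The assumption concerns q times the triple product, so its exponents 2, …, 2K become 3, …, 2K +
1, those of the lower parameter c₁c₂c₃q^(M+2) of the series. -/
theorem Regular.shift (hq : q ≠ 0) {K : ℤ} (h : Regular q (q * t) K) :
    ∀ k : ℤ, 3 ≤ k → k ≤ 2 * K + 1 → 1 - t * q ^ k ≠ 0 := by
  intro k h1 h2
  have := h (k - 1) (by omega) (by omega)
  rwa [mul_comm q, mul_assoc, ← zpow_one_add₀ hq, add_sub_cancel] at this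

theorem Admissible.regular₁₂₃ (h : Admissible N q c₀ c₁ c₂ c₃ c₄) :
    RegularRacah q c₁ c₂ c₃ N where
  q_ne := h.q_ne_zero
  c₂_ne := h.c_ne_zero _ (by simp)
  q_pow := h.q_pow
  c₂_pow := h.c_pow _ (by simp)
  c₃_pow := h.c_pow _ (by simp)
  reg₂₃ := h.regular _ (by simp)
  reg₁₂₃ := (show Regular q (q * (c₁ * c₂ * c₃)) N by
    simpa only [mul_assoc] using h.regular (q * c₁ * c₂ * c₃) (by simp)).shift h.q_ne_zero

theorem Admissible.regular₃₀₄ (h : Admissible N q c₀ c₁ c₂ c₃ c₄) :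
    RegularRacah q c₃ c₀ c₄ N where
  q_ne := h.q_ne_zero
  c₂_ne := h.c_ne_zero _ (by simp)
  q_pow := h.q_pow
  c₂_pow := h.c_pow _ (by simp)
  c₃_pow := h.c_pow _ (by simp)
  reg₂₃ := h.regular _ (by simp)
  reg₁₂₃ := (show Regular q (q * (c₃ * c₀ * c₄)) N by
    rw [show q * (c₃ * c₀ * c₄) = q * c₀ * c₃ * c₄ by ring]
    exact h.regular _ (by simp)).shift h.q_ne_zero

theorem Admissible.regular₄₂₁ (h : Admissible N q c₀ c₁ c₂ c₃ c₄) :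
    RegularRacah q c₄ c₂ c₁ N where
  q_ne := h.q_ne_zero
  c₂_ne := h.c_ne_zero _ (by simp)
  q_pow := h.q_pow
  c₂_pow := h.c_pow _ (by simp)
  c₃_pow := h.c_pow _ (by simp)
  reg₂₃ := by
    rw [mul_comm]
    exact h.regular _ (by simp)
  reg₁₂₃ := (show Regular q (q * (c₄ * c₂ * c₁)) N by
    rw [show q * (c₄ * c₂ * c₁) = q * c₁ * c₂ * c₄ by ring]
    exact h.regular _ (by simp)).shift h.q_ne_zero

end Admissible

/-! ### The curve in the parameter variety and the passage to the limit. -/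

section Extension

open Filter Topology

variable {s d₀ d₁ d₂ d₃ d₄ q c₀ c₁ c₂ c₃ c₄ : ℂ} {N : ℕ}

/-- With s, d₁, …, d₄ scaled by z, the product s^(2N+3)d₁d₂d₃d₄ gains z^(2N+7), which d₀ has to
compensate. -/
theorem Roots.deform (H : Roots s d₀ d₁ d₂ d₃ d₄ q c₀ c₁ c₂ c₃ c₄ N) {z : ℂ} (hz : z ≠ 0) :
    Roots (s * z) (d₀ * z ^ (-(2 * N + 7) : ℤ)) (d₁ * z) (d₂ * z) (d₃ * z) (d₄ * z) (q * z ^ 2)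
      (c₀ * z ^ (-(4 * N + 14) : ℤ)) (c₁ * z ^ (2 : ℤ)) (c₂ * z ^ (2 : ℤ)) (c₃ * z ^ (2 : ℤ))
      (c₄ * z ^ (2 : ℤ)) N where
  hs := by rw [mul_pow, H.hs]
  h₀ := by
    rw [mul_pow, H.h₀, ← zpow_natCast (z ^ _) 2, ← zpow_mul]
    congr 2
    push_cast
    ring
  h₁ := by rw [mul_pow, H.h₁, zpow_ofNat]
  h₂ := by rw [mul_pow, H.h₂, zpow_ofNat]
  h₃ := by rw [mul_pow, H.h₃, zpow_ofNat]
  h₄ := by rw [mul_pow, H.h₄, zpow_ofNat]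
  prod := by
    have e : z ^ (-(2 * N + 7) : ℤ) = (z ^ (2 * N + 7))⁻¹ := by
      rw [zpow_neg]; congr 1
    have hp := H.prod
    rw [zpow_natCast] at hp ⊢
    rw [e]
    have hz' := pow_ne_zero (2 * N + 7) hz
    calc _ = q * q ^ N * s * d₀ * d₁ * d₂ * d₃ * d₄ * (z ^ (2 * N + 7) * (z ^ (2 * N + 7))⁻¹) := by
          ring
      _ = 1 := by rw [hp, mul_inv_cancel₀ hz', one_mul]

/-- Products without c₀ acquire positive exponents. For c₀c₃, c₀c₄ and c₀c₁ the exponent is −4N − 12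
+ 2k, and for triple products with c₀ it is −4N − 10 + 2k; both are negative for k ≤ 2N + 4. -/
theorem Admissible.eventually_generic (h : Admissible N q c₀ c₁ c₂ c₃ c₄) :
    ∀ᶠ z in 𝓝[≠] (1 : ℂ), GenericGriffiths (q * z ^ 2)
      (c₀ * z ^ (-(4 * N + 14) : ℤ)) (c₁ * z ^ (2 : ℤ)) (c₂ * z ^ (2 : ℤ)) (c₃ * z ^ (2 : ℤ))
      (c₄ * z ^ (2 : ℤ)) N := by
  have hq := h.q_ne_zero
  have n0 := h.c_ne_zero c₀ (by simp)
  have n1 := h.c_ne_zero c₁ (by simp)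
  have n2 := h.c_ne_zero c₂ (by simp)
  have n3 := h.c_ne_zero c₃ (by simp)
  have n4 := h.c_ne_zero c₄ (by simp)
  have p0 := h.c_pow c₀ (by simp)
  have p1 := h.c_pow c₁ (by simp)
  have p2 := h.c_pow c₂ (by simp)
  have p3 := h.c_pow c₃ (by simp)
  have p4 := h.c_pow c₄ (by simp)
  have e1 := eventually_genericRacah (m₁ := 2) (m₂ := 2) (m₃ := 2) hq n1 n2 n3 h.q_pow p1 p2 p3
    (by omega) (by omega) (by omega)
  have e2 := eventually_genericRacah (m₁ := 2) (m₂ := -(4 * N + 14)) (m₃ := 2) hq n3 n0 n4 h.q_pow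
    p3 p0 p4 (by omega) (by omega) (by omega)
  have e3 := eventually_genericRacah (m₁ := 2) (m₂ := 2) (m₃ := 2) hq n4 n2 n1 h.q_pow p4 p2 p1
    (by omega) (by omega) (by omega)
  have e4 := eventually_genericRacah (m₁ := 2) (m₂ := -(4 * N + 14)) (m₃ := 2) hq n1 n0 n4 h.q_pow
    p1 p0 p4 (by omega) (by omega) (by omega)
  have e5 := eventually_genericRacah (m₁ := 2) (m₂ := 2) (m₃ := 2) hq n4 n2 n3 h.q_pow p4 p2 p3
    (by omega) (by omega) (by omega)
  -- With K = −2 only k = 0 remains; for t = q² and m = 4 it says that 1 − (qz²)² ≠ 0, needed for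
  -- division by 1 − q².
  have e6 := GriffithsQRacah.eventually_generic (m := 4) (K := -2) hq (pow_ne_zero 2 hq) (by omega)
  filter_upwards [e1, e2, e3, e4, e5, e6] with z h1 h2 h3 h4 h5 h6
  refine ⟨h1, h2, h3, h4, h5, ?_⟩
  have := h6 0 le_rfl (by norm_num)
  rwa [zpow_zero, mul_one, zpow_ofNat, show q ^ 2 * z ^ 4 = (q * z ^ 2) ^ 2 by ring] at this

theorem eventually_ne_zero_punctured : ∀ᶠ z in 𝓝[≠] (1 : ℂ), z ≠ 0 :=
  (continuousAt_id (x := (1 : ℂ))).eventually_ne one_ne_zero |>.filter_mono nhdsWithin_le_nhds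

theorem continuousAt_lam {X : Type*} [TopologicalSpace X] {p : X} {q c : X → ℂ}
    (hq : ContinuousAt q p) (hq0 : q p ≠ 0) (hc : ContinuousAt c p) (n : ℤ) :
    ContinuousAt (fun x => lam (q x) (c x) n) p := by
  unfold lam
  fun_prop (disch := exact Or.inl hq0)

/-- Both sides are continuous at z = 1 along the curve and agree for all nearby z ≠ 1, where the
parameters are generic. -/
theorem recurrence_relations (H : Roots s d₀ d₁ d₂ d₃ d₄ q c₀ c₁ c₂ c₃ c₄ N)
    (hadm : Admissible N q c₀ c₁ c₂ c₃ c₄) {i j x y : ℤ} (hi : 0 ≤ i) (hj : 0 ≤ j)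
    (hij : i + j ≤ N) (hx : 0 ≤ x) (hy : 0 ≤ y) (hxy : x + y ≤ N) :
    (lam q (c₃ * c₀) y * griffiths s d₀ d₁ d₂ d₃ d₄ N i j x y =
      ∑ ε : SignType, ∑ ε' : SignType,
        coeffA s d₀ d₁ d₂ d₃ d₄ N ε ε' (i + (ε : ℤ)) (j + (ε' : ℤ)) *
          griffiths s d₀ d₁ d₂ d₃ d₄ N (i + (ε : ℤ)) (j + (ε' : ℤ)) x y) ∧
    (lam q (c₄ * c₂) x * griffiths s d₀ d₁ d₂ d₃ d₄ N i j x y =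
      ∑ ε : SignType, ∑ ε' : SignType,
        omegaRatio s d₀ d₁ d₂ d₃ d₄ (q ^ i) (q ^ j) ε ε' *
          coeffA s d₂ d₁ d₀ d₄ d₃ N ε' ε (j + (ε' : ℤ)) (i + (ε : ℤ)) *
          griffiths s d₀ d₁ d₂ d₃ d₄ N (i + (ε : ℤ)) (j + (ε' : ℤ)) x y) := by
  obtain ⟨hq, hs0, hd0, hd1, hd2, hd3, hd4⟩ := H.ne
  have hev := hadm.eventually_generic.and eventually_ne_zero_punctured
  have r123 := hadm.regular₁₂₃
  have r304 := hadm.regular₃₀₄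
  have r421 := hadm.regular₄₂₁
  have g23 := hadm.regular (c₂ * c₃) (by simp)
  have g04 := hadm.regular (c₀ * c₄) (by simp)
  have g32 := g23
  have g40 := g04
  rw [mul_comm] at g32 g40
  simp only [← H.hs, ← H.h₀, ← H.h₁, ← H.h₂, ← H.h₃, ← H.h₄] at r123 r304 r421 g23 g04 g32 g40 hq ⊢
  set S : ℂ → ℂ := fun z => s * z with hS
  set D₀ : ℂ → ℂ := fun z => d₀ * z ^ (-(2 * N + 7) : ℤ) with hD₀
  set D₁ : ℂ → ℂ := fun z => d₁ * z with hD₁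
  set D₂ : ℂ → ℂ := fun z => d₂ * z with hD₂
  set D₃ : ℂ → ℂ := fun z => d₃ * z with hD₃
  set D₄ : ℂ → ℂ := fun z => d₄ * z with hD₄
  have vS : S 1 = s := mul_one s
  have v0 : D₀ 1 = d₀ := by simp [hD₀]
  have v1 : D₁ 1 = d₁ := mul_one d₁
  have v2 : D₂ 1 = d₂ := mul_one d₂
  have v3 : D₃ 1 = d₃ := mul_one d₃
  have v4 : D₄ 1 = d₄ := mul_one d₄
  have cS : ContinuousAt S 1 := by fun_prop
  have k0 : ContinuousAt D₀ 1 := by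
    simp only [hD₀]
    fun_prop (disch := exact Or.inl one_ne_zero)
  have k1 : ContinuousAt D₁ 1 := by fun_prop
  have k2 : ContinuousAt D₂ 1 := by fun_prop
  have k3 : ContinuousAt D₃ 1 := by fun_prop
  have k4 : ContinuousAt D₄ 1 := by fun_prop
  have hG : ∀ᶠ z in 𝓝[≠] (1 : ℂ), Roots (S z) (D₀ z) (D₁ z) (D₂ z) (D₃ z) (D₄ z) (S z ^ 2)
      (D₀ z ^ 2) (D₁ z ^ 2) (D₂ z ^ 2) (D₃ z ^ 2) (D₄ z ^ 2) N ∧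
      GenericGriffiths (S z ^ 2) (D₀ z ^ 2) (D₁ z ^ 2) (D₂ z ^ 2) (D₃ z ^ 2) (D₄ z ^ 2) N := by
    filter_upwards [hev] with z hz
    have R := H.deform hz.2
    have e := hz.1
    rw [← R.hs, ← R.h₀, ← R.h₁, ← R.h₂, ← R.h₃, ← R.h₄] at e
    exact ⟨⟨rfl, rfl, rfl, rfl, rfl, rfl, by rw [← R.prod, ← R.hs]⟩, e⟩
  -- From here on only continuity at 1, the values there and genericity nearby matter; the original
  -- roots are replaced by the values of the curve at 1.
  clear_value S D₀ D₁ D₂ D₃ D₄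
  clear hS hD₀ hD₁ hD₂ hD₃ hD₄
  subst vS v0 v1 v2 v3 v4
  have cG : ∀ {i j : ℤ} {f : ℂ → ℂ}, (0 ≤ i → 0 ≤ j → i + j ≤ N → ContinuousAt f 1) →
      ContinuousAt (fun z => f z *
        griffiths (S z) (D₀ z) (D₁ z) (D₂ z) (D₃ z) (D₄ z) N i j x y) 1 := fun hf =>
    continuousAt_mul_griffiths cS k0 k1 k2 k3 k4 hd1 hd3 hd4 r123 r304 r421 x hy hf
  have cz : ∀ n : ℤ, ContinuousAt (fun z => (S z ^ 2) ^ n) 1 := fun n => by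
    fun_prop (disch := exact Or.inl hq)
  constructor
  · refine eq_of_eventually_eq_punctured (p := 1)
      (f := fun z => lam (S z ^ 2) (D₃ z ^ 2 * D₀ z ^ 2) y *
        griffiths (S z) (D₀ z) (D₁ z) (D₂ z) (D₃ z) (D₄ z) N i j x y)
      (g := fun z => ∑ ε : SignType, ∑ ε' : SignType,
        coeffA (S z) (D₀ z) (D₁ z) (D₂ z) (D₃ z) (D₄ z) N ε ε' (i + (ε : ℤ)) (j + (ε' : ℤ)) *
          griffiths (S z) (D₀ z) (D₁ z) (D₂ z) (D₃ z) (D₄ z) N (i + (ε : ℤ)) (j + (ε' : ℤ)) x y)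
      ?_ ?_ ?_
    · exact cG fun _ _ _ => continuousAt_lam (cS.pow 2) hq ((k3.pow 2).mul (k0.pow 2)) y
    · exact tendsto_finsetSum _ fun ε _ => tendsto_finsetSum _ fun ε' _ => cG fun h1 h2 h3 =>
        continuousAt_coeffA cS hs0 k0 k1 k2 k3 k4 hd2 hd3 g23 g40 h1 h2 h3 ε ε'
    · filter_upwards [hG] with z hz
      exact first_relation rfl rfl rfl rfl rfl rfl hz.1.prod_sq hz.2.h123 hz.2.h304 hi hj hij hy
  · refine eq_of_eventually_eq_punctured (p := 1)
      (f := fun z => lam (S z ^ 2) (D₄ z ^ 2 * D₂ z ^ 2) x *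
        griffiths (S z) (D₀ z) (D₁ z) (D₂ z) (D₃ z) (D₄ z) N i j x y)
      (g := fun z => ∑ ε : SignType, ∑ ε' : SignType,
        omegaRatio (S z) (D₀ z) (D₁ z) (D₂ z) (D₃ z) (D₄ z) ((S z ^ 2) ^ i) ((S z ^ 2) ^ j) ε ε' *
          coeffA (S z) (D₂ z) (D₁ z) (D₀ z) (D₄ z) (D₃ z) N ε' ε (j + (ε' : ℤ)) (i + (ε : ℤ)) *
          griffiths (S z) (D₀ z) (D₁ z) (D₂ z) (D₃ z) (D₄ z) N (i + (ε : ℤ)) (j + (ε' : ℤ)) x y)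
      ?_ ?_ ?_
    · exact cG fun _ _ _ => continuousAt_lam (cS.pow 2) hq ((k4.pow 2).mul (k2.pow 2)) x
    · refine tendsto_finsetSum _ fun ε _ => tendsto_finsetSum _ fun ε' _ => cG fun h1 h2 h3 =>
        .mul ?_ (continuousAt_coeffA cS hs0 k2 k1 k0 k4 k3 hd0 hd4 g04 g32 h2 h1 (by omega) ε' ε)
      have hI : (S 1 ^ 2) ^ i ≠ 0 := zpow_ne_zero i hq
      have hJ : (S 1 ^ 2) ^ j ≠ 0 := zpow_ne_zero j hq
      refine .div (continuousAt_omegaFn cS ((cz i).mul (((k2.mul k3).mul k4).div k1 hd1)) hs0 ?_ _)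
        (continuousAt_omegaFn cS ((cz j).mul (((k0.mul k3).mul k4).div k1 hd1)) hs0 ?_ _)
        (omegaFn_ne_zero hs0 ?_ _)
      · exact mul_ne_zero hI (div_ne_zero (mul_ne_zero (mul_ne_zero hd2 hd3) hd4) hd1)
      · exact mul_ne_zero hJ (div_ne_zero (mul_ne_zero (mul_ne_zero hd0 hd3) hd4) hd1)
      · exact mul_ne_zero hJ (div_ne_zero (mul_ne_zero (mul_ne_zero hd0 hd3) hd4) hd1)
    · filter_upwards [hG] with z hz
      exact second_relation hz.1 hz.2 hi hj hij hx hy hxy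

end Extension
end GriffithsQRacah

open GriffithsQRacah in
/-- The two nine-term recurrence relations of the Griffiths polynomials of `q`-Racah type.
Here `s, d₀, …, d₄` are square roots of `q, c₀, …, c₄`, chosen such that
`s ^ (2 N + 3) d₀ d₁ d₂ d₃ d₄ = 1`; in particular `q ^ (2 N + 3) c₀ c₁ c₂ c₃ c₄ = 1`. -/
theorem mainTheorem7 (N : ℕ) (q c₀ c₁ c₂ c₃ c₄ s d₀ d₁ d₂ d₃ d₄ : ℂ)
    (hs : s ^ 2 = q) (h₀ : d₀ ^ 2 = c₀) (h₁ : d₁ ^ 2 = c₁) (h₂ : d₂ ^ 2 = c₂)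
    (h₃ : d₃ ^ 2 = c₃) (h₄ : d₄ ^ 2 = c₄)
    (hprod : s ^ (2 * N + 3) * d₀ * d₁ * d₂ * d₃ * d₄ = 1)
    (hadm : Admissible N q c₀ c₁ c₂ c₃ c₄)
    (i j x y : ℕ) (hij : i + j ≤ N) (hxy : x + y ≤ N) :
    (lam q (c₃ * c₀) y * griffiths s d₀ d₁ d₂ d₃ d₄ N i j x y =
      ∑ ε : SignType, ∑ ε' : SignType,
        coeffA s d₀ d₁ d₂ d₃ d₄ N ε ε' (i + (ε : ℤ)) (j + (ε' : ℤ)) *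
          griffiths s d₀ d₁ d₂ d₃ d₄ N (i + (ε : ℤ)) (j + (ε' : ℤ)) x y) ∧
    (lam q (c₄ * c₂) x * griffiths s d₀ d₁ d₂ d₃ d₄ N i j x y =
      ∑ ε : SignType, ∑ ε' : SignType,
        omegaFn s (q ^ i * (d₂ * d₃ * d₄ / d₁)) ε / omegaFn s (q ^ j * (d₀ * d₃ * d₄ / d₁)) ε' *
          coeffA s d₂ d₁ d₀ d₄ d₃ N ε' ε (j + (ε' : ℤ)) (i + (ε : ℤ)) *
          griffiths s d₀ d₁ d₂ d₃ d₄ N (i + (ε : ℤ)) (j + (ε' : ℤ)) x y) := by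
  have H : Roots s d₀ d₁ d₂ d₃ d₄ q c₀ c₁ c₂ c₃ c₄ N := by
    refine ⟨hs, h₀, h₁, h₂, h₃, h₄, ?_⟩
    rw [← hprod, ← hs, zpow_natCast]
    ring
  have h := recurrence_relations H hadm (i := i) (j := j) (x := x) (y := y) (by omega) (by omega) (by omega)
    (by omega) (by omega) (by omega)
  simpa only [omegaRatio, zpow_natCast] using h
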